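/- **Setting.** Let $0\le R_1<R_2\le\infty$ and $\Omega=\{x\in\mathbb R^3 : R_1\le r<R_2,\ x_3=z\in\mathbb T_{2\pi}\}$, with $r=\sqrt{x_1^2+x_2^2}$ and cylindrical coordinates $(r,\theta,z)$. Consider the ideal MHD system $\partial_tv+v\cdot\nabla v+\nabla p=H\cdot\nabla H$, $\partial_tH+v\cdot\nabla H=H\cdot\nabla v$, $\operatorname{div}v=\operatorname{div}H=0$ in $\Omega$, with $v\cdot\mathbf n=H\cdot\mathbf n=0$ on $\partial\Omega$ and $(v,H)\to(v_0,H_0)$ at infinity if $R_2=\infty$, and the steady state $v_0=r\omega(r)\mathbf e_\theta$, $H_0=\epsilon b(r)\mathbf e_z$, $\epsilon\ne0$, with magnetic potential $\psi_0(r)=-\epsilon\int_{R_1}^r s\,b(s)\,ds$. **Hypotheses on the steady state.** $\omega$ and $b$ are $C^3$ on $(R_1,R_2)$, up to those endpoints that are positive and finite, and $b$ has a positive lower bound. i) If $R_1=0$: for some $\beta\ge4$, as $r\to0$, $\partial_r\omega=O(r^{\beta-3})$, $\partial_r^2\omega=O(r^{\beta-4})$, $\partial_rb=O(r^{\beta-1})$,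 $\partial_r^2b=O(r^{\beta-2})$. ii) If $R_2=\infty$: for some $\alpha>1$, as $r\to\infty$, $\partial_r^j\omega=O(r^{-1-\alpha-j})$ for $j=0,1,2$, and $\partial_rb=O(r^{-1-2\alpha})$, $\partial_r^2b=O(r^{-2-2\alpha})$. iii) $\mathbb L_1>0$, that is, for every $h\ne0$, $h(R_1)=h(R_2)=0$, with $\int_{R_1}^{R_2}\frac1r(|h'|^2+|h|^2)\,dr<\infty$, $$\int_{R_1}^{R_2}\Big(\frac{|h'|^2}{r}+\frac{|h|^2}{r}+\mathfrak F(r)\,r\,|h|^2\Big)dr>0,\qquad \mathfrak F=\frac{\partial_r(\omega^2)}{\epsilon^2b^2r}+\frac{\partial_r^2b}{r^2b}-\frac{\partial_rb}{r^3b}.$$ **Weak solutions.** A global axisymmetric weak solution is a pair $(v,H)$ of axisymmetric fields on $[0,\infty)\times\Omega$ with $(v-v_0,H-H_0)(t)\in L^2(\Omega)$ for all $t\ge0$, continuous in $t>0$ with values in $L^2$, such that $v(t)$ and $H(t)$ are divergence free with zero normal component on $\partial\Omega$, weakly ($\int_\Omega v\cdot\nabla\eta\,dx=\int_\Omega H\cdot\nabla\eta\,dx=0$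 for all smooth $\eta$ that are $2\pi$-periodic in $z$ and have bounded support in $r$), and such that for all $t>0$ and all smooth divergence-free $\xi$, $2\pi$-periodic in $z$, compactly supported in $[0,\infty)\times\operatorname{int}\Omega$, $$\int_0^t\!\!\int_\Omega\big[\partial_s\xi\cdot v+\nabla\xi:(v\otimes v-H\otimes H)\big]dx\,ds=\int_\Omega\xi\cdot v\,dx\Big|_0^t,\qquad \int_0^t\!\!\int_\Omega\big[\partial_s\xi\cdot H+\nabla\xi:(H\otimes v-v\otimes H)\big]dx\,ds=\int_\Omega\xi\cdot H\,dx\Big|_0^t,$$ where $\nabla\xi:(a\otimes c)=\sum_{i,j}\partial_j\xi_i\,a_ic_j$. Its magnetic potential $\psi(t,r,z)$ satisfies $H_r=\partial_z\psi/r$, $H_z=-\partial_r\psi/r$, $\psi|_{r=R_1}=0$; if $R_2<\infty$, $\psi|_{r=R_2}$ is a constant independent of $t$ and $z$, namely $-\int_{R_1}^{R_2}rH_z(0,r,z)\,dr$; if $R_2=\infty$, $\psi-\psi_0\to0$ as $r\to\infty$. The distance to the steady state is $$d(t)=\frac12\int_\Omega\big(|v_r|^2+|v_z|^2+|H_\theta|^2\big)dx+\frac12\int_\Omega|v_\theta-r\omega|^2dx+\frac12\int_\Omega\frac1{r^2}\big(|\partial_z(\psi-\psi_0)|^2+|\partial_r(\psi-\psi_0)|^2\big)dx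 .$$ **Theorem (conditional nonlinear stability).** Under these hypotheses there are $\delta>0$ and $C>0$, depending only on the steady state and on $\Omega$, such that every global axisymmetric weak solution with $d(0)<\delta$ for which 1. the total energy is non-increasing on $[0,\infty)$; it is $\frac12\int_\Omega(|v|^2+|H|^2)\,dx$ if $R_2<\infty$, and $\lim_{R\to\infty}\frac12\int_{\Omega\cap\{r<R\}}(|v|^2+|H|^2-|v_0|^2-|H_0|^2)\,dx$, assumed to exist, if $R_2=\infty$, 2. $d$ is continuous on $[0,\infty)$, 3. for all $f,\Phi\in C^1(\mathbb R)$ the functionals $\int_\Omega f(\psi)\,dx$ and $\int_\Omega rv_\theta\Phi(\psi)\,dx$ if $R_2<\infty$, respectively $\int_\Omega(f(\psi)-f(\psi_0))\,dx$ and $\int_\Omega(rv_\theta\Phi(\psi)-r^2\omega\,\Phi(\psi_0))\,dx$ if $R_2=\infty$, are conserved, i.e. have at each time $t$ their initial value whenever both integrals converge absolutely, satisfies $d(t)\le C\,d(0)$ for all $t\ge0$. -/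

import Mathlib

open MeasureTheory Filter Topology Set Asymptotics

noncomputable section

namespace RotMHD

/-! ### Geometry: the periodic cylinder or annulus -/

/-- Cartesian space; the third coordinate is the `2π`-periodic vertical variable. -/
abbrev E3 := EuclideanSpace ℝ (Fin 3)

/-- The cylindrical radius `r = √(x₁² + x₂²)`. -/
def cylR (x : E3) : ℝ := Real.sqrt (x 0 ^ 2 + x 1 ^ 2)

/-- A fundamental cell of `Ω = {R₁ ≤ r < R₂, x₃ ∈ 𝕋_{2π}}`; `R₂ = ⊤` is the unbounded case. -/
def Omega (R₁ : ℝ) (R₂ : EReal) : Set E3 :=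
  {x | R₁ ≤ cylR x ∧ (cylR x : EReal) < R₂ ∧ x 2 ∈ Ioc 0 (2 * Real.pi)}

/-- The open radial interval `(R₁, R₂)`. -/
def radial (R₁ : ℝ) (R₂ : EReal) : Set ℝ := {r | R₁ < r ∧ (r : EReal) < R₂}

/-- `(R₁, R₂)` together with those endpoints that are positive and finite. -/
def radialClosed (R₁ : ℝ) (R₂ : EReal) : Set ℝ := {r | 0 < r ∧ R₁ ≤ r ∧ (r : EReal) ≤ R₂}

/-- The filter `r → R₂` from inside (`r → ∞` if `R₂ = ∞`). -/
def toOuter (R₂ : EReal) : Filter ℝ := open Classical in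
  if R₂ = ⊤ then atTop else 𝓝[<] R₂.toReal

/-- The period cell in `z`, with Lebesgue measure. -/
def zMeasure : Measure ℝ := volume.restrict (Ioc 0 (2 * Real.pi))

/-- Planar Lebesgue measure `dr dz` on `(R₁, R₂) × (0, 2π]`. -/
def planeMeasure (R₁ : ℝ) (R₂ : EReal) : Measure (ℝ × ℝ) :=
  (volume.restrict (radial R₁ R₂)).prod zMeasure

/-- The volume `dx = r dr dθ dz` of `Ω` on functions of `(r, z)`, with `θ` integrated out:
`2π r dr dz`. -/
def cylMeasure (R₁ : ℝ) (R₂ : EReal) : Measure (ℝ × ℝ) :=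
  ENNReal.ofReal (2 * Real.pi) •
    (planeMeasure R₁ R₂).withDensity (fun p => ENNReal.ofReal p.1)

/-! ### Axisymmetric vector fields -/

/-- An axisymmetric vector field `u_r e_r + u_θ e_θ + u_z e_z`; the components are functions
of `(r, z)`, with `z` in the period cell. -/
structure AxiField where
  /-- radial component -/
  r : ℝ → ℝ → ℝ
  /-- azimuthal component -/
  θ : ℝ → ℝ → ℝ
  /-- vertical component -/
  z : ℝ → ℝ → ℝ

namespace AxiField

instance : Sub AxiField :=
  ⟨fun u w => ⟨fun r z => u.r r z - w.r r z, fun r z => u.θ r z - w.θ r z,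
    fun r z => u.z r z - w.z r z⟩⟩

/-- The Cartesian vector field with the given cylindrical components. -/
def toField (u : AxiField) (x : E3) : E3 :=
  !₂[u.r (cylR x) (x 2) * (x 0 / cylR x) - u.θ (cylR x) (x 2) * (x 1 / cylR x),
     u.r (cylR x) (x 2) * (x 1 / cylR x) + u.θ (cylR x) (x 2) * (x 0 / cylR x),
     u.z (cylR x) (x 2)]

/-- `|u|²` as a function of `(r, z)`. -/
def sq (u : AxiField) (p : ℝ × ℝ) : ℝ :=
  u.r p.1 p.2 ^ 2 + u.θ p.1 p.2 ^ 2 + u.z p.1 p.2 ^ 2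

/-- `u ∈ L²(Ω)`. -/
def MemL2 (R₁ : ℝ) (R₂ : EReal) (u : AxiField) : Prop :=
  MemLp (fun p : ℝ × ℝ => u.r p.1 p.2) 2 (cylMeasure R₁ R₂) ∧
  MemLp (fun p : ℝ × ℝ => u.θ p.1 p.2) 2 (cylMeasure R₁ R₂) ∧
  MemLp (fun p : ℝ × ℝ => u.z p.1 p.2) 2 (cylMeasure R₁ R₂)

/-- `u` is divergence free in `Ω` and `u · n = 0` on `∂Ω`, both in the weak sense:
`∫_Ω u · ∇η dx = 0` for all smooth `η`, periodic in `x₃`, with bounded radial support (`η` need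
not vanish on `∂Ω`). -/
def Solenoidal (R₁ : ℝ) (R₂ : EReal) (u : AxiField) : Prop :=
  ∀ η : E3 → ℝ, ContDiff ℝ ((⊤ : ℕ∞) : WithTop ℕ∞) η →
    (∀ x, η (x + EuclideanSpace.single 2 (2 * Real.pi)) = η x) →
    (∃ M : ℝ, ∀ x, η x ≠ 0 → cylR x ≤ M) →
    ∫ x in Omega R₁ R₂, fderiv ℝ η x (u.toField x) = 0

end AxiField

/-! ### The steady state -/

/-- `v₀ = r ω(r) e_θ`. -/
def v₀ (ω : ℝ → ℝ) : AxiField := ⟨fun _ _ => 0, fun r _ => r * ω r, fun _ _ => 0⟩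

/-- `H₀ = ε b(r) e_z`. -/
def H₀ (b : ℝ → ℝ) (ε : ℝ) : AxiField := ⟨fun _ _ => 0, fun _ _ => 0, fun r _ => ε * b r⟩

/-- The magnetic potential of `H₀`: `ψ₀(r) = -ε ∫_{R₁}^r s b(s) ds`. -/
def ψ₀ (R₁ : ℝ) (b : ℝ → ℝ) (ε : ℝ) (r : ℝ) : ℝ := -ε * ∫ s in R₁..r, s * b s

/-- `ω` and `b` are `C³` on `(R₁, R₂)`, up to the positive finite endpoints, and `b` has a
positive lower bound. -/
structure RegularProfile (R₁ : ℝ) (R₂ : EReal) (ω b : ℝ → ℝ) : Prop where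
  contDiff_ω : ContDiffOn ℝ 3 ω (radialClosed R₁ R₂)
  contDiff_b : ContDiffOn ℝ 3 b (radialClosed R₁ R₂)
  lower_b : ∃ c > 0, ∀ r ∈ radial R₁ R₂, c ≤ b r

/-- Behaviour as `r → 0`: `ω' = O(r^{β-3})`, `b' = O(r^{β-1})` for some `β ≥ 4`, where these
relations may be differentiated once. -/
def DecayAtZero (ω b : ℝ → ℝ) : Prop :=
  ∃ β : ℝ, 4 ≤ β ∧
    deriv ω =O[𝓝[>] 0] (fun r => r ^ (β - 3)) ∧
    deriv (deriv ω) =O[𝓝[>] 0] (fun r => r ^ (β - 4)) ∧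
    deriv b =O[𝓝[>] 0] (fun r => r ^ (β - 1)) ∧
    deriv (deriv b) =O[𝓝[>] 0] (fun r => r ^ (β - 2))

/-- Behaviour as `r → ∞`: `ω = O(r^{-1-α})`, `b' = O(r^{-1-2α})` for some `α > 1`, where these
relations may be differentiated, up to the second derivatives of `ω` and `b`. -/
def DecayAtInfinity (ω b : ℝ → ℝ) : Prop :=
  ∃ α : ℝ, 1 < α ∧
    ω =O[atTop] (fun r => r ^ (-1 - α)) ∧
    deriv ω =O[atTop] (fun r => r ^ (-2 - α)) ∧
    deriv (deriv ω) =O[atTop] (fun r => r ^ (-3 - α)) ∧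
    deriv b =O[atTop] (fun r => r ^ (-1 - 2 * α)) ∧
    deriv (deriv b) =O[atTop] (fun r => r ^ (-2 - 2 * α))

/-! ### The operators `𝕃_k` -/

/-- `𝔉(r) = ∂_r(ω²) / (ε² b² r) + (∂_r² b / (r² b) - ∂_r b / (r³ b))`. -/
def frakF (ω b : ℝ → ℝ) (ε r : ℝ) : ℝ :=
  deriv (fun s => ω s ^ 2) r / (ε ^ 2 * b r ^ 2 * r) +
    (deriv (deriv b) r / (r ^ 2 * b r) - deriv b r / (r ^ 3 * b r))

/-- `h ∈ H_mag^r(R₁, R₂)` with (a.e. defined) derivative `h'`: `h` is absolutely continuous,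
`h(R₁) = h(R₂) = 0` and `∫ (|h'|² / r + |h|² / r) dr < ∞`. -/
structure MemHmagR (R₁ : ℝ) (R₂ : EReal) (h h' : ℝ → ℝ) : Prop where
  aesm : AEStronglyMeasurable h' (volume.restrict (radial R₁ R₂))
  primitive : ∀ r ∈ radial R₁ R₂, h r = ∫ s in R₁..r, h' s
  outer : Tendsto h (toOuter R₂) (𝓝 0)
  integrable_deriv : IntegrableOn (fun r => h' r ^ 2 / r) (radial R₁ R₂)
  integrable_self : IntegrableOn (fun r => h r ^ 2 / r) (radial R₁ R₂)

/-- The quadratic form `⟨𝕃_k h, h⟩` of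
`𝕃_k = -(1/r) ∂_r ((1/r) ∂_r ·) + k²/r² + 𝔉(r)`, with the pairing `∫ · · r dr`. -/
def formL (R₁ : ℝ) (R₂ : EReal) (ω b : ℝ → ℝ) (ε : ℝ) (k : ℤ) (h h' : ℝ → ℝ) : ℝ :=
  ∫ r in radial R₁ R₂,
    (h' r ^ 2 / r + (k : ℝ) ^ 2 * h r ^ 2 / r + frakF ω b ε r * r * h r ^ 2)

/-- `𝕃_k > 0` on `H_mag^r`. -/
def LPos (R₁ : ℝ) (R₂ : EReal) (ω b : ℝ → ℝ) (ε : ℝ) (k : ℤ) : Prop :=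
  ∀ h h' : ℝ → ℝ, MemHmagR R₁ R₂ h h' → (∃ r ∈ radial R₁ R₂, h r ≠ 0) →
    0 < formL R₁ R₂ ω b ε k h h'

/-! ### Weak solutions -/

/-- Divergence-free test fields: smooth in `(s, x)`, periodic in `x₃`, with compact support in
`[0, ∞) × Ω` (the axis `r = 0` belongs to the interior of `Ω` if `R₁ = 0`). -/
structure IsTestField (R₁ : ℝ) (R₂ : EReal) (ξ : ℝ → E3 → E3) : Prop where
  smooth : ContDiff ℝ ((⊤ : ℕ∞) : WithTop ℕ∞) (fun p : ℝ × E3 => ξ p.1 p.2)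
  periodic : ∀ s x, ξ s (x + EuclideanSpace.single 2 (2 * Real.pi)) = ξ s x
  divFree : ∀ s x, ∑ i : Fin 3, fderiv ℝ (ξ s) x (EuclideanSpace.single i 1) i = 0
  support : ∃ K : Set ℝ, IsCompact K ∧ (∀ ρ ∈ K, (R₁ = 0 ∨ R₁ < ρ) ∧ (ρ : EReal) < R₂) ∧
    ∃ S : ℝ, ∀ s x, ξ s x ≠ 0 → s ≤ S ∧ cylR x ∈ K

/-- `∫_Ω [∂_s ξ · v + ∇ξ : (v ⊗ v - H ⊗ H)] dx` at time `s`. -/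
def momentumRHS (R₁ : ℝ) (R₂ : EReal) (v H : ℝ → AxiField) (ξ : ℝ → E3 → E3) (s : ℝ) : ℝ :=
  ∫ x in Omega R₁ R₂,
    (inner ℝ (deriv (fun τ => ξ τ x) s) ((v s).toField x) +
      inner ℝ (fderiv ℝ (ξ s) x ((v s).toField x)) ((v s).toField x) -
      inner ℝ (fderiv ℝ (ξ s) x ((H s).toField x)) ((H s).toField x))

/-- `∫_Ω [∂_s ξ · H + ∇ξ : (H ⊗ v - v ⊗ H)] dx` at time `s`, where
`∇ξ : (a ⊗ c) = ∑_{i,j} ∂_j ξ_i a_i c_j`. -/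
def inductionRHS (R₁ : ℝ) (R₂ : EReal) (v H : ℝ → AxiField) (ξ : ℝ → E3 → E3) (s : ℝ) : ℝ :=
  ∫ x in Omega R₁ R₂,
    (inner ℝ (deriv (fun τ => ξ τ x) s) ((H s).toField x) +
      inner ℝ (fderiv ℝ (ξ s) x ((v s).toField x)) ((H s).toField x) -
      inner ℝ (fderiv ℝ (ξ s) x ((H s).toField x)) ((v s).toField x))

/-- `∫_Ω ξ · u dx`. -/
def pairing (R₁ : ℝ) (R₂ : EReal) (ξ : E3 → E3) (u : AxiField) : ℝ :=
  ∫ x in Omega R₁ R₂, inner ℝ (ξ x) (u.toField x)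

/-- Global axisymmetric weak solutions of ideal MHD with initial datum `(v 0, H 0)`. The
perturbation `(v - v₀, H - H₀)` is in `L²` at all times (for bounded `Ω` this is the same as
`(v, H) ∈ L²`; for `R₂ = ∞` it contains the condition at infinity). -/
structure IsWeakSolution (R₁ : ℝ) (R₂ : EReal) (ω b : ℝ → ℝ) (ε : ℝ) (v H : ℝ → AxiField) :
    Prop where
  memL2 : ∀ t, 0 ≤ t → (v t - v₀ ω).MemL2 R₁ R₂ ∧ (H t - H₀ b ε).MemL2 R₁ R₂
  continuous : ∀ t, 0 < t → Tendsto
    (fun s => ∫ p, ((v s - v t).sq p + (H s - H t).sq p) ∂(cylMeasure R₁ R₂)) (𝓝 t) (𝓝 0)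
  solenoidal : ∀ t, 0 ≤ t → (v t).Solenoidal R₁ R₂ ∧ (H t).Solenoidal R₁ R₂
  momentum : ∀ ξ, IsTestField R₁ R₂ ξ → ∀ t, 0 < t →
    IntervalIntegrable (momentumRHS R₁ R₂ v H ξ) volume 0 t ∧
    ∫ s in (0 : ℝ)..t, momentumRHS R₁ R₂ v H ξ s =
      pairing R₁ R₂ (ξ t) (v t) - pairing R₁ R₂ (ξ 0) (v 0)
  induction : ∀ ξ, IsTestField R₁ R₂ ξ → ∀ t, 0 < t →
    IntervalIntegrable (inductionRHS R₁ R₂ v H ξ) volume 0 t ∧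
    ∫ s in (0 : ℝ)..t, inductionRHS R₁ R₂ v H ξ s =
      pairing R₁ R₂ (ξ t) (H t) - pairing R₁ R₂ (ξ 0) (H 0)

/-- `ψ` is the magnetic potential of `H`: `H_r = ∂_z ψ / r`, `H_z = -∂_r ψ / r`, `ψ = 0` at
`r = R₁`; at `r = R₂ < ∞`, `ψ` is a constant independent of `z` and of time (necessarily
`-∫ r H_z(0, r, z) dr`), and `ψ - ψ₀ → 0` as `r → ∞` if `R₂ = ∞`. -/
structure IsMagneticPotential (R₁ : ℝ) (R₂ : EReal) (b : ℝ → ℝ) (ε : ℝ)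
    (H : ℝ → AxiField) (ψ : ℝ → ℝ → ℝ → ℝ) : Prop where
  aesm : ∀ t, 0 ≤ t → AEStronglyMeasurable (fun p : ℝ × ℝ => ψ t p.1 p.2) (planeMeasure R₁ R₂)
  /-- for a.e. `z`, `ψ` is absolutely continuous in `r` with `∂_r ψ = -r H_z`, `ψ(R₁, z) = 0` -/
  radial_deriv : ∀ t, 0 ≤ t → ∀ᵐ z ∂zMeasure, ∀ r ∈ radial R₁ R₂,
    ψ t r z = -∫ s in R₁..r, s * (H t).z s z
  /-- `∂_z ψ = r H_r` in the sense of distributions, on the periodic strip -/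
  axial_deriv : ∀ t, 0 ≤ t → ∀ χ : ℝ × ℝ → ℝ, ContDiff ℝ ((⊤ : ℕ∞) : WithTop ℕ∞) χ →
    (∀ r z, χ (r, z + 2 * Real.pi) = χ (r, z)) →
    (∃ K ⊆ radial R₁ R₂, IsCompact K ∧ ∀ p, χ p ≠ 0 → p.1 ∈ K) →
    ∫ p, ψ t p.1 p.2 * deriv (fun z => χ (p.1, z)) p.2 ∂(planeMeasure R₁ R₂) =
      -∫ p, p.1 * (H t).r p.1 p.2 * χ p ∂(planeMeasure R₁ R₂)
  outer_finite : R₂ ≠ ⊤ → ∃ C : ℝ, ∀ t, 0 ≤ t → ∀ᵐ z ∂zMeasure,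
    Tendsto (fun r => ψ t r z) (toOuter R₂) (𝓝 C)
  outer_infinite : R₂ = ⊤ → ∀ t, 0 ≤ t → ∀ᵐ z ∂zMeasure,
    Tendsto (fun r => ψ t r z - ψ₀ R₁ b ε r) atTop (𝓝 0)

/-! ### Distance, energy and Casimir functionals -/

/-- The distance of `(v, H)` to the steady state. The last integrand is
`|∂_z(ψ - ψ₀)|² / r² + |∂_r(ψ - ψ₀)|² / r²`, because `∂_z ψ = r H_r` and `∂_r ψ = -r H_z`. -/
def mhdDist (R₁ : ℝ) (R₂ : EReal) (ω b : ℝ → ℝ) (ε : ℝ) (v H : AxiField) : ℝ :=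
  1 / 2 * (∫ p, (v.r p.1 p.2 ^ 2 + v.z p.1 p.2 ^ 2 + H.θ p.1 p.2 ^ 2) ∂(cylMeasure R₁ R₂)) +
  1 / 2 * (∫ p, (v.θ p.1 p.2 - p.1 * ω p.1) ^ 2 ∂(cylMeasure R₁ R₂)) +
  1 / 2 * (∫ p, (H.r p.1 p.2 ^ 2 + (H.z p.1 p.2 - ε * b p.1) ^ 2) ∂(cylMeasure R₁ R₂))

/-- `e` is the total energy of `(v, H)`: `½ ∫_Ω (|v|² + |H|²) dx` if `R₂ < ∞`, and the relative
energy `½ ∫_Ω (|v|² + |H|² - |v₀|² - |H₀|²) dx` if `R₂ = ∞`. The latter need not converge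
absolutely for finite-distance states, and is taken as the limit of the integrals over
`{r < R}`. -/
def IsTotalEnergy (R₁ : ℝ) (R₂ : EReal) (ω b : ℝ → ℝ) (ε : ℝ) (v H : AxiField) (e : ℝ) : Prop :=
  (R₂ ≠ ⊤ → e = 1 / 2 * ∫ p, (v.sq p + H.sq p) ∂(cylMeasure R₁ R₂)) ∧
  (R₂ = ⊤ → Tendsto (fun R : ℝ => 1 / 2 * ∫ p in {p : ℝ × ℝ | p.1 < R},
      (v.sq p + H.sq p - (v₀ ω).sq p - (H₀ b ε).sq p) ∂(cylMeasure R₁ R₂)) atTop (𝓝 e))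

/-- The total energy is well defined and non-increasing in time. -/
def EnergyNonincreasing (R₁ : ℝ) (R₂ : EReal) (ω b : ℝ → ℝ) (ε : ℝ) (v H : ℝ → AxiField) : Prop :=
  ∃ E : ℝ → ℝ, (∀ t, 0 ≤ t → IsTotalEnergy R₁ R₂ ω b ε (v t) (H t) (E t)) ∧
    AntitoneOn E (Ici 0)

/-- A functional `t ↦ ∫_Ω g(t, ·) dx` is conserved: its value at any time at which it is defined
is its initial value. -/
def Conserved (R₁ : ℝ) (R₂ : EReal) (g : ℝ → ℝ × ℝ → ℝ) : Prop :=
  ∀ t, 0 ≤ t → Integrable (g 0) (cylMeasure R₁ R₂) → Integrable (g t) (cylMeasure R₁ R₂) →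
    ∫ p, g t p ∂(cylMeasure R₁ R₂) = ∫ p, g 0 p ∂(cylMeasure R₁ R₂)

/-- Conservation of the Casimirs `∫ f(ψ) dx` and `∫ r v_θ Φ(ψ) dx` for all `f, Φ ∈ C¹(ℝ)`; if
`R₂ = ∞` they are taken relative to the steady state. -/
def CasimirsConserved (R₁ : ℝ) (R₂ : EReal) (ω b : ℝ → ℝ) (ε : ℝ) (v : ℝ → AxiField)
    (ψ : ℝ → ℝ → ℝ → ℝ) : Prop :=
  (R₂ ≠ ⊤ →
    (∀ f : ℝ → ℝ, ContDiff ℝ 1 f → Conserved R₁ R₂ (fun t p => f (ψ t p.1 p.2))) ∧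
    (∀ Φ : ℝ → ℝ, ContDiff ℝ 1 Φ →
      Conserved R₁ R₂ (fun t p => p.1 * (v t).θ p.1 p.2 * Φ (ψ t p.1 p.2)))) ∧
  (R₂ = ⊤ →
    (∀ f : ℝ → ℝ, ContDiff ℝ 1 f →
      Conserved R₁ R₂ (fun t p => f (ψ t p.1 p.2) - f (ψ₀ R₁ b ε p.1))) ∧
    (∀ Φ : ℝ → ℝ, ContDiff ℝ 1 Φ →
      Conserved R₁ R₂ (fun t p => p.1 * (v t).θ p.1 p.2 * Φ (ψ t p.1 p.2) -
        p.1 ^ 2 * ω p.1 * Φ (ψ₀ R₁ b ε p.1))))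

end RotMHD

end

open MeasureTheory Filter Topology Set Asymptotics

noncomputable section

namespace RotMHD

/-! ### Integral inequalities -/

theorem sq_integral_mul_le {α : Type*} [MeasurableSpace α] {m : Measure α} {f g : α → ℝ}
    (hf : Integrable (fun x => f x ^ 2) m) (hg : Integrable (fun x => g x ^ 2) m)
    (hfg : Integrable (fun x => f x * g x) m) :
    (∫ x, f x * g x ∂m) ^ 2 ≤ (∫ x, f x ^ 2 ∂m) * ∫ x, g x ^ 2 ∂m := by
  have key : ∀ l : ℝ, 0 ≤ (∫ x, g x ^ 2 ∂m) * (l * l) + (-2 * ∫ x, f x * g x ∂m) * l +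
      ∫ x, f x ^ 2 ∂m := by
    intro l
    have h0 : 0 ≤ ∫ x, (f x - l * g x) ^ 2 ∂m := integral_nonneg fun x => sq_nonneg _
    have h1 : ∫ x, (f x - l * g x) ^ 2 ∂m =
        ∫ x, (f x ^ 2 + (-2 * l) * (f x * g x) + (l * l) * g x ^ 2) ∂m := by
      congr 1; ext x; ring
    have h2 : Integrable (fun x => f x ^ 2 + (-2 * l) * (f x * g x)) m :=
      hf.add (hfg.const_mul _)
    rw [h1, integral_add h2 (hg.const_mul _), integral_add hf (hfg.const_mul _), integral_const_mul, integral_const_mul] at h0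
    linarith
  have := discrim_le_zero key
  rw [discrim] at this
  nlinarith

theorem abs_le_sq_div_add {x s : ℝ} (hs : 0 < s) : |x| ≤ x ^ 2 / s + s := by
  rw [abs_le]
  constructor
  · have : 0 ≤ (x / s + 1) ^ 2 * s + (x^2/s + s) := by positivity
    have e : (x / s + 1) ^ 2 * s = x ^ 2 / s + 2 * x + s := by field_simp; ring
    linarith
  · have : 0 ≤ (x / s - 1) ^ 2 * s + (x^2/s + s) := by positivity
    have e : (x / s - 1) ^ 2 * s = x ^ 2 / s - 2 * x + s := by field_simp; ring
    linarith

/-! ### The radial interval -/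

section Radial

variable {R1 : ℝ} {R2 : EReal}

theorem isOpen_radial : IsOpen (radial R1 R2) :=
  isOpen_Ioi.inter (isOpen_Iio.preimage continuous_coe_real_ereal)

theorem measurableSet_radial : MeasurableSet (radial R1 R2) := isOpen_radial.measurableSet

theorem ordConnected_radial : (radial R1 R2).OrdConnected := by
  constructor
  rintro a ha b hb c ⟨h1, h2⟩
  exact ⟨lt_of_lt_of_le ha.1 h1, lt_of_le_of_lt (by exact_mod_cast h2) hb.2⟩

theorem Ioc_subset_radial {r : ℝ} (hr : r ∈ radial R1 R2) : Ioc R1 r ⊆ radial R1 R2 :=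
  fun _ hs => ⟨hs.1, lt_of_le_of_lt (by exact_mod_cast hs.2) hr.2⟩

theorem uIoc_subset_radial {a b : ℝ} (ha : a ∈ insert R1 (radial R1 R2))
    (hb : b ∈ insert R1 (radial R1 R2)) : uIoc a b ⊆ radial R1 R2 := by
  have key : ∀ {a b s : ℝ}, a ∈ insert R1 (radial R1 R2) → b ∈ insert R1 (radial R1 R2) →
      a < s → s ≤ b → s ∈ radial R1 R2 := by
    intro a b s ha hb h1 h2
    have ha' : R1 ≤ a := by
      rcases ha with ha | ha
      · exact ha.ge
      · exact ha.1.le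
    rcases hb with hb | hb
    · rw [hb] at h2; linarith
    · exact Ioc_subset_radial hb ⟨by linarith, h2⟩
  intro s hs
  rcases mem_uIoc.1 hs with ⟨h1, h2⟩ | ⟨h1, h2⟩
  · exact key ha hb h1 h2
  · exact key hb ha h1 h2

theorem radial_subset_radialClosed (h₁ : 0 ≤ R1) : radial R1 R2 ⊆ radialClosed R1 R2 :=
  fun _ hr => ⟨lt_of_le_of_lt h₁ hr.1, hr.1.le, hr.2.le⟩

theorem radial_nonempty (hR : (R1 : EReal) < R2) : (radial R1 R2).Nonempty := by
  obtain ⟨r, h1, h2⟩ := EReal.lt_iff_exists_real_btwn.1 hR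
  exact ⟨r, by exact_mod_cast h1, h2⟩

theorem radial_pos (h₁ : 0 ≤ R1) {r : ℝ} (hr : r ∈ radial R1 R2) : 0 < r :=
  lt_of_le_of_lt h₁ hr.1

/-- For bounded `Ω`, `toOuter` is the left neighbourhood of `R2`. -/
theorem exists_toOuter_eq (hR : (R1 : EReal) < R2) (h : R2 ≠ ⊤) :
    ∃ c : ℝ, R2 = c ∧ R1 < c ∧ toOuter R2 = 𝓝[<] c ∧ radial R1 R2 = Ioo R1 c := by
  have hb : R2 ≠ ⊥ := (lt_of_le_of_lt bot_le hR).ne'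
  lift R2 to ℝ using ⟨h, hb⟩
  refine ⟨R2, rfl, by exact_mod_cast hR, by simp [toOuter], ?_⟩
  ext r; simp [radial]

theorem radial_top : radial R1 ⊤ = Ioi R1 := by
  ext r; simp [radial, EReal.coe_lt_top]

theorem toOuter_top : toOuter ⊤ = atTop := by simp [toOuter]

theorem radial_mem_toOuter (hR : (R1 : EReal) < R2) : radial R1 R2 ∈ toOuter R2 := by
  by_cases h : R2 = ⊤
  · subst h; rw [radial_top, toOuter_top]; exact Ioi_mem_atTop _
  · obtain ⟨c, -, hc, h1, h2⟩ := exists_toOuter_eq hR h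
    rw [h1, h2]
    exact Ioo_mem_nhdsLT hc

instance toOuter_neBot : (toOuter R2).NeBot := by
  by_cases h : R2 = ⊤
  · subst h; rw [toOuter_top]; infer_instance
  · simp only [toOuter, h, if_false]; infer_instance

instance toOuter_isCountablyGenerated : (toOuter R2).IsCountablyGenerated := by
  by_cases h : R2 = ⊤
  · subst h; rw [toOuter_top]; infer_instance
  · simp only [toOuter, h, if_false]; infer_instance

theorem eventually_lt_toOuter (hR : (R1 : EReal) < R2) {r : ℝ} (hr : r ∈ radial R1 R2) :
    ∀ᶠ s in toOuter R2, r < s := by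
  by_cases h : R2 = ⊤
  · subst h; rw [toOuter_top]; exact eventually_gt_atTop r
  · obtain ⟨c, -, hc, h1, h2⟩ := exists_toOuter_eq hR h
    rw [h1]; rw [h2] at hr
    exact eventually_of_mem (Ioo_mem_nhdsLT hr.2) fun x hx => hx.1

end Radial

/-! ### Primitives of functions in `L²(dr / r)` -/

section Primitive

variable {R1 : ℝ} {R2 : EReal} {g h : ℝ → ℝ}

theorem intervalIntegrable_of_sq_div (h₁ : 0 ≤ R1)
    (hm : AEStronglyMeasurable g (volume.restrict (radial R1 R2)))
    (hg : IntegrableOn (fun r => g r ^ 2 / r) (radial R1 R2)) {a b : ℝ}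
    (ha : a ∈ insert R1 (radial R1 R2)) (hb : b ∈ insert R1 (radial R1 R2)) :
    IntervalIntegrable g volume a b := by
  rw [intervalIntegrable_iff]
  have hsub := uIoc_subset_radial ha hb
  have hid : IntegrableOn (fun s : ℝ => s) (uIoc a b) :=
    intervalIntegrable_iff.1 (continuous_id.intervalIntegrable _ _)
  refine Integrable.mono' ((hg.mono_set hsub).add hid) (hm.mono_set hsub) ?_
  filter_upwards [ae_restrict_mem measurableSet_uIoc] with s hs
  exact abs_le_sq_div_add (radial_pos h₁ (hsub hs))

theorem sq_integral_le_of_sq_div (h₁ : 0 ≤ R1)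
    (hm : AEStronglyMeasurable g (volume.restrict (radial R1 R2)))
    (hg : IntegrableOn (fun r => g r ^ 2 / r) (radial R1 R2)) {a b : ℝ}
    (ha : a ∈ insert R1 (radial R1 R2)) (hb : b ∈ insert R1 (radial R1 R2)) (hab : a ≤ b) :
    (∫ s in a..b, g s) ^ 2 ≤ (b ^ 2 - a ^ 2) / 2 * ∫ r in radial R1 R2, g r ^ 2 / r := by
  have hI := intervalIntegrable_of_sq_div h₁ hm hg ha hb
  have hsub := uIoc_subset_radial ha hb
  rw [uIoc_of_le hab] at hsub
  rw [intervalIntegrable_iff_integrableOn_Ioc_of_le hab] at hI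
  have hid : IntegrableOn (fun s : ℝ => s) (Ioc a b) :=
    (intervalIntegrable_iff_integrableOn_Ioc_of_le hab).1 (continuous_id.intervalIntegrable _ _)
  have hpos : ∀ᵐ s ∂volume.restrict (Ioc a b), 0 < s := by
    filter_upwards [ae_restrict_mem measurableSet_Ioc] with s hs
    exact radial_pos h₁ (hsub hs)
  have e1 : (fun s => Real.sqrt s ^ 2) =ᵐ[volume.restrict (Ioc a b)] fun s => s := by
    filter_upwards [hpos] with s hs using Real.sq_sqrt hs.le
  have e2 : (fun s => (g s / Real.sqrt s) ^ 2) =ᵐ[volume.restrict (Ioc a b)]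
      fun s => g s ^ 2 / s := by
    filter_upwards [hpos] with s hs
    rw [div_pow, Real.sq_sqrt hs.le]
  have e3 : (fun s => Real.sqrt s * (g s / Real.sqrt s)) =ᵐ[volume.restrict (Ioc a b)] g := by
    filter_upwards [hpos] with s hs
    rw [mul_div_cancel₀]
    exact (Real.sqrt_pos.2 hs).ne'
  have := sq_integral_mul_le (f := fun s => Real.sqrt s) (g := fun s => g s / Real.sqrt s)
    (hid.congr e1.symm) (Integrable.congr (hg.mono_set hsub) e2.symm)
    (Integrable.congr hI e3.symm)
  rw [integral_congr_ae e1, integral_congr_ae e2, integral_congr_ae e3] at this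
  rw [intervalIntegral.integral_of_le hab]
  refine this.trans ?_
  rw [← intervalIntegral.integral_of_le hab, integral_id]
  refine mul_le_mul_of_nonneg_left ?_ ?_
  · refine setIntegral_mono_set hg ?_ hsub.eventuallyLE
    filter_upwards [ae_restrict_mem measurableSet_radial] with s hs
    have := radial_pos h₁ hs
    positivity
  · have ha0 : 0 ≤ a := by
      rcases ha with rfl | ha
      · exact h₁
      · exact (radial_pos h₁ ha).le
    nlinarith

/-- `h` is the primitive of `g`, vanishing at `R1`, and `∫ g² / r dr < ∞`. -/
structure RadialPrimitive (R1 : ℝ) (R2 : EReal) (h g : ℝ → ℝ) : Prop where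
  aesm : AEStronglyMeasurable g (volume.restrict (radial R1 R2))
  integrable : IntegrableOn (fun r => g r ^ 2 / r) (radial R1 R2)
  primitive : ∀ r ∈ radial R1 R2, h r = ∫ s in R1..r, g s

/-- The energy `∫ g² / r dr`. -/
def gradEnergy (R1 : ℝ) (R2 : EReal) (g : ℝ → ℝ) : ℝ := ∫ r in radial R1 R2, g r ^ 2 / r

theorem gradEnergy_nonneg (h₁ : 0 ≤ R1) : 0 ≤ gradEnergy R1 R2 g := by
  refine setIntegral_nonneg measurableSet_radial fun r hr => ?_
  have := radial_pos h₁ hr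
  positivity

namespace RadialPrimitive

theorem intervalIntegrable (hp : RadialPrimitive R1 R2 h g) (h₁ : 0 ≤ R1) {a b : ℝ}
    (ha : a ∈ insert R1 (radial R1 R2)) (hb : b ∈ insert R1 (radial R1 R2)) :
    IntervalIntegrable g volume a b :=
  intervalIntegrable_of_sq_div h₁ hp.aesm hp.integrable ha hb

theorem sub_eq (hp : RadialPrimitive R1 R2 h g) (h₁ : 0 ≤ R1) {a b : ℝ}
    (ha : a ∈ radial R1 R2) (hb : b ∈ radial R1 R2) : h b - h a = ∫ s in a..b, g s := by
  rw [hp.primitive b hb, hp.primitive a ha]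
  exact intervalIntegral.integral_interval_sub_left
    (hp.intervalIntegrable h₁ (mem_insert _ _) (mem_insert_of_mem _ hb))
    (hp.intervalIntegrable h₁ (mem_insert _ _) (mem_insert_of_mem _ ha))

theorem sq_sub_le (hp : RadialPrimitive R1 R2 h g) (h₁ : 0 ≤ R1) {a b : ℝ}
    (ha : a ∈ radial R1 R2) (hb : b ∈ radial R1 R2) :
    (h b - h a) ^ 2 ≤ |b ^ 2 - a ^ 2| / 2 * gradEnergy R1 R2 g := by
  rcases le_total a b with hab | hab
  · rw [hp.sub_eq h₁ ha hb, abs_of_nonneg (by have := radial_pos h₁ ha; nlinarith)]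
    exact sq_integral_le_of_sq_div h₁ hp.aesm hp.integrable (mem_insert_of_mem _ ha)
      (mem_insert_of_mem _ hb) hab
  · rw [← neg_sub (h a) (h b), neg_sq, hp.sub_eq h₁ hb ha, abs_sub_comm,
      abs_of_nonneg (by have := radial_pos h₁ hb; nlinarith)]
    exact sq_integral_le_of_sq_div h₁ hp.aesm hp.integrable (mem_insert_of_mem _ hb)
      (mem_insert_of_mem _ ha) hab

theorem sq_le' (hp : RadialPrimitive R1 R2 h g) (h₁ : 0 ≤ R1) {r : ℝ}
    (hr : r ∈ radial R1 R2) : h r ^ 2 ≤ (r ^ 2 - R1 ^ 2) / 2 * gradEnergy R1 R2 g := by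
  rw [hp.primitive r hr]
  exact sq_integral_le_of_sq_div h₁ hp.aesm hp.integrable (mem_insert _ _)
    (mem_insert_of_mem _ hr) hr.1.le

theorem sq_le (hp : RadialPrimitive R1 R2 h g) (h₁ : 0 ≤ R1) {r : ℝ}
    (hr : r ∈ radial R1 R2) : h r ^ 2 ≤ r ^ 2 / 2 * gradEnergy R1 R2 g :=
  (hp.sq_le' h₁ hr).trans (mul_le_mul_of_nonneg_right (by nlinarith [sq_nonneg R1])
    (gradEnergy_nonneg h₁))

theorem continuousOn (hp : RadialPrimitive R1 R2 h g) (h₁ : 0 ≤ R1) :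
    ContinuousOn h (radial R1 R2) := by
  intro a ha
  rw [ContinuousWithinAt, tendsto_iff_dist_tendsto_zero]
  have lim : Tendsto (fun b => Real.sqrt (|b ^ 2 - a ^ 2| / 2 * gradEnergy R1 R2 g))
      (𝓝[radial R1 R2] a) (𝓝 0) := by
    have : Continuous (fun b => Real.sqrt (|b ^ 2 - a ^ 2| / 2 * gradEnergy R1 R2 g)) := by
      fun_prop
    have h2 := this.tendsto a
    simp only [sub_self, abs_zero, zero_div, zero_mul, Real.sqrt_zero] at h2
    exact h2.mono_left nhdsWithin_le_nhds
  refine squeeze_zero' (Eventually.of_forall fun _ => dist_nonneg) ?_ lim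
  filter_upwards [self_mem_nhdsWithin] with b hb
  rw [Real.dist_eq]
  exact Real.abs_le_sqrt (hp.sq_sub_le h₁ ha hb)

theorem aestronglyMeasurable (hp : RadialPrimitive R1 R2 h g) (h₁ : 0 ≤ R1) :
    AEStronglyMeasurable h (volume.restrict (radial R1 R2)) :=
  (hp.continuousOn h₁).aestronglyMeasurable measurableSet_radial

theorem add {h' g' : ℝ → ℝ} (hp : RadialPrimitive R1 R2 h g) (hp' : RadialPrimitive R1 R2 h' g')
    (h₁ : 0 ≤ R1) : RadialPrimitive R1 R2 (fun r => h r + h' r) (fun r => g r + g' r) where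
  aesm := hp.aesm.add hp'.aesm
  integrable := by
    have hm := hp.aesm.add hp'.aesm
    refine Integrable.mono' ((hp.integrable.const_mul 2).add (hp'.integrable.const_mul 2))
      ((hm.pow 2).mul (measurable_id.inv.aestronglyMeasurable)) ?_
    filter_upwards [ae_restrict_mem measurableSet_radial] with r hr
    have := radial_pos h₁ hr
    rw [Real.norm_of_nonneg (by positivity)]
    simp only [Pi.add_apply]
    rw [← mul_div_assoc, ← mul_div_assoc, ← add_div]
    gcongr
    nlinarith [sq_nonneg (g r - g' r)]
  primitive r hr := by
    rw [hp.primitive r hr, hp'.primitive r hr, intervalIntegral.integral_add]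
    · exact hp.intervalIntegrable h₁ (mem_insert _ _) (mem_insert_of_mem _ hr)
    · exact hp'.intervalIntegrable h₁ (mem_insert _ _) (mem_insert_of_mem _ hr)

theorem const_mul (hp : RadialPrimitive R1 R2 h g) (c : ℝ) :
    RadialPrimitive R1 R2 (fun r => c * h r) (fun r => c * g r) where
  aesm := hp.aesm.const_mul c
  integrable := by
    refine (hp.integrable.const_mul (c ^ 2)).congr (Eventually.of_forall fun r => ?_)
    simp only; ring
  primitive r hr := by
    rw [hp.primitive r hr, intervalIntegral.integral_const_mul]

end RadialPrimitive

/-- Product rule for a primitive and a `C¹` function, in integrated form. -/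
theorem integral_mul_add_mul_of_primitive {a b : ℝ} (hab : a ≤ b) {u u' k : ℝ → ℝ} {c : ℝ}
    (hu : ∀ x ∈ Icc a b, HasDerivAt u (u' x) x) (hu' : ContinuousOn u' (Icc a b))
    (hk : IntervalIntegrable k volume a b) :
    ∫ x in a..b, (u' x * (c + ∫ s in a..x, k s) + u x * k x) =
      u b * (c + ∫ s in a..b, k s) - u a * c := by
  have hL : AbsolutelyContinuousOnInterval u a b := by
    obtain ⟨C, hC⟩ := isCompact_Icc.exists_bound_of_continuousOn hu'
    refine LipschitzOnWith.absolutelyContinuousOnInterval (K := Real.toNNReal C) ?_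
    rw [uIcc_of_le hab]
    refine (convex_Icc a b).lipschitzOnWith_of_nnnorm_hasDerivWithin_le
      (fun x hx => (hu x hx).hasDerivWithinAt) fun x hx => ?_
    rw [← NNReal.coe_le_coe, coe_nnnorm]
    exact (hC x hx).trans (Real.le_coe_toNNReal C)
  have hK := hk.absolutelyContinuousOnInterval_intervalIntegral (c := a) (by simp)
  have hK' : AbsolutelyContinuousOnInterval (fun x => c + ∫ s in a..x, k s) a b := by
    have h0 : AbsolutelyContinuousOnInterval (fun _ : ℝ => c) a b :=
      LipschitzOnWith.absolutelyContinuousOnInterval (K := 0) (LipschitzWith.const c).lipschitzOnWith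
    exact h0.fun_add hK
  have := hL.integral_deriv_mul_eq_sub hK'
  simp only [intervalIntegral.integral_same, add_zero] at this
  rw [← this]
  refine intervalIntegral.integral_congr_ae ?_
  filter_upwards [hk.ae_hasDerivAt_integral] with x hx hxm
  have hx1 : x ∈ uIcc a b := uIoc_subset_uIcc hxm
  have h1 := ((hx hx1 a (by simp)).const_add c).deriv
  rw [uIcc_of_le hab] at hx1
  rw [h1, (hu x hx1).deriv]

theorem integral_mul_add_mul_of_primitives {a b : ℝ} {k l : ℝ → ℝ} {c d : ℝ}
    (hk : IntervalIntegrable k volume a b) (hl : IntervalIntegrable l volume a b) :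
    ∫ x in a..b, (k x * (d + ∫ s in a..x, l s) + (c + ∫ s in a..x, k s) * l x) =
      (c + ∫ s in a..b, k s) * (d + ∫ s in a..b, l s) - c * d := by
  have key : ∀ {m : ℝ → ℝ} (e : ℝ), IntervalIntegrable m volume a b →
      AbsolutelyContinuousOnInterval (fun x => e + ∫ s in a..x, m s) a b := fun e hm =>
    (LipschitzOnWith.absolutelyContinuousOnInterval (K := 0)
      (LipschitzWith.const e).lipschitzOnWith).fun_add
      (hm.absolutelyContinuousOnInterval_intervalIntegral (c := a) (by simp))
  have := (key c hk).integral_deriv_mul_eq_sub (key d hl)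
  simp only [intervalIntegral.integral_same, add_zero] at this
  rw [← this]
  refine intervalIntegral.integral_congr_ae ?_
  filter_upwards [hk.ae_hasDerivAt_integral, hl.ae_hasDerivAt_integral] with x hx hx' hxm
  have hx1 : x ∈ uIcc a b := uIoc_subset_uIcc hxm
  rw [((hx hx1 a (by simp)).const_add c).deriv, ((hx' hx1 a (by simp)).const_add d).deriv]

end Primitive

/-! ### Periodic functions of `z` -/

section Fourier

instance : IsFiniteMeasure zMeasure := by unfold zMeasure; infer_instance

theorem zMeasure_univ : zMeasure.real univ = 2 * Real.pi := by
  simp [zMeasure, Measure.real, Real.pi_pos.le]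

theorem integral_zMeasure (u : ℝ → ℝ) :
    ∫ z, u z ∂zMeasure = ∫ z in (0 : ℝ)..(2 * Real.pi), u z := by
  rw [zMeasure, intervalIntegral.integral_of_le Real.two_pi_pos.le]

theorem integrable_mul_cos {u : ℝ → ℝ} (hu : Integrable u zMeasure) (n : ℤ) :
    Integrable (fun z => u z * Real.cos (n * z)) zMeasure :=
  hu.mul_bdd (c := 1) (by fun_prop) (Eventually.of_forall fun z => Real.abs_cos_le_one _)

theorem integrable_mul_sin {u : ℝ → ℝ} (hu : Integrable u zMeasure) (n : ℤ) :
    Integrable (fun z => u z * Real.sin (n * z)) zMeasure :=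
  hu.mul_bdd (c := 1) (by fun_prop) (Eventually.of_forall fun z => Real.abs_sin_le_one _)

theorem fourierCoeffOn_ofReal {u : ℝ → ℝ} (hu : Integrable u zMeasure) (n : ℤ) :
    fourierCoeffOn Real.two_pi_pos (fun z => (u z : ℂ)) n =
      (1 / (2 * Real.pi) : ℝ) * ((∫ z, u z * Real.cos (n * z) ∂zMeasure : ℝ) -
        Complex.I * (∫ z, u z * Real.sin (n * z) ∂zMeasure : ℝ)) := by
  rw [fourierCoeffOn_eq_integral, sub_zero, Complex.real_smul,
    intervalIntegral.integral_of_le Real.two_pi_pos.le]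
  congr 1
  rw [← integral_complex_ofReal, ← integral_complex_ofReal, ← integral_const_mul, ← integral_sub]
  · rw [zMeasure]
    congr 1
    ext z
    rw [fourier_coe_apply, smul_eq_mul]
    have e : 2 * (Real.pi : ℂ) * Complex.I * ((-n : ℤ) : ℂ) * (z : ℂ) /
        ((2 * Real.pi : ℝ) : ℂ) = ((-(n * z) : ℝ) : ℂ) * Complex.I := by
      have : (Real.pi : ℂ) ≠ 0 := by exact_mod_cast Real.pi_ne_zero
      push_cast
      field_simp
    rw [e, Complex.exp_mul_I, ← Complex.ofReal_cos, ← Complex.ofReal_sin, Real.cos_neg,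
      Real.sin_neg]
    push_cast
    ring
  · exact (integrable_mul_cos hu n).ofReal
  · exact (integrable_mul_sin hu n).ofReal.const_mul _

theorem hasSum_sq_coeff {u : ℝ → ℝ} (hu : MemLp u 2 zMeasure) :
    HasSum (fun n : ℤ => ‖fourierCoeffOn Real.two_pi_pos (fun z => (u z : ℂ)) n‖ ^ 2)
      ((2 * Real.pi)⁻¹ * ∫ z, u z ^ 2 ∂zMeasure) := by
  have := hasSum_sq_fourierCoeffOn (f := fun z => (u z : ℂ)) Real.two_pi_pos hu.ofReal
  simpa [integral_zMeasure] using this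

/-- `k` is the derivative of the periodic function `u`, in the sense of Fourier coefficients. -/
def IsPeriodicDeriv (u k : ℝ → ℝ) : Prop := ∀ n : ℤ,
  ∫ z, k z * Real.cos (n * z) ∂zMeasure = n * ∫ z, u z * Real.sin (n * z) ∂zMeasure ∧
  ∫ z, k z * Real.sin (n * z) ∂zMeasure = -(n * ∫ z, u z * Real.cos (n * z) ∂zMeasure)

/-- The mean value over the period. -/
def zMean (u : ℝ → ℝ) : ℝ := (2 * Real.pi)⁻¹ * ∫ z, u z ∂zMeasure

theorem integral_cos_int {n : ℤ} (hn : n ≠ 0) : ∫ z, Real.cos (n * z) ∂zMeasure = 0 := by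
  have hn' : (n : ℝ) ≠ 0 := by exact_mod_cast hn
  rw [integral_zMeasure, intervalIntegral.integral_comp_mul_left _ hn', integral_cos]
  have := Real.sin_int_mul_pi (2 * n)
  push_cast at this
  have h2 : Real.sin (n * (2 * Real.pi)) = 0 := by rw [← this]; ring_nf
  simp [h2]

theorem integral_sin_int (n : ℤ) : ∫ z, Real.sin (n * z) ∂zMeasure = 0 := by
  rcases eq_or_ne n 0 with rfl | hn
  · simp
  have hn' : (n : ℝ) ≠ 0 := by exact_mod_cast hn
  rw [integral_zMeasure, intervalIntegral.integral_comp_mul_left _ hn', integral_sin]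
  simp [Real.cos_int_mul_two_pi]

theorem integral_sub_const_sq {u : ℝ → ℝ} (hu : MemLp u 2 zMeasure) :
    ∫ z, (u z - zMean u) ^ 2 ∂zMeasure = ∫ z, u z ^ 2 ∂zMeasure - 2 * Real.pi * zMean u ^ 2 := by
  have h1 := hu.integrable_sq
  have h2 : Integrable u zMeasure := hu.integrable one_le_two
  have e : (fun z => (u z - zMean u) ^ 2) =
      fun z => u z ^ 2 - ((2 * zMean u) * u z - zMean u ^ 2) := by ext z; ring
  have h3 : Integrable (fun z => (2 * zMean u) * u z - zMean u ^ 2) zMeasure :=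
    (h2.const_mul _).sub (integrable_const _)
  rw [e, integral_sub h1 h3,
    integral_sub (h2.const_mul _) (integrable_const _), integral_const_mul, integral_const,
    zMeasure_univ, smul_eq_mul]
  have : ∫ z, u z ∂zMeasure = 2 * Real.pi * zMean u := by
    rw [zMean, mul_inv_cancel_left₀ Real.two_pi_pos.ne']
  rw [this]; ring

theorem ae_eq_zMean_of_coeff {u : ℝ → ℝ} (hu : MemLp u 2 zMeasure)
    (h : ∀ n : ℤ, n ≠ 0 → ∫ z, u z * Real.cos (n * z) ∂zMeasure = 0 ∧
      ∫ z, u z * Real.sin (n * z) ∂zMeasure = 0) : ∀ᵐ z ∂zMeasure, u z = zMean u := by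
  have hs := hasSum_sq_coeff hu
  have hi : Integrable u zMeasure := hu.integrable one_le_two
  have hs' : HasSum (fun n : ℤ => ‖fourierCoeffOn Real.two_pi_pos (fun z => (u z : ℂ)) n‖ ^ 2)
      (‖fourierCoeffOn Real.two_pi_pos (fun z => (u z : ℂ)) 0‖ ^ 2) := by
    refine hasSum_single 0 fun n hn => ?_
    rw [fourierCoeffOn_ofReal hi, (h n hn).1, (h n hn).2]
    simp
  have h0 := hs.unique hs'
  rw [fourierCoeffOn_ofReal hi] at h0
  have h1 : ‖((1 / (2 * Real.pi) : ℝ) : ℂ) * ((∫ z, u z * Real.cos ((0 : ℤ) * z) ∂zMeasure : ℝ) -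
        Complex.I * (∫ z, u z * Real.sin ((0 : ℤ) * z) ∂zMeasure : ℝ))‖ ^ 2 = zMean u ^ 2 := by
    simp only [Int.cast_zero, zero_mul, Real.cos_zero, mul_one, Real.sin_zero, mul_zero,
      integral_zero, Complex.ofReal_zero, sub_zero]
    rw [← Complex.ofReal_mul, Complex.norm_real, Real.norm_eq_abs, sq_abs, zMean, one_div]
  rw [h1] at h0
  have h2 : ∫ z, (u z - zMean u) ^ 2 ∂zMeasure = 0 := by
    rw [integral_sub_const_sq hu, ← h0, mul_inv_cancel_left₀ Real.two_pi_pos.ne']; ring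
  have h3 : MemLp (fun z => u z - zMean u) 2 zMeasure := hu.sub (memLp_const _)
  rw [integral_eq_zero_iff_of_nonneg (fun z => sq_nonneg _) h3.integrable_sq] at h2
  filter_upwards [h2] with z hz
  have : u z - zMean u = 0 := by simpa using hz
  linarith

theorem integral_sub_zMean_sq_le {u k : ℝ → ℝ} (hu : MemLp u 2 zMeasure)
    (hk : MemLp k 2 zMeasure) (h : IsPeriodicDeriv u k) :
    ∫ z, (u z - zMean u) ^ 2 ∂zMeasure ≤ ∫ z, k z ^ 2 ∂zMeasure := by
  have hi : Integrable u zMeasure := hu.integrable one_le_two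
  have hik : Integrable k zMeasure := hk.integrable one_le_two
  have hv : MemLp (fun z => u z - zMean u) 2 zMeasure := hu.sub (memLp_const _)
  have hiv : Integrable (fun z => u z - zMean u) zMeasure := hv.integrable one_le_two
  have h1 := hasSum_sq_coeff hv
  have h2 := hasSum_sq_coeff hk
  have hle := hasSum_le (fun n => ?_) h1 h2
  · exact le_of_mul_le_mul_left hle (inv_pos.2 Real.two_pi_pos)
  rcases eq_or_ne n 0 with rfl | hn
  · have : fourierCoeffOn Real.two_pi_pos (fun z => ((u z - zMean u : ℝ) : ℂ)) 0 = 0 := by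
      rw [fourierCoeffOn_ofReal hiv]
      simp only [Int.cast_zero, zero_mul, Real.cos_zero, mul_one, Real.sin_zero, mul_zero,
        integral_zero, Complex.ofReal_zero, sub_zero]
      rw [integral_sub hi (integrable_const _), integral_const, zMeasure_univ, smul_eq_mul, zMean,
        mul_inv_cancel_left₀ Real.two_pi_pos.ne']
      simp
    rw [this]; simp
  · have e1 : ∫ z, (u z - zMean u) * Real.cos (n * z) ∂zMeasure =
        ∫ z, u z * Real.cos (n * z) ∂zMeasure := by
      simp_rw [sub_mul]
      rw [integral_sub (integrable_mul_cos hi n) (integrable_mul_cos (integrable_const _) n),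
        integral_const_mul, integral_cos_int hn]; simp
    have e2 : ∫ z, (u z - zMean u) * Real.sin (n * z) ∂zMeasure =
        ∫ z, u z * Real.sin (n * z) ∂zMeasure := by
      simp_rw [sub_mul]
      rw [integral_sub (integrable_mul_sin hi n) (integrable_mul_sin (integrable_const _) n),
        integral_const_mul, integral_sin_int n]; simp
    have : fourierCoeffOn Real.two_pi_pos (fun z => (k z : ℂ)) n =
        (Complex.I * n) *
          fourierCoeffOn Real.two_pi_pos (fun z => ((u z - zMean u : ℝ) : ℂ)) n := by
      rw [fourierCoeffOn_ofReal hiv, fourierCoeffOn_ofReal hik, (h n).1, (h n).2, e1, e2]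
      push_cast
      linear_combination (1 / (2 * (Real.pi : ℂ)) * n *
        ((∫ z, u z * Real.sin (n * z) ∂zMeasure : ℝ) : ℂ)) * Complex.I_sq
    rw [this, norm_mul, mul_pow, norm_mul, Complex.norm_I, one_mul, Complex.norm_intCast]
    refine le_mul_of_one_le_left (by positivity) ?_
    rw [sq_abs]
    have : (1 : ℤ) ≤ n ^ 2 := by nlinarith [Int.one_le_abs hn, sq_abs n]
    exact_mod_cast this

theorem ae_sub_zMean_sq_le {u k : ℝ → ℝ} (hu : MemLp u 2 zMeasure)
    (hk : MemLp k 2 zMeasure) (h : IsPeriodicDeriv u k) :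
    ∀ᵐ z ∂zMeasure, (u z - zMean u) ^ 2 ≤ 2 * Real.pi * ∫ z, k z ^ 2 ∂zMeasure := by
  have hi : Integrable u zMeasure := hu.integrable one_le_two
  have hik : Integrable k zMeasure := hk.integrable one_le_two
  have hkI : IntervalIntegrable k volume 0 (2 * Real.pi) :=
    (intervalIntegrable_iff_integrableOn_Ioc_of_le Real.two_pi_pos.le).2 hik
  set P : ℝ → ℝ := fun z => ∫ s in (0 : ℝ)..z, k s with hP
  have hmem : ∀ᵐ z ∂zMeasure, z ∈ Ioc 0 (2 * Real.pi) := ae_restrict_mem measurableSet_Ioc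
  have hPc : ContinuousOn P (Icc 0 (2 * Real.pi)) := by
    have := intervalIntegral.continuousOn_primitive_interval (f := k) (μ := volume) (a := 0)
      (b := 2 * Real.pi)
      (by rw [uIcc_of_le Real.two_pi_pos.le]
          exact (intervalIntegrable_iff_integrableOn_Icc_of_le Real.two_pi_pos.le).1 hkI)
    rwa [uIcc_of_le Real.two_pi_pos.le] at this
  have hPm : AEStronglyMeasurable P zMeasure :=
    (hPc.mono Ioc_subset_Icc_self).aestronglyMeasurable measurableSet_Ioc
  have hosc : ∀ a ∈ Ioc 0 (2 * Real.pi), ∀ b ∈ Ioc 0 (2 * Real.pi),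
      |P a - P b| ≤ ∫ z, |k z| ∂zMeasure := by
    intro a ha b hb
    have hsub : ∀ c ∈ Ioc 0 (2 * Real.pi), IntervalIntegrable k volume 0 c := fun c hc =>
      hkI.mono_set (by rw [uIcc_of_le hc.1.le, uIcc_of_le Real.two_pi_pos.le]
                       exact Icc_subset_Icc_right hc.2)
    rw [hP]
    simp only
    rw [intervalIntegral.integral_interval_sub_left (hsub a ha) (hsub b hb)]
    rw [← Real.norm_eq_abs]
    refine (intervalIntegral.norm_integral_le_integral_norm_uIoc).trans ?_
    refine setIntegral_mono_set hik.norm (Eventually.of_forall fun z => norm_nonneg _) ?_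
    refine LE.le.eventuallyLE ?_
    intro z hz
    rcases mem_uIoc.1 hz with h | h
    · exact ⟨hb.1.trans h.1, h.2.trans ha.2⟩
    · exact ⟨ha.1.trans h.1, h.2.trans hb.2⟩
  have hlast : (2 * Real.pi) ∈ Ioc 0 (2 * Real.pi) := ⟨Real.two_pi_pos, le_rfl⟩
  have hk0 : P (2 * Real.pi) = 0 := by
    have := (h 0).1
    simp only [Int.cast_zero, zero_mul, Real.cos_zero, mul_one] at this
    rw [hP]; simp only; rw [← integral_zMeasure, this]
  have hPb : ∀ᵐ z ∂zMeasure, ‖P z‖ ≤ ∫ z, |k z| ∂zMeasure := by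
    filter_upwards [hmem] with z hz
    simpa [hk0] using hosc z hz _ hlast
  have hP2 : MemLp P 2 zMeasure := MemLp.of_bound hPm _ hPb
  have hPi : Integrable P zMeasure := hP2.integrable one_le_two
  have hv := ae_eq_zMean_of_coeff (hu.sub hP2) (fun n hn => by
    have hn' : (n : ℝ) ≠ 0 := by exact_mod_cast hn
    have c1 := integral_mul_add_mul_of_primitive (a := 0) (b := 2 * Real.pi) Real.two_pi_pos.le
      (u := fun z => Real.cos (n * z)) (u' := fun z => -(n * Real.sin (n * z))) (k := k) (c := 0)
      (fun x _ => by
        have := (Real.hasDerivAt_cos (n * x)).comp x ((hasDerivAt_id x).const_mul (n : ℝ))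
        simpa [Function.comp_def, mul_comm] using this)
      (by fun_prop) hkI
    have c2 := integral_mul_add_mul_of_primitive (a := 0) (b := 2 * Real.pi) Real.two_pi_pos.le
      (u := fun z => Real.sin (n * z)) (u' := fun z => n * Real.cos (n * z)) (k := k) (c := 0)
      (fun x _ => by
        have := (Real.hasDerivAt_sin (n * x)).comp x ((hasDerivAt_id x).const_mul (n : ℝ))
        simpa [Function.comp_def, mul_comm] using this)
      (by fun_prop) hkI
    have hk0' : ∫ s in (0 : ℝ)..(2 * Real.pi), k s = 0 := hk0
    rw [← integral_zMeasure, hk0'] at c1 c2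
    simp only [zero_add, mul_zero, sub_zero] at c1 c2
    have d1 : ∫ z, (-(n * Real.sin (n * z)) * P z + Real.cos (n * z) * k z) ∂zMeasure =
        -n * ∫ z, P z * Real.sin (n * z) ∂zMeasure + ∫ z, k z * Real.cos (n * z) ∂zMeasure := by
      rw [← integral_const_mul, ← integral_add ((integrable_mul_sin hPi n).const_mul _)
        (integrable_mul_cos hik n)]
      congr 1; ext z; ring
    have d2 : ∫ z, (n * Real.cos (n * z) * P z + Real.sin (n * z) * k z) ∂zMeasure =
        n * ∫ z, P z * Real.cos (n * z) ∂zMeasure + ∫ z, k z * Real.sin (n * z) ∂zMeasure := by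
      rw [← integral_const_mul, ← integral_add ((integrable_mul_cos hPi n).const_mul _)
        (integrable_mul_sin hik n)]
      congr 1; ext z; ring
    rw [d1, (h n).1] at c1
    rw [d2, (h n).2] at c2
    simp only [Pi.sub_apply, sub_mul]
    rw [integral_sub (integrable_mul_cos hi n) (integrable_mul_cos hPi n),
      integral_sub (integrable_mul_sin hi n) (integrable_mul_sin hPi n)]
    constructor
    · apply mul_left_cancel₀ hn'; linarith
    · apply mul_left_cancel₀ hn'; linarith)
  have hm : zMean (u - P) = zMean u - zMean P := by
    rw [zMean, zMean, zMean, ← mul_sub, ← integral_sub hi hPi]; rfl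
  have hL1 : (∫ z, |k z| ∂zMeasure) ^ 2 ≤ 2 * Real.pi * ∫ z, k z ^ 2 ∂zMeasure := by
    have := sq_integral_mul_le (f := fun _ => (1 : ℝ)) (g := fun z => |k z|) (m := zMeasure)
      (integrable_const _) (by simpa using hk.integrable_sq) (by simpa using hik.norm)
    simpa [zMeasure_univ] using this
  filter_upwards [hv, hmem] with z hz hzm
  have e : u z - zMean u = P z - zMean P := by
    rw [hm] at hz
    simp only [Pi.sub_apply] at hz
    linarith
  have e2 : P z - zMean P = (2 * Real.pi)⁻¹ * ∫ s, (P z - P s) ∂zMeasure := by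
    rw [integral_sub (integrable_const _) hPi, integral_const, zMeasure_univ, smul_eq_mul, mul_sub,
      inv_mul_cancel_left₀ Real.two_pi_pos.ne', zMean]
  have e3 : |P z - zMean P| ≤ ∫ z, |k z| ∂zMeasure := by
    rw [e2, abs_mul, abs_of_pos (inv_pos.2 Real.two_pi_pos), inv_mul_le_iff₀ Real.two_pi_pos]
    have := norm_integral_le_of_norm_le_const (μ := zMeasure) (f := fun s => P z - P s)
      (C := ∫ z, |k z| ∂zMeasure) (by
        filter_upwards [hmem] with s hs using hosc z hzm s hs)
    rw [zMeasure_univ, Real.norm_eq_abs] at this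
    linarith
  rw [e]
  refine le_trans ?_ hL1
  rw [← sq_abs]
  exact pow_le_pow_left₀ (abs_nonneg _) e3 2

end Fourier

/-! ### A Fatou lemma -/

theorem integrable_of_tendsto_of_integral_le {α : Type*} [MeasurableSpace α] {m : Measure α}
    {f : ℕ → α → ℝ} {F : α → ℝ} {C : ℝ} (hf : ∀ n, Integrable (f n) m)
    (h0 : ∀ n, 0 ≤ᵐ[m] f n) (hlim : ∀ᵐ x ∂m, Tendsto (fun n => f n x) atTop (𝓝 (F x)))
    (hC : ∀ n, ∫ x, f n x ∂m ≤ C) : Integrable F m ∧ ∫ x, F x ∂m ≤ C := by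
  have hm : AEStronglyMeasurable F m :=
    aestronglyMeasurable_of_tendsto_ae atTop (fun n => (hf n).aestronglyMeasurable) hlim
  have hF0 : 0 ≤ᵐ[m] F := by
    filter_upwards [hlim, ae_all_iff.2 h0] with x hx hx0
    exact ge_of_tendsto' hx hx0
  have hC0 : 0 ≤ C := (integral_nonneg_of_ae (h0 0)).trans (hC 0)
  have hl : ∫⁻ x, ENNReal.ofReal (F x) ∂m ≤ ENNReal.ofReal C := by
    calc ∫⁻ x, ENNReal.ofReal (F x) ∂m
        = ∫⁻ x, liminf (fun n => ENNReal.ofReal (f n x)) atTop ∂m := by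
          refine lintegral_congr_ae ?_
          filter_upwards [hlim] with x hx
          exact ((ENNReal.continuous_ofReal.tendsto _).comp hx).liminf_eq.symm
      _ ≤ liminf (fun n => ∫⁻ x, ENNReal.ofReal (f n x) ∂m) atTop :=
          lintegral_liminf_le' fun n => (hf n).aestronglyMeasurable.aemeasurable.ennreal_ofReal
      _ ≤ ENNReal.ofReal C := by
          refine liminf_le_of_le (by isBoundedDefault) fun b hb => ?_
          obtain ⟨n, hn⟩ := hb.exists
          refine hn.trans ?_
          rw [← ofReal_integral_eq_lintegral_ofReal (hf n) (h0 n)]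
          exact ENNReal.ofReal_le_ofReal (hC n)
  refine ⟨⟨hm, ?_⟩, ?_⟩
  · rw [hasFiniteIntegral_iff_ofReal hF0]
    exact hl.trans_lt ENNReal.ofReal_lt_top
  · rw [integral_eq_lintegral_of_nonneg_ae hF0 hm]
    exact ENNReal.toReal_le_of_le_ofReal hC0 hl

section Radial

variable {R1 : ℝ} {R2 : EReal} {g h : ℝ → ℝ}

theorem exists_radial_exhaustion (hR : (R1 : EReal) < R2) :
    ∃ a b : ℕ → ℝ, (∀ n, a n ∈ radial R1 R2 ∧ b n ∈ radial R1 R2 ∧ a n ≤ b n) ∧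
      ∀ x ∈ radial R1 R2, ∀ᶠ n in atTop, x ∈ Icc (a n) (b n) := by
  obtain ⟨x₀, hx₀⟩ := radial_nonempty hR
  have hI : radial R1 R2 ∈ 𝓝[>] R1 :=
    mem_of_superset (Ioo_mem_nhdsGT hx₀.1) fun x hx =>
      ⟨hx.1, lt_of_le_of_lt (by exact_mod_cast hx.2.le) hx₀.2⟩
  obtain ⟨a, ha⟩ := exists_seq_tendsto (𝓝[>] R1)
  obtain ⟨b, hb⟩ := exists_seq_tendsto (toOuter R2)
  have h1 : ∀ᶠ n in atTop, a n ∈ radial R1 R2 := ha hI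
  have h2 : ∀ᶠ n in atTop, b n ∈ radial R1 R2 := hb (radial_mem_toOuter hR)
  have h3 : ∀ᶠ n in atTop, a n < x₀ := ha (mem_of_superset (Ioo_mem_nhdsGT hx₀.1) fun x hx => hx.2)
  have h4 : ∀ᶠ n in atTop, x₀ < b n := hb.eventually (eventually_lt_toOuter hR hx₀)
  obtain ⟨M, hM⟩ := eventually_atTop.1 (h1.and (h2.and (h3.and h4)))
  refine ⟨fun n => a (n + M), fun n => b (n + M), fun n => ?_, fun x hx => ?_⟩
  · obtain ⟨q1, q2, q3, q4⟩ := hM (n + M) (by omega)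
    exact ⟨q1, q2, by linarith⟩
  · have l1 : ∀ᶠ n in atTop, a n < x :=
      ha (mem_of_superset (Ioo_mem_nhdsGT hx.1) fun x hx => hx.2)
    have l2 : ∀ᶠ n in atTop, x < b n := hb.eventually (eventually_lt_toOuter hR hx)
    filter_upwards [(tendsto_add_atTop_nat M).eventually l1,
      (tendsto_add_atTop_nat M).eventually l2] with n k1 k2
    exact ⟨k1.le, k2.le⟩

theorem integrableOn_radial_of_bounded (hR : (R1 : EReal) < R2) {f : ℝ → ℝ} {C : ℝ}
    (hf0 : ∀ r ∈ radial R1 R2, 0 ≤ f r)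
    (hf : ∀ a ∈ radial R1 R2, ∀ b ∈ radial R1 R2, a ≤ b →
      IntegrableOn f (Icc a b) ∧ ∫ r in a..b, f r ≤ C) :
    IntegrableOn f (radial R1 R2) ∧ ∫ r in radial R1 R2, f r ≤ C := by
  obtain ⟨a, b, hab, hcov⟩ := exists_radial_exhaustion hR
  have hsub : ∀ n, Icc (a n) (b n) ⊆ radial R1 R2 := fun n =>
    ordConnected_radial.out (hab n).1 (hab n).2.1
  refine integrable_of_tendsto_of_integral_le (f := fun n => (Icc (a n) (b n)).indicator f)
    (fun n => ?_) (fun n => ?_) ?_ (fun n => ?_)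
  · exact ((hf _ (hab n).1 _ (hab n).2.1 (hab n).2.2).1.integrable_indicator
      measurableSet_Icc).integrableOn
  · filter_upwards [ae_restrict_mem measurableSet_radial] with x hx
    exact indicator_nonneg (fun y hy => hf0 y (hsub n hy)) x
  · filter_upwards [ae_restrict_mem measurableSet_radial] with x hx
    refine tendsto_const_nhds.congr' ?_
    filter_upwards [hcov x hx] with n hn
    rw [indicator_of_mem hn]
  · rw [setIntegral_indicator measurableSet_Icc, inter_eq_self_of_subset_right (hsub n),
      integral_Icc_eq_integral_Ioc, ← intervalIntegral.integral_of_le (hab n).2.2]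
    exact (hf _ (hab n).1 _ (hab n).2.1 (hab n).2.2).2

/-! ### Hardy's inequality -/

theorem RadialPrimitive.div_eq (hp : RadialPrimitive R1 R2 h g) (h₁ : 0 ≤ R1) {a b : ℝ}
    (ha : a ∈ radial R1 R2) (hb : b ∈ radial R1 R2) (hab : a ≤ b) :
    IntervalIntegrable (fun x => g x / x - h x / x ^ 2) volume a b ∧
    h b / b = h a / a + ∫ x in a..b, (g x / x - h x / x ^ 2) := by
  have ha0 := radial_pos h₁ ha
  have hne : ∀ x ∈ Icc a b, x ≠ 0 := fun x hx => (ha0.trans_le hx.1).ne'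
  have hsub : Icc a b ⊆ radial R1 R2 := ordConnected_radial.out ha hb
  have hgi := hp.intervalIntegrable h₁ (mem_insert_of_mem _ ha) (mem_insert_of_mem _ hb)
  have hc := (hp.continuousOn h₁).mono hsub
  have i1 : IntervalIntegrable (fun x => g x / x) volume a b := by
    simp_rw [div_eq_mul_inv]
    refine hgi.mul_continuousOn ?_
    rw [uIcc_of_le hab]
    exact continuousOn_inv₀.mono fun x hx => hne x hx
  have i2 : IntervalIntegrable (fun x => h x / x ^ 2) volume a b := by
    refine ContinuousOn.intervalIntegrable ?_
    rw [uIcc_of_le hab]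
    exact hc.div (by fun_prop) fun x hx => pow_ne_zero 2 (hne x hx)
  refine ⟨i1.sub i2, ?_⟩
  have key := integral_mul_add_mul_of_primitive hab (u := fun x => x⁻¹) (u' := fun x => -(x ^ 2)⁻¹)
    (k := g) (c := h a) (fun x hx => hasDerivAt_inv (hne x hx))
    ((continuousOn_pow 2).inv₀ (fun x hx => pow_ne_zero 2 (hne x hx))).neg hgi
  have hh : ∀ x ∈ Icc a b, h a + ∫ s in a..x, g s = h x := fun x hx => by
    rw [← hp.sub_eq h₁ ha (hsub hx)]; ring
  rw [hh b (right_mem_Icc.2 hab)] at key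
  rw [intervalIntegral.integral_congr (g := fun x => g x / x - h x / x ^ 2)] at key
  · rw [key]; ring
  · intro x hx
    rw [uIcc_of_le hab] at hx
    change -(x ^ 2)⁻¹ * (h a + ∫ s in a..x, g s) + x⁻¹ * g x = g x / x - h x / x ^ 2
    rw [hh x hx]
    ring

theorem RadialPrimitive.hardy (hp : RadialPrimitive R1 R2 h g) (h₁ : 0 ≤ R1)
    (hR : (R1 : EReal) < R2) :
    IntegrableOn (fun r => h r ^ 2 / r ^ 3) (radial R1 R2) ∧
      ∫ r in radial R1 R2, h r ^ 2 / r ^ 3 ≤ 3 / 2 * gradEnergy R1 R2 g := by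
  refine integrableOn_radial_of_bounded hR (fun r hr => ?_) fun a ha b hb hab => ?_
  · have := radial_pos h₁ hr
    positivity
  have ha0 := radial_pos h₁ ha
  have hne : ∀ x ∈ Icc a b, x ≠ 0 := fun x hx => (ha0.trans_le hx.1).ne'
  have hsub : Icc a b ⊆ radial R1 R2 := ordConnected_radial.out ha hb
  have hc := (hp.continuousOn h₁).mono hsub
  have hci : ContinuousOn (fun r => h r ^ 2 / r ^ 3) (Icc a b) :=
    (hc.pow 2).div (by fun_prop) fun x hx => pow_ne_zero 3 (hne x hx)
  refine ⟨hci.integrableOn_Icc, ?_⟩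
  obtain ⟨hk, hkb⟩ := hp.div_eq h₁ ha hb hab
  have key := integral_mul_add_mul_of_primitives (c := h a / a) (d := h a / a) hk hk
  rw [← hkb] at key
  have hx' : ∀ x ∈ Icc a b, h a / a + ∫ s in a..x, (g s / s - h s / s ^ 2) = h x / x :=
    fun x hx => (hp.div_eq h₁ ha (hsub hx) hx.1).2.symm
  have e : ∫ x in a..b, 2 * (h x / x) * (g x / x - h x / x ^ 2) =
      h b / b * (h b / b) - h a / a * (h a / a) := by
    rw [← key]
    refine intervalIntegral.integral_congr fun x hx => ?_
    rw [uIcc_of_le hab] at hx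
    rw [hx' x hx]
    ring
  have hci' : IntervalIntegrable (fun r => h r ^ 2 / r ^ 3) volume a b :=
    (intervalIntegrable_iff_integrableOn_Icc_of_le hab).2 hci.integrableOn_Icc
  have hgi : IntervalIntegrable (fun r => g r ^ 2 / r) volume a b :=
    (intervalIntegrable_iff_integrableOn_Icc_of_le hab).2 (hp.integrable.mono_set hsub)
  have hli : IntervalIntegrable (fun x => 2 * (h x / x) * (g x / x - h x / x ^ 2)) volume a b := by
    refine hk.continuousOn_mul ?_
    rw [uIcc_of_le hab]
    exact (hc.div continuousOn_id hne).const_mul 2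
  have hle : ∫ x in a..b, 2 * (h x / x) * (g x / x - h x / x ^ 2) ≤
      ∫ x in a..b, (g x ^ 2 / x - h x ^ 2 / x ^ 3) := by
    refine intervalIntegral.integral_mono_on hab hli (hgi.sub hci') fun x hx => ?_
    have hx0 : 0 < x := ha0.trans_le hx.1
    have : 0 ≤ (g x - h x / x) ^ 2 / x := by positivity
    have e2 : g x ^ 2 / x - h x ^ 2 / x ^ 3 - 2 * (h x / x) * (g x / x - h x / x ^ 2) =
      (g x - h x / x) ^ 2 / x := by field_simp; ring
    linarith
  rw [e, intervalIntegral.integral_sub hgi hci'] at hle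
  have hgE : ∫ x in a..b, g x ^ 2 / x ≤ gradEnergy R1 R2 g := by
    rw [intervalIntegral.integral_of_le hab, ← integral_Icc_eq_integral_Ioc]
    refine setIntegral_mono_set hp.integrable ?_ hsub.eventuallyLE
    filter_upwards [ae_restrict_mem measurableSet_radial] with s hs
    have := radial_pos h₁ hs
    positivity
  have hA : h a / a * (h a / a) ≤ 1 / 2 * gradEnergy R1 R2 g := by
    have := hp.sq_le h₁ ha
    rw [div_mul_div_comm, div_le_iff₀ (by positivity)]
    nlinarith
  nlinarith [mul_self_nonneg (h b / b)]

/-! ### The weight `1 / (1 + r⁶)` -/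

/-- The weight `1 / (1 + r⁶)`. -/
def wt (r : ℝ) : ℝ := (1 + r ^ 6)⁻¹

theorem wt_den_pos (r : ℝ) : 0 < 1 + r ^ 6 := by positivity

theorem wt_pos (r : ℝ) : 0 < wt r := by unfold wt; positivity

theorem continuous_wt : Continuous wt := by
  unfold wt
  exact Continuous.inv₀ (by fun_prop) fun r => (wt_den_pos r).ne'

theorem pow_le_one_add_pow {r : ℝ} (hr : 0 ≤ r) {j k : ℕ} (hjk : j ≤ k) : r ^ j ≤ 1 + r ^ k := by
  rcases le_total r 1 with h | h
  · have : r ^ j ≤ 1 := pow_le_one₀ hr h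
    have : 0 ≤ r ^ k := by positivity
    linarith
  · have : r ^ j ≤ r ^ k := pow_le_pow_right₀ h hjk
    linarith

theorem wt_mul_pow_le {r : ℝ} (hr : 0 ≤ r) {j : ℕ} (hj : j ≤ 6) : wt r * r ^ j ≤ 1 := by
  rw [wt, inv_mul_le_iff₀ (wt_den_pos r), mul_one]
  exact pow_le_one_add_pow hr hj

theorem integrableOn_wt_mul_pow (h₁ : 0 ≤ R1) {j : ℕ} (hj : j ≤ 4) :
    IntegrableOn (fun r => wt r * r ^ j) (radial R1 R2) := by
  refine Integrable.mono' ((integrable_inv_one_add_sq.const_mul 2).integrableOn)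
    (continuous_wt.mul (continuous_pow j)).aestronglyMeasurable ?_
  filter_upwards [ae_restrict_mem measurableSet_radial] with r hr
  have hr0 := (radial_pos h₁ hr).le
  rw [Real.norm_of_nonneg (mul_nonneg (wt_pos r).le (by positivity))]
  have := wt_mul_pow_le hr0 (show j ≤ 6 by omega)
  have h2 := wt_mul_pow_le hr0 (show j + 2 ≤ 6 by omega)
  rw [← div_eq_mul_inv, le_div_iff₀ (by positivity)]
  calc wt r * r ^ j * (1 + r ^ 2) = wt r * r ^ j + wt r * r ^ (j + 2) := by ring
    _ ≤ 2 := by linarith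

theorem RadialPrimitive.integrable_wt_sq (hp : RadialPrimitive R1 R2 h g) (h₁ : 0 ≤ R1) :
    IntegrableOn (fun r => wt r * r * h r ^ 2) (radial R1 R2) := by
  refine Integrable.mono' ((integrableOn_wt_mul_pow h₁ (show 3 ≤ 4 by norm_num)).const_mul
    (1 / 2 * gradEnergy R1 R2 g)) ?_ ?_
  · exact ((continuous_wt.mul continuous_id).aestronglyMeasurable).mul
      ((hp.aestronglyMeasurable h₁).pow 2)
  · filter_upwards [ae_restrict_mem measurableSet_radial] with r hr
    have hr0 := (radial_pos h₁ hr).le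
    have hw := (wt_pos r).le
    rw [Real.norm_of_nonneg (by positivity)]
    calc wt r * r * h r ^ 2 ≤ wt r * r * (r ^ 2 / 2 * gradEnergy R1 R2 g) := by
          gcongr; exact hp.sq_le h₁ hr
      _ = _ := by ring

end Radial

/-! ### Finitely many moments control the weighted `L²` norm -/

/-- The tent function of radius `p.2` around `p.1`. -/
def tent (p : ℝ × ℝ) (y : ℝ) : ℝ := max 0 (p.2 - |y - p.1|)

theorem continuous_tent (p : ℝ × ℝ) : Continuous (tent p) := by unfold tent; fun_prop

theorem tent_nonneg (p : ℝ × ℝ) (y : ℝ) : 0 ≤ tent p y := le_max_left _ _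

theorem abs_lt_of_tent_ne_zero {p : ℝ × ℝ} {y : ℝ} (h : tent p y ≠ 0) : |y - p.1| < p.2 := by
  by_contra hcon
  exact h (max_eq_left (by linarith))

theorem abs_tent_sub_le (p : ℝ × ℝ) (y y' : ℝ) : |tent p y - tent p y'| ≤ |y - y'| := by
  unfold tent
  refine (abs_max_sub_max_le_max _ _ _ _).trans (max_le (by simp) ?_)
  have := abs_abs_sub_abs_le_abs_sub (y' - p.1) (y - p.1)
  rw [show p.2 - |y - p.1| - (p.2 - |y' - p.1|) = |y' - p.1| - |y - p.1| by ring]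
  refine this.trans ?_
  rw [show y' - p.1 - (y - p.1) = y' - y by ring, abs_sub_comm]

/-- The moment `∫ tent(y₀(r)) h(r) r dr`. -/
def moment (R1 : ℝ) (R2 : EReal) (y₀ : ℝ → ℝ) (p : ℝ × ℝ) (h : ℝ → ℝ) : ℝ :=
  ∫ r in radial R1 R2, tent p (y₀ r) * r * h r

section FiniteRank

variable {R1 : ℝ} {R2 : EReal} {g h y₀ : ℝ → ℝ}

/-- The tent `p ∘ y₀` is supported in a compact subset of the radial interval. -/
def TentSupported (R1 : ℝ) (R2 : EReal) (y₀ : ℝ → ℝ) (p : ℝ × ℝ) : Prop :=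
  ∃ c ∈ radial R1 R2, ∃ d ∈ radial R1 R2, ∀ r ∈ radial R1 R2, tent p (y₀ r) ≠ 0 → r ∈ Icc c d

theorem TentSupported.integrableOn {p : ℝ × ℝ} (hT : TentSupported R1 R2 y₀ p)
    (hy : ContinuousOn y₀ (radial R1 R2)) {k : ℝ → ℝ} (hk : ContinuousOn k (radial R1 R2)) :
    IntegrableOn (fun r => tent p (y₀ r) * k r) (radial R1 R2) := by
  obtain ⟨c, hc, d, hd, hcd⟩ := hT
  have hsub : Icc c d ⊆ radial R1 R2 := ordConnected_radial.out hc hd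
  refine IntegrableOn.of_forall_sdiff_eq_zero (s := Icc c d) ?_ measurableSet_radial ?_
  · exact ContinuousOn.integrableOn_Icc
      (((continuous_tent p).comp_continuousOn (hy.mono hsub)).mul (hk.mono hsub))
  · intro r hr
    by_cases h0 : tent p (y₀ r) = 0
    · rw [h0, zero_mul]
    · exact absurd (hcd r hr.1 h0) hr.2

theorem TentSupported.integrableOn_mul {p : ℝ × ℝ} (hT : TentSupported R1 R2 y₀ p)
    (h₁ : 0 ≤ R1) (hy : ContinuousOn y₀ (radial R1 R2)) (hp : RadialPrimitive R1 R2 h g) :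
    IntegrableOn (fun r => tent p (y₀ r) * r * h r) (radial R1 R2) := by
  have := hT.integrableOn hy (k := fun r => r * h r) (continuousOn_id.mul (hp.continuousOn h₁))
  simpa only [mul_assoc] using this

theorem exists_sq_moment_le {p : ℝ × ℝ} (hT : TentSupported R1 R2 y₀ p)
    (h₁ : 0 ≤ R1) (hy : ContinuousOn y₀ (radial R1 R2)) :
    ∃ C, 0 ≤ C ∧ ∀ h g, RadialPrimitive R1 R2 h g →
      moment R1 R2 y₀ p h ^ 2 ≤ C * gradEnergy R1 R2 g := by
  have hI : IntegrableOn (fun r => tent p (y₀ r) * (r * r)) (radial R1 R2) :=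
    hT.integrableOn hy (by fun_prop)
  refine ⟨(∫ r in radial R1 R2, tent p (y₀ r) * (r * r)) ^ 2, sq_nonneg _, fun h g hp => ?_⟩
  have hE := gradEnergy_nonneg (R2 := R2) (g := g) h₁
  have hb : |moment R1 R2 y₀ p h| ≤
      (∫ r in radial R1 R2, tent p (y₀ r) * (r * r)) * Real.sqrt (gradEnergy R1 R2 g) := by
    rw [← integral_mul_const, ← Real.norm_eq_abs]
    refine norm_integral_le_of_norm_le (hI.mul_const _) ?_
    filter_upwards [ae_restrict_mem measurableSet_radial] with r hr
    have hr0 := radial_pos h₁ hr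
    have ht := tent_nonneg p (y₀ r)
    rw [norm_mul, norm_mul, Real.norm_of_nonneg ht, Real.norm_of_nonneg hr0.le, mul_assoc,
      mul_assoc, mul_assoc]
    refine mul_le_mul_of_nonneg_left (mul_le_mul_of_nonneg_left ?_ hr0.le) ht
    have h3 : r * Real.sqrt (gradEnergy R1 R2 g) = Real.sqrt (r ^ 2 * gradEnergy R1 R2 g) := by
      rw [Real.sqrt_mul (sq_nonneg r), Real.sqrt_sq hr0.le]
    rw [Real.norm_eq_abs, h3]
    refine Real.abs_le_sqrt ((hp.sq_le h₁ hr).trans ?_)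
    nlinarith [mul_nonneg (sq_nonneg r) hE]
  calc _ = |moment R1 R2 y₀ p h| ^ 2 := (sq_abs _).symm
    _ ≤ _ := pow_le_pow_left₀ (abs_nonneg _) hb 2
    _ = _ := by rw [mul_pow, Real.sq_sqrt hE]

theorem exists_tent_control (h₁ : 0 ≤ R1) (hy : ContinuousOn y₀ (radial R1 R2))
    (hmono : StrictMonoOn y₀ (radial R1 R2)) {r₀ η : ℝ} (hr₀ : r₀ ∈ radial R1 R2) (hη : 0 < η) :
    ∃ U ∈ 𝓝 r₀, ∃ p : ℝ × ℝ, TentSupported R1 R2 y₀ p ∧ ∃ C, 0 ≤ C ∧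
      ∀ h g, RadialPrimitive R1 R2 h g → ∀ r ∈ U,
        h r ^ 2 ≤ η * gradEnergy R1 R2 g + C * moment R1 R2 y₀ p h ^ 2 := by
  have hA : {r | r ∈ radial R1 R2 ∧ |r ^ 2 - r₀ ^ 2| < η / 2} ∈ 𝓝 r₀ := by
    refine inter_mem (isOpen_radial.mem_nhds hr₀) ?_
    have : Continuous fun r : ℝ => |r ^ 2 - r₀ ^ 2| := by fun_prop
    exact this.continuousAt.preimage_mem_nhds (Iio_mem_nhds (by simpa using half_pos hη))
  obtain ⟨e, he, hball⟩ := Metric.mem_nhds_iff.1 hA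
  rw [Real.ball_eq_Ioo] at hball
  set c := r₀ - e / 2 with hc
  set d := r₀ + e / 2 with hd
  have hcA := hball (show c ∈ Ioo (r₀ - e) (r₀ + e) by constructor <;> linarith)
  have hdA := hball (show d ∈ Ioo (r₀ - e) (r₀ + e) by constructor <;> linarith)
  have hcr : y₀ c < y₀ r₀ := hmono hcA.1 hr₀ (by linarith)
  have hdr : y₀ r₀ < y₀ d := hmono hr₀ hdA.1 (by linarith)
  set ρ := min (y₀ r₀ - y₀ c) (y₀ d - y₀ r₀) with hρ
  have hρ0 : 0 < ρ := lt_min (by linarith) (by linarith)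
  set p : ℝ × ℝ := (y₀ r₀, ρ) with hp
  have hsupp : ∀ r ∈ radial R1 R2, tent p (y₀ r) ≠ 0 → r ∈ Ioo c d := by
    intro r hr ht
    have h2 := abs_lt.1 (abs_lt_of_tent_ne_zero ht)
    have h3 : ρ ≤ y₀ r₀ - y₀ c := min_le_left _ _
    have h4 : ρ ≤ y₀ d - y₀ r₀ := min_le_right _ _
    simp only [hp] at h2
    exact ⟨(hmono.lt_iff_lt hcA.1 hr).1 (by linarith), (hmono.lt_iff_lt hr hdA.1).1 (by linarith)⟩
  have hT : TentSupported R1 R2 y₀ p :=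
    ⟨c, hcA.1, d, hdA.1, fun r hr ht => Ioo_subset_Icc_self (hsupp r hr ht)⟩
  have hmI : IntegrableOn (fun r => tent p (y₀ r) * r) (radial R1 R2) :=
    hT.integrableOn hy continuousOn_id
  have hnn : ∀ r ∈ radial R1 R2, 0 ≤ tent p (y₀ r) * r := fun r hr =>
    mul_nonneg (tent_nonneg _ _) (radial_pos h₁ hr).le
  have hm0 : 0 < ∫ r in radial R1 R2, tent p (y₀ r) * r := by
    have hcont : ContinuousOn (fun r => tent p (y₀ r) * r) (radial R1 R2) :=
      ((continuous_tent p).comp_continuousOn hy).mul continuousOn_id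
    rw [setIntegral_pos_iff_support_of_nonneg_ae ?_ hmI]
    · have hopen : IsOpen (radial R1 R2 ∩ (fun r => tent p (y₀ r) * r) ⁻¹' {0}ᶜ) :=
        hcont.isOpen_inter_preimage isOpen_radial isOpen_compl_singleton
      rw [inter_comm]
      refine hopen.measure_pos volume ⟨r₀, hr₀, ?_⟩
      have : tent p (y₀ r₀) = ρ := by simp [tent, hp, hρ0.le]
      simp only [mem_preimage, this, mem_compl_iff, mem_singleton_iff]
      exact (mul_pos hρ0 (radial_pos h₁ hr₀)).ne'
    · filter_upwards [ae_restrict_mem measurableSet_radial] with r hr using hnn r hr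
  set m₀ := ∫ r in radial R1 R2, tent p (y₀ r) * r with hm₀
  refine ⟨Ioo c d, Ioo_mem_nhds (by linarith) (by linarith), p, hT, 2 * (m₀⁻¹) ^ 2,
    by positivity, fun h g hpr r hr => ?_⟩
  have hE := gradEnergy_nonneg (R2 := R2) (g := g) h₁
  have hAr : ∀ r ∈ Ioo c d, r ∈ radial R1 R2 ∧ |r ^ 2 - r₀ ^ 2| < η / 2 := fun r hr =>
    hball ⟨by linarith [hr.1], by linarith [hr.2]⟩
  have hrI := (hAr r hr).1
  have hmh := hT.integrableOn_mul h₁ hy hpr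
  have e1 : m₀ * h r - moment R1 R2 y₀ p h =
      ∫ s in radial R1 R2, tent p (y₀ s) * s * (h r - h s) := by
    rw [hm₀, moment, ← integral_mul_const, ← integral_sub (hmI.mul_const _) hmh]
    congr 1; ext s; ring
  have hbd : |m₀ * h r - moment R1 R2 y₀ p h| ≤
      m₀ * Real.sqrt (η / 2 * gradEnergy R1 R2 g) := by
    rw [e1, hm₀, ← integral_mul_const, ← Real.norm_eq_abs]
    refine norm_integral_le_of_norm_le (hmI.mul_const _) ?_
    filter_upwards [ae_restrict_mem measurableSet_radial] with s hs
    rw [norm_mul, Real.norm_of_nonneg (hnn s hs)]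
    by_cases ht : tent p (y₀ s) = 0
    · simp [ht]
    · have h5 := (hAr s (hsupp s hs ht)).2
      have h6 := (hAr r hr).2
      refine mul_le_mul_of_nonneg_left ?_ (hnn s hs)
      rw [Real.norm_eq_abs]
      refine Real.abs_le_sqrt ((hpr.sq_sub_le h₁ hs hrI).trans ?_)
      refine mul_le_mul_of_nonneg_right ?_ hE
      have : |r ^ 2 - s ^ 2| ≤ |r ^ 2 - r₀ ^ 2| + |s ^ 2 - r₀ ^ 2| := by
        rw [abs_sub_comm (s ^ 2)]
        exact abs_sub_le _ _ _
      linarith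
  have e2 : h r = m₀⁻¹ * (m₀ * h r - moment R1 R2 y₀ p h) + m₀⁻¹ * moment R1 R2 y₀ p h := by
    field_simp; ring
  have h7 : (m₀⁻¹ * (m₀ * h r - moment R1 R2 y₀ p h)) ^ 2 ≤ η / 2 * gradEnergy R1 R2 g := by
    rw [← sq_abs, abs_mul, abs_of_pos (inv_pos.2 hm0)]
    have h8 : m₀⁻¹ * |m₀ * h r - moment R1 R2 y₀ p h| ≤
        Real.sqrt (η / 2 * gradEnergy R1 R2 g) := by
      rw [inv_mul_le_iff₀ hm0]; exact hbd
    calc _ ≤ Real.sqrt (η / 2 * gradEnergy R1 R2 g) ^ 2 :=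
          pow_le_pow_left₀ (by positivity) h8 2
      _ = _ := Real.sq_sqrt (by positivity)
  rw [e2]
  nlinarith [sq_nonneg (m₀⁻¹ * (m₀ * h r - moment R1 R2 y₀ p h) - m₀⁻¹ * moment R1 R2 y₀ p h)]

theorem exists_moments_control (h₁ : 0 ≤ R1) (hy : ContinuousOn y₀ (radial R1 R2))
    (hmono : StrictMonoOn y₀ (radial R1 R2)) {η : ℝ} (hη : 0 < η) :
    ∃ T : Finset (ℝ × ℝ), (∀ p ∈ T, TentSupported R1 R2 y₀ p) ∧ ∃ C, 0 ≤ C ∧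
      ∀ h g, RadialPrimitive R1 R2 h g →
        ∫ r in radial R1 R2, wt r * r * h r ^ 2 ≤
          η * gradEnergy R1 R2 g + C * ∑ p ∈ T, moment R1 R2 y₀ p h ^ 2 := by
  classical
  have hW3 := integrableOn_wt_mul_pow (R2 := R2) h₁ (show 3 ≤ 4 by norm_num)
  have hW1 : IntegrableOn (fun r => wt r * r) (radial R1 R2) := by
    simpa using integrableOn_wt_mul_pow (R2 := R2) h₁ (show 1 ≤ 4 by norm_num)
  have hw3 : 0 ≤ᵐ[volume.restrict (radial R1 R2)] fun r => wt r * r ^ 3 := by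
    filter_upwards [ae_restrict_mem measurableSet_radial] with r hr
    have := radial_pos h₁ hr
    have := (wt_pos r).le
    positivity
  set W := ∫ r in radial R1 R2, wt r * r with hW
  have hW0 : 0 ≤ W := setIntegral_nonneg measurableSet_radial fun r hr =>
    mul_nonneg (wt_pos r).le (radial_pos h₁ hr).le
  set m : Measure ℝ := (volume.restrict (radial R1 R2)).withDensity
    fun r => ENNReal.ofReal (wt r * r ^ 3) with hm
  have : IsFiniteMeasure m := isFiniteMeasure_withDensity_ofReal hW3.2
  obtain ⟨K, hKI, hK, hmK⟩ := (measurableSet_radial (R1 := R1) (R2 := R2)).exists_isCompact_sdiff_lt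
    (measure_ne_top m _) (ε := ENNReal.ofReal η) (by simpa using hη)
  have hKm := hK.isClosed.measurableSet
  have hout : ∫ r in radial R1 R2 \ K, wt r * r ^ 3 ≤ η := by
    have e : m (radial R1 R2 \ K) = ENNReal.ofReal (∫ r in radial R1 R2 \ K, wt r * r ^ 3) := by
      rw [hm, withDensity_apply _ (measurableSet_radial.diff hKm),
        Measure.restrict_restrict (measurableSet_radial.diff hKm),
        inter_eq_self_of_subset_left sdiff_subset,
        ofReal_integral_eq_lintegral_ofReal (hW3.mono_set sdiff_subset)
          (ae_restrict_of_ae_restrict_of_subset sdiff_subset hw3)]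
    rw [e] at hmK
    exact (ENNReal.ofReal_lt_ofReal_iff hη).1 hmK |>.le
  have hη' : 0 < η / (2 * (W + 1)) := by positivity
  choose! U hU p hp C hC hctl using fun r₀ (hr₀ : r₀ ∈ radial R1 R2) =>
    exists_tent_control h₁ hy hmono hr₀ hη'
  obtain ⟨t, htK, ht⟩ := hK.elim_nhds_subcover U fun x hx => hU x (hKI hx)
  refine ⟨t.image p, fun q hq => ?_, W * ∑ x ∈ t, C x, ?_, fun h g hpr => ?_⟩
  · obtain ⟨x, hx, rfl⟩ := Finset.mem_image.1 hq
    exact hp x (hKI (htK x hx))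
  · exact mul_nonneg hW0 (Finset.sum_nonneg fun x hx => hC x (hKI (htK x hx)))
  have hE := gradEnergy_nonneg (R2 := R2) (g := g) h₁
  set S := ∑ q ∈ t.image p, moment R1 R2 y₀ q h ^ 2 with hS
  have hSx : ∀ x ∈ t, moment R1 R2 y₀ (p x) h ^ 2 ≤ S := fun x hx =>
    Finset.single_le_sum (f := fun q => moment R1 R2 y₀ q h ^ 2) (fun q _ => sq_nonneg _)
      (Finset.mem_image_of_mem p hx)
  have hS0 : 0 ≤ S := Finset.sum_nonneg fun q _ => sq_nonneg _
  have hinner : ∀ r ∈ K, h r ^ 2 ≤ η / (2 * (W + 1)) * gradEnergy R1 R2 g + (∑ x ∈ t, C x) * S := by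
    intro r hr
    obtain ⟨x, hx, hrx⟩ := mem_iUnion₂.1 (ht hr)
    refine (hctl x (hKI (htK x hx)) h g hpr r hrx).trans (add_le_add le_rfl ?_)
    exact mul_le_mul (Finset.single_le_sum (f := C) (fun y hy => hC y (hKI (htK y hy))) hx)
      (hSx x hx) (sq_nonneg _) (Finset.sum_nonneg fun y hy => hC y (hKI (htK y hy)))
  have hI := hpr.integrable_wt_sq h₁
  rw [← integral_inter_add_sdiff hKm hI, inter_eq_self_of_subset_right hKI]
  have b1 : ∫ r in K, wt r * r * h r ^ 2 ≤
      W * (η / (2 * (W + 1)) * gradEnergy R1 R2 g + (∑ x ∈ t, C x) * S) := by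
    have hCS : 0 ≤ ∑ x ∈ t, C x := Finset.sum_nonneg fun y hy => hC y (hKI (htK y hy))
    have hc0 : 0 ≤ η / (2 * (W + 1)) * gradEnergy R1 R2 g + (∑ x ∈ t, C x) * S := by positivity
    calc ∫ r in K, wt r * r * h r ^ 2
        ≤ ∫ r in K, wt r * r * (η / (2 * (W + 1)) * gradEnergy R1 R2 g + (∑ x ∈ t, C x) * S) := by
          refine setIntegral_mono_on (hI.mono_set hKI) ((hW1.mono_set hKI).mul_const _) hKm
            fun r hr => ?_
          exact mul_le_mul_of_nonneg_left (hinner r hr)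
            (mul_nonneg (wt_pos r).le (radial_pos h₁ (hKI hr)).le)
      _ = (∫ r in K, wt r * r) * _ := integral_mul_const _ _
      _ ≤ W * _ := by
          refine mul_le_mul_of_nonneg_right ?_ hc0
          refine setIntegral_mono_set hW1 ?_ (LE.le.eventuallyLE hKI)
          filter_upwards [ae_restrict_mem measurableSet_radial] with r hr
          exact mul_nonneg (wt_pos r).le (radial_pos h₁ hr).le
  have b2 : ∫ r in radial R1 R2 \ K, wt r * r * h r ^ 2 ≤ η * (1 / 2 * gradEnergy R1 R2 g) := by
    calc ∫ r in radial R1 R2 \ K, wt r * r * h r ^ 2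
        ≤ ∫ r in radial R1 R2 \ K, wt r * r ^ 3 * (1 / 2 * gradEnergy R1 R2 g) := by
          refine setIntegral_mono_on (hI.mono_set sdiff_subset)
            ((hW3.mono_set sdiff_subset).mul_const _) (measurableSet_radial.diff hKm)
            fun r hr => ?_
          have := wt_pos r
          have := radial_pos h₁ hr.1
          calc wt r * r * h r ^ 2 ≤ wt r * r * (r ^ 2 / 2 * gradEnergy R1 R2 g) := by
                gcongr; exact hpr.sq_le h₁ hr.1
            _ = _ := by ring
      _ = (∫ r in radial R1 R2 \ K, wt r * r ^ 3) * _ := integral_mul_const _ _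
      _ ≤ _ := mul_le_mul_of_nonneg_right hout (by positivity)
  have b3 : W * (η / (2 * (W + 1)) * gradEnergy R1 R2 g) ≤ η * (1 / 2 * gradEnergy R1 R2 g) := by
    have : W * (η / (2 * (W + 1))) ≤ η * (1 / 2) := by
      rw [mul_div_assoc', div_le_iff₀ (by positivity)]
      nlinarith
    calc _ = W * (η / (2 * (W + 1))) * gradEnergy R1 R2 g := by ring
      _ ≤ η * (1 / 2) * gradEnergy R1 R2 g := mul_le_mul_of_nonneg_right this hE
      _ = _ := by ring
  rw [mul_add] at b1
  calc _ ≤ _ := add_le_add b1 b2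
    _ ≤ _ := by linarith

end FiniteRank

/-! ### The quadratic form of `𝕃₁` on functions of finite energy -/

section FiniteEnergy

variable {R1 : ℝ} {R2 : EReal} {g h l k V : ℝ → ℝ} {K : ℝ}

/-- `h` is the primitive of `g` with finite energy, and vanishes at `R2` if `R2 < ∞`. -/
structure FiniteEnergy (R1 : ℝ) (R2 : EReal) (h g : ℝ → ℝ) : Prop extends
    RadialPrimitive R1 R2 h g where
  integrable_self : IntegrableOn (fun r => h r ^ 2 / r) (radial R1 R2)
  outer : R2 ≠ ⊤ → Tendsto h (toOuter R2) (𝓝 0)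

/-- `V` is measurable and bounded by a multiple of the weight. -/
structure WeightBound (R1 : ℝ) (R2 : EReal) (V : ℝ → ℝ) (K : ℝ) : Prop where
  nonneg : 0 ≤ K
  aesm : AEStronglyMeasurable V (volume.restrict (radial R1 R2))
  le : ∀ r ∈ radial R1 R2, |V r| ≤ K * wt r

/-- The form `∫ (g² / r + h² / r + V r h²) dr`. -/
def formQ (R1 : ℝ) (R2 : EReal) (V h g : ℝ → ℝ) : ℝ :=
  ∫ r in radial R1 R2, (g r ^ 2 / r + h r ^ 2 / r + V r * r * h r ^ 2)

/-- The bilinear form of `formQ`. -/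
def formB (R1 : ℝ) (R2 : EReal) (V h g k l : ℝ → ℝ) : ℝ :=
  ∫ r in radial R1 R2, (g r * l r / r + h r * k r / r + V r * r * (h r * k r))

theorem integrable_sq_div_of_bound (h₁ : 0 ≤ R1)
    (hm : AEStronglyMeasurable g (volume.restrict (radial R1 R2))) {B : ℝ → ℝ}
    (hB : IntegrableOn B (radial R1 R2)) (hle : ∀ r ∈ radial R1 R2, g r ^ 2 / r ≤ B r) :
    IntegrableOn (fun r => g r ^ 2 / r) (radial R1 R2) := by
  refine Integrable.mono' hB ((hm.pow 2).mul (measurable_id.inv.aestronglyMeasurable)) ?_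
  filter_upwards [ae_restrict_mem measurableSet_radial] with r hr
  have := radial_pos h₁ hr
  rw [Real.norm_of_nonneg (by positivity)]
  exact hle r hr

theorem WeightBound.integrable (hV : WeightBound R1 R2 V K) (hp : RadialPrimitive R1 R2 h g)
    (h₁ : 0 ≤ R1) : IntegrableOn (fun r => V r * r * h r ^ 2) (radial R1 R2) := by
  refine Integrable.mono' ((hp.integrable_wt_sq h₁).const_mul K)
    ((hV.aesm.mul continuous_id.aestronglyMeasurable).mul ((hp.aestronglyMeasurable h₁).pow 2)) ?_
  filter_upwards [ae_restrict_mem measurableSet_radial] with r hr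
  have hr0 := radial_pos h₁ hr
  rw [norm_mul, norm_mul, Real.norm_of_nonneg hr0.le, Real.norm_of_nonneg (sq_nonneg _),
    Real.norm_eq_abs]
  calc |V r| * r * h r ^ 2 ≤ K * wt r * r * h r ^ 2 := by gcongr; exact hV.le r hr
    _ = _ := by ring

namespace FiniteEnergy

theorem add (ha : FiniteEnergy R1 R2 h g) (hb : FiniteEnergy R1 R2 k l) (h₁ : 0 ≤ R1) :
    FiniteEnergy R1 R2 (fun r => h r + k r) (fun r => g r + l r) where
  toRadialPrimitive := ha.toRadialPrimitive.add hb.toRadialPrimitive h₁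
  integrable_self := by
    refine integrable_sq_div_of_bound h₁ ((ha.aestronglyMeasurable h₁).add
      (hb.aestronglyMeasurable h₁)) ((ha.integrable_self.const_mul 2).add
      (hb.integrable_self.const_mul 2)) fun r hr => ?_
    have := radial_pos h₁ hr
    simp only [Pi.add_apply]
    rw [← mul_div_assoc, ← mul_div_assoc, ← add_div]
    gcongr
    nlinarith [sq_nonneg (h r - k r)]
  outer hR := by simpa using (ha.outer hR).add (hb.outer hR)

theorem const_mul (ha : FiniteEnergy R1 R2 h g) (c : ℝ) :
    FiniteEnergy R1 R2 (fun r => c * h r) (fun r => c * g r) where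
  toRadialPrimitive := ha.toRadialPrimitive.const_mul c
  integrable_self := by
    refine (ha.integrable_self.const_mul (c ^ 2)).congr (Eventually.of_forall fun r => ?_)
    simp only; ring
  outer hR := by simpa using (ha.outer hR).const_mul c

theorem sub (ha : FiniteEnergy R1 R2 h g) (hb : FiniteEnergy R1 R2 k l) (h₁ : 0 ≤ R1) :
    FiniteEnergy R1 R2 (fun r => h r - k r) (fun r => g r - l r) := by
  have := ha.add (hb.const_mul (-1)) h₁
  simpa only [neg_one_mul, ← sub_eq_add_neg] using this

theorem integrable_density (ha : FiniteEnergy R1 R2 h g) (hV : WeightBound R1 R2 V K)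
    (h₁ : 0 ≤ R1) : IntegrableOn (fun r => g r ^ 2 / r + h r ^ 2 / r + V r * r * h r ^ 2)
      (radial R1 R2) :=
  (ha.integrable.add ha.integrable_self).add (hV.integrable ha.toRadialPrimitive h₁)

theorem integrable_cross (ha : FiniteEnergy R1 R2 h g) (hb : FiniteEnergy R1 R2 k l)
    (hV : WeightBound R1 R2 V K) (h₁ : 0 ≤ R1) :
    IntegrableOn (fun r => g r * l r / r + h r * k r / r + V r * r * (h r * k r))
      (radial R1 R2) := by
  have := (((ha.add hb h₁).integrable_density hV h₁).sub (ha.integrable_density hV h₁)).sub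
    (hb.integrable_density hV h₁)
  refine (this.const_mul (1 / 2)).congr (Eventually.of_forall fun r => ?_)
  simp only [Pi.sub_apply]
  ring

theorem formQ_add_mul (ha : FiniteEnergy R1 R2 h g) (hb : FiniteEnergy R1 R2 k l)
    (hV : WeightBound R1 R2 V K) (h₁ : 0 ≤ R1) (t : ℝ) :
    formQ R1 R2 V (fun r => h r + t * k r) (fun r => g r + t * l r) =
      formQ R1 R2 V h g + 2 * t * formB R1 R2 V h g k l + t ^ 2 * formQ R1 R2 V k l := by
  unfold formQ formB
  rw [← integral_const_mul, ← integral_const_mul, ← integral_add (ha.integrable_density hV h₁)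
    ((ha.integrable_cross hb hV h₁).const_mul _), ← integral_add _
    ((hb.integrable_density hV h₁).const_mul _)]
  · congr 1; ext r; ring
  · exact (ha.integrable_density hV h₁).add ((ha.integrable_cross hb hV h₁).const_mul _)

theorem formQ_sub (ha : FiniteEnergy R1 R2 h g) (hb : FiniteEnergy R1 R2 k l)
    (hV : WeightBound R1 R2 V K) (h₁ : 0 ≤ R1) (hnn : ∀ h g, FiniteEnergy R1 R2 h g →
      0 ≤ formQ R1 R2 V h g) :
    formQ R1 R2 V (fun r => h r - k r) (fun r => g r - l r) ≤
      2 * formQ R1 R2 V h g + 2 * formQ R1 R2 V k l := by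
  have e1 := ha.formQ_add_mul hb hV h₁ (-1)
  have e2 := ha.formQ_add_mul hb hV h₁ 1
  have := hnn _ _ (ha.add hb h₁)
  simp only [one_mul, neg_one_mul, ← sub_eq_add_neg] at e1 e2
  linarith

theorem formQ_const_mul (c : ℝ) : formQ R1 R2 V (fun r => c * h r) (fun r => c * g r) =
    c ^ 2 * formQ R1 R2 V h g := by
  unfold formQ
  rw [← integral_const_mul]
  congr 1; ext r; ring

theorem formB_eq_zero (ha : FiniteEnergy R1 R2 h g) (hb : FiniteEnergy R1 R2 k l)
    (hV : WeightBound R1 R2 V K) (h₁ : 0 ≤ R1) (hnn : ∀ h g, FiniteEnergy R1 R2 h g →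
      0 ≤ formQ R1 R2 V h g) (h0 : formQ R1 R2 V h g = 0) : formB R1 R2 V h g k l = 0 := by
  have key : ∀ t : ℝ, 0 ≤ formQ R1 R2 V k l * (t * t) + (2 * formB R1 R2 V h g k l) * t + 0 := by
    intro t
    have := hnn _ _ (ha.add (hb.const_mul t) h₁)
    rw [ha.formQ_add_mul hb hV h₁ t, h0] at this
    linarith
  have := discrim_le_zero key
  rw [discrim] at this
  nlinarith [sq_nonneg (formB R1 R2 V h g k l)]

theorem gradEnergy_le (ha : FiniteEnergy R1 R2 h g) (h₁ : 0 ≤ R1) :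
    gradEnergy R1 R2 g ≤ formQ R1 R2 0 h g := by
  have h0 : WeightBound R1 R2 0 0 := ⟨le_rfl, aestronglyMeasurable_zero, by simp⟩
  refine setIntegral_mono_on ha.integrable (ha.integrable_density h0 h₁) measurableSet_radial
    fun r hr => ?_
  have := radial_pos h₁ hr
  have : 0 ≤ h r ^ 2 / r := by positivity
  simpa using this

theorem formQ_eq (ha : FiniteEnergy R1 R2 h g) (hV : WeightBound R1 R2 V K) (h₁ : 0 ≤ R1) :
    formQ R1 R2 V h g = formQ R1 R2 0 h g + ∫ r in radial R1 R2, V r * r * h r ^ 2 := by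
  unfold formQ
  have h2 : IntegrableOn (fun r => g r ^ 2 / r + h r ^ 2 / r) (radial R1 R2) :=
    ha.integrable.add ha.integrable_self
  rw [integral_add h2 (hV.integrable ha.toRadialPrimitive h₁)]
  simp

theorem abs_integral_le (ha : RadialPrimitive R1 R2 h g) (hV : WeightBound R1 R2 V K)
    (h₁ : 0 ≤ R1) : |∫ r in radial R1 R2, V r * r * h r ^ 2| ≤
      K * ∫ r in radial R1 R2, wt r * r * h r ^ 2 := by
  rw [← integral_const_mul, ← Real.norm_eq_abs]
  refine norm_integral_le_of_norm_le ((ha.integrable_wt_sq h₁).const_mul K) ?_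
  filter_upwards [ae_restrict_mem measurableSet_radial] with r hr
  have hr0 := radial_pos h₁ hr
  rw [norm_mul, norm_mul, Real.norm_of_nonneg hr0.le, Real.norm_of_nonneg (sq_nonneg _),
    Real.norm_eq_abs]
  calc |V r| * r * h r ^ 2 ≤ K * wt r * r * h r ^ 2 := by gcongr; exact hV.le r hr
    _ = _ := by ring

/-- Multiplication by a smooth function with bounded derivative. -/
theorem smul (ha : FiniteEnergy R1 R2 h g) (h₁ : 0 ≤ R1) (htop : R2 = ⊤) {χ χ' : ℝ → ℝ} {C : ℝ}
    (hχ : ∀ x, R1 ≤ x → HasDerivAt χ (χ' x) x) (hχ' : ContinuousOn χ' (Ici R1))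
    (hb : ∀ x, R1 ≤ x → |χ x| ≤ C ∧ |χ' x| ≤ C) :
    FiniteEnergy R1 R2 (fun r => χ r * h r) (fun r => χ r * g r + χ' r * h r) := by
  have hI : radial R1 R2 ⊆ Ici R1 := fun r hr => hr.1.le
  have hχc : ContinuousOn χ (Ici R1) := fun x hx => (hχ x hx).continuousAt.continuousWithinAt
  have m1 := (hχc.mono hI).aestronglyMeasurable (measurableSet_radial (R1 := R1) (R2 := R2))
    (μ := volume)
  have m2 := (hχ'.mono hI).aestronglyMeasurable (measurableSet_radial (R1 := R1) (R2 := R2))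
    (μ := volume)
  have hm : AEStronglyMeasurable (fun r => χ r * g r + χ' r * h r)
      (volume.restrict (radial R1 R2)) :=
    (m1.mul ha.aesm).add (m2.mul (ha.aestronglyMeasurable h₁))
  have hsq : ∀ {a : ℝ}, |a| ≤ C → a ^ 2 ≤ C ^ 2 := fun {a} h => by
    rw [← sq_abs]; exact pow_le_pow_left₀ (abs_nonneg _) h 2
  refine ⟨⟨hm, ?_, fun r hr => ?_⟩, ?_, fun hR => ?_⟩
  · refine integrable_sq_div_of_bound h₁ hm ((ha.integrable.const_mul (2 * C ^ 2)).add
      (ha.integrable_self.const_mul (2 * C ^ 2))) fun r hr => ?_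
    have hr0 := radial_pos h₁ hr
    simp only [Pi.add_apply]
    rw [← mul_div_assoc, ← mul_div_assoc, ← add_div]
    gcongr
    have c1 := hsq (hb r hr.1.le).1
    have c2 := hsq (hb r hr.1.le).2
    nlinarith [sq_nonneg (χ r * g r - χ' r * h r), mul_le_mul_of_nonneg_right c1 (sq_nonneg (g r)),
      mul_le_mul_of_nonneg_right c2 (sq_nonneg (h r))]
  · have := integral_mul_add_mul_of_primitive hr.1.le (u := χ) (u' := χ') (k := g) (c := 0)
      (fun x hx => hχ x hx.1) (hχ'.mono fun x hx => hx.1)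
      (ha.intervalIntegrable h₁ (mem_insert _ _) (mem_insert_of_mem _ hr))
    simp only [zero_add, mul_zero, sub_zero] at this
    rw [ha.primitive r hr, ← this]
    refine intervalIntegral.integral_congr_ae (Eventually.of_forall fun x hx => ?_)
    rw [uIoc_of_le hr.1.le] at hx
    rw [ha.primitive x (Ioc_subset_radial hr hx)]
    ring
  · refine integrable_sq_div_of_bound h₁ (m1.mul (ha.aestronglyMeasurable h₁))
      (ha.integrable_self.const_mul (C ^ 2)) fun r hr => ?_
    have hr0 := radial_pos h₁ hr
    rw [mul_pow, mul_div_assoc]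
    exact mul_le_mul_of_nonneg_right (hsq (hb r hr.1.le).1) (by positivity)
  · exact absurd htop hR

end FiniteEnergy

end FiniteEnergy

/-! ### Coercivity of `𝕃₁` -/

section Coercivity

variable {R1 : ℝ} {R2 : EReal} {V : ℝ → ℝ} {K : ℝ}

theorem FiniteEnergy.memHmagR {h g : ℝ → ℝ} (ha : FiniteEnergy R1 R2 h g)
    (h0 : Tendsto h (toOuter R2) (𝓝 0)) : MemHmagR R1 R2 h g where
  aesm := ha.aesm
  primitive := ha.primitive
  outer := h0
  integrable_deriv := ha.integrable
  integrable_self := ha.integrable_self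

/-- Positivity of the form on functions vanishing at both ends. -/
def FormPos (R1 : ℝ) (R2 : EReal) (V : ℝ → ℝ) : Prop :=
  ∀ h g : ℝ → ℝ, MemHmagR R1 R2 h g → (∃ r ∈ radial R1 R2, h r ≠ 0) → 0 < formQ R1 R2 V h g

theorem FormPos.nonneg_of_tendsto (hL : FormPos R1 R2 V) (h₁ : 0 ≤ R1) {h g : ℝ → ℝ}
    (ha : FiniteEnergy R1 R2 h g) (h0 : Tendsto h (toOuter R2) (𝓝 0)) :
    0 ≤ formQ R1 R2 V h g := by
  by_cases hz : ∃ r ∈ radial R1 R2, h r ≠ 0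
  · exact (hL h g (ha.memHmagR h0) hz).le
  · push Not at hz
    refine setIntegral_nonneg measurableSet_radial fun r hr => ?_
    have := radial_pos h₁ hr
    rw [hz r hr]
    simp only [ne_eq, OfNat.ofNat_ne_zero, not_false_eq_true, zero_pow, zero_div, mul_zero, add_zero]
    positivity

theorem FormPos.nonneg (hL : FormPos R1 R2 V) (hV : WeightBound R1 R2 V K) (h₁ : 0 ≤ R1)
    {h g : ℝ → ℝ} (ha : FiniteEnergy R1 R2 h g) : 0 ≤ formQ R1 R2 V h g := by
  by_cases hR : R2 = ⊤
  swap
  · exact hL.nonneg_of_tendsto h₁ ha (ha.outer hR)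
  subst hR
  have hd : ∀ n : ℕ, ∀ x : ℝ, HasDerivAt (fun x => Real.exp (-(x / (n + 1))))
      (-(Real.exp (-(x / (n + 1))) / (n + 1))) x := by
    intro n x
    have := (((hasDerivAt_id x).div_const ((n : ℝ) + 1)).fun_neg).exp
    refine this.congr_deriv ?_
    simp only [id]
    ring
  have hexp : ∀ n : ℕ, ∀ x : ℝ, 0 ≤ x → Real.exp (-(x / ((n : ℝ) + 1))) ≤ 1 := by
    intro n x hx
    rw [Real.exp_le_one_iff]
    have : 0 ≤ x / ((n : ℝ) + 1) := by positivity
    linarith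
  have hexp' : ∀ n : ℕ, ∀ x : ℝ, 0 ≤ x → Real.exp (-(x / ((n : ℝ) + 1))) / ((n : ℝ) + 1) ≤ 1 := by
    intro n x hx
    rw [div_le_one (by positivity)]
    have : (0 : ℝ) ≤ n := Nat.cast_nonneg n
    linarith [hexp n x hx]
  have hF : ∀ n : ℕ, FiniteEnergy R1 ⊤ (fun r => Real.exp (-(r / (n + 1))) * h r)
      (fun r => Real.exp (-(r / (n + 1))) * g r + -(Real.exp (-(r / (n + 1))) / (n + 1)) * h r) := by
    intro n
    refine ha.smul h₁ rfl (C := 1) (fun x _ => hd n x) (by fun_prop) fun x hx => ⟨?_, ?_⟩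
    · rw [abs_of_pos (Real.exp_pos _)]; exact hexp n x (h₁.trans hx)
    · rw [abs_neg, abs_of_nonneg (by positivity)]; exact hexp' n x (h₁.trans hx)
  have hnn : ∀ n : ℕ, 0 ≤ formQ R1 ⊤ V (fun r => Real.exp (-(r / ((n : ℝ) + 1))) * h r)
      (fun r => Real.exp (-(r / ((n : ℝ) + 1))) * g r +
        -(Real.exp (-(r / ((n : ℝ) + 1))) / ((n : ℝ) + 1)) * h r) := by
    intro n
    refine hL.nonneg_of_tendsto h₁ (hF n) ?_
    rw [toOuter_top]
    have lim : Tendsto (fun r : ℝ => Real.sqrt (1 / 2 * gradEnergy R1 ⊤ g) *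
        (r * Real.exp (-(r / ((n : ℝ) + 1))))) atTop (𝓝 0) := by
      have := (Real.tendsto_pow_mul_exp_neg_atTop_nhds_zero 1).comp
        (tendsto_id.atTop_div_const (show (0 : ℝ) < n + 1 by positivity))
      have h3 := this.const_mul (Real.sqrt (1 / 2 * gradEnergy R1 ⊤ g) * (n + 1))
      rw [mul_zero] at h3
      refine h3.congr fun r => ?_
      have : (n : ℝ) + 1 ≠ 0 := by positivity
      simp only [Function.comp, id, pow_one]
      field_simp
    refine squeeze_zero_norm' ?_ lim
    filter_upwards [eventually_gt_atTop R1] with r hr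
    have hrI : r ∈ radial R1 ⊤ := by rw [radial_top]; exact hr
    have hr0 := radial_pos h₁ hrI
    rw [norm_mul, Real.norm_of_nonneg (Real.exp_pos _).le, Real.norm_eq_abs]
    have h4 : |h r| ≤ r * Real.sqrt (1 / 2 * gradEnergy R1 ⊤ g) := by
      have : r * Real.sqrt (1 / 2 * gradEnergy R1 ⊤ g) =
          Real.sqrt (r ^ 2 * (1 / 2 * gradEnergy R1 ⊤ g)) := by
        rw [Real.sqrt_mul (sq_nonneg r), Real.sqrt_sq hr0.le]
      rw [this]
      refine Real.abs_le_sqrt ((ha.sq_le h₁ hrI).trans (le_of_eq (by ring)))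
    calc _ ≤ Real.exp (-(r / (↑n + 1))) * (r * Real.sqrt (1 / 2 * gradEnergy R1 ⊤ g)) := by
          gcongr
      _ = _ := by ring
  refine ge_of_tendsto' (f := fun n : ℕ => formQ R1 ⊤ V
    (fun r => Real.exp (-(r / ((n : ℝ) + 1))) * h r)
      (fun r => Real.exp (-(r / ((n : ℝ) + 1))) * g r +
        -(Real.exp (-(r / ((n : ℝ) + 1))) / ((n : ℝ) + 1)) * h r)) (x := atTop) ?_ hnn
  refine tendsto_integral_of_dominated_convergence (fun r => 2 * (g r ^ 2 / r + h r ^ 2 / r) +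
    h r ^ 2 / r + |V r * r * h r ^ 2|) (fun n => ((hF n).integrable_density hV h₁).1)
    ((((ha.integrable.add ha.integrable_self).const_mul 2).add ha.integrable_self).add
      (hV.integrable ha.toRadialPrimitive h₁).abs) (fun n => ?_) ?_
  · filter_upwards [ae_restrict_mem measurableSet_radial] with r hr
    have hr0 := radial_pos h₁ hr
    have q1 := hexp n r hr0.le
    have q2 := hexp' n r hr0.le
    have q3 : 0 ≤ Real.exp (-(r / ((n : ℝ) + 1))) / ((n : ℝ) + 1) := by positivity
    set e := Real.exp (-(r / ((n : ℝ) + 1))) with he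
    have he0 : 0 < e := Real.exp_pos _
    set d := e / ((n : ℝ) + 1)
    have he2 : e ^ 2 ≤ 1 := pow_le_one₀ he0.le q1
    have hd2 : d ^ 2 ≤ 1 := pow_le_one₀ q3 q2
    rw [Real.norm_eq_abs]
    refine (abs_add_le _ _).trans (add_le_add ((abs_add_le _ _).trans (add_le_add ?_ ?_)) ?_)
    · rw [abs_of_nonneg (by positivity), ← add_div, ← mul_div_assoc]
      gcongr
      nlinarith [sq_nonneg (e * g r + d * h r), mul_le_mul_of_nonneg_right he2 (sq_nonneg (g r)),
        mul_le_mul_of_nonneg_right hd2 (sq_nonneg (h r))]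
    · rw [abs_of_nonneg (by positivity)]
      refine div_le_div_of_nonneg_right ?_ hr0.le
      nlinarith [mul_le_mul_of_nonneg_right he2 (sq_nonneg (h r))]
    · rw [mul_pow, show V r * r * (e ^ 2 * h r ^ 2) = e ^ 2 * (V r * r * h r ^ 2) by ring, abs_mul,
        abs_of_nonneg (sq_nonneg e)]
      exact mul_le_of_le_one_left (abs_nonneg _) he2
  · filter_upwards with r
    have t0 : Tendsto (fun n : ℕ => r / ((n : ℝ) + 1)) atTop (𝓝 0) :=
      tendsto_const_div_atTop_nhds_zero_nat r |>.comp (tendsto_add_atTop_nat 1) |>.congr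
        fun n => by simp
    have t1 : Tendsto (fun n : ℕ => Real.exp (-(r / ((n : ℝ) + 1)))) atTop (𝓝 1) := by
      have := (Real.continuous_exp.tendsto _).comp t0.neg
      simpa [Function.comp_def] using this
    have t2 : Tendsto (fun n : ℕ => Real.exp (-(r / ((n : ℝ) + 1))) / ((n : ℝ) + 1)) atTop
        (𝓝 0) := by
      have := t1.mul (tendsto_one_div_add_atTop_nhds_zero_nat (𝕜 := ℝ))
      simpa [div_eq_mul_inv] using this
    have t3 := (t1.mul_const (g r)).add (t2.neg.mul_const (h r))
    have t4 := t1.mul_const (h r)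
    have := (((t3.pow 2).div_const r).add ((t4.pow 2).div_const r)).add
      ((t4.pow 2).const_mul (V r * r))
    simpa using this

/-- A null vector of a nonnegative form on an unbounded interval decays. -/
theorem FiniteEnergy.tendsto_of_formQ_eq_zero {h g : ℝ → ℝ} (ha : FiniteEnergy R1 ⊤ h g)
    (hV : WeightBound R1 ⊤ V K) (h₁ : 0 ≤ R1)
    (hnn : ∀ h g, FiniteEnergy R1 ⊤ h g → 0 ≤ formQ R1 ⊤ V h g)
    (h0 : formQ R1 ⊤ V h g = 0) : Tendsto h atTop (𝓝 0) := by
  have hE := gradEnergy_nonneg (R2 := ⊤) (g := g) h₁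
  have hW := integrableOn_wt_mul_pow (R1 := R1) (R2 := ⊤) h₁ (show 4 ≤ 4 by norm_num)
  have hNi : IntegrableOn (fun r => g r ^ 2 / r + h r ^ 2 / r) (radial R1 ⊤) :=
    ha.integrable.add ha.integrable_self
  set χ : ℕ → ℝ → ℝ := fun n r => (n + 1) * r / ((n + 1) + r) with hχ
  set χ' : ℕ → ℝ → ℝ := fun n r => ((n + 1) / ((n + 1) + r)) ^ 2 with hχ'
  have hden : ∀ n : ℕ, ∀ x : ℝ, R1 ≤ x → (0 : ℝ) < (n + 1) + x := fun n x hx => by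
    have := h₁.trans hx; positivity
  have hd : ∀ n : ℕ, ∀ x : ℝ, R1 ≤ x → HasDerivAt (χ n) (χ' n x) x := by
    intro n x hx
    have h2 := hden n x hx
    have := ((hasDerivAt_id x).const_mul ((n : ℝ) + 1)).fun_div
      ((hasDerivAt_id x).const_add ((n : ℝ) + 1)) h2.ne'
    refine this.congr_deriv ?_
    simp only [hχ', id]
    field_simp
    ring
  have hχ1 : ∀ n : ℕ, ∀ x : ℝ, R1 ≤ x → 0 ≤ χ n x ∧ χ n x ≤ n + 1 ∧ χ n x ≤ x ∧
      0 ≤ χ' n x ∧ χ' n x ≤ 1 := by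
    intro n x hx
    have h2 := hden n x hx
    have hx0 : 0 ≤ x := h₁.trans hx
    have hn : (0 : ℝ) ≤ n := Nat.cast_nonneg n
    refine ⟨by positivity, ?_, ?_, by positivity, ?_⟩
    · simp only [hχ]; rw [div_le_iff₀ h2]; nlinarith
    · simp only [hχ]; rw [div_le_iff₀ h2]; nlinarith
    · refine pow_le_one₀ (by positivity) ?_
      rw [div_le_one h2]; linarith
  have hF : ∀ n, FiniteEnergy R1 ⊤ (fun r => χ n r * h r)
      (fun r => χ n r * g r + χ' n r * h r) := by
    intro n
    refine ha.smul h₁ rfl (C := n + 1) (hd n) ?_ fun x hx => ?_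
    · refine ContinuousOn.pow (ContinuousOn.div (by fun_prop) (by fun_prop) fun x hx => ?_) 2
      exact (hden n x hx).ne'
    · obtain ⟨c1, c2, -, c3, c4⟩ := hχ1 n x hx
      rw [abs_of_nonneg c1, abs_of_nonneg c3]
      have hn : (0 : ℝ) ≤ n := Nat.cast_nonneg n
      exact ⟨c2, by linarith⟩
  have hB : ∀ n, formB R1 ⊤ V h g (fun r => χ n r * h r)
      (fun r => χ n r * g r + χ' n r * h r) = 0 := fun n =>
    ha.formB_eq_zero (hF n) hV h₁ hnn h0
  set C : ℝ := 1 / 2 * (∫ r in radial R1 ⊤, (g r ^ 2 / r + h r ^ 2 / r)) +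
    K * (1 / 2 * gradEnergy R1 ⊤ g) * ∫ r in radial R1 ⊤, wt r * r ^ 4 with hC
  have hmeas : ∀ n, AEStronglyMeasurable (χ n) (volume.restrict (radial R1 ⊤)) := fun n => by
    refine ContinuousOn.aestronglyMeasurable (fun x hx => ?_) measurableSet_radial
    exact (hd n x hx.1.le).continuousAt.continuousWithinAt
  have hint : ∀ n : ℕ, IntegrableOn (fun r => χ n r * (g r ^ 2 / r + h r ^ 2 / r))
      (radial R1 ⊤) := by
    intro n
    refine hNi.bdd_mul (c := n + 1) (hmeas n) ?_
    filter_upwards [ae_restrict_mem measurableSet_radial] with r hr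
    obtain ⟨c1, c2, -⟩ := hχ1 n r hr.1.le
    rwa [Real.norm_of_nonneg c1]
  have hle : ∀ n, ∫ r in radial R1 ⊤, χ n r * (g r ^ 2 / r + h r ^ 2 / r) ≤ C := by
    intro n
    have hbd : IntegrableOn (fun r => 1 / 2 * (g r ^ 2 / r + h r ^ 2 / r) +
        K * (1 / 2 * gradEnergy R1 ⊤ g) * (wt r * r ^ 4)) (radial R1 ⊤) :=
      (hNi.const_mul _).add (hW.const_mul _)
    have hcr := ha.integrable_cross (hF n) hV h₁
    have e : ∫ r in radial R1 ⊤, χ n r * (g r ^ 2 / r + h r ^ 2 / r) =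
        ∫ r in radial R1 ⊤, (χ n r * (g r ^ 2 / r + h r ^ 2 / r) -
          (g r * (χ n r * g r + χ' n r * h r) / r + h r * (χ n r * h r) / r +
            V r * r * (h r * (χ n r * h r)))) := by
      rw [integral_sub (hint n) hcr]
      have := hB n
      unfold formB at this
      rw [this, sub_zero]
    rw [e]
    calc _ ≤ ∫ r in radial R1 ⊤, (1 / 2 * (g r ^ 2 / r + h r ^ 2 / r) +
        K * (1 / 2 * gradEnergy R1 ⊤ g) * (wt r * r ^ 4)) := by
          refine setIntegral_mono_on ((hint n).sub hcr) hbd measurableSet_radial fun r hr => ?_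
          have hr0 := radial_pos h₁ hr
          obtain ⟨c1, -, c2, c3, c4⟩ := hχ1 n r hr.1.le
          have e3 : χ n r * (g r ^ 2 / r + h r ^ 2 / r) -
              (g r * (χ n r * g r + χ' n r * h r) / r + h r * (χ n r * h r) / r +
              V r * r * (h r * (χ n r * h r))) =
              -(χ' n r * (g r * h r / r)) + -(V r * r * χ n r * h r ^ 2) := by ring
          rw [e3]
          refine add_le_add ?_ ?_
          · have a1 : |g r * h r / r| ≤ 1 / 2 * (g r ^ 2 / r + h r ^ 2 / r) := by
              rw [abs_div, abs_of_pos hr0, abs_mul, ← add_div, ← mul_div_assoc]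
              refine div_le_div_of_nonneg_right ?_ hr0.le
              nlinarith [sq_nonneg (|g r| - |h r|), sq_abs (g r), sq_abs (h r)]
            have a2 : |χ' n r * (g r * h r / r)| ≤ |g r * h r / r| := by
              rw [abs_mul, abs_of_nonneg c3]
              exact mul_le_of_le_one_left (abs_nonneg _) c4
            linarith [neg_abs_le (χ' n r * (g r * h r / r))]
          · refine (neg_le_abs _).trans ?_
            rw [abs_mul, abs_mul, abs_mul, abs_of_pos hr0, abs_of_nonneg c1,
              abs_of_nonneg (sq_nonneg (h r))]
            have hw := (wt_pos r).le
            have hK := hV.nonneg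
            calc |V r| * r * χ n r * h r ^ 2 ≤ (K * wt r) * r * r *
                (r ^ 2 / 2 * gradEnergy R1 ⊤ g) := by
                  gcongr
                  · exact hV.le r hr
                  · exact ha.sq_le h₁ hr
              _ = _ := by ring
      _ = C := by
          rw [integral_add (hNi.const_mul _) (hW.const_mul _), integral_const_mul,
            integral_const_mul]
  obtain ⟨hGH, -⟩ := integrable_of_tendsto_of_integral_le (F := fun r => g r ^ 2 + h r ^ 2) hint
    (fun n => by
      filter_upwards [ae_restrict_mem measurableSet_radial] with r hr
      have hr0 := radial_pos h₁ hr
      have := (hχ1 n r hr.1.le).1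
      simp only [Pi.zero_apply]
      positivity)
    (by
      filter_upwards [ae_restrict_mem measurableSet_radial] with r hr
      have hr0 := radial_pos h₁ hr
      have t1 : Tendsto (fun n : ℕ => χ n r) atTop (𝓝 r) := by
        have : Tendsto (fun n : ℕ => r / (1 + r * (1 / ((n : ℝ) + 1)))) atTop
            (𝓝 (r / (1 + r * 0))) := by
          refine tendsto_const_nhds.div (tendsto_const_nhds.add
            (tendsto_one_div_add_atTop_nhds_zero_nat.const_mul r)) (by simp)
        simp only [mul_zero, add_zero, div_one] at this
        refine this.congr fun n => ?_
        have hn : (n : ℝ) + 1 ≠ 0 := by positivity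
        have := (hden n r hr.1.le).ne'
        simp only [hχ]
        rw [show 1 + r * (1 / ((n : ℝ) + 1)) = ((n : ℝ) + 1 + r) / (n + 1) by field_simp]
        field_simp
      have := t1.mul_const (g r ^ 2 / r + h r ^ 2 / r)
      convert this using 2
      field_simp) hle
  have hm2 : AEStronglyMeasurable h (volume.restrict (radial R1 ⊤)) := ha.aestronglyMeasurable h₁
  have hH : IntegrableOn (fun r => h r ^ 2) (radial R1 ⊤) := by
    refine Integrable.mono' hGH (hm2.pow 2) (Eventually.of_forall fun r => ?_)
    rw [Real.norm_of_nonneg (sq_nonneg _)]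
    linarith [sq_nonneg (g r)]
  have hgh : IntegrableOn (fun r => 2 * (g r * h r)) (radial R1 ⊤) := by
    refine Integrable.mono' hGH ((ha.aesm.mul hm2).const_mul 2) (Eventually.of_forall fun r => ?_)
    rw [Real.norm_eq_abs, abs_mul, abs_two, abs_mul]
    nlinarith [sq_nonneg (|g r| - |h r|), sq_abs (g r), sq_abs (h r)]
  rw [radial_top] at hgh hH
  have hI : ∀ r, R1 < r → r ∈ radial R1 ⊤ := fun r hr => by rw [radial_top]; exact hr
  have ha1 := hI (R1 + 1) (by linarith)
  have hsqeq : ∀ r, R1 + 1 ≤ r → h r ^ 2 = h (R1 + 1) ^ 2 + ∫ s in (R1 + 1)..r, 2 * (g s * h s) := by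
    intro r hr
    have hrI := hI r (by linarith)
    have hgi := ha.intervalIntegrable h₁ (mem_insert_of_mem _ ha1) (mem_insert_of_mem _ hrI)
    have := integral_mul_add_mul_of_primitives (c := h (R1 + 1)) (d := h (R1 + 1)) hgi hgi
    have hh : ∀ x, R1 + 1 ≤ x → h (R1 + 1) + ∫ s in (R1 + 1)..x, g s = h x := fun x hx => by
      rw [← ha.sub_eq h₁ ha1 (hI x (by linarith))]; ring
    rw [hh r hr] at this
    have e : ∫ s in (R1 + 1)..r, 2 * (g s * h s) = h r * h r - h (R1 + 1) * h (R1 + 1) := by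
      rw [← this]
      refine intervalIntegral.integral_congr fun x hx => ?_
      rw [uIcc_of_le hr] at hx
      rw [hh x hx.1]; ring
    rw [e]; ring
  have hlim : Tendsto (fun r => h r ^ 2) atTop
      (𝓝 (h (R1 + 1) ^ 2 + ∫ s in Ioi (R1 + 1), 2 * (g s * h s))) := by
    have := (intervalIntegral_tendsto_integral_Ioi (R1 + 1)
      (hgh.mono_set (Ioi_subset_Ioi (by linarith))) tendsto_id).const_add (h (R1 + 1) ^ 2)
    refine this.congr' ?_
    filter_upwards [eventually_ge_atTop (R1 + 1)] with r hr using (hsqeq r hr).symm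
  set L := h (R1 + 1) ^ 2 + ∫ s in Ioi (R1 + 1), 2 * (g s * h s) with hLdef
  have hL0 : 0 ≤ L := ge_of_tendsto' hlim fun r => sq_nonneg _
  have hLz : L = 0 := by
    by_contra hne
    have hLp : 0 < L := lt_of_le_of_ne hL0 (Ne.symm hne)
    obtain ⟨M, hM⟩ := eventually_atTop.1 (hlim.eventually (lt_mem_nhds (half_lt_self hLp)))
    have hc : IntegrableOn (fun _ : ℝ => L / 2) (Ioi (max M R1)) := by
      refine Integrable.mono' (hH.mono_set (Ioi_subset_Ioi (le_max_right _ _)))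
        aestronglyMeasurable_const ?_
      filter_upwards [ae_restrict_mem measurableSet_Ioi] with r hr
      rw [Real.norm_of_nonneg (by positivity)]
      exact (hM r ((le_max_left _ _).trans (le_of_lt hr))).le
    rw [integrableOn_const_iff] at hc
    rcases hc with hc | hc
    · rw [enorm_eq_zero] at hc; linarith
    · simp at hc
  rw [hLz] at hlim
  have := (Real.continuous_sqrt.tendsto _).comp hlim
  simp only [Function.comp_def, Real.sqrt_zero, Real.sqrt_sq_eq_abs] at this
  exact (tendsto_zero_iff_abs_tendsto_zero h).2 this

theorem FormPos.eq_zero (hL : FormPos R1 R2 V) (hV : WeightBound R1 R2 V K) (h₁ : 0 ≤ R1)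
    {h g : ℝ → ℝ} (ha : FiniteEnergy R1 R2 h g) (h0 : formQ R1 R2 V h g = 0) :
    ∀ r ∈ radial R1 R2, h r = 0 := by
  have ht : Tendsto h (toOuter R2) (𝓝 0) := by
    by_cases hR : R2 = ⊤
    · subst hR
      rw [toOuter_top]
      exact ha.tendsto_of_formQ_eq_zero hV h₁ (fun h g ha => hL.nonneg hV h₁ ha) h0
    · exact ha.outer hR
  by_contra hz
  push Not at hz
  exact (hL h g (ha.memHmagR ht) hz).ne' h0

end Coercivity

/-! ### Completeness and uniform positivity -/

section Complete

variable {R1 : ℝ} {R2 : EReal} {V : ℝ → ℝ} {K : ℝ}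

theorem norm_toLp_sq {α : Type*} [MeasurableSpace α] {m : Measure α} {F : α → ℝ}
    (hF : MemLp F 2 m) : ‖hF.toLp F‖ ^ 2 = ∫ x, F x ^ 2 ∂m := by
  rw [← real_inner_self_eq_norm_sq, L2.inner_def]
  refine integral_congr_ae ?_
  filter_upwards [hF.coeFn_toLp] with x hx
  rw [hx, real_inner_self_eq_norm_sq, Real.norm_eq_abs, sq_abs]

theorem formQ_zero_eq {h g : ℝ → ℝ} (hg : IntegrableOn (fun r => g r ^ 2 / r) (radial R1 R2))
    (hh : IntegrableOn (fun r => h r ^ 2 / r) (radial R1 R2)) :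
    formQ R1 R2 0 h g = gradEnergy R1 R2 g + ∫ r in radial R1 R2, h r ^ 2 / r := by
  rw [gradEnergy, ← integral_add hg hh]
  simp [formQ]

theorem FiniteEnergy.integral_sq_le {h g : ℝ → ℝ} (ha : FiniteEnergy R1 R2 h g) (h₁ : 0 ≤ R1) :
    ∫ r in radial R1 R2, h r ^ 2 / r ≤ formQ R1 R2 0 h g := by
  rw [formQ_zero_eq ha.integrable ha.integrable_self]
  linarith [gradEnergy_nonneg (R2 := R2) (g := g) h₁]

theorem FiniteEnergy.complete (h₁ : 0 ≤ R1) (hR : (R1 : EReal) < R2) {u u' : ℕ → ℝ → ℝ}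
    (hu : ∀ n, FiniteEnergy R1 R2 (u n) (u' n))
    (hc : ∀ ε > 0, ∃ N, ∀ n ≥ N, ∀ m ≥ N,
      formQ R1 R2 0 (fun r => u n r - u m r) (fun r => u' n r - u' m r) ≤ ε) :
    ∃ h g, FiniteEnergy R1 R2 h g ∧ ∀ ε > 0, ∃ N, ∀ n ≥ N,
      formQ R1 R2 0 (fun r => u n r - h r) (fun r => u' n r - g r) ≤ ε := by
  set ν := volume.restrict (radial R1 R2) with hν
  have hpos : ∀ᵐ r ∂ν, 0 < r := by
    filter_upwards [ae_restrict_mem measurableSet_radial] with r hr using radial_pos h₁ hr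
  have hsqrt : AEStronglyMeasurable (fun r : ℝ => Real.sqrt r) ν :=
    Real.continuous_sqrt.aestronglyMeasurable
  have hsqdiv : ∀ k : ℝ → ℝ, (fun r => (k r / Real.sqrt r) ^ 2) =ᵐ[ν] fun r => k r ^ 2 / r := by
    intro k
    filter_upwards [hpos] with r hr
    rw [div_pow, Real.sq_sqrt hr.le]
  have hmem : ∀ n, MemLp (fun r => u' n r / Real.sqrt r) 2 ν := fun n => by
    have hm : AEStronglyMeasurable (fun r => u' n r / Real.sqrt r) ν := by
      have := (hu n).aesm.aemeasurable.div hsqrt.aemeasurable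
      exact this.aestronglyMeasurable
    rw [memLp_two_iff_integrable_sq hm]
    exact ((hu n).integrable).congr (hsqdiv _).symm
  have hcs : CauchySeq fun n => (hmem n).toLp _ := by
    refine Metric.cauchySeq_iff.2 fun ε hε => ?_
    obtain ⟨N, hN⟩ := hc (ε ^ 2 / 2) (by positivity)
    refine ⟨N, fun n hn m hm => ?_⟩
    rw [dist_eq_norm, ← MemLp.toLp_sub]
    refine lt_of_pow_lt_pow_left₀ 2 hε.le ?_
    rw [norm_toLp_sq]
    have e : ∫ r, ((fun r => u' n r / Real.sqrt r) - fun r => u' m r / Real.sqrt r) r ^ 2 ∂ν =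
        gradEnergy R1 R2 (fun r => u' n r - u' m r) := by
      refine integral_congr_ae ?_
      filter_upwards [hsqdiv (fun r => u' n r - u' m r)] with r hr
      rw [← hr]; simp only [Pi.sub_apply]; ring
    rw [e]
    have h2 := ((hu n).sub (hu m) h₁).gradEnergy_le h₁
    have h3 := hN n hn m hm
    have h4 : 0 < ε ^ 2 := by positivity
    linarith
  obtain ⟨G, hG⟩ := cauchySeq_tendsto_of_complete hcs
  have hGm := Lp.memLp G
  set g : ℝ → ℝ := fun r => Real.sqrt r * G r with hg
  set h : ℝ → ℝ := fun r => ∫ s in R1..r, g s with hh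
  have hgG : (fun r => g r ^ 2 / r) =ᵐ[ν] fun r => G r ^ 2 := by
    filter_upwards [hpos] with r hr
    rw [hg]; simp only; rw [mul_pow, Real.sq_sqrt hr.le]
    field_simp
  have hP : RadialPrimitive R1 R2 h g :=
    ⟨hsqrt.mul hGm.1, hGm.integrable_sq.congr hgG.symm, fun r _ => rfl⟩
  have hsubP : ∀ n, RadialPrimitive R1 R2 (fun r => u n r - h r) (fun r => u' n r - g r) := by
    intro n
    have := (hu n).toRadialPrimitive.add (hP.const_mul (-1)) h₁
    simpa only [neg_one_mul, ← sub_eq_add_neg] using this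
  have hgrad : ∀ n, gradEnergy R1 R2 (fun r => u' n r - g r) = ‖(hmem n).toLp _ - G‖ ^ 2 := by
    intro n
    have : ‖(hmem n).toLp _ - G‖ ^ 2 = ‖((hmem n).sub hGm).toLp _‖ ^ 2 := by
      rw [MemLp.toLp_sub (hmem n) hGm, Lp.toLp_coeFn G hGm]
    rw [this, norm_toLp_sq]
    refine integral_congr_ae ?_
    filter_upwards [hpos] with r hr
    have hs : Real.sqrt r ≠ 0 := (Real.sqrt_pos.2 hr).ne'
    simp only [Pi.sub_apply, hg]
    have e : u' n r / Real.sqrt r - G r = (u' n r - Real.sqrt r * G r) / Real.sqrt r := by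
      field_simp
    rw [e, div_pow, Real.sq_sqrt hr.le]
  have hgrad0 : Tendsto (fun n => gradEnergy R1 R2 (fun r => u' n r - g r)) atTop (𝓝 0) := by
    simp_rw [hgrad]
    have := ((tendsto_iff_norm_sub_tendsto_zero.1 hG).pow 2)
    simpa using this
  have hptw : ∀ r ∈ radial R1 R2, Tendsto (fun n => u n r) atTop (𝓝 (h r)) := by
    intro r hr
    have l1 : Tendsto (fun n => (u n r - h r) ^ 2) atTop (𝓝 0) := by
      refine squeeze_zero (fun n => sq_nonneg _) (fun n => (hsubP n).sq_le h₁ hr) ?_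
      simpa using hgrad0.const_mul (r ^ 2 / 2)
    have l2 := (Real.continuous_sqrt.tendsto _).comp l1
    simp only [Function.comp_def, Real.sqrt_zero, Real.sqrt_sq_eq_abs] at l2
    rw [tendsto_iff_dist_tendsto_zero]
    exact l2
  have hself : ∀ ε > 0, ∃ N, ∀ n ≥ N,
      IntegrableOn (fun r => (u n r - h r) ^ 2 / r) (radial R1 R2) ∧
      ∫ r in radial R1 R2, (u n r - h r) ^ 2 / r ≤ ε := by
    intro ε hε
    obtain ⟨N, hN⟩ := hc ε hε
    refine ⟨N, fun n hn => ?_⟩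
    refine integrable_of_tendsto_of_integral_le (f := fun m r => (u n r - u (m + N) r) ^ 2 / r)
      (fun m => ((hu n).sub (hu (m + N)) h₁).integrable_self) (fun m => ?_) ?_ fun m => ?_
    · filter_upwards [hpos] with r hr
      simp only [Pi.zero_apply]; positivity
    · filter_upwards [ae_restrict_mem measurableSet_radial] with r hr
      have := ((hptw r hr).comp (tendsto_add_atTop_nat N)).const_sub (u n r)
      exact (this.pow 2).div_const r
    · exact (((hu n).sub (hu (m + N)) h₁).integral_sq_le h₁).trans (hN n hn (m + N) (by omega))
  have hFE : FiniteEnergy R1 R2 h g := by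
    obtain ⟨N, hN⟩ := hself 1 one_pos
    refine ⟨hP, ?_, fun hRt => ?_⟩
    · refine integrable_sq_div_of_bound h₁ (hP.aestronglyMeasurable h₁)
        (((hu N).integrable_self.const_mul 2).add ((hN N le_rfl).1.const_mul 2)) fun r hr => ?_
      have hr0 := radial_pos h₁ hr
      simp only [Pi.add_apply]
      rw [← mul_div_assoc, ← mul_div_assoc, ← add_div]
      refine div_le_div_of_nonneg_right ?_ hr0.le
      nlinarith [sq_nonneg (u N r - (u N r - h r) + (u N r)), sq_nonneg (2 * u N r - h r)]
    · obtain ⟨c, -, hcR, -, hI⟩ := exists_toOuter_eq hR hRt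
      rw [Metric.tendsto_nhds]
      intro ε hε
      have hl : Tendsto (fun n => c ^ 2 / 2 * gradEnergy R1 R2 (fun r => u' n r - g r)) atTop
          (𝓝 0) := by simpa using hgrad0.const_mul (c ^ 2 / 2)
      obtain ⟨n, hn⟩ := (hl.eventually (gt_mem_nhds (show 0 < (ε / 2) ^ 2 by positivity))).exists
      filter_upwards [Metric.tendsto_nhds.1 ((hu n).outer hRt) (ε / 2) (by positivity),
        radial_mem_toOuter hR] with r hr hrI
      rw [Real.dist_0_eq_abs] at hr ⊢
      have h3 := (hsubP n).sq_le h₁ hrI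
      have h4 : r ^ 2 / 2 * gradEnergy R1 R2 (fun r => u' n r - g r) ≤
          c ^ 2 / 2 * gradEnergy R1 R2 (fun r => u' n r - g r) := by
        have hr0 := radial_pos h₁ hrI
        have hrc : r < c := by rw [hI] at hrI; exact hrI.2
        have := gradEnergy_nonneg (R2 := R2) (g := fun r => u' n r - g r) h₁
        gcongr
      have h5 : |u n r - h r| < ε / 2 := abs_lt_of_sq_lt_sq (by linarith) (by positivity)
      have h6 : |h r| ≤ |u n r| + |u n r - h r| := by
        have := abs_sub (u n r) (u n r - h r)
        simpa using this
      linarith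
  refine ⟨h, g, hFE, fun ε hε => ?_⟩
  obtain ⟨N, hN⟩ := hself (ε / 2) (by positivity)
  obtain ⟨M, hM⟩ := eventually_atTop.1 (hgrad0.eventually (gt_mem_nhds (half_pos hε)))
  refine ⟨max N M, fun n hn => ?_⟩
  rw [formQ_zero_eq (hsubP n).integrable (hN n (le_of_max_le_left hn)).1]
  linarith [(hN n (le_of_max_le_left hn)).2, hM n (le_of_max_le_right hn)]

theorem moment_sub {y₀ : ℝ → ℝ} {p : ℝ × ℝ} (hT : TentSupported R1 R2 y₀ p) (h₁ : 0 ≤ R1)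
    (hy : ContinuousOn y₀ (radial R1 R2)) {h g k l : ℝ → ℝ} (ha : RadialPrimitive R1 R2 h g)
    (hb : RadialPrimitive R1 R2 k l) :
    moment R1 R2 y₀ p (fun r => h r - k r) = moment R1 R2 y₀ p h - moment R1 R2 y₀ p k := by
  unfold moment
  rw [← integral_sub (hT.integrableOn_mul h₁ hy ha) (hT.integrableOn_mul h₁ hy hb)]
  congr 1; ext r; ring

/-- A positive form whose potential is bounded by the weight is uniformly positive. -/
theorem FormPos.exists_coercive (hL : FormPos R1 R2 V) (hV : WeightBound R1 R2 V K) (h₁ : 0 ≤ R1)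
    (hR : (R1 : EReal) < R2) :
    ∃ c > 0, ∀ h g, FiniteEnergy R1 R2 h g → c * formQ R1 R2 0 h g ≤ formQ R1 R2 V h g := by
  classical
  have hnn : ∀ h g, FiniteEnergy R1 R2 h g → 0 ≤ formQ R1 R2 V h g :=
    fun h g ha => hL.nonneg hV h₁ ha
  have hK := hV.nonneg
  obtain ⟨T, hT, C, hC, hctl⟩ := exists_moments_control (R1 := R1) (R2 := R2) (y₀ := fun r => r) h₁
    continuousOn_id (fun a _ b _ h => h) (η := 1 / (2 * (K + 1))) (by positivity)
  have hgard : ∀ h g, FiniteEnergy R1 R2 h g → 1 / 2 * formQ R1 R2 0 h g ≤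
      formQ R1 R2 V h g + K * C * ∑ p ∈ T, moment R1 R2 (fun r => r) p h ^ 2 := by
    intro h g ha
    have e1 := ha.formQ_eq hV h₁
    have e2 := FiniteEnergy.abs_integral_le ha.toRadialPrimitive hV h₁
    have e3 := hctl h g ha.toRadialPrimitive
    have e4 := ha.gradEnergy_le h₁
    have e5 := gradEnergy_nonneg (R2 := R2) (g := g) h₁
    have e6 := neg_abs_le (∫ r in radial R1 R2, V r * r * h r ^ 2)
    have e7 := mul_le_mul_of_nonneg_left e3 hK
    have e8 : K * (1 / (2 * (K + 1)) * gradEnergy R1 R2 g) ≤ 1 / 2 * gradEnergy R1 R2 g := by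
      rw [← mul_assoc]
      refine mul_le_mul_of_nonneg_right ?_ e5
      rw [mul_one_div, div_le_div_iff₀ (by positivity) (by norm_num)]
      linarith
    rw [mul_add, ← mul_assoc K C] at e7
    linarith
  by_contra! hcon
  have hseq : ∀ n : ℕ, ∃ h g, FiniteEnergy R1 R2 h g ∧ formQ R1 R2 0 h g = 1 ∧
      formQ R1 R2 V h g < 1 / ((n : ℝ) + 1) := by
    intro n
    obtain ⟨h, g, ha, hlt⟩ := hcon (1 / ((n : ℝ) + 1)) (by positivity)
    have hpos : 0 < formQ R1 R2 0 h g := by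
      have := (hnn h g ha).trans_lt hlt
      exact pos_of_mul_pos_right this (by positivity)
    set s := (Real.sqrt (formQ R1 R2 0 h g))⁻¹ with hs
    have hs2 : s ^ 2 = (formQ R1 R2 0 h g)⁻¹ := by rw [hs, inv_pow, Real.sq_sqrt hpos.le]
    refine ⟨_, _, ha.const_mul s, ?_, ?_⟩
    · rw [FiniteEnergy.formQ_const_mul, hs2, inv_mul_cancel₀ hpos.ne']
    · rw [FiniteEnergy.formQ_const_mul, hs2, inv_mul_lt_iff₀ hpos]
      linarith
  choose u u' hu hu1 hulim using hseq
  -- the moments of the sequence are bounded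
  have hbdd : ∃ M, ∀ n, ∀ p : T, |moment R1 R2 (fun r => r) p.1 (u n)| ≤ M := by
    have : ∀ p : T, ∃ C, 0 ≤ C ∧ ∀ h g, RadialPrimitive R1 R2 h g →
        moment R1 R2 (fun r => r) p.1 h ^ 2 ≤ C * gradEnergy R1 R2 g := fun p =>
      exists_sq_moment_le (hT p.1 p.2) h₁ continuousOn_id
    choose D hD0 hD using this
    refine ⟨∑ p, Real.sqrt (D p), fun n p => ?_⟩
    have h2 : moment R1 R2 (fun r => r) p.1 (u n) ^ 2 ≤ D p := by
      refine (hD p _ _ (hu n).toRadialPrimitive).trans ?_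
      have := (hu n).gradEnergy_le h₁
      rw [hu1 n] at this
      exact mul_le_of_le_one_right (hD0 p) this
    refine (Real.abs_le_sqrt h2).trans ?_
    exact Finset.single_le_sum (f := fun p => Real.sqrt (D p)) (fun q _ => Real.sqrt_nonneg _)
      (Finset.mem_univ p)
  obtain ⟨M, hM⟩ := hbdd
  obtain ⟨a, -, φ, hφ, hlim⟩ := tendsto_subseq_of_bounded
    (x := fun n => fun p : T => moment R1 R2 (fun r => r) p.1 (u n))
    (Metric.isBounded_closedBall (x := (0 : T → ℝ)) (r := max M 0)) (fun n => by
      rw [mem_closedBall_zero_iff, pi_norm_le_iff_of_nonneg (le_max_right _ _)]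
      exact fun p => (hM n p).trans (le_max_left _ _))
  have hQφ : Tendsto (fun n => formQ R1 R2 V (u (φ n)) (u' (φ n))) atTop (𝓝 0) := by
    refine squeeze_zero (fun n => hnn _ _ (hu _)) (fun n => (hulim (φ n)).le) ?_
    exact tendsto_one_div_add_atTop_nhds_zero_nat.comp hφ.tendsto_atTop
  have hcauchy : ∀ ε > 0, ∃ N, ∀ n ≥ N, ∀ m ≥ N,
      formQ R1 R2 0 (fun r => u (φ n) r - u (φ m) r) (fun r => u' (φ n) r - u' (φ m) r) ≤ ε := by
    intro ε hε
    have hm : ∀ p : T, ∀ δ > 0, ∃ N, ∀ n ≥ N, ∀ m ≥ N,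
        |moment R1 R2 (fun r => r) p.1 (u (φ n)) - moment R1 R2 (fun r => r) p.1 (u (φ m))| < δ := by
      intro p δ hδ
      have := ((continuous_apply p).tendsto a).comp hlim
      exact Metric.cauchySeq_iff.1 this.cauchySeq δ hδ
    set δ := Real.sqrt (ε / (8 * (K * C + 1) * (T.card + 1))) with hδ
    have hδ0 : 0 < δ := Real.sqrt_pos.2 (by positivity)
    choose N hN using fun p : T => hm p δ hδ0
    obtain ⟨N', hN'⟩ := eventually_atTop.1
      (hQφ.eventually (gt_mem_nhds (show 0 < ε / 16 by positivity)))
    refine ⟨max N' (Finset.univ.sup N), fun n hn m hm' => ?_⟩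
    have b1 := hgard _ _ ((hu (φ n)).sub (hu (φ m)) h₁)
    have b2 := (hu (φ n)).formQ_sub (hu (φ m)) hV h₁ hnn
    have b3 := hN' n (le_of_max_le_left hn)
    have b4 := hN' m (le_of_max_le_left hm')
    have b5 : ∑ p ∈ T, moment R1 R2 (fun r => r) p (fun r => u (φ n) r - u (φ m) r) ^ 2 ≤
        T.card * δ ^ 2 := by
      rw [← nsmul_eq_mul]
      refine Finset.sum_le_card_nsmul _ _ _ fun p hp => ?_
      rw [moment_sub (hT p hp) h₁ continuousOn_id (hu _).toRadialPrimitive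
        (hu _).toRadialPrimitive]
      have hNp : N ⟨p, hp⟩ ≤ Finset.univ.sup N := Finset.le_sup (f := N) (Finset.mem_univ _)
      have := hN ⟨p, hp⟩ n (hNp.trans (le_of_max_le_right hn)) m
        (hNp.trans (le_of_max_le_right hm'))
      rw [← sq_abs]
      exact pow_le_pow_left₀ (abs_nonneg _) this.le 2
    have b6 : K * C * (T.card * δ ^ 2) ≤ ε / 8 := by
      rw [hδ, Real.sq_sqrt (by positivity)]
      have hKC : 0 ≤ K * C := by positivity
      have : K * C * (T.card * (ε / (8 * (K * C + 1) * (T.card + 1)))) =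
          ε / 8 * ((K * C) / (K * C + 1)) * (T.card / (T.card + 1)) := by
        field_simp
      rw [this]
      have i1 : (K * C) / (K * C + 1) ≤ 1 := by rw [div_le_one (by positivity)]; linarith
      have i2 : (T.card : ℝ) / (T.card + 1) ≤ 1 := by rw [div_le_one (by positivity)]; linarith
      calc ε / 8 * ((K * C) / (K * C + 1)) * (T.card / (T.card + 1)) ≤ ε / 8 * 1 * 1 := by
            gcongr
        _ = ε / 8 := by ring
    have b7 := mul_le_mul_of_nonneg_left b5 (show 0 ≤ K * C by positivity)
    linarith
  obtain ⟨h, g, ha, hconv⟩ := FiniteEnergy.complete h₁ hR (fun n => hu (φ n)) hcauchy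
  have hz : WeightBound R1 R2 0 0 := ⟨le_rfl, aestronglyMeasurable_zero, by simp⟩
  have hnn0 : ∀ h g, FiniteEnergy R1 R2 h g → 0 ≤ formQ R1 R2 0 h g := fun h g ha =>
    (gradEnergy_nonneg h₁).trans (ha.gradEnergy_le h₁)
  have hQ0 : formQ R1 R2 V h g = 0 := by
    refine le_antisymm ?_ (hnn h g ha)
    refine le_of_forall_pos_le_add fun ε hε => ?_
    obtain ⟨N, hN⟩ := hconv (ε / (4 * (K + 1))) (by positivity)
    obtain ⟨N', hN'⟩ := eventually_atTop.1
      (hQφ.eventually (gt_mem_nhds (show 0 < ε / 4 by positivity)))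
    set n := max N N'
    have hd := (hu (φ n)).sub ha h₁
    have b1 := (hu (φ n)).formQ_sub hd hV h₁ hnn
    simp only [sub_sub_cancel] at b1
    have b2 := hN' n (le_max_right _ _)
    have b3 := hN n (le_max_left _ _)
    have b4 : formQ R1 R2 V (fun r => u (φ n) r - h r) (fun r => u' (φ n) r - g r) ≤
        (K + 1) * formQ R1 R2 0 (fun r => u (φ n) r - h r) (fun r => u' (φ n) r - g r) := by
      have e1 := hd.formQ_eq hV h₁
      have e2 := FiniteEnergy.abs_integral_le hd.toRadialPrimitive hV h₁
      have e3 : ∫ r in radial R1 R2, wt r * r * (u (φ n) r - h r) ^ 2 ≤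
          ∫ r in radial R1 R2, (u (φ n) r - h r) ^ 2 / r := by
        refine setIntegral_mono_on (hd.integrable_wt_sq h₁) hd.integrable_self
          measurableSet_radial fun r hr => ?_
        have hr0 := radial_pos h₁ hr
        rw [le_div_iff₀ hr0]
        have := wt_mul_pow_le hr0.le (show 2 ≤ 6 by norm_num)
        calc wt r * r * (u (φ n) r - h r) ^ 2 * r = (wt r * r ^ 2) * (u (φ n) r - h r) ^ 2 := by ring
          _ ≤ 1 * (u (φ n) r - h r) ^ 2 := by gcongr
          _ = _ := one_mul _
      have e4 := hd.integral_sq_le h₁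
      have e5 := le_abs_self (∫ r in radial R1 R2, V r * r * (u (φ n) r - h r) ^ 2)
      have e6 := mul_le_mul_of_nonneg_left (e3.trans e4) hK
      linarith
    have b5 : (K + 1) * (ε / (4 * (K + 1))) = ε / 4 := by field_simp
    have b6 := mul_le_mul_of_nonneg_left b3 (show 0 ≤ K + 1 by positivity)
    linarith
  have hh0 := hL.eq_zero hV h₁ ha hQ0
  have hN0 : formQ R1 R2 0 h g = 0 := by
    have := hgard h g ha
    have hmom : ∀ p ∈ T, moment R1 R2 (fun r => r) p h ^ 2 = 0 := by
      intro p _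
      have : moment R1 R2 (fun r => r) p h = 0 := by
        refine setIntegral_eq_zero_of_forall_eq_zero fun r hr => ?_
        rw [hh0 r hr, mul_zero]
      rw [this]; norm_num
    rw [hQ0, Finset.sum_eq_zero hmom] at this
    linarith [hnn0 h g ha]
  obtain ⟨N, hN⟩ := hconv (1 / 4) (by norm_num)
  have b1 := (hu (φ N)).sub ha h₁
  have b2 := b1.formQ_sub (ha.const_mul (-1)) hz h₁ hnn0
  rw [FiniteEnergy.formQ_const_mul, hN0] at b2
  simp only [neg_one_mul, sub_neg_eq_add, sub_add_cancel] at b2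
  rw [hu1] at b2
  linarith [hN N le_rfl]

end Complete

/-! ### Functions on the strip -/

section Strip

variable {R1 : ℝ} {R2 : EReal}

theorem ae_prod_le_of_ae_ae {ν : Measure ℝ} [SFinite ν] {f g : ℝ × ℝ → ℝ}
    (hf : AEStronglyMeasurable f (ν.prod zMeasure)) (hg : AEStronglyMeasurable g (ν.prod zMeasure))
    (h : ∀ᵐ r ∂ν, ∀ᵐ z ∂zMeasure, f (r, z) ≤ g (r, z)) : ∀ᵐ p ∂ν.prod zMeasure, f p ≤ g p := by
  have hfe := hf.ae_eq_mk
  have hge := hg.ae_eq_mk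
  have hms : MeasurableSet {p | hf.mk f p ≤ hg.mk g p} :=
    measurableSet_le hf.stronglyMeasurable_mk.measurable hg.stronglyMeasurable_mk.measurable
  have : ∀ᵐ p ∂ν.prod zMeasure, hf.mk f p ≤ hg.mk g p := by
    rw [Measure.ae_prod_iff_ae_ae hms]
    filter_upwards [h, Measure.ae_ae_of_ae_prod hfe, Measure.ae_ae_of_ae_prod hge] with r h1 h2 h3
    filter_upwards [h1, h2, h3] with z h1 h2 h3
    rwa [← h2, ← h3]
  filter_upwards [this, hfe, hge] with p h1 h2 h3
  rwa [h2, h3]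

theorem ae_planeMeasure_snd {P : ℝ → Prop} (h : ∀ᵐ z ∂zMeasure, P z) :
    ∀ᵐ p ∂planeMeasure R1 R2, P p.2 :=
  Measure.quasiMeasurePreserving_snd.ae h

theorem ae_planeMeasure_fst {P : ℝ → Prop} (h : ∀ᵐ r ∂volume.restrict (radial R1 R2), P r) :
    ∀ᵐ p ∂planeMeasure R1 R2, P p.1 :=
  Measure.quasiMeasurePreserving_fst.ae h

theorem ae_planeMeasure_mem : ∀ᵐ p ∂planeMeasure R1 R2, p.1 ∈ radial R1 R2 :=
  ae_planeMeasure_fst (ae_restrict_mem measurableSet_radial)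

theorem aestronglyMeasurable_fst {f : ℝ → ℝ}
    (hf : AEStronglyMeasurable f (volume.restrict (radial R1 R2))) :
    AEStronglyMeasurable (fun p : ℝ × ℝ => f p.1) (planeMeasure R1 R2) := hf.comp_fst

theorem zMean_sq_le {u : ℝ → ℝ} (hu : MemLp u 2 zMeasure) :
    2 * Real.pi * zMean u ^ 2 ≤ ∫ z, u z ^ 2 ∂zMeasure := by
  have := integral_sub_const_sq hu
  have h0 : 0 ≤ ∫ z, (u z - zMean u) ^ 2 ∂zMeasure := integral_nonneg fun _ => sq_nonneg _
  linarith

theorem aestronglyMeasurable_zMean {u : ℝ × ℝ → ℝ}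
    (hu : AEStronglyMeasurable u (planeMeasure R1 R2)) :
    AEStronglyMeasurable (fun r => zMean fun z => u (r, z)) (volume.restrict (radial R1 R2)) :=
  hu.integral_prod_right'.const_mul _

/-- Splitting a weighted square integral into the axial mean and the fluctuation. -/
theorem integral_weight_sub_zMean_sq {u : ℝ × ℝ → ℝ} {W : ℝ → ℝ}
    (hu : AEStronglyMeasurable u (planeMeasure R1 R2))
    (hW : AEStronglyMeasurable W (volume.restrict (radial R1 R2)))
    (hmem : ∀ᵐ r ∂volume.restrict (radial R1 R2), MemLp (fun z => u (r, z)) 2 zMeasure)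
    (hint : Integrable (fun p => W p.1 * u p ^ 2) (planeMeasure R1 R2)) :
    IntegrableOn (fun r => W r * (zMean fun z => u (r, z)) ^ 2) (radial R1 R2) ∧
    Integrable (fun p => W p.1 * (u p - zMean fun z => u (p.1, z)) ^ 2) (planeMeasure R1 R2) ∧
    ∫ p, W p.1 * (u p - zMean fun z => u (p.1, z)) ^ 2 ∂planeMeasure R1 R2 =
      ∫ p, W p.1 * u p ^ 2 ∂planeMeasure R1 R2 -
        2 * Real.pi * ∫ r in radial R1 R2, W r * (zMean fun z => u (r, z)) ^ 2 := by
  have hm := aestronglyMeasurable_zMean hu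
  have hpi := Real.two_pi_pos
  have i1 : IntegrableOn (fun r => W r * (zMean fun z => u (r, z)) ^ 2) (radial R1 R2) := by
    refine Integrable.mono' (hint.integral_norm_prod_left.const_mul (2 * Real.pi)⁻¹)
      (hW.mul (hm.pow 2)) ?_
    filter_upwards [hmem] with r hr
    have := zMean_sq_le hr
    have e : ∫ z, ‖W r * u (r, z) ^ 2‖ ∂zMeasure = |W r| * ∫ z, u (r, z) ^ 2 ∂zMeasure := by
      rw [← integral_const_mul]
      refine integral_congr_ae (Eventually.of_forall fun z => ?_)
      simp
    have hmain : ‖W r * (zMean fun z => u (r, z)) ^ 2‖ =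
        |W r| * (zMean fun z => u (r, z)) ^ 2 := by simp
    rw [hmain]
    change _ ≤ (2 * Real.pi)⁻¹ * ∫ z, ‖W r * u (r, z) ^ 2‖ ∂zMeasure
    rw [e, ← mul_assoc, mul_comm (2 * Real.pi)⁻¹, mul_assoc]
    refine mul_le_mul_of_nonneg_left ?_ (abs_nonneg _)
    rw [le_inv_mul_iff₀ hpi]
    exact this
  have i1' : Integrable (fun p : ℝ × ℝ => W p.1 * (zMean fun z => u (p.1, z)) ^ 2)
      (planeMeasure R1 R2) := i1.comp_fst zMeasure
  have i2 : Integrable (fun p => W p.1 * (u p - zMean fun z => u (p.1, z)) ^ 2)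
      (planeMeasure R1 R2) := by
    refine Integrable.mono' ((hint.norm.const_mul 2).add (i1'.norm.const_mul 2))
      ((aestronglyMeasurable_fst hW).mul ((hu.sub (aestronglyMeasurable_fst hm)).pow 2))
      (Eventually.of_forall fun p => ?_)
    simp only [Pi.add_apply, norm_mul, norm_pow, Real.norm_eq_abs, sq_abs]
    have := abs_nonneg (W p.1)
    have h2 : (u p - zMean fun z => u (p.1, z)) ^ 2 ≤
        2 * u p ^ 2 + 2 * (zMean fun z => u (p.1, z)) ^ 2 := by
      nlinarith [sq_nonneg (u p + zMean fun z => u (p.1, z))]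
    nlinarith [mul_le_mul_of_nonneg_left h2 this]
  refine ⟨i1, i2, ?_⟩
  have e1 := integral_prod _ i2
  have e2 := integral_prod _ hint
  rw [planeMeasure, e1, e2, ← integral_const_mul, ← integral_sub hint.integral_prod_left
    (i1.const_mul _)]
  refine integral_congr_ae ?_
  filter_upwards [hmem] with r hr
  rw [integral_const_mul, integral_const_mul, integral_sub_const_sq hr]
  ring

/-- A function on the strip with radial derivative `g`, vanishing at `R1` and constant at `R2`,
together with a candidate `k` for the axial derivative. -/
structure StripBase (R1 : ℝ) (R2 : EReal) (h g k : ℝ × ℝ → ℝ) : Prop where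
  aesm : AEStronglyMeasurable h (planeMeasure R1 R2)
  aesm_g : AEStronglyMeasurable g (planeMeasure R1 R2)
  aesm_k : AEStronglyMeasurable k (planeMeasure R1 R2)
  int_g : Integrable (fun p => g p ^ 2 / p.1) (planeMeasure R1 R2)
  int_k : Integrable (fun p => k p ^ 2 / p.1) (planeMeasure R1 R2)
  primitive : ∀ᵐ z ∂zMeasure, ∀ r ∈ radial R1 R2, h (r, z) = ∫ s in R1..r, g (s, z)
  outer : R2 ≠ ⊤ → ∃ κ : ℝ, ∀ᵐ z ∂zMeasure, Tendsto (fun r => h (r, z)) (toOuter R2) (𝓝 κ)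

/-- The integral `∫∫ g² / r dr dz`. -/
def stripEnergy (R1 : ℝ) (R2 : EReal) (g : ℝ × ℝ → ℝ) : ℝ :=
  ∫ p, g p ^ 2 / p.1 ∂planeMeasure R1 R2

theorem stripEnergy_nonneg (h₁ : 0 ≤ R1) (g : ℝ × ℝ → ℝ) : 0 ≤ stripEnergy R1 R2 g := by
  refine integral_nonneg_of_ae ?_
  filter_upwards [ae_planeMeasure_mem] with p hp
  have := radial_pos h₁ hp
  simp only [Pi.zero_apply]
  positivity

namespace StripBase

variable {h g k : ℝ × ℝ → ℝ}

theorem radialPrimitive (hs : StripBase R1 R2 h g k) :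
    ∀ᵐ z ∂zMeasure, RadialPrimitive R1 R2 (fun r => h (r, z)) (fun r => g (r, z)) := by
  filter_upwards [hs.aesm_g.prodMk_right, hs.int_g.prod_left_ae, hs.primitive] with z h1 h2 h3
  exact ⟨h1, h2, h3⟩

theorem integrable_gradEnergy (hs : StripBase R1 R2 h g k) :
    Integrable (fun z => gradEnergy R1 R2 fun r => g (r, z)) zMeasure :=
  hs.int_g.integral_prod_right

theorem integral_gradEnergy (hs : StripBase R1 R2 h g k) :
    ∫ z, gradEnergy R1 R2 (fun r => g (r, z)) ∂zMeasure = stripEnergy R1 R2 g :=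
  (integral_prod_symm _ hs.int_g).symm

theorem ae_sq_le (hs : StripBase R1 R2 h g k) (h₁ : 0 ≤ R1) :
    ∀ᵐ p ∂planeMeasure R1 R2,
      h p ^ 2 ≤ p.1 ^ 2 / 2 * gradEnergy R1 R2 (fun r => g (r, p.2)) := by
  filter_upwards [ae_planeMeasure_snd hs.radialPrimitive, ae_planeMeasure_mem] with p h1 h2
  exact h1.sq_le h₁ h2

/-- Weighted `L²` bounds for the perturbation. -/
theorem integral_weight_sq_le (hs : StripBase R1 R2 h g k) (h₁ : 0 ≤ R1) {w : ℝ → ℝ}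
    (hw : ∀ r ∈ radial R1 R2, 0 ≤ w r)
    (hw3 : IntegrableOn (fun r => w r * r ^ 2) (radial R1 R2))
    (hwm : AEStronglyMeasurable w (volume.restrict (radial R1 R2))) :
    Integrable (fun p => w p.1 * h p ^ 2) (planeMeasure R1 R2) ∧
    ∫ p, w p.1 * h p ^ 2 ∂planeMeasure R1 R2 ≤
      (∫ r in radial R1 R2, w r * r ^ 2) / 2 * stripEnergy R1 R2 g := by
  have hi : Integrable (fun p : ℝ × ℝ => (w p.1 * p.1 ^ 2) *
      gradEnergy R1 R2 (fun r => g (r, p.2))) (planeMeasure R1 R2) :=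
    Integrable.mul_prod hw3 hs.integrable_gradEnergy
  have hle : ∀ᵐ p ∂planeMeasure R1 R2, w p.1 * h p ^ 2 ≤
      1 / 2 * ((w p.1 * p.1 ^ 2) * gradEnergy R1 R2 (fun r => g (r, p.2))) := by
    filter_upwards [hs.ae_sq_le h₁, ae_planeMeasure_mem] with p h1 h2
    nlinarith [mul_le_mul_of_nonneg_left h1 (hw _ h2)]
  have hI : Integrable (fun p => w p.1 * h p ^ 2) (planeMeasure R1 R2) := by
    refine Integrable.mono' (hi.const_mul (1 / 2))
      ((aestronglyMeasurable_fst hwm).mul (hs.aesm.pow 2)) ?_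
    filter_upwards [hle, ae_planeMeasure_mem] with p h1 h2
    rw [Real.norm_of_nonneg (mul_nonneg (hw _ h2) (sq_nonneg _))]
    exact h1
  refine ⟨hI, (integral_mono_ae hI (hi.const_mul _) hle).trans_eq ?_⟩
  rw [integral_const_mul, planeMeasure, integral_prod_mul (fun r => w r * r ^ 2)
    (fun z => gradEnergy R1 R2 fun r => g (r, z)), hs.integral_gradEnergy]
  ring

theorem integral_wt_sq_le (hs : StripBase R1 R2 h g k) (h₁ : 0 ≤ R1) :
    Integrable (fun p => wt p.1 * p.1 * h p ^ 2) (planeMeasure R1 R2) ∧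
    ∫ p, wt p.1 * p.1 * h p ^ 2 ∂planeMeasure R1 R2 ≤
      (∫ r in radial R1 R2, wt r * r ^ 3) / 2 * stripEnergy R1 R2 g := by
  have h3 := integrableOn_wt_mul_pow (R2 := R2) h₁ (show 3 ≤ 4 by norm_num)
  have e : (fun r => wt r * r * r ^ 2) = fun r => wt r * r ^ 3 := by ext r; ring
  have := hs.integral_weight_sq_le h₁ (w := fun r => wt r * r)
    (fun r hr => mul_nonneg (wt_pos r).le (radial_pos h₁ hr).le) (by rw [e]; exact h3)
    (continuous_wt.mul continuous_id).aestronglyMeasurable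
  rwa [e] at this

/-- The axial mean of the perturbation. -/
theorem zMean_radialPrimitive (hs : StripBase R1 R2 h g k) (h₁ : 0 ≤ R1) :
    RadialPrimitive R1 R2 (fun r => zMean fun z => h (r, z)) (fun r => zMean fun z => g (r, z)) ∧
    Integrable (fun p => (g p - zMean fun z => g (p.1, z)) ^ 2 / p.1) (planeMeasure R1 R2) ∧
    ∫ p, (g p - zMean fun z => g (p.1, z)) ^ 2 / p.1 ∂planeMeasure R1 R2 =
      stripEnergy R1 R2 g -
        2 * Real.pi * gradEnergy R1 R2 (fun r => zMean fun z => g (r, z)) := by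
  have hmem : ∀ᵐ r ∂volume.restrict (radial R1 R2), MemLp (fun z => g (r, z)) 2 zMeasure := by
    filter_upwards [hs.aesm_g.prodMk_left, hs.int_g.prod_right_ae,
      ae_restrict_mem measurableSet_radial] with r h1 h2 h3
    have := radial_pos h₁ h3
    refine (memLp_two_iff_integrable_sq h1).2 ((h2.mul_const r).congr
      (Eventually.of_forall fun z => ?_))
    simp only
    field_simp
  have key := integral_weight_sub_zMean_sq (W := fun r => r⁻¹) hs.aesm_g
    measurable_id.inv.aestronglyMeasurable hmem (hs.int_g.congr (Eventually.of_forall fun p => by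
      simp only; ring))
  simp only [inv_mul_eq_div] at key
  refine ⟨⟨aestronglyMeasurable_zMean hs.aesm_g, key.1, fun r hr => ?_⟩, key.2.1, key.2.2⟩
  have hr0 := radial_pos h₁ hr
  have hsub := Ioc_subset_radial hr
  have hgi : Integrable (fun p : ℝ × ℝ => g p)
      ((volume.restrict (Ioc R1 r)).prod zMeasure) := by
    have hle : (volume.restrict (Ioc R1 r)).prod zMeasure ≤ planeMeasure R1 R2 :=
      Measure.prod_mono (Measure.restrict_mono hsub le_rfl) le_rfl
    have hc : Integrable (fun p : ℝ × ℝ => p.1) ((volume.restrict (Ioc R1 r)).prod zMeasure) :=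
      Integrable.comp_fst (f := fun s : ℝ => s) (continuous_id.integrableOn_Ioc) zMeasure
    refine Integrable.mono' ((hs.int_g.mono_measure hle).add hc) (hs.aesm_g.mono_measure hle) ?_
    have : ∀ᵐ p : ℝ × ℝ ∂(volume.restrict (Ioc R1 r)).prod zMeasure, p.1 ∈ Ioc R1 r :=
      Measure.quasiMeasurePreserving_fst.ae (ae_restrict_mem measurableSet_Ioc)
    filter_upwards [this] with p hp
    exact abs_le_sq_div_add (h₁.trans_lt hp.1)
  have e1 : ∫ z, h (r, z) ∂zMeasure = ∫ z, (∫ s in Ioc R1 r, g (s, z)) ∂zMeasure := by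
    refine integral_congr_ae ?_
    filter_upwards [hs.primitive] with z hz
    rw [hz r hr, intervalIntegral.integral_of_le hr.1.le]
  rw [zMean, e1, intervalIntegral.integral_of_le hr.1.le, ← integral_integral_swap hgi,
    ← integral_const_mul]
  rfl

end StripBase

end Strip

/-! ### Fluctuations and coercivity on the strip -/

section StripCoercive

variable {R1 : ℝ} {R2 : EReal}

/-- A perturbation of the magnetic potential on the strip, with derivatives `g` and `k` in `r`
and `z`, vanishing at `R1` and constant at `R2`. -/
structure StripPert (R1 : ℝ) (R2 : EReal) (h g k : ℝ × ℝ → ℝ) : Prop extends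
    StripBase R1 R2 h g k where
  axial : ∀ᵐ r ∂volume.restrict (radial R1 R2),
    IsPeriodicDeriv (fun z => h (r, z)) (fun z => k (r, z))

namespace StripPert

variable {h g k : ℝ × ℝ → ℝ} {V : ℝ → ℝ} {K : ℝ}

theorem memLp_slice (hs : StripPert R1 R2 h g k) (h₁ : 0 ≤ R1) :
    ∀ᵐ r ∂volume.restrict (radial R1 R2), MemLp (fun z => h (r, z)) 2 zMeasure := by
  filter_upwards [hs.aesm.prodMk_left, (hs.integral_wt_sq_le h₁).1.prod_right_ae,
    ae_restrict_mem measurableSet_radial] with r h1 h2 h3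
  have h0 := radial_pos h₁ h3
  have hw := wt_pos r
  refine (memLp_two_iff_integrable_sq h1).2 ((h2.const_mul (wt r * r)⁻¹).congr
    (Eventually.of_forall fun z => ?_))
  simp only
  field_simp

theorem memLp_slice_axial (hs : StripPert R1 R2 h g k) (h₁ : 0 ≤ R1) :
    ∀ᵐ r ∂volume.restrict (radial R1 R2), MemLp (fun z => k (r, z)) 2 zMeasure := by
  filter_upwards [hs.aesm_k.prodMk_left, hs.int_k.prod_right_ae,
    ae_restrict_mem measurableSet_radial] with r h1 h2 h3
  have := radial_pos h₁ h3
  refine (memLp_two_iff_integrable_sq h1).2 ((h2.mul_const r).congr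
    (Eventually.of_forall fun z => ?_))
  simp only
  field_simp

theorem integrable_axial (hs : StripPert R1 R2 h g k) :
    IntegrableOn (fun r => (∫ z, k (r, z) ^ 2 ∂zMeasure) / r) (radial R1 R2) := by
  refine hs.int_k.integral_prod_left.congr (Eventually.of_forall fun r => ?_)
  simp only
  rw [integral_div]

theorem integral_axial (hs : StripPert R1 R2 h g k) :
    ∫ r in radial R1 R2, (∫ z, k (r, z) ^ 2 ∂zMeasure) / r = stripEnergy R1 R2 k := by
  rw [stripEnergy, planeMeasure, integral_prod _ hs.int_k]
  refine integral_congr_ae (Eventually.of_forall fun r => ?_)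
  simp only
  rw [integral_div]

/-- Poincaré inequality in the axial variable. -/
theorem fluctuation (hs : StripPert R1 R2 h g k) (h₁ : 0 ≤ R1) :
    Integrable (fun p => (h p - zMean fun z => h (p.1, z)) ^ 2 / p.1) (planeMeasure R1 R2) ∧
    ∫ p, (h p - zMean fun z => h (p.1, z)) ^ 2 / p.1 ∂planeMeasure R1 R2 ≤
      stripEnergy R1 R2 k := by
  have hm := hs.aesm.sub (aestronglyMeasurable_fst (aestronglyMeasurable_zMean hs.aesm))
  have hmm : AEStronglyMeasurable (fun p => (h p - zMean fun z => h (p.1, z)) ^ 2 / p.1)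
      (planeMeasure R1 R2) := by
    simp only [div_eq_mul_inv]
    exact (hm.pow 2).mul measurable_fst.inv.aestronglyMeasurable
  have hb : ∀ᵐ r ∂volume.restrict (radial R1 R2),
      ∫ z, (h (r, z) - zMean fun z => h (r, z)) ^ 2 / r ∂zMeasure ≤
        (∫ z, k (r, z) ^ 2 ∂zMeasure) / r := by
    filter_upwards [hs.memLp_slice h₁, hs.memLp_slice_axial h₁, hs.axial,
      ae_restrict_mem measurableSet_radial] with r h1 h2 h3 h4
    rw [integral_div]
    exact div_le_div_of_nonneg_right (integral_sub_zMean_sq_le h1 h2 h3) (radial_pos h₁ h4).le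
  have hI : Integrable (fun p => (h p - zMean fun z => h (p.1, z)) ^ 2 / p.1)
      (planeMeasure R1 R2) := by
    refine (integrable_prod_iff hmm).2 ⟨?_, ?_⟩
    · filter_upwards [hs.memLp_slice h₁] with r h1
      exact ((h1.sub (memLp_const _)).integrable_sq).div_const r
    · refine Integrable.mono' hs.integrable_axial hmm.norm.integral_prod_right' ?_
      filter_upwards [hb, ae_restrict_mem measurableSet_radial] with r h1 h2
      have hr := radial_pos h₁ h2
      rw [Real.norm_of_nonneg (integral_nonneg fun _ => norm_nonneg _)]
      refine le_trans (le_of_eq ?_) h1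
      refine integral_congr_ae (Eventually.of_forall fun z => ?_)
      exact Real.norm_of_nonneg (by positivity)
  refine ⟨hI, ?_⟩
  rw [← hs.integral_axial, planeMeasure, integral_prod _ hI]
  exact integral_mono_ae hI.integral_prod_left hs.integrable_axial hb

theorem ae_fluctuation_sq_le (hs : StripPert R1 R2 h g k) (h₁ : 0 ≤ R1) :
    ∀ᵐ p ∂planeMeasure R1 R2, (h p - zMean fun z => h (p.1, z)) ^ 2 ≤
      2 * Real.pi * ∫ z, k (p.1, z) ^ 2 ∂zMeasure := by
  refine ae_prod_le_of_ae_ae (f := fun p => (h p - zMean fun z => h (p.1, z)) ^ 2)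
    (g := fun p => 2 * Real.pi * ∫ z, k (p.1, z) ^ 2 ∂zMeasure) ?_ ?_ ?_
  · exact (hs.aesm.sub (aestronglyMeasurable_fst (aestronglyMeasurable_zMean hs.aesm))).pow 2
  · exact (aestronglyMeasurable_fst (hs.aesm_k.pow 2).integral_prod_right').const_mul _
  · filter_upwards [hs.memLp_slice h₁, hs.memLp_slice_axial h₁, hs.axial] with r h1 h2 h3
    exact ae_sub_zMean_sq_le h1 h2 h3

theorem gradEnergy_zMean_le (hs : StripPert R1 R2 h g k) (h₁ : 0 ≤ R1) :
    2 * Real.pi * gradEnergy R1 R2 (fun r => zMean fun z => g (r, z)) ≤ stripEnergy R1 R2 g := by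
  have h1 := (hs.zMean_radialPrimitive h₁).2.2
  have : 0 ≤ ∫ p, (g p - zMean fun z => g (p.1, z)) ^ 2 / p.1 ∂planeMeasure R1 R2 := by
    refine integral_nonneg_of_ae ?_
    filter_upwards [ae_planeMeasure_mem] with p hp
    have := radial_pos h₁ hp
    simp only [Pi.zero_apply]
    positivity
  linarith

/-- Weighted `L⁴` bound for the perturbation. -/
theorem integral_wt_pow_four_le (hs : StripPert R1 R2 h g k) (h₁ : 0 ≤ R1)
    (hR : (R1 : EReal) < R2) :
    Integrable (fun p => wt p.1 * p.1 * h p ^ 4) (planeMeasure R1 R2) ∧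
    ∫ p, wt p.1 * p.1 * h p ^ 4 ∂planeMeasure R1 R2 ≤
      4 * Real.pi * (stripEnergy R1 R2 g + stripEnergy R1 R2 k) ^ 2 := by
  set a : ℝ → ℝ := fun z => gradEnergy R1 R2 fun r => g (r, z) with ha
  set m : ℝ → ℝ := fun r => zMean fun z => h (r, z) with hm
  obtain ⟨hp, -, -⟩ := hs.zMean_radialPrimitive h₁
  obtain ⟨hh1, hh2⟩ := hp.hardy h₁ hR
  have i1 : Integrable (fun p : ℝ × ℝ => (m p.1 ^ 2 / p.1 ^ 3) * a p.2) (planeMeasure R1 R2) :=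
    Integrable.mul_prod (f := fun r => m r ^ 2 / r ^ 3) hh1 hs.integrable_gradEnergy
  have i2 : Integrable (fun p : ℝ × ℝ => ((∫ z, k (p.1, z) ^ 2 ∂zMeasure) / p.1) * a p.2)
      (planeMeasure R1 R2) :=
    Integrable.mul_prod (f := fun r => (∫ z, k (r, z) ^ 2 ∂zMeasure) / r)
      hs.integrable_axial hs.integrable_gradEnergy
  have hle : ∀ᵐ p ∂planeMeasure R1 R2, wt p.1 * p.1 * h p ^ 4 ≤
      (m p.1 ^ 2 / p.1 ^ 3) * a p.2 +
        2 * Real.pi * (((∫ z, k (p.1, z) ^ 2 ∂zMeasure) / p.1) * a p.2) := by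
    filter_upwards [hs.ae_sq_le h₁, hs.ae_fluctuation_sq_le h₁, ae_planeMeasure_mem]
      with p h1 h2 h3
    have hr := radial_pos h₁ h3
    have hw := wt_pos p.1
    have w6 := wt_mul_pow_le hr.le (le_refl 6)
    have w4 := wt_mul_pow_le hr.le (show 4 ≤ 6 by norm_num)
    have ha0 : 0 ≤ a p.2 := gradEnergy_nonneg h₁
    set κ := ∫ z, k (p.1, z) ^ 2 ∂zMeasure with hκ
    have hκ0 : 0 ≤ κ := integral_nonneg fun _ => sq_nonneg _
    have hsq : h p ^ 2 ≤ 2 * m p.1 ^ 2 + 2 * (2 * Real.pi * κ) := by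
      have : (h p - m p.1) ^ 2 ≤ 2 * Real.pi * κ := h2
      nlinarith [sq_nonneg (h p - 2 * m p.1)]
    have h4 : h p ^ 4 ≤ (p.1 ^ 2 / 2 * a p.2) * (2 * m p.1 ^ 2 + 2 * (2 * Real.pi * κ)) := by
      have : h p ^ 4 = h p ^ 2 * h p ^ 2 := by ring
      rw [this]
      exact mul_le_mul h1 hsq (sq_nonneg _) (by positivity)
    have e1 : wt p.1 * p.1 * h p ^ 4 ≤
        wt p.1 * p.1 ^ 6 * (m p.1 ^ 2 / p.1 ^ 3 * a p.2) +
          wt p.1 * p.1 ^ 4 * (2 * Real.pi * (κ / p.1 * a p.2)) := by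
      calc wt p.1 * p.1 * h p ^ 4 ≤ wt p.1 * p.1 *
            ((p.1 ^ 2 / 2 * a p.2) * (2 * m p.1 ^ 2 + 2 * (2 * Real.pi * κ))) :=
          mul_le_mul_of_nonneg_left h4 (by positivity)
        _ = _ := by field_simp
    refine e1.trans (add_le_add ?_ ?_)
    · exact mul_le_of_le_one_left (by positivity) w6
    · exact mul_le_of_le_one_left (by positivity) w4
  have hI : Integrable (fun p => wt p.1 * p.1 * h p ^ 4) (planeMeasure R1 R2) := by
    refine Integrable.mono' (i1.add (i2.const_mul (2 * Real.pi))) ?_ ?_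
    · exact ((continuous_wt.comp continuous_fst).mul continuous_fst).aestronglyMeasurable.mul
        (hs.aesm.pow 4)
    · filter_upwards [hle, ae_planeMeasure_mem] with p h1 h2
      have := wt_pos p.1
      have := radial_pos h₁ h2
      rw [Real.norm_of_nonneg (by positivity)]
      exact h1
  refine ⟨hI, (integral_mono_ae hI (i1.add (i2.const_mul _)) hle).trans ?_⟩
  have e1 : ∫ p : ℝ × ℝ, (m p.1 ^ 2 / p.1 ^ 3) * a p.2 ∂planeMeasure R1 R2 =
      (∫ r in radial R1 R2, m r ^ 2 / r ^ 3) * stripEnergy R1 R2 g := by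
    rw [planeMeasure, integral_prod_mul (fun r => m r ^ 2 / r ^ 3) a, ha, hs.integral_gradEnergy]
  have e2 : ∫ p : ℝ × ℝ, ((∫ z, k (p.1, z) ^ 2 ∂zMeasure) / p.1) * a p.2 ∂planeMeasure R1 R2 =
      stripEnergy R1 R2 k * stripEnergy R1 R2 g := by
    rw [planeMeasure, integral_prod_mul (fun r => (∫ z, k (r, z) ^ 2 ∂zMeasure) / r) a, ha,
      hs.integral_gradEnergy, hs.integral_axial]
  have e3 : ∫ p : ℝ × ℝ, ((m p.1 ^ 2 / p.1 ^ 3) * a p.2 +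
      2 * Real.pi * (((∫ z, k (p.1, z) ^ 2 ∂zMeasure) / p.1) * a p.2)) ∂planeMeasure R1 R2 =
      (∫ r in radial R1 R2, m r ^ 2 / r ^ 3) * stripEnergy R1 R2 g +
        2 * Real.pi * (stripEnergy R1 R2 k * stripEnergy R1 R2 g) := by
    rw [integral_add i1 (i2.const_mul _), integral_const_mul, e1, e2]
  refine e3.trans_le ?_
  have hA := stripEnergy_nonneg (R2 := R2) h₁ g
  have hB := stripEnergy_nonneg (R2 := R2) h₁ k
  have hG := hs.gradEnergy_zMean_le h₁
  have hpi := Real.pi_gt_three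
  have hG0 := gradEnergy_nonneg (R2 := R2) (g := fun r => zMean fun z => g (r, z)) h₁
  have : ∫ r in radial R1 R2, m r ^ 2 / r ^ 3 ≤ stripEnergy R1 R2 g := by
    refine hh2.trans ?_
    nlinarith
  nlinarith [mul_nonneg hA hB, mul_le_mul_of_nonneg_right this hA,
    mul_nonneg (mul_nonneg hA hB) Real.pi_pos.le, mul_nonneg (mul_nonneg hA hA) Real.pi_pos.le,
    mul_nonneg (mul_nonneg hB hB) Real.pi_pos.le]

theorem ae_abs_le (hs : StripPert R1 R2 h g k) (h₁ : 0 ≤ R1) {r : ℝ} (hr : r ∈ radial R1 R2) :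
    ∀ᵐ z ∂zMeasure, |h (r, z)| ≤ r * (1 + gradEnergy R1 R2 fun s => g (s, z)) := by
  filter_upwards [hs.radialPrimitive] with z hz
  have h1 := hz.sq_le h₁ hr
  have h2 := gradEnergy_nonneg (R2 := R2) (g := fun s => g (s, z)) h₁
  have h3 := radial_pos h₁ hr
  refine abs_le_of_sq_le_sq (h1.trans ?_) (by positivity)
  rw [mul_pow]
  have : gradEnergy R1 R2 (fun s => g (s, z)) / 2 ≤
      (1 + gradEnergy R1 R2 fun s => g (s, z)) ^ 2 := by nlinarith
  nlinarith [mul_le_mul_of_nonneg_left this (sq_nonneg r)]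

theorem aesm_slice (hs : StripPert R1 R2 h g k) {r : ℝ} (hr : r ∈ radial R1 R2) :
    AEStronglyMeasurable (fun z => h (r, z)) zMeasure := by
  have hle : (volume.restrict (Ioc R1 r)).prod zMeasure ≤ planeMeasure R1 R2 :=
    Measure.prod_mono (Measure.restrict_mono (Ioc_subset_radial hr) le_rfl) le_rfl
  have : AEStronglyMeasurable (fun z => ∫ s in Ioc R1 r, g (s, z)) zMeasure :=
    (hs.aesm_g.mono_measure hle).prod_swap.integral_prod_right'
  refine this.congr ?_
  filter_upwards [hs.primitive] with z hz
  rw [hz r hr, intervalIntegral.integral_of_le hr.1.le]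

/-- At a finite outer boundary the axial mean has the same boundary value. -/
theorem tendsto_zMean (hs : StripPert R1 R2 h g k) (h₁ : 0 ≤ R1) (hR : (R1 : EReal) < R2)
    (h2 : R2 ≠ ⊤) {κ : ℝ}
    (hκ : ∀ᵐ z ∂zMeasure, Tendsto (fun r => h (r, z)) (toOuter R2) (𝓝 κ)) :
    Tendsto (fun r => zMean fun z => h (r, z)) (toOuter R2) (𝓝 κ) := by
  obtain ⟨c, hc, hRc, -, -⟩ := exists_toOuter_eq hR h2
  have : (toOuter R2).IsCountablyGenerated := toOuter_isCountablyGenerated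
  have hlim : Tendsto (fun r => ∫ z, h (r, z) ∂zMeasure) (toOuter R2)
      (𝓝 (∫ _, κ ∂zMeasure)) := by
    refine tendsto_integral_filter_of_dominated_convergence
      (fun z => c * (1 + gradEnergy R1 R2 fun s => g (s, z))) ?_ ?_ ?_ hκ
    · filter_upwards [radial_mem_toOuter hR] with r hr using hs.aesm_slice hr
    · filter_upwards [radial_mem_toOuter hR] with r hr
      filter_upwards [hs.ae_abs_le h₁ hr] with z hz
      refine hz.trans (mul_le_mul_of_nonneg_right ?_ ?_)
      · have := hr.2
        rw [hc] at this
        exact_mod_cast this.le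
      · have := gradEnergy_nonneg (R2 := R2) (g := fun s => g (s, z)) h₁
        linarith
    · exact ((integrable_const _).add hs.integrable_gradEnergy).const_mul _
  have h3 := hlim.const_mul (2 * Real.pi)⁻¹
  rwa [integral_const, zMeasure_univ, smul_eq_mul, inv_mul_cancel_left₀ Real.two_pi_pos.ne'] at h3

theorem finiteEnergy_fluctuation (hs : StripPert R1 R2 h g k) (h₁ : 0 ≤ R1)
    (hR : (R1 : EReal) < R2) :
    ∀ᵐ z ∂zMeasure, FiniteEnergy R1 R2 (fun r => h (r, z) - zMean fun z => h (r, z))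
      (fun r => g (r, z) - zMean fun z => g (r, z)) := by
  have hm := (hs.zMean_radialPrimitive h₁).1
  have ho : ∀ᵐ z ∂zMeasure, R2 ≠ ⊤ →
      Tendsto (fun r => h (r, z) - zMean fun z => h (r, z)) (toOuter R2) (𝓝 0) := by
    by_cases h2 : R2 = ⊤
    · exact Eventually.of_forall fun z h => absurd h2 h
    · obtain ⟨κ, hκ⟩ := hs.outer h2
      have := hs.tendsto_zMean h₁ hR h2 hκ
      filter_upwards [hκ] with z hz _
      simpa using hz.sub this
  filter_upwards [hs.radialPrimitive, (hs.fluctuation h₁).1.prod_left_ae, ho] with z h1 h2 h3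
  have hrp : RadialPrimitive R1 R2 (fun r => h (r, z) - zMean fun z => h (r, z))
      (fun r => g (r, z) - zMean fun z => g (r, z)) := by
    simpa [sub_eq_add_neg] using h1.add (hm.const_mul (-1)) h₁
  exact ⟨hrp, h2, h3⟩

theorem integrable_weight (hs : StripPert R1 R2 h g k) (h₁ : 0 ≤ R1)
    (hV : WeightBound R1 R2 V K) :
    Integrable (fun p => V p.1 * p.1 * h p ^ 2) (planeMeasure R1 R2) := by
  refine Integrable.mono' ((hs.integral_wt_sq_le h₁).1.const_mul K)
    (((aestronglyMeasurable_fst hV.aesm).mul continuous_fst.aestronglyMeasurable).mul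
      (hs.aesm.pow 2)) ?_
  filter_upwards [ae_planeMeasure_mem] with p hp
  have hr0 := radial_pos h₁ hp
  rw [norm_mul, norm_mul, Real.norm_of_nonneg hr0.le, Real.norm_of_nonneg (sq_nonneg _),
    Real.norm_eq_abs]
  calc |V p.1| * p.1 * h p ^ 2 ≤ K * wt p.1 * p.1 * h p ^ 2 :=
        mul_le_mul_of_nonneg_right (mul_le_mul_of_nonneg_right (hV.le _ hp) hr0.le) (sq_nonneg _)
    _ = _ := by ring

/-- The quadratic form is coercive modulo finitely many moments of the axial mean. -/
theorem exists_coercive {y₀ : ℝ → ℝ} (hL : FormPos R1 R2 V) (hV : WeightBound R1 R2 V K)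
    (h₁ : 0 ≤ R1) (hR : (R1 : EReal) < R2) (hy : ContinuousOn y₀ (radial R1 R2))
    (hmono : StrictMonoOn y₀ (radial R1 R2)) :
    ∃ c > 0, ∃ T : Finset (ℝ × ℝ), (∀ q ∈ T, TentSupported R1 R2 y₀ q) ∧ ∃ C, 0 ≤ C ∧
      ∀ h g k, StripPert R1 R2 h g k →
        c * (stripEnergy R1 R2 g + stripEnergy R1 R2 k) ≤
          stripEnergy R1 R2 g + stripEnergy R1 R2 k +
            ∫ p, V p.1 * p.1 * h p ^ 2 ∂planeMeasure R1 R2 +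
          C * ∑ q ∈ T, moment R1 R2 y₀ q (fun r => zMean fun z => h (r, z)) ^ 2 := by
  obtain ⟨c, hc, hcoer⟩ := hL.exists_coercive hV h₁ hR
  have hK := hV.nonneg
  obtain ⟨T, hT, C, hC, hctl⟩ := exists_moments_control h₁ hy hmono
    (show 0 < (2 * (K + 1))⁻¹ by positivity)
  refine ⟨min c (1 / 2), by positivity, T, hT, 2 * Real.pi * (K * C), by positivity,
    fun h g k hs => ?_⟩
  set m : ℝ → ℝ := fun r => zMean fun z => h (r, z) with hm
  obtain ⟨hp, hg1, hg2⟩ := hs.zMean_radialPrimitive h₁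
  obtain ⟨hf1, hf2⟩ := hs.fluctuation h₁
  obtain ⟨hv1, hv2, hv3⟩ := integral_weight_sub_zMean_sq (W := fun r => V r * r) hs.aesm
    (hV.aesm.mul continuous_id.aestronglyMeasurable) (hs.memLp_slice h₁)
    (hs.integrable_weight h₁ hV)
  set G := gradEnergy R1 R2 (fun r => zMean fun z => g (r, z)) with hG
  set A' := ∫ p, (g p - zMean fun z => g (p.1, z)) ^ 2 / p.1 ∂planeMeasure R1 R2 with hA'
  set P := ∫ p, (h p - zMean fun z => h (p.1, z)) ^ 2 / p.1 ∂planeMeasure R1 R2 with hP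
  set V' := ∫ p, V p.1 * p.1 * (h p - zMean fun z => h (p.1, z)) ^ 2 ∂planeMeasure R1 R2 with hV'
  set S := ∑ q ∈ T, moment R1 R2 y₀ q m ^ 2 with hS
  have hsum : Integrable (fun p => (g p - zMean fun z => g (p.1, z)) ^ 2 / p.1 +
      (h p - zMean fun z => h (p.1, z)) ^ 2 / p.1) (planeMeasure R1 R2) := hg1.add hf1
  have hfluct : c * (A' + P) ≤ A' + P + V' := by
    have hv2' : Integrable (fun p => V p.1 * p.1 * (h p - zMean fun z => h (p.1, z)) ^ 2)
      (planeMeasure R1 R2) := hv2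
    have hall : Integrable (fun p => (g p - zMean fun z => g (p.1, z)) ^ 2 / p.1 +
        (h p - zMean fun z => h (p.1, z)) ^ 2 / p.1 +
        V p.1 * p.1 * (h p - zMean fun z => h (p.1, z)) ^ 2) (planeMeasure R1 R2) :=
      hsum.add hv2'
    have e0 : A' + P + V' = ∫ p, ((g p - zMean fun z => g (p.1, z)) ^ 2 / p.1 +
        (h p - zMean fun z => h (p.1, z)) ^ 2 / p.1 +
        V p.1 * p.1 * (h p - zMean fun z => h (p.1, z)) ^ 2) ∂planeMeasure R1 R2 := by
      rw [integral_add hsum hv2', integral_add hg1 hf1]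
    have e1 : A' + P = ∫ p, ((g p - zMean fun z => g (p.1, z)) ^ 2 / p.1 +
        (h p - zMean fun z => h (p.1, z)) ^ 2 / p.1) ∂planeMeasure R1 R2 := by
      rw [integral_add hg1 hf1]
    rw [e0, e1, planeMeasure, integral_prod_symm _ hsum, integral_prod_symm _ hall,
      ← integral_const_mul]
    refine integral_mono_ae (hsum.integral_prod_right.const_mul c)
      hall.integral_prod_right ?_
    filter_upwards [hs.finiteEnergy_fluctuation h₁ hR] with z hz
    have := hcoer _ _ hz
    simpa [formQ] using this
  have hWm : |∫ r in radial R1 R2, V r * r * m r ^ 2| ≤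
      K * ∫ r in radial R1 R2, wt r * r * m r ^ 2 := by
    rw [← integral_const_mul, ← Real.norm_eq_abs]
    refine norm_integral_le_of_norm_le ((hp.integrable_wt_sq h₁).const_mul K) ?_
    filter_upwards [ae_restrict_mem measurableSet_radial] with r hr
    have hr0 := radial_pos h₁ hr
    rw [norm_mul, norm_mul, Real.norm_of_nonneg hr0.le, Real.norm_of_nonneg (sq_nonneg _),
      Real.norm_eq_abs]
    calc |V r| * r * m r ^ 2 ≤ K * wt r * r * m r ^ 2 :=
          mul_le_mul_of_nonneg_right (mul_le_mul_of_nonneg_right (hV.le _ hr) hr0.le) (sq_nonneg _)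
      _ = _ := by ring
  have hmean : G / 2 - K * C * S ≤ G + ∫ r in radial R1 R2, V r * r * m r ^ 2 := by
    have h3 := hctl m _ hp
    have hG0 : 0 ≤ G := gradEnergy_nonneg h₁
    have h4 := mul_le_mul_of_nonneg_left h3 hK
    have h5 : K * ((2 * (K + 1))⁻¹ * G) ≤ G / 2 := by
      have : K * (2 * (K + 1))⁻¹ ≤ 1 / 2 := by
        rw [← div_eq_mul_inv, div_le_div_iff₀ (by positivity) (by norm_num)]
        linarith
      nlinarith
    have h6 := (abs_le.1 hWm).1
    nlinarith
  have hA0 : 0 ≤ A' := by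
    refine integral_nonneg_of_ae ?_
    filter_upwards [ae_planeMeasure_mem] with p hp
    have := radial_pos h₁ hp
    simp only [Pi.zero_apply]
    positivity
  have hG0 : 0 ≤ G := gradEnergy_nonneg h₁
  have hpi := Real.pi_pos
  have hP0 : 0 ≤ P := by
    refine integral_nonneg_of_ae ?_
    filter_upwards [ae_planeMeasure_mem] with p hp
    have := radial_pos h₁ hp
    simp only [Pi.zero_apply]
    positivity
  have hcm1 : min c (1 / 2) ≤ c := min_le_left _ _
  have hcm2 : min c (1 / 2) ≤ 1 / 2 := min_le_right _ _
  have q1 := mul_le_mul_of_nonneg_right hcm1 (add_nonneg hA0 hP0)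
  have q2 := mul_le_mul_of_nonneg_right hcm2 (mul_nonneg hpi.le hG0)
  have q3 : 0 ≤ (1 - min c (1 / 2)) * (stripEnergy R1 R2 k - P) :=
    mul_nonneg (by linarith) (by linarith)
  have q4 := mul_le_mul_of_nonneg_left hmean hpi.le
  nlinarith

end StripPert

end StripCoercive

/-! ### Global bounds for the steady state -/

section ProfileBounds

variable {R1 : ℝ} {R2 : EReal}

theorem convex_radialClosed : Convex ℝ (radialClosed R1 R2) := by
  refine OrdConnected.convex ⟨fun x hx y hy z hz => ⟨hx.1.trans_le hz.1, hx.2.1.trans hz.1, ?_⟩⟩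
  exact le_trans (by exact_mod_cast hz.2) hy.2.2

theorem Ioo_subset_radial {x y : ℝ} (hx : x ∈ radialClosed R1 R2) (hy : y ∈ radialClosed R1 R2) :
    Ioo x y ⊆ radial R1 R2 := fun _ hz =>
  ⟨hx.2.1.trans_lt hz.1, lt_of_lt_of_le (by exact_mod_cast hz.2) hy.2.2⟩

theorem radialClosed_subset_closure (h₁ : 0 ≤ R1) (hR : (R1 : EReal) < R2) :
    radialClosed R1 R2 ⊆ closure (radial R1 R2) := by
  intro x hx
  obtain ⟨y, hy⟩ := radial_nonempty hR
  have hy' := radial_subset_radialClosed h₁ hy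
  rcases lt_trichotomy x y with h | h | h
  · refine closure_mono (Ioo_subset_radial hx hy') ?_
    rw [closure_Ioo h.ne]
    exact left_mem_Icc.2 h.le
  · exact subset_closure (h ▸ hy)
  · refine closure_mono (Ioo_subset_radial hy' hx) ?_
    rw [closure_Ioo h.ne]
    exact right_mem_Icc.2 h.le

theorem isCompact_radialClosed_inter {a A : ℝ} (ha : 0 < a) :
    IsCompact (radialClosed R1 R2 ∩ Icc a A) := by
  have : radialClosed R1 R2 ∩ Icc a A =
      Icc a A ∩ (Ici R1 ∩ (fun r : ℝ => (r : EReal)) ⁻¹' Iic R2) := by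
    ext r
    constructor
    · rintro ⟨⟨_, h2, h3⟩, h4⟩
      exact ⟨h4, h2, h3⟩
    · rintro ⟨h4, h2, h3⟩
      exact ⟨⟨ha.trans_le h4.1, h2, h3⟩, h4⟩
  rw [this]
  exact isCompact_Icc.inter_right
    (isClosed_Ici.inter (isClosed_Iic.preimage continuous_coe_real_ereal))

/-- A continuous function with prescribed behaviour at the singular endpoints is bounded by a
multiple of the weight. -/
theorem exists_bound_of_isBigO (h₁ : 0 ≤ R1) {φ w : ℝ → ℝ}
    (hφ : ContinuousOn φ (radialClosed R1 R2)) (hw : ContinuousOn w (Ioi 0))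
    (hw0 : ∀ r > 0, 0 < w r) (h0 : R1 = 0 → φ =O[𝓝[>] 0] w) (hi : R2 = ⊤ → φ =O[atTop] w) :
    ∃ K, 0 ≤ K ∧ ∀ r ∈ radialClosed R1 R2, |φ r| ≤ K * w r := by
  have hlow : ∃ a > 0, ∃ K, ∀ r ∈ radialClosed R1 R2, r < a → |φ r| ≤ K * w r := by
    rcases h₁.eq_or_lt with h | h
    · obtain ⟨K, hK⟩ := (h0 h.symm).bound
      obtain ⟨a, ha, hsub⟩ := mem_nhdsGT_iff_exists_Ioo_subset.1 hK
      refine ⟨a, ha, K, fun r hr hra => ?_⟩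
      have := hsub ⟨hr.1, hra⟩
      simpa [abs_of_pos (hw0 r hr.1)] using this
    · exact ⟨R1, h, 0, fun r hr hra => absurd hr.2.1 (not_le.2 hra)⟩
  have hhigh : ∃ A, ∃ K, ∀ r ∈ radialClosed R1 R2, A < r → |φ r| ≤ K * w r := by
    rcases eq_or_ne R2 ⊤ with h | h
    · obtain ⟨K, hK⟩ := (hi h).bound
      obtain ⟨A, hA⟩ := eventually_atTop.1 hK
      refine ⟨A, K, fun r hr hra => ?_⟩
      have := hA r hra.le
      simpa [abs_of_pos (hw0 r hr.1)] using this
    · refine ⟨R2.toReal, 0, fun r hr hra => absurd hr.2.2 (not_le.2 ?_)⟩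
      have h3 : R2 ≠ ⊥ := by
        rintro rfl
        exact absurd hr.2.2 (not_le.2 (EReal.bot_lt_coe r))
      rw [← EReal.coe_toReal h h3]
      exact_mod_cast hra
  obtain ⟨a, ha, K₁, hK₁⟩ := hlow
  obtain ⟨A, K₂, hK₂⟩ := hhigh
  have hcont : ContinuousOn (fun r => φ r / w r) (radialClosed R1 R2 ∩ Icc a A) :=
    (hφ.mono inter_subset_left).div (hw.mono fun r hr => hr.1.1) fun r hr => (hw0 r hr.1.1).ne'
  obtain ⟨K₃, hK₃⟩ := (isCompact_radialClosed_inter ha).exists_bound_of_continuousOn hcont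
  refine ⟨max 0 (max K₁ (max K₂ K₃)), le_max_left _ _, fun r hr => ?_⟩
  have hwr := (hw0 r hr.1).le
  rcases lt_or_ge r a with h | h
  · exact (hK₁ r hr h).trans (mul_le_mul_of_nonneg_right (by simp) hwr)
  rcases lt_or_ge A r with h' | h'
  · exact (hK₂ r hr h').trans (mul_le_mul_of_nonneg_right (by simp) hwr)
  · have := hK₃ r ⟨hr, h, h'⟩
    rw [Real.norm_eq_abs, abs_div, abs_of_pos (hw0 r hr.1), div_le_iff₀ (hw0 r hr.1)] at this
    exact this.trans (mul_le_mul_of_nonneg_right (by simp) hwr)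

theorem abs_sub_le_of_abs_deriv_le {x y K : ℝ} (hxy : x ≤ y) {φ φ' Y Y' : ℝ → ℝ}
    (hφ : ContinuousOn φ (Icc x y)) (hY : ContinuousOn Y (Icc x y))
    (hφ' : ∀ s ∈ Ioo x y, HasDerivAt φ (φ' s) s) (hY' : ∀ s ∈ Ioo x y, HasDerivAt Y (Y' s) s)
    (h0 : ∀ s ∈ Ioo x y, 0 < Y' s) (hle : ∀ s ∈ Ioo x y, |φ' s| ≤ K * Y' s) :
    |φ y - φ x| ≤ K * |Y y - Y x| := by
  rcases hxy.eq_or_lt with rfl | hxy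
  · simp
  obtain ⟨s, hs, he⟩ := exists_ratio_hasDerivAt_eq_ratio_slope φ φ' hxy hφ hφ' Y Y' hY hY'
  have h1 := h0 s hs
  have h2 : |Y y - Y x| * |φ' s| = |φ y - φ x| * Y' s := by
    rw [← abs_mul, he, abs_mul, abs_of_pos h1]
  have h3 := mul_le_mul_of_nonneg_left (hle s hs) (abs_nonneg (Y y - Y x))
  have h4 : |φ y - φ x| * Y' s ≤ (K * |Y y - Y x|) * Y' s := by
    rw [← h2]; linarith
  exact le_of_mul_le_mul_right h4 h1

theorem exists_derivs (h₁ : 0 ≤ R1) (hR : (R1 : EReal) < R2) {φ : ℝ → ℝ}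
    (hφ : ContDiffOn ℝ 3 φ (radialClosed R1 R2)) :
    ∃ φ₁ φ₂ : ℝ → ℝ, ContinuousOn φ₁ (radialClosed R1 R2) ∧
      ContinuousOn φ₂ (radialClosed R1 R2) ∧ ∀ r ∈ radial R1 R2,
        HasDerivAt φ (φ₁ r) r ∧ HasDerivAt φ₁ (φ₂ r) r ∧
        φ₁ r = deriv φ r ∧ φ₂ r = deriv (deriv φ) r := by
  have hsub := radial_subset_radialClosed (R2 := R2) h₁
  have hnhds : ∀ r ∈ radial R1 R2, radialClosed R1 R2 ∈ 𝓝 r := fun r hr =>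
    mem_of_superset (isOpen_radial.mem_nhds hr) hsub
  have hU : UniqueDiffOn ℝ (radialClosed R1 R2) := by
    refine uniqueDiffOn_convex convex_radialClosed ?_
    obtain ⟨x, hx⟩ := radial_nonempty hR
    exact ⟨x, mem_interior_iff_mem_nhds.2 (hnhds x hx)⟩
  have c1 : ContDiffOn ℝ 2 (derivWithin φ (radialClosed R1 R2)) (radialClosed R1 R2) :=
    hφ.derivWithin hU (by norm_num)
  have c2 : ContDiffOn ℝ 1 (derivWithin (derivWithin φ (radialClosed R1 R2)) (radialClosed R1 R2))
      (radialClosed R1 R2) := c1.derivWithin hU (by norm_num)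
  have e1 : ∀ r ∈ radial R1 R2, derivWithin φ (radialClosed R1 R2) r = deriv φ r := fun r hr =>
    derivWithin_of_mem_nhds (hnhds r hr)
  refine ⟨_, _, c1.continuousOn, c2.continuousOn, fun r hr => ⟨?_, ?_, e1 r hr, ?_⟩⟩
  · exact ((hφ.differentiableOn (by norm_num) r (hsub hr)).hasDerivWithinAt).hasDerivAt
      (hnhds r hr)
  · exact ((c1.differentiableOn (by norm_num) r (hsub hr)).hasDerivWithinAt).hasDerivAt
      (hnhds r hr)
  · rw [derivWithin_of_mem_nhds (hnhds r hr)]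
    refine EventuallyEq.deriv_eq ?_
    filter_upwards [isOpen_radial.mem_nhds hr] with s hs using e1 s hs

/-- The weight `r ^ j / (1 + r ^ k)`. -/
def rwt (j k : ℕ) (r : ℝ) : ℝ := r ^ j / (1 + r ^ k)

theorem rwt_pos {j k : ℕ} {r : ℝ} (hr : 0 < r) : 0 < rwt j k r := by unfold rwt; positivity

theorem continuousOn_rwt {j k : ℕ} : ContinuousOn (rwt j k) (Ioi 0) := by
  unfold rwt
  refine ContinuousOn.div (by fun_prop) (by fun_prop) fun r hr => ?_
  have : (0 : ℝ) < r := hr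
  positivity

theorem rpow_isBigO_rwt_zero {x : ℝ} {j k : ℕ} (hx : (j : ℝ) ≤ x) :
    (fun r : ℝ => r ^ x) =O[𝓝[>] 0] rwt j k := by
  refine IsBigO.of_bound 2 ?_
  filter_upwards [Ioo_mem_nhdsGT (zero_lt_one' ℝ)] with r hr
  have h1 : r ^ x ≤ r ^ j := by
    rw [← Real.rpow_natCast]
    exact Real.rpow_le_rpow_of_exponent_ge hr.1 hr.2.le hx
  have h2 : r ^ k ≤ 1 := pow_le_one₀ hr.1.le hr.2.le
  have h0 := hr.1
  rw [Real.norm_of_nonneg (Real.rpow_nonneg hr.1.le _), Real.norm_of_nonneg (rwt_pos hr.1).le, rwt,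
    mul_div_assoc', le_div_iff₀ (by positivity)]
  have : 0 ≤ r ^ x := Real.rpow_nonneg hr.1.le _
  nlinarith

theorem rpow_isBigO_rwt_atTop {x : ℝ} {j k : ℕ} (hx : x ≤ j - k) :
    (fun r : ℝ => r ^ x) =O[atTop] rwt j k := by
  refine IsBigO.of_bound 2 ?_
  filter_upwards [eventually_ge_atTop (1 : ℝ)] with r hr
  have h0 : 0 < r := by linarith
  have h1 : r ^ x ≤ r ^ j / r ^ k := by
    rw [← Real.rpow_natCast, ← Real.rpow_natCast, ← Real.rpow_sub h0]
    exact Real.rpow_le_rpow_of_exponent_le hr hx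
  have h2 : 1 ≤ r ^ k := one_le_pow₀ hr
  rw [Real.norm_of_nonneg (Real.rpow_nonneg h0.le _), Real.norm_of_nonneg (rwt_pos h0).le]
  refine h1.trans ?_
  rw [rwt, mul_div_assoc', div_le_div_iff₀ (by positivity) (by positivity)]
  have : 0 ≤ r ^ j := by positivity
  nlinarith

theorem rwt_le_inv_one_add_sq {j k : ℕ} (hjk : j + 2 ≤ k) {r : ℝ} (hr : 0 < r) :
    rwt j k r ≤ 2 * (1 / (1 + r ^ 2)) := by
  rw [rwt, mul_one_div, div_le_div_iff₀ (by positivity) (by positivity)]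
  have h1 := pow_le_one_add_pow hr.le (show j ≤ k by omega)
  have h2 := pow_le_one_add_pow hr.le hjk
  rw [pow_add] at h2
  nlinarith

theorem exists_bound_of_deriv (h₁ : 0 ≤ R1) (hR : (R1 : EReal) < R2) {φ φ' : ℝ → ℝ}
    (hφ : ContinuousOn φ (radialClosed R1 R2))
    (hd : ∀ r ∈ radial R1 R2, HasDerivAt φ (φ' r) r) {K : ℝ} (hK : 0 ≤ K) {j k : ℕ}
    (hjk : j + 2 ≤ k) (hb : ∀ r ∈ radialClosed R1 R2, |φ' r| ≤ K * rwt j k r) :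
    ∃ B, 0 ≤ B ∧ ∀ r ∈ radialClosed R1 R2, |φ r| ≤ B := by
  obtain ⟨x, hx⟩ := radial_nonempty hR
  have hsub := radial_subset_radialClosed (R2 := R2) h₁
  have key : ∀ s ∈ radialClosed R1 R2, ∀ t ∈ radialClosed R1 R2, s ≤ t →
      |φ t - φ s| ≤ 2 * K * Real.pi := by
    intro s hs t ht hst
    have hI := Ioo_subset_radial hs ht
    have h3 := abs_sub_le_of_abs_deriv_le (K := 2 * K) hst
      (hφ.mono (convex_radialClosed.ordConnected.out hs ht)) Real.continuous_arctan.continuousOn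
      (fun u hu => hd u (hI hu)) (fun u _ => Real.hasDerivAt_arctan u)
      (fun u _ => by positivity) fun u hu => by
        refine (hb u (hsub (hI hu))).trans ?_
        have := mul_le_mul_of_nonneg_left (rwt_le_inv_one_add_sq hjk (radial_pos h₁ (hI hu))) hK
        linarith
    refine h3.trans (mul_le_mul_of_nonneg_left ?_ (by positivity))
    rw [abs_le]
    have a1 := Real.arctan_lt_pi_div_two t
    have a2 := Real.neg_pi_div_two_lt_arctan t
    have a3 := Real.arctan_lt_pi_div_two s
    have a4 := Real.neg_pi_div_two_lt_arctan s
    constructor <;> linarith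
  refine ⟨|φ x| + 2 * K * Real.pi, by positivity, fun r hr => ?_⟩
  have h4 : |φ r - φ x| ≤ 2 * K * Real.pi := by
    rcases le_total x r with h | h
    · exact key x (hsub hx) r hr h
    · rw [abs_sub_comm]
      exact key r hr x (hsub hx) h
  have := abs_add_le (φ r - φ x) (φ x)
  rw [sub_add_cancel] at this
  linarith

/-- Quantitative form of the hypotheses on the steady state. -/
structure ProfileBound (R1 : ℝ) (R2 : EReal) (ω ω₁ ω₂ b b₁ b₂ : ℝ → ℝ) (c K : ℝ) : Prop where
  cont_ω : ContinuousOn ω (radialClosed R1 R2)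
  cont_ω₁ : ContinuousOn ω₁ (radialClosed R1 R2)
  cont_ω₂ : ContinuousOn ω₂ (radialClosed R1 R2)
  cont_b : ContinuousOn b (radialClosed R1 R2)
  cont_b₁ : ContinuousOn b₁ (radialClosed R1 R2)
  cont_b₂ : ContinuousOn b₂ (radialClosed R1 R2)
  deriv_ω : ∀ r ∈ radial R1 R2, HasDerivAt ω (ω₁ r) r
  deriv_ω₁ : ∀ r ∈ radial R1 R2, HasDerivAt ω₁ (ω₂ r) r
  deriv_b : ∀ r ∈ radial R1 R2, HasDerivAt b (b₁ r) r
  deriv_b₁ : ∀ r ∈ radial R1 R2, HasDerivAt b₁ (b₂ r) r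
  frakF_eq : ∀ r ∈ radial R1 R2, ∀ ε, frakF ω b ε r = 2 * ω r * ω₁ r / (ε ^ 2 * b r ^ 2 * r) +
    (b₂ r / (r ^ 2 * b r) - b₁ r / (r ^ 3 * b r))
  c_pos : 0 < c
  K_nonneg : 0 ≤ K
  lower_b : ∀ r ∈ radialClosed R1 R2, c ≤ b r
  upper_b : ∀ r ∈ radialClosed R1 R2, b r ≤ K
  bound_ω : ∀ r ∈ radialClosed R1 R2, |ω r| ≤ K * rwt 0 2 r
  bound_ω₁ : ∀ r ∈ radialClosed R1 R2, |ω₁ r| ≤ K * rwt 1 4 r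
  bound_ω₂ : ∀ r ∈ radialClosed R1 R2, |ω₂ r| ≤ K * rwt 0 4 r
  bound_b₁ : ∀ r ∈ radialClosed R1 R2, |b₁ r| ≤ K * rwt 3 6 r
  bound_b₂ : ∀ r ∈ radialClosed R1 R2, |b₂ r| ≤ K * rwt 2 6 r
  integrable : IntegrableOn (fun r => r ^ 3 * ω r ^ 2) (radial R1 R2)

theorem exists_profileBound (h₁ : 0 ≤ R1) (hR : (R1 : EReal) < R2) {ω b : ℝ → ℝ}
    (hreg : RegularProfile R1 R2 ω b) (hzero : R1 = 0 → DecayAtZero ω b)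
    (hinf : R2 = ⊤ → DecayAtInfinity ω b) :
    ∃ ω₁ ω₂ b₁ b₂ : ℝ → ℝ, ∃ c K : ℝ, ProfileBound R1 R2 ω ω₁ ω₂ b b₁ b₂ c K := by
  obtain ⟨ω₁, ω₂, cω₁, cω₂, dω⟩ := exists_derivs h₁ hR hreg.contDiff_ω
  obtain ⟨b₁, b₂, cb₁, cb₂, db⟩ := exists_derivs h₁ hR hreg.contDiff_b
  have hsub := radial_subset_radialClosed (R2 := R2) h₁
  have cω := hreg.contDiff_ω.continuousOn
  have cb := hreg.contDiff_b.continuousOn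
  have ev0 : R1 = 0 → ∀ᶠ r in 𝓝[>] (0 : ℝ), r ∈ radial R1 R2 := fun h => by
    obtain ⟨x, hx⟩ := radial_nonempty hR
    rw [← h]
    filter_upwards [Ioo_mem_nhdsGT hx.1] with r hr
    exact ⟨hr.1, lt_trans (by exact_mod_cast hr.2) hx.2⟩
  have evi : R2 = ⊤ → ∀ᶠ r in atTop, r ∈ radial R1 R2 := fun h => by
    have := radial_mem_toOuter hR
    rw [h, toOuter_top] at this
    rw [h]
    exact this
  have comb : ∀ {φ φ' : ℝ → ℝ} {j k : ℕ}, ContinuousOn φ (radialClosed R1 R2) →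
      (∀ r ∈ radial R1 R2, φ r = φ' r) → (R1 = 0 → φ' =O[𝓝[>] 0] rwt j k) →
      (R2 = ⊤ → φ' =O[atTop] rwt j k) →
      ∃ K, 0 ≤ K ∧ ∀ r ∈ radialClosed R1 R2, |φ r| ≤ K * rwt j k r := by
    intro φ φ' j k hφ he h0 hi
    refine exists_bound_of_isBigO h₁ hφ continuousOn_rwt (fun r hr => rwt_pos hr) (fun h => ?_)
      fun h => ?_
    · exact (h0 h).congr' ((ev0 h).mono fun r hr => (he r hr).symm) EventuallyEq.rfl
    · exact (hi h).congr' ((evi h).mono fun r hr => (he r hr).symm) EventuallyEq.rfl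
  obtain ⟨K₁, hK₁, bω₁⟩ := comb (j := 1) (k := 4) cω₁ (fun r hr => (dω r hr).2.2.1)
    (fun h => by
      obtain ⟨β, hβ, h1, -, -, -⟩ := hzero h
      exact h1.trans (rpow_isBigO_rwt_zero (by push_cast; linarith)))
    (fun h => by
      obtain ⟨α, hα, -, h1, -, -, -⟩ := hinf h
      exact h1.trans (rpow_isBigO_rwt_atTop (by push_cast; linarith)))
  obtain ⟨K₂, hK₂, bω₂⟩ := comb (j := 0) (k := 4) cω₂ (fun r hr => (dω r hr).2.2.2)
    (fun h => by
      obtain ⟨β, hβ, -, h1, -, -⟩ := hzero h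
      exact h1.trans (rpow_isBigO_rwt_zero (by push_cast; linarith)))
    (fun h => by
      obtain ⟨α, hα, -, -, h1, -, -⟩ := hinf h
      exact h1.trans (rpow_isBigO_rwt_atTop (by push_cast; linarith)))
  obtain ⟨K₃, hK₃, bb₁⟩ := comb (j := 3) (k := 6) cb₁ (fun r hr => (db r hr).2.2.1)
    (fun h => by
      obtain ⟨β, hβ, -, -, h1, -⟩ := hzero h
      exact h1.trans (rpow_isBigO_rwt_zero (by push_cast; linarith)))
    (fun h => by
      obtain ⟨α, hα, -, -, -, h1, -⟩ := hinf h
      exact h1.trans (rpow_isBigO_rwt_atTop (by push_cast; linarith)))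
  obtain ⟨K₄, hK₄, bb₂⟩ := comb (j := 2) (k := 6) cb₂ (fun r hr => (db r hr).2.2.2)
    (fun h => by
      obtain ⟨β, hβ, -, -, -, h1⟩ := hzero h
      exact h1.trans (rpow_isBigO_rwt_zero (by push_cast; linarith)))
    (fun h => by
      obtain ⟨α, hα, -, -, -, -, h1⟩ := hinf h
      exact h1.trans (rpow_isBigO_rwt_atTop (by push_cast; linarith)))
  obtain ⟨B₁, hB₁, hωB⟩ := exists_bound_of_deriv h₁ hR cω (fun r hr => (dω r hr).1) hK₁
    (by norm_num) bω₁
  obtain ⟨B₂, hB₂, hbB⟩ := exists_bound_of_deriv h₁ hR cb (fun r hr => (db r hr).1) hK₃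
    (by norm_num) bb₁
  obtain ⟨K₅, hK₅, bω⟩ := comb (j := 0) (k := 2) cω (φ' := ω) (fun r hr => rfl)
    (fun h => by
      have : ω =O[𝓝[>] 0] (fun r : ℝ => r ^ (0 : ℝ)) := by
        refine IsBigO.of_bound B₁ ((ev0 h).mono fun r hr => ?_)
        simpa using hωB r (hsub hr)
      exact this.trans (rpow_isBigO_rwt_zero (by simp)))
    (fun h => by
      obtain ⟨α, hα, h1, -, -, -, -⟩ := hinf h
      exact h1.trans (rpow_isBigO_rwt_atTop (by push_cast; linarith)))
  obtain ⟨c, hc, hcb⟩ := hreg.lower_b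
  have hcb' : ∀ r ∈ radialClosed R1 R2, c ≤ b r := by
    intro r hr
    have hcl := radialClosed_subset_closure h₁ hR hr
    have hw : ContinuousWithinAt b (radial R1 R2) r := (cb r hr).mono hsub
    exact ContinuousWithinAt.closure_le hcl continuousWithinAt_const hw fun y hy => hcb y hy
  have hint : IntegrableOn (fun r => r ^ 3 * ω r ^ 2) (radial R1 R2) := by
    have hcont : ContinuousOn (fun r => r ^ 3 * ω r ^ 2) (radial R1 R2) :=
      (continuousOn_id.pow 3).mul ((cω.mono hsub).pow 2)
    have hfin : ∀ A : ℝ, IntegrableOn (fun r => r ^ 3 * ω r ^ 2) (radial R1 R2 ∩ Iic A) := by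
      intro A
      have hms : MeasurableSet (radial R1 R2 ∩ Iic A) := measurableSet_radial.inter measurableSet_Iic
      refine IntegrableOn.of_bound (C := |A| ^ 3 * B₁ ^ 2) ?_
        ((hcont.mono inter_subset_left).aestronglyMeasurable hms) ?_
      · have hs : radial R1 R2 ∩ Iic A ⊆ Icc 0 A := fun r hr => ⟨(radial_pos h₁ hr.1).le, hr.2⟩
        exact (measure_mono hs).trans_lt measure_Icc_lt_top
      · filter_upwards [ae_restrict_mem hms] with r hr
        have hr0 := radial_pos h₁ hr.1
        have h3 := hωB r (hsub hr.1)
        rw [Real.norm_of_nonneg (by positivity)]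
        refine mul_le_mul (pow_le_pow_left₀ hr0.le (hr.2.trans (le_abs_self A)) 3) ?_
          (sq_nonneg _) (by positivity)
        rw [← sq_abs]
        exact pow_le_pow_left₀ (abs_nonneg _) h3 2
    rcases eq_or_ne R2 ⊤ with h | h
    · obtain ⟨α, hα, h1, -, -, -, -⟩ := hinf h
      obtain ⟨C, hC⟩ := h1.bound
      obtain ⟨A, hA⟩ := eventually_atTop.1 hC
      have hA' : radial R1 R2 ⊆ (radial R1 R2 ∩ Iic (max A 1)) ∪
          (radial R1 R2 ∩ Ioi (max A 1)) := fun r hr => by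
        rcases le_or_gt r (max A 1) with h | h
        · exact Or.inl ⟨hr, h⟩
        · exact Or.inr ⟨hr, h⟩
      refine IntegrableOn.mono_set ((hfin _).union ?_) hA'
      have hms : MeasurableSet (radial R1 R2 ∩ Ioi (max A 1)) :=
        measurableSet_radial.inter measurableSet_Ioi
      have hi : IntegrableOn (fun r : ℝ => C ^ 2 * r ^ (1 - 2 * α))
          (radial R1 R2 ∩ Ioi (max A 1)) :=
        ((integrableOn_Ioi_rpow_of_lt (by linarith) (by positivity)).mono_set
          inter_subset_right).const_mul _
      refine Integrable.mono' hi ((hcont.mono inter_subset_left).aestronglyMeasurable hms) ?_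
      filter_upwards [ae_restrict_mem hms] with r hr
      have hr0 := radial_pos h₁ hr.1
      have h3 := hA r ((le_max_left _ _).trans (le_of_lt hr.2))
      rw [Real.norm_of_nonneg (by positivity), ← sq_abs]
      rw [Real.norm_eq_abs, Real.norm_of_nonneg (Real.rpow_nonneg hr0.le _)] at h3
      calc r ^ 3 * |ω r| ^ 2 ≤ r ^ 3 * (C * r ^ (-1 - α)) ^ 2 := by gcongr
        _ = C ^ 2 * r ^ (1 - 2 * α) := by
          have : r ^ (1 - 2 * α) = r ^ (3 : ℕ) * (r ^ (-1 - α)) ^ 2 := by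
            rw [← Real.rpow_natCast, ← Real.rpow_natCast, ← Real.rpow_mul hr0.le,
              ← Real.rpow_add hr0]
            congr 1
            push_cast
            ring
          rw [this]; ring
    · obtain ⟨d, hd, -, -, -⟩ := exists_toOuter_eq hR h
      refine (hfin d).mono_set fun r hr => ⟨hr, ?_⟩
      have := hr.2
      rw [hd] at this
      exact_mod_cast this.le
  set K := K₁ + K₂ + K₃ + K₄ + K₅ + B₂ with hK
  have up : ∀ {j k : ℕ} {φ : ℝ → ℝ} {L : ℝ}, L ≤ K →
      (∀ r ∈ radialClosed R1 R2, |φ r| ≤ L * rwt j k r) →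
      ∀ r ∈ radialClosed R1 R2, |φ r| ≤ K * rwt j k r := fun hL h r hr =>
    (h r hr).trans (mul_le_mul_of_nonneg_right hL (rwt_pos hr.1).le)
  refine ⟨ω₁, ω₂, b₁, b₂, c, K, ⟨cω, cω₁, cω₂, cb, cb₁, cb₂, fun r hr => (dω r hr).1,
    fun r hr => (dω r hr).2.1, fun r hr => (db r hr).1, fun r hr => (db r hr).2.1,
    fun r hr ε => ?_, hc, by positivity, hcb',
    fun r hr => (le_abs_self _).trans ((hbB r hr).trans (by linarith)),
    up (by linarith) bω, up (by linarith) bω₁, up (by linarith) bω₂, up (by linarith) bb₁,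
    up (by linarith) bb₂, hint⟩⟩
  have h2 : deriv (fun s => ω s ^ 2) r = 2 * ω r * ω₁ r := by
    have := ((dω r hr).1.fun_pow 2).deriv
    simpa using this
  rw [frakF, h2, ← (db r hr).2.2.1, ← (db r hr).2.2.2]

theorem ProfileBound.frakF_bound {ω ω₁ ω₂ b b₁ b₂ : ℝ → ℝ} {c K : ℝ}
    (hP : ProfileBound R1 R2 ω ω₁ ω₂ b b₁ b₂ c K) (h₁ : 0 ≤ R1) {ε : ℝ} (hε : ε ≠ 0) :
    ∃ L, WeightBound R1 R2 (frakF ω b ε) L := by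
  have hc := hP.c_pos
  have hK := hP.K_nonneg
  have hsub := radial_subset_radialClosed (R2 := R2) h₁
  have hε2 : 0 < ε ^ 2 := by positivity
  refine ⟨4 * K * K / (ε ^ 2 * c ^ 2) + (K / c + K / c), by positivity, ?_, fun r hr => ?_⟩
  · refine AEStronglyMeasurable.congr (f := fun r => 2 * ω r * ω₁ r / (ε ^ 2 * b r ^ 2 * r) +
      (b₂ r / (r ^ 2 * b r) - b₁ r / (r ^ 3 * b r))) ?_ ?_
    · refine ContinuousOn.aestronglyMeasurable ?_ measurableSet_radial
      have c1 := hP.cont_ω.mono hsub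
      have c2 := hP.cont_ω₁.mono hsub
      have c3 := hP.cont_b.mono hsub
      have c4 := hP.cont_b₁.mono hsub
      have c5 := hP.cont_b₂.mono hsub
      have hne : ∀ r ∈ radial R1 R2, r ≠ 0 ∧ b r ≠ 0 := fun r hr =>
        ⟨(radial_pos h₁ hr).ne', (hc.trans_le (hP.lower_b r (hsub hr))).ne'⟩
      refine ContinuousOn.add (ContinuousOn.div (by fun_prop) (by fun_prop) fun r hr => ?_)
        (ContinuousOn.sub (ContinuousOn.div (by fun_prop) (by fun_prop) fun r hr => ?_)
          (ContinuousOn.div (by fun_prop) (by fun_prop) fun r hr => ?_))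
      all_goals
        obtain ⟨n1, n2⟩ := hne r hr
        positivity
    · filter_upwards [ae_restrict_mem measurableSet_radial] with r hr
      exact (hP.frakF_eq r hr ε).symm
  · rw [hP.frakF_eq r hr ε]
    have hr0 := radial_pos h₁ hr
    have hcl := hsub hr
    have hb := hP.lower_b r hcl
    have hb0 := hc.trans_le hb
    have hw := wt_pos r
    have e1 : |2 * ω r * ω₁ r / (ε ^ 2 * b r ^ 2 * r)| ≤ 4 * K * K / (ε ^ 2 * c ^ 2) * wt r := by
      rw [abs_div, abs_mul, abs_mul, abs_two, abs_of_pos (show 0 < ε ^ 2 * b r ^ 2 * r by positivity)]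
      have n1 : 2 * |ω r| * |ω₁ r| ≤ 2 * (K * rwt 0 2 r) * (K * rwt 1 4 r) := by
        have := hP.bound_ω r hcl
        have := hP.bound_ω₁ r hcl
        have := rwt_pos (j := 0) (k := 2) hr0
        gcongr
      calc 2 * |ω r| * |ω₁ r| / (ε ^ 2 * b r ^ 2 * r)
          ≤ 2 * (K * rwt 0 2 r) * (K * rwt 1 4 r) / (ε ^ 2 * c ^ 2 * r) := by
            have := rwt_pos (j := 0) (k := 2) hr0
            have := rwt_pos (j := 1) (k := 4) hr0
            gcongr
        _ = 2 * K * K / (ε ^ 2 * c ^ 2) * (1 / ((1 + r ^ 2) * (1 + r ^ 4))) := by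
            unfold rwt
            field_simp
        _ ≤ 2 * K * K / (ε ^ 2 * c ^ 2) * (2 * wt r) := by
            refine mul_le_mul_of_nonneg_left ?_ (by positivity)
            rw [wt, ← one_div, mul_one_div, div_le_div_iff₀ (by positivity) (by positivity)]
            nlinarith [pow_pos hr0 2, pow_pos hr0 4, pow_pos hr0 6]
        _ = _ := by ring
    have e2 : |b₂ r / (r ^ 2 * b r)| ≤ K / c * wt r := by
      rw [abs_div, abs_of_pos (show 0 < r ^ 2 * b r by positivity)]
      calc |b₂ r| / (r ^ 2 * b r) ≤ K * rwt 2 6 r / (r ^ 2 * c) := by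
            have := hP.bound_b₂ r hcl
            have := rwt_pos (j := 2) (k := 6) hr0
            gcongr
        _ = _ := by
            unfold rwt wt
            field_simp
    have e3 : |b₁ r / (r ^ 3 * b r)| ≤ K / c * wt r := by
      rw [abs_div, abs_of_pos (show 0 < r ^ 3 * b r by positivity)]
      calc |b₁ r| / (r ^ 3 * b r) ≤ K * rwt 3 6 r / (r ^ 3 * c) := by
            have := hP.bound_b₁ r hcl
            have := rwt_pos (j := 3) (k := 6) hr0
            gcongr
        _ = _ := by
            unfold rwt wt
            field_simp
    refine (abs_add_le _ _).trans ?_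
    rw [add_mul, add_mul]
    refine add_le_add e1 ((abs_sub _ _).trans (add_le_add e2 e3))

end ProfileBounds

/-! ### Functions of the magnetic potential with prescribed values along the steady state -/

section Transplant

variable {R1 : ℝ} {R2 : EReal}

/-- The projection of `(0, ∞)` onto `radialClosed R1 R2`. -/
def rclamp (R1 : ℝ) (R2 : EReal) (r : ℝ) : ℝ := open Classical in
  if R2 = ⊤ then max R1 r else max R1 (min r R2.toReal)

theorem continuous_rclamp : Continuous (rclamp R1 R2) := by
  unfold rclamp
  split_ifs <;> fun_prop

theorem rclamp_mem (hR : (R1 : EReal) < R2) {r : ℝ} (hr : 0 < r) (h₁ : 0 ≤ R1) :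
    rclamp R1 R2 r ∈ radialClosed R1 R2 := by
  unfold rclamp
  split_ifs with h
  · exact ⟨lt_max_of_lt_right hr, le_max_left _ _, h ▸ le_top⟩
  · obtain ⟨d, rfl, hd, -, -⟩ := exists_toOuter_eq hR h
    rw [EReal.toReal_coe]
    refine ⟨lt_max_of_lt_right (lt_min hr (h₁.trans_lt hd)), le_max_left _ _, ?_⟩
    exact_mod_cast max_le hd.le (min_le_right _ _)

theorem rclamp_eq {r : ℝ} (hr : r ∈ radialClosed R1 R2) : rclamp R1 R2 r = r := by
  unfold rclamp
  split_ifs with h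
  · exact max_eq_right hr.2.1
  · have h3 : R2 ≠ ⊥ := by
      rintro rfl
      exact absurd hr.2.2 (not_le.2 (EReal.bot_lt_coe r))
    have : r ≤ R2.toReal := by
      have := hr.2.2
      rw [← EReal.coe_toReal h h3] at this
      exact_mod_cast this
    rw [min_eq_left this, max_eq_right hr.2.1]

theorem rclamp_between {r s : ℝ} (hr : r ∈ radial R1 R2) :
    (r ≤ s → r ≤ rclamp R1 R2 s ∧ rclamp R1 R2 s ≤ s) ∧
    (s ≤ r → s ≤ rclamp R1 R2 s ∧ rclamp R1 R2 s ≤ r) := by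
  unfold rclamp
  split_ifs with h
  · exact ⟨fun h' => ⟨le_max_of_le_right h', max_le (hr.1.le.trans h') le_rfl⟩,
      fun h' => ⟨le_max_right _ _, max_le hr.1.le h'⟩⟩
  · have h3 : R2 ≠ ⊥ := by
      rintro rfl
      exact absurd hr.2 (not_lt.2 bot_le)
    have : r ≤ R2.toReal := by
      have := hr.2.le
      rw [← EReal.coe_toReal h h3] at this
      exact_mod_cast this
    exact ⟨fun h' => ⟨le_max_of_le_right (le_min h' this),
      max_le (hr.1.le.trans h') (min_le_left _ _)⟩,
      fun h' => ⟨le_max_of_le_right (le_min le_rfl (h'.trans this)),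
        max_le hr.1.le ((min_le_left _ _).trans h')⟩⟩

/-- `b` is continuous and lies between positive constants. -/
structure PositiveBound (R1 : ℝ) (R2 : EReal) (b : ℝ → ℝ) (c K : ℝ) : Prop where
  cont : ContinuousOn b (radialClosed R1 R2)
  c_pos : 0 < c
  lower : ∀ r ∈ radialClosed R1 R2, c ≤ b r
  upper : ∀ r ∈ radialClosed R1 R2, b r ≤ K

/-- The flux function `∫₀ʳ s b(s) ds` of the extension of `b` to `(0, ∞)`. -/
def flux (R1 : ℝ) (R2 : EReal) (b : ℝ → ℝ) (r : ℝ) : ℝ := ∫ s in (0 : ℝ)..r, s * b (rclamp R1 R2 s)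

namespace PositiveBound

variable {b : ℝ → ℝ} {c K : ℝ}

section

variable (hb : PositiveBound R1 R2 b c K) (h₁ : 0 ≤ R1) (hR : (R1 : EReal) < R2)

include hb h₁ hR

theorem K_pos : 0 < K :=
  have h := rclamp_mem hR one_pos h₁
  hb.c_pos.trans_le ((hb.lower _ h).trans (hb.upper _ h))

theorem continuousOn_density : ContinuousOn (fun s => s * b (rclamp R1 R2 s)) (Ioi 0) :=
  continuousOn_id.mul (hb.cont.comp continuous_rclamp.continuousOn
    fun _ hs => rclamp_mem hR hs h₁)

theorem intervalIntegrable {x y : ℝ} (hx : 0 ≤ x) (hy : 0 ≤ y) :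
    IntervalIntegrable (fun s => s * b (rclamp R1 R2 s)) volume x y := by
  refine IntervalIntegrable.mono_fun' (g := fun s => K * s)
    (Continuous.intervalIntegrable (by fun_prop) _ _) ?_ ?_
  · exact ((hb.continuousOn_density h₁ hR).mono fun s hs =>
      (le_min hx hy).trans_lt hs.1).aestronglyMeasurable measurableSet_uIoc
  · filter_upwards [ae_restrict_mem measurableSet_uIoc] with s hs
    have hs0 : 0 < s := (le_min hx hy).trans_lt hs.1
    have hm := rclamp_mem hR hs0 h₁
    have := hb.lower _ hm
    have := hb.upper _ hm
    have hc := hb.c_pos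
    rw [Real.norm_of_nonneg (by nlinarith)]
    nlinarith

theorem flux_sub
    {x y : ℝ} (hx : 0 ≤ x) (hy : 0 ≤ y) :
    flux R1 R2 b y - flux R1 R2 b x = ∫ s in x..y, s * b (rclamp R1 R2 s) :=
  intervalIntegral.integral_interval_sub_left (hb.intervalIntegrable h₁ hR le_rfl hy)
    (hb.intervalIntegrable h₁ hR le_rfl hx)

theorem flux_sub_bounds
    {x y : ℝ} (hx : 0 ≤ x) (hxy : x ≤ y) :
    c / 2 * (y ^ 2 - x ^ 2) ≤ flux R1 R2 b y - flux R1 R2 b x ∧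
    flux R1 R2 b y - flux R1 R2 b x ≤ K / 2 * (y ^ 2 - x ^ 2) := by
  rw [hb.flux_sub h₁ hR hx (hx.trans hxy)]
  have e : ∀ a : ℝ, ∫ s in x..y, a * s = a / 2 * (y ^ 2 - x ^ 2) := fun a => by
    rw [intervalIntegral.integral_const_mul, integral_id]; ring
  have hi := hb.intervalIntegrable h₁ hR hx (hx.trans hxy)
  rw [← e, ← e]
  constructor
  · refine intervalIntegral.integral_mono_on_of_le_Ioo hxy
      (Continuous.intervalIntegrable (by fun_prop) _ _) hi fun s hs => ?_
    have hs0 := hx.trans_lt hs.1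
    nlinarith [hb.lower _ (rclamp_mem hR hs0 h₁)]
  · refine intervalIntegral.integral_mono_on_of_le_Ioo hxy hi
      (Continuous.intervalIntegrable (by fun_prop) _ _) fun s hs => ?_
    have hs0 := hx.trans_lt hs.1
    nlinarith [hb.upper _ (rclamp_mem hR hs0 h₁)]

theorem flux_bounds
    {y : ℝ} (hy : 0 ≤ y) : c / 2 * y ^ 2 ≤ flux R1 R2 b y ∧ flux R1 R2 b y ≤ K / 2 * y ^ 2 := by
  have := hb.flux_sub_bounds h₁ hR le_rfl hy
  simpa [flux] using this

theorem strictMonoOn_flux :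
    StrictMonoOn (flux R1 R2 b) (Ici 0) := fun x hx y _ hxy => by
  have hx0 : (0 : ℝ) ≤ x := hx
  have := (hb.flux_sub_bounds h₁ hR hx hxy.le).1
  have h3 : 0 < c / 2 * (y ^ 2 - x ^ 2) := by
    have := hb.c_pos
    have : 0 < y ^ 2 - x ^ 2 := by nlinarith
    positivity
  linarith

theorem continuousOn_flux :
    ContinuousOn (flux R1 R2 b) (Ici 0) := by
  intro x hx
  have hx0 : (0 : ℝ) ≤ x := hx
  rw [ContinuousWithinAt, tendsto_iff_dist_tendsto_zero]
  have lim : Tendsto (fun y => K / 2 * |y ^ 2 - x ^ 2|) (𝓝[Ici 0] x) (𝓝 0) := by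
    have : Continuous fun y : ℝ => K / 2 * |y ^ 2 - x ^ 2| := by fun_prop
    have h2 := this.tendsto x
    simp only [sub_self, abs_zero, mul_zero] at h2
    exact h2.mono_left nhdsWithin_le_nhds
  refine squeeze_zero' (Eventually.of_forall fun _ => dist_nonneg) ?_ lim
  filter_upwards [self_mem_nhdsWithin] with y hy
  have hy0 : (0 : ℝ) ≤ y := hy
  have hc := hb.c_pos
  rw [Real.dist_eq]
  rcases le_total x y with h | h
  · obtain ⟨h2, h3⟩ := hb.flux_sub_bounds h₁ hR hx0 h
    have h4 : 0 ≤ y ^ 2 - x ^ 2 := by nlinarith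
    rw [abs_of_nonneg (le_trans (by positivity) h2), abs_of_nonneg h4]
    exact h3
  · obtain ⟨h2, h3⟩ := hb.flux_sub_bounds h₁ hR hy0 h
    have h4 : 0 ≤ x ^ 2 - y ^ 2 := by nlinarith
    rw [abs_sub_comm, abs_sub_comm (y ^ 2), abs_of_nonneg (le_trans (by positivity) h2),
      abs_of_nonneg h4]
    exact h3

theorem hasDerivAt_flux
    {r : ℝ} (hr : 0 < r) : HasDerivAt (flux R1 R2 b) (r * b (rclamp R1 R2 r)) r := by
  have hc := hb.continuousOn_density h₁ hR
  refine intervalIntegral.integral_hasDerivAt_right (hb.intervalIntegrable h₁ hR le_rfl hr.le) ?_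
    (hc.continuousAt (Ioi_mem_nhds hr))
  exact hc.stronglyMeasurableAtFilter isOpen_Ioi r hr

theorem exists_flux_eq
    {y : ℝ} (hy : 0 < y) : ∃ r > 0, flux R1 R2 b r = y := by
  have hc := hb.c_pos
  set M := Real.sqrt (2 * y / c) with hM
  have hM2 : M ^ 2 = 2 * y / c := Real.sq_sqrt (by positivity)
  have hM0 : 0 ≤ M := Real.sqrt_nonneg _
  have h1 : y ≤ flux R1 R2 b M := by
    refine le_trans (le_of_eq ?_) (hb.flux_bounds h₁ hR hM0).1
    rw [hM2]; field_simp
  have h0 : flux R1 R2 b 0 = 0 := by simp [flux]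
  obtain ⟨r, hr, he⟩ := intermediate_value_Icc hM0
    ((hb.continuousOn_flux h₁ hR).mono Icc_subset_Ici_self) (show y ∈ Icc _ _ from ⟨by rw [h0]; exact hy.le, h1⟩)
  refine ⟨r, lt_of_le_of_ne hr.1 ?_, he⟩
  rintro rfl
  rw [h0] at he
  exact hy.ne he

end

end PositiveBound

/-- The inverse of the flux function on `(0, ∞)`. -/
def fluxInv (R1 : ℝ) (R2 : EReal) (b : ℝ → ℝ) : ℝ → ℝ :=
  Function.invFunOn (flux R1 R2 b) (Ioi 0)

/-- The slope `φ' / (r b)` as a function of the flux. -/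
def fluxSlope (R1 : ℝ) (R2 : EReal) (b φ' : ℝ → ℝ) (y : ℝ) : ℝ := open Classical in
  if 0 < y then φ' (rclamp R1 R2 (fluxInv R1 R2 b y)) /
    (rclamp R1 R2 (fluxInv R1 R2 b y) * b (rclamp R1 R2 (fluxInv R1 R2 b y))) else 0

/-- The function of the flux that equals `φ` along the steady state, normalized at `r₀`. -/
def fluxFun (R1 : ℝ) (R2 : EReal) (b φ φ' : ℝ → ℝ) (r₀ y : ℝ) : ℝ :=
  φ r₀ + ∫ s in flux R1 R2 b r₀..y, fluxSlope R1 R2 b φ' s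

/-- Lipschitz bounds for functions of the flux, with decay near the steady state. -/
structure NearBound (R1 : ℝ) (R2 : EReal) (y₀ F : ℝ → ℝ) (k : ℕ) (L : ℝ) : Prop where
  nonneg : 0 ≤ L
  lip : ∀ y y', |F y - F y'| ≤ L * |y - y'|
  near : ∀ r ∈ radial R1 R2, ∀ y, y₀ r / 2 ≤ y → |F y - F (y₀ r)| ≤ L * rwt 0 k r * |y - y₀ r|
  bdd : R2 = ⊤ → ∀ y, |F y| ≤ L

theorem rwt_zero_scale {k : ℕ} {κ x r : ℝ} (hκ : 0 < κ) (hκ1 : κ ≤ 1) (hr : 0 < r)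
    (hx : κ * r ≤ x) : rwt 0 k x ≤ (κ ^ k)⁻¹ * rwt 0 k r := by
  have hx0 : 0 < x := lt_of_lt_of_le (by positivity) hx
  have h1 : (κ * r) ^ k ≤ x ^ k := pow_le_pow_left₀ (by positivity) hx k
  rw [mul_pow] at h1
  have h2 : κ ^ k ≤ 1 := pow_le_one₀ hκ.le hκ1
  rw [rwt, rwt, pow_zero, pow_zero, inv_mul_eq_div, div_div,
    div_le_div_iff₀ (by positivity) (by positivity)]
  nlinarith

theorem rwt_zero_le_one {k : ℕ} {r : ℝ} (hr : 0 < r) : rwt 0 k r ≤ 1 := by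
  rw [rwt, pow_zero, div_le_one (by positivity)]
  have : 0 ≤ r ^ k := by positivity
  linarith

namespace PositiveBound

variable {b φ φ' : ℝ → ℝ} {c K : ℝ}

section

variable (hb : PositiveBound R1 R2 b c K) (h₁ : 0 ≤ R1) (hR : (R1 : EReal) < R2)

include hb h₁ hR

theorem fluxInv_spec
    {y : ℝ} (hy : 0 < y) : 0 < fluxInv R1 R2 b y ∧ flux R1 R2 b (fluxInv R1 R2 b y) = y :=
  ⟨Function.invFunOn_mem (hb.exists_flux_eq h₁ hR hy),
    Function.invFunOn_eq (hb.exists_flux_eq h₁ hR hy)⟩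

theorem flux_pos
    {r : ℝ} (hr : 0 < r) : 0 < flux R1 R2 b r := by
  have := hb.c_pos
  exact lt_of_lt_of_le (by positivity) (hb.flux_bounds h₁ hR hr.le).1

theorem fluxInv_flux
    {r : ℝ} (hr : 0 < r) : fluxInv R1 R2 b (flux R1 R2 b r) = r := by
  obtain ⟨h2, h3⟩ := hb.fluxInv_spec h₁ hR (hb.flux_pos h₁ hR hr)
  exact (hb.strictMonoOn_flux h₁ hR).injOn h2.le hr.le h3

theorem continuousOn_fluxInv : ContinuousOn (fluxInv R1 R2 b) (Ioi 0) := by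
  have hc := hb.c_pos
  have hsq : ContinuousOn (fun y => fluxInv R1 R2 b y ^ 2) (Ioi 0) := by
    intro x hx
    have hx0 : (0 : ℝ) < x := hx
    rw [ContinuousWithinAt, tendsto_iff_dist_tendsto_zero]
    have lim : Tendsto (fun y => 2 / c * |y - x|) (𝓝[Ioi 0] x) (𝓝 0) := by
      have : Continuous fun y : ℝ => 2 / c * |y - x| := by fun_prop
      have h2 := this.tendsto x
      simp only [sub_self, abs_zero, mul_zero] at h2
      exact h2.mono_left nhdsWithin_le_nhds
    refine squeeze_zero' (Eventually.of_forall fun _ => dist_nonneg) ?_ lim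
    filter_upwards [self_mem_nhdsWithin] with y hy
    obtain ⟨a1, a2⟩ := hb.fluxInv_spec h₁ hR hx0
    obtain ⟨b1, b2⟩ := hb.fluxInv_spec h₁ hR (show 0 < y from hy)
    set s := fluxInv R1 R2 b x
    set t := fluxInv R1 R2 b y
    rw [Real.dist_eq, div_mul_eq_mul_div, le_div_iff₀ hc]
    rcases le_total s t with h | h
    · have h2 := (hb.flux_sub_bounds h₁ hR a1.le h).1
      rw [a2, b2] at h2
      have h4 : 0 ≤ t ^ 2 - s ^ 2 := by nlinarith
      rw [abs_of_nonneg h4]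
      have := le_abs_self (y - x)
      nlinarith
    · have h2 := (hb.flux_sub_bounds h₁ hR b1.le h).1
      rw [a2, b2] at h2
      have h4 : 0 ≤ s ^ 2 - t ^ 2 := by nlinarith
      rw [abs_sub_comm, abs_of_nonneg h4]
      have := neg_abs_le (y - x)
      nlinarith
  refine (hsq.sqrt).congr fun y hy => ?_
  exact (Real.sqrt_sq (hb.fluxInv_spec h₁ hR hy).1.le).symm

theorem continuousOn_clamped (hφ : ContinuousOn φ' (radialClosed R1 R2)) :
    ContinuousOn (fluxSlope R1 R2 b φ') (Ioi 0) := by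
  have hcl : ContinuousOn (fun y => rclamp R1 R2 (fluxInv R1 R2 b y)) (Ioi 0) :=
    continuous_rclamp.comp_continuousOn (hb.continuousOn_fluxInv h₁ hR)
  have hmaps : MapsTo (fun y => rclamp R1 R2 (fluxInv R1 R2 b y)) (Ioi 0) (radialClosed R1 R2) :=
    fun y hy => rclamp_mem hR (hb.fluxInv_spec h₁ hR hy).1 h₁
  have : ContinuousOn (fun y => φ' (rclamp R1 R2 (fluxInv R1 R2 b y)) /
      (rclamp R1 R2 (fluxInv R1 R2 b y) * b (rclamp R1 R2 (fluxInv R1 R2 b y)))) (Ioi 0) := by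
    refine (hφ.comp hcl hmaps).div (hcl.mul (hb.cont.comp hcl hmaps)) fun y hy => ?_
    have hm := hmaps hy
    exact (mul_pos hm.1 (hb.c_pos.trans_le (hb.lower _ hm))).ne'
  refine this.congr fun y hy => ?_
  rw [fluxSlope, if_pos (mem_Ioi.1 hy)]

theorem fluxSlope_flux {r : ℝ} (hr : r ∈ radialClosed R1 R2) :
    fluxSlope R1 R2 b φ' (flux R1 R2 b r) = φ' r / (r * b r) := by
  rw [fluxSlope, if_pos (hb.flux_pos h₁ hR hr.1), hb.fluxInv_flux h₁ hR hr.1, rclamp_eq hr]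

theorem abs_fluxSlope_le
    {L : ℝ} {k : ℕ} (hL : ∀ r ∈ radialClosed R1 R2, |φ' r| ≤ L * (r * rwt 0 k r)) {y : ℝ}
    (hy : 0 < y) : |fluxSlope R1 R2 b φ' y| ≤
      L / c * rwt 0 k (rclamp R1 R2 (fluxInv R1 R2 b y)) := by
  rw [fluxSlope, if_pos hy]
  have hm := rclamp_mem hR (hb.fluxInv_spec h₁ hR hy).1 h₁
  set x := rclamp R1 R2 (fluxInv R1 R2 b y)
  have hx := hm.1
  have hc := hb.c_pos
  have hbx := hb.lower x hm
  rw [abs_div, abs_of_pos (mul_pos hx (hc.trans_le hbx))]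
  have h2 := hL x hm
  calc |φ' x| / (x * b x) ≤ |φ' x| / (x * c) := by
        refine div_le_div_of_nonneg_left (abs_nonneg _) (by positivity) ?_
        exact mul_le_mul_of_nonneg_left hbx hx.le
    _ ≤ L * (x * rwt 0 k x) / (x * c) := div_le_div_of_nonneg_right h2 (by positivity)
    _ = _ := by field_simp

end

/-- The fraction of the radius that is kept when the flux is halved. -/
def ratio (c K : ℝ) : ℝ := Real.sqrt (c / (2 * K))

section

variable (hb : PositiveBound R1 R2 b c K) (h₁ : 0 ≤ R1) (hR : (R1 : EReal) < R2)

include hb h₁ hR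

theorem ratio_spec :
    0 < ratio c K ∧ ratio c K ≤ 1 ∧ ∀ r ∈ radial R1 R2, ∀ y, flux R1 R2 b r / 2 ≤ y →
      0 < y ∧ ratio c K * r ≤ fluxInv R1 R2 b y ∧
        ratio c K * r ≤ rclamp R1 R2 (fluxInv R1 R2 b y) := by
  have hK := hb.K_pos h₁ hR
  have hc := hb.c_pos
  have hcK : c ≤ K := by
    have h := rclamp_mem hR one_pos h₁
    exact (hb.lower _ h).trans (hb.upper _ h)
  have h0 : 0 < ratio c K := Real.sqrt_pos.2 (by positivity)
  have hle : ratio c K ≤ 1 := by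
    rw [ratio, Real.sqrt_le_one]
    rw [div_le_one (by positivity)]
    linarith
  refine ⟨h0, hle, fun r hr y hy => ?_⟩
  have hr0 := radial_pos h₁ hr
  have hy0 : 0 < y := lt_of_lt_of_le (half_pos (hb.flux_pos h₁ hR hr0)) hy
  obtain ⟨a1, a2⟩ := hb.fluxInv_spec h₁ hR hy0
  set s := fluxInv R1 R2 b y
  have h3 : ratio c K * r ≤ s := by
    refine abs_le_of_sq_le_sq' ?_ a1.le |>.2
    rw [mul_pow, ratio, Real.sq_sqrt (by positivity), div_mul_eq_mul_div,
      div_le_iff₀ (by positivity)]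
    have h4 := (hb.flux_bounds h₁ hR a1.le).2
    have h5 := (hb.flux_bounds h₁ hR hr0.le).1
    rw [a2] at h4
    nlinarith
  refine ⟨hy0, h3, ?_⟩
  rcases le_total r s with h | h
  · have := ((rclamp_between (s := s) hr).1 h).1
    nlinarith
  · exact h3.trans ((rclamp_between hr).2 h).1

theorem measurable_fluxSlope (hφ : ContinuousOn φ' (radialClosed R1 R2)) :
    AEStronglyMeasurable (fluxSlope R1 R2 b φ') volume := by
  have h1 : AEStronglyMeasurable (fluxSlope R1 R2 b φ') (volume.restrict (Ioi 0)) :=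
    (hb.continuousOn_clamped h₁ hR hφ).aestronglyMeasurable measurableSet_Ioi
  have h2 : AEStronglyMeasurable (fluxSlope R1 R2 b φ') (volume.restrict (Ioi 0)ᶜ) := by
    refine (aestronglyMeasurable_const (b := (0 : ℝ))).congr ?_
    filter_upwards [ae_restrict_mem measurableSet_Ioi.compl] with y hy
    rw [fluxSlope, if_neg fun h : 0 < y => hy h]
  have := (aestronglyMeasurable_union_iff (s := Ioi (0 : ℝ)) (t := (Ioi 0)ᶜ)).2 ⟨h1, h2⟩
  rwa [union_compl_self, Measure.restrict_univ] at this

theorem abs_fluxSlope_le_const {L : ℝ} (hL0 : 0 ≤ L) {k : ℕ}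
    (hL : ∀ r ∈ radialClosed R1 R2, |φ' r| ≤ L * (r * rwt 0 k r)) (y : ℝ) :
    |fluxSlope R1 R2 b φ' y| ≤ L / c := by
  have hc := hb.c_pos
  by_cases hy : 0 < y
  · refine (hb.abs_fluxSlope_le h₁ hR hL hy).trans (mul_le_of_le_one_right (by positivity) ?_)
    exact rwt_zero_le_one (rclamp_mem hR (hb.fluxInv_spec h₁ hR hy).1 h₁).1
  · rw [fluxSlope, if_neg hy, abs_zero]
    positivity

theorem intervalIntegrable_fluxSlope (hφ : ContinuousOn φ' (radialClosed R1 R2)) {L : ℝ} (hL0 : 0 ≤ L)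
    {k : ℕ} (hL : ∀ r ∈ radialClosed R1 R2, |φ' r| ≤ L * (r * rwt 0 k r)) (x y : ℝ) :
    IntervalIntegrable (fluxSlope R1 R2 b φ') volume x y := by
  refine IntervalIntegrable.mono_fun' (g := fun _ => L / c)
    (Continuous.intervalIntegrable (by fun_prop) _ _)
    (hb.measurable_fluxSlope h₁ hR hφ).restrict (Eventually.of_forall fun y => ?_)
  exact hb.abs_fluxSlope_le_const h₁ hR hL0 hL y

theorem fluxFun_sub (hφ : ContinuousOn φ' (radialClosed R1 R2)) {L : ℝ} (hL0 : 0 ≤ L)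
    {k : ℕ} (hL : ∀ r ∈ radialClosed R1 R2, |φ' r| ≤ L * (r * rwt 0 k r)) (r₀ x y : ℝ) :
    fluxFun R1 R2 b φ φ' r₀ y - fluxFun R1 R2 b φ φ' r₀ x =
      ∫ s in x..y, fluxSlope R1 R2 b φ' s := by
  have hi := hb.intervalIntegrable_fluxSlope h₁ hR hφ hL0 hL
  rw [← intervalIntegral.integral_interval_sub_left (hi (flux R1 R2 b r₀) y) (hi _ x)]
  simp only [fluxFun]
  ring

theorem hasDerivAt_fluxFun (hφ : ContinuousOn φ' (radialClosed R1 R2)) {L : ℝ} (hL0 : 0 ≤ L)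
    {k : ℕ} (hL : ∀ r ∈ radialClosed R1 R2, |φ' r| ≤ L * (r * rwt 0 k r)) {r₀ y : ℝ}
    (hy : 0 < y) :
    HasDerivAt (fluxFun R1 R2 b φ φ' r₀) (fluxSlope R1 R2 b φ' y) y := by
  have hc := hb.continuousOn_clamped h₁ hR hφ
  exact (intervalIntegral.integral_hasDerivAt_right
    (hb.intervalIntegrable_fluxSlope h₁ hR hφ hL0 hL _ _)
    (hc.stronglyMeasurableAtFilter isOpen_Ioi y hy)
    (hc.continuousAt (Ioi_mem_nhds hy))).const_add _

/-- Along the steady state, `fluxFun` takes the prescribed values. -/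
theorem fluxFun_flux (hφ : ContinuousOn φ' (radialClosed R1 R2)) {L : ℝ} (hL0 : 0 ≤ L)
    {k : ℕ} (hL : ∀ r ∈ radialClosed R1 R2, |φ' r| ≤ L * (r * rwt 0 k r))
    (hd : ∀ r ∈ radial R1 R2, HasDerivAt φ (φ' r) r) {r₀ r : ℝ} (hr₀ : r₀ ∈ radial R1 R2)
    (hr : r ∈ radial R1 R2) : fluxFun R1 R2 b φ φ' r₀ (flux R1 R2 b r) = φ r := by
  have hder : ∀ s ∈ radial R1 R2,
      HasDerivAt (fun s => fluxFun R1 R2 b φ φ' r₀ (flux R1 R2 b s) - φ s) 0 s := by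
    intro s hs
    have hs0 := radial_pos h₁ hs
    have hcl := radial_subset_radialClosed h₁ hs
    have e1 := (hb.hasDerivAt_fluxFun (φ := φ) h₁ hR hφ hL0 hL (r₀ := r₀) (hb.flux_pos h₁ hR hs0)).comp s
      (hb.hasDerivAt_flux h₁ hR hs0)
    rw [hb.fluxSlope_flux h₁ hR hcl, rclamp_eq hcl] at e1
    have e2 := e1.sub (hd s hs)
    have hbs := hb.c_pos.trans_le (hb.lower s hcl)
    rw [div_mul_cancel₀ _ (mul_pos hs0 hbs).ne', sub_self] at e2
    exact e2
  have hconv : Convex ℝ (radial R1 R2) := ordConnected_radial.convex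
  have := hconv.is_const_of_fderivWithin_eq_zero (𝕜 := ℝ)
    (f := fun s => fluxFun R1 R2 b φ φ' r₀ (flux R1 R2 b s) - φ s)
    (fun s hs => (hder s hs).differentiableAt.differentiableWithinAt) (fun s hs => by
      rw [fderivWithin_of_isOpen isOpen_radial hs]
      ext
      simp [(hder s hs).deriv]) hr hr₀
  have h0 : fluxFun R1 R2 b φ φ' r₀ (flux R1 R2 b r₀) = φ r₀ := by simp [fluxFun]
  simp only [h0, sub_self] at this
  linarith

theorem nearBound_fluxFun (hφ : ContinuousOn φ' (radialClosed R1 R2)) {L : ℝ} (hL0 : 0 ≤ L)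
    {k : ℕ} (hL : ∀ r ∈ radialClosed R1 R2, |φ' r| ≤ L * (r * rwt 0 k r))
    (hd : ∀ r ∈ radial R1 R2, HasDerivAt φ (φ' r) r) {B : ℝ}
    (hB : ∀ r ∈ radial R1 R2, |φ r| ≤ B) {r₀ : ℝ} (hr₀ : r₀ ∈ radial R1 R2) :
    ∃ M, NearBound R1 R2 (flux R1 R2 b) (fluxFun R1 R2 b φ φ' r₀) k M := by
  obtain ⟨k0, k1, hk⟩ := hb.ratio_spec h₁ hR
  have hc := hb.c_pos
  have hsub := hb.fluxFun_sub (φ := φ) h₁ hR hφ hL0 hL r₀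
  set κ := PositiveBound.ratio c K
  set y₁ := flux R1 R2 b r₀
  have hr00 := radial_pos h₁ hr₀
  have hy1 : 0 < y₁ := hb.flux_pos h₁ hR hr00
  have hB0 : 0 ≤ B := (abs_nonneg _).trans (hB r₀ hr₀)
  have lip : ∀ y y', |fluxFun R1 R2 b φ φ' r₀ y - fluxFun R1 R2 b φ φ' r₀ y'| ≤
      L / c * |y - y'| := fun y y' => by
    rw [hsub]
    exact intervalIntegral.norm_integral_le_of_norm_le_const
      (f := fluxSlope R1 R2 b φ') (C := L / c) fun s _ =>
        hb.abs_fluxSlope_le_const h₁ hR hL0 hL s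
  have hkk : 1 ≤ (κ ^ k)⁻¹ := (one_le_inv₀ (by positivity)).2 (pow_le_one₀ k0.le k1)
  set M := L / c * (κ ^ k)⁻¹ + (B + L / c * y₁)
  have hM1 : L / c ≤ M := by
    have : L / c ≤ L / c * (κ ^ k)⁻¹ := le_mul_of_one_le_right (by positivity) hkk
    have : 0 ≤ B + L / c * y₁ := by positivity
    linarith
  have hM2 : L / c * (κ ^ k)⁻¹ ≤ M := by
    have : 0 ≤ B + L / c * y₁ := by positivity
    linarith
  have hM3 : B + L / c * y₁ ≤ M := by
    have : 0 ≤ L / c * (κ ^ k)⁻¹ := by positivity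
    linarith
  refine ⟨M, by positivity, fun y y' => (lip y y').trans
    (mul_le_mul_of_nonneg_right hM1 (abs_nonneg _)), fun r hr y hy => ?_, fun htop y => ?_⟩
  · have hr0 := radial_pos h₁ hr
    rw [hsub]
    have : ∀ s ∈ uIoc (flux R1 R2 b r) y, ‖fluxSlope R1 R2 b φ' s‖ ≤
        L / c * ((κ ^ k)⁻¹ * rwt 0 k r) := by
      intro s hs
      have hfp := hb.flux_pos h₁ hR hr0
      have hs2 : flux R1 R2 b r / 2 ≤ s :=
        (le_min (by linarith) hy).trans hs.1.le
      obtain ⟨s0, -, s2⟩ := hk r hr s hs2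
      exact (hb.abs_fluxSlope_le h₁ hR hL s0).trans
        (mul_le_mul_of_nonneg_left (rwt_zero_scale k0 k1 hr0 s2) (by positivity))
    refine (intervalIntegral.norm_integral_le_of_norm_le_const this).trans
      (mul_le_mul_of_nonneg_right ?_ (abs_nonneg _))
    rw [← mul_assoc]
    exact mul_le_mul_of_nonneg_right hM2 (rwt_pos hr0).le
  · refine le_trans ?_ hM3
    rcases le_total y₁ y with h | h
    · obtain ⟨a1, a2⟩ := hb.fluxInv_spec h₁ hR (hy1.trans_le h)
      have hmem : fluxInv R1 R2 b y ∈ radial R1 R2 := by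
        have : r₀ ≤ fluxInv R1 R2 b y := by
          rw [← a2] at h
          exact ((hb.strictMonoOn_flux h₁ hR).le_iff_le hr00.le a1.le).1 h
        exact ⟨hr₀.1.trans_le this, by rw [htop]; exact EReal.coe_lt_top _⟩
      have := hb.fluxFun_flux h₁ hR hφ hL0 hL hd hr₀ hmem
      rw [a2] at this
      rw [this]
      have := hB _ hmem
      have : 0 ≤ L / c * y₁ := by positivity
      linarith
    · have e0 : fluxFun R1 R2 b φ φ' r₀ y₁ = φ r₀ := by simp [fluxFun, y₁]
      have e1 := lip (max y 0) y₁
      have e2 : fluxFun R1 R2 b φ φ' r₀ (max y 0) = fluxFun R1 R2 b φ φ' r₀ y := by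
        rw [← sub_eq_zero, hsub]
        refine intervalIntegral.integral_zero_ae (Eventually.of_forall fun s hs => ?_)
        rw [fluxSlope, if_neg]
        rw [uIoc_of_le (le_max_left _ _)] at hs
        rcases le_total y 0 with hy | hy
        · rw [max_eq_right hy] at hs
          exact not_lt.2 hs.2
        · rw [max_eq_left hy] at hs
          exact absurd hs.2 (not_le.2 hs.1)
      rw [e2, e0] at e1
      have e3 : |max y 0 - y₁| ≤ y₁ := by
        rw [abs_le]
        constructor
        · have := le_max_right y 0
          linarith
        · have := max_le h hy1.le
          linarith
      have e4 := hB r₀ hr₀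
      have e5 := abs_add_le (fluxFun R1 R2 b φ φ' r₀ y - φ r₀) (φ r₀)
      rw [sub_add_cancel] at e5
      have e6 := mul_le_mul_of_nonneg_left e3 (show 0 ≤ L / c by positivity)
      linarith

end

end PositiveBound

end Transplant

/-! ### Pointwise estimates for functions of the flux -/

section Pointwise

variable {R1 : ℝ} {R2 : EReal}

theorem wt_eq_rwt (r : ℝ) : wt r = rwt 0 6 r := by simp [wt, rwt]

theorem abs_sub_le_of_hasDerivAt {f F : ℝ → ℝ} {a x S : ℝ}
    (hf : ∀ s ∈ uIcc a x, HasDerivAt f (F s) s) (hS : ∀ s ∈ uIcc a x, |F s| ≤ S) :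
    |f x - f a| ≤ S * |x - a| :=
  (convex_uIcc a x).norm_image_sub_le_of_norm_hasDerivWithin_le
    (fun s hs => (hf s hs).hasDerivWithinAt) hS left_mem_uIcc right_mem_uIcc

theorem abs_sub_linear_le {f F : ℝ → ℝ} {a h S : ℝ}
    (hf : ∀ s ∈ uIcc a (a + h), HasDerivAt f (F s) s)
    (hS : ∀ s ∈ uIcc a (a + h), |F s - F a| ≤ S) :
    |f (a + h) - f a - F a * h| ≤ S * |h| := by
  have := abs_sub_le_of_hasDerivAt (f := fun s => f s - F a * s) (F := fun s => F s - F a)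
    (a := a) (x := a + h) (S := S)
    (fun s hs => ((hf s hs).sub ((hasDerivAt_id s).const_mul (F a))).congr_deriv (by simp)) hS
  have e : f (a + h) - F a * (a + h) - (f a - F a * a) = f (a + h) - f a - F a * h := by ring
  rwa [e, add_sub_cancel_left] at this

theorem abs_sub_quadratic_le {f F : ℝ → ℝ} {a h p η : ℝ} (hη : 0 ≤ η)
    (hf : ∀ s ∈ uIcc a (a + h), HasDerivAt f (F s) s)
    (hS : ∀ s ∈ uIcc a (a + h), |F s - F a - p * (s - a)| ≤ η * |s - a|) :
    |f (a + h) - f a - F a * h - 1 / 2 * p * h ^ 2| ≤ η * h ^ 2 := by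
  have := abs_sub_le_of_hasDerivAt (f := fun s => f s - F a * s - 1 / 2 * p * (s - a) ^ 2)
    (F := fun s => F s - F a - p * (s - a)) (a := a) (x := a + h) (S := η * |h|)
    (fun s hs => by
      have h1 := ((hf s hs).sub ((hasDerivAt_id s).const_mul (F a))).sub
        ((((hasDerivAt_id s).sub_const a).fun_pow 2).const_mul (1 / 2 * p))
      refine h1.congr_deriv ?_
      simp
      ring) (fun s hs => (hS s hs).trans (mul_le_mul_of_nonneg_left ?_ hη))
  · have e : f (a + h) - F a * (a + h) - 1 / 2 * p * (a + h - a) ^ 2 -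
        (f a - F a * a - 1 / 2 * p * (a - a) ^ 2) =
        f (a + h) - f a - F a * h - 1 / 2 * p * h ^ 2 := by ring
    rw [e, add_sub_cancel_left] at this
    refine this.trans_eq ?_
    rw [mul_assoc, ← abs_mul, ← sq, abs_of_nonneg (sq_nonneg h)]
  · have := abs_sub_left_of_mem_uIcc hs
    simpa using this

theorem exists_radius_dichotomy (hR : (R1 : EReal) < R2) :
    ∃ M : ℝ, 1 ≤ M ∧ ∀ r ∈ radial R1 R2, r ≤ M ∨ (R2 = ⊤ ∧ 1 ≤ r) := by
  rcases eq_or_ne R2 ⊤ with h | h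
  · exact ⟨1, le_rfl, fun r _ => (le_total r 1).imp id fun h' => ⟨h, h'⟩⟩
  · obtain ⟨d, rfl, hd, -, -⟩ := exists_toOuter_eq hR h
    refine ⟨max 1 d, le_max_left _ _, fun r hr => Or.inl (le_max_of_le_right ?_)⟩
    exact_mod_cast hr.2.le

theorem one_le_mul_wt_of_le {r M : ℝ} (hr : 0 ≤ r) (hM : r ≤ M) : 1 ≤ (1 + M ^ 6) * wt r := by
  rw [wt, ← div_eq_mul_inv, le_div_iff₀ (wt_den_pos r), one_mul]
  have := pow_le_pow_left₀ hr hM 6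
  linarith

theorem one_le_mul_wt_of_one_le {r : ℝ} (hr : 1 ≤ r) : 1 ≤ 2 * r ^ 6 * wt r := by
  rw [wt, ← div_eq_mul_inv, le_div_iff₀ (wt_den_pos r), one_mul]
  have : 1 ≤ r ^ 6 := one_le_pow₀ hr
  linarith

/-- Large deviations at large radii are controlled by the fourth power. -/
theorem large_deviation {r x κ : ℝ} (hκ : 0 < κ) (hr : 1 ≤ r) (hx : κ * r ^ 2 ≤ 2 * x) :
    r ^ 2 ≤ 2 * (2 / κ) ^ 4 * (wt r * x ^ 4) ∧ x ≤ 2 * (2 / κ) ^ 3 * (wt r * x ^ 4) := by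
  have hw := wt_pos r
  have h1 := one_le_mul_wt_of_one_le hr
  have h2 : r ^ 2 ≤ 2 / κ * x := by
    rw [div_mul_eq_mul_div, le_div_iff₀ hκ]; linarith
  have hr2 : 0 ≤ r ^ 2 := sq_nonneg r
  have hx0 : 0 ≤ x := by
    have : 0 ≤ κ * r ^ 2 := by positivity
    linarith
  have h4 := pow_le_pow_left₀ hr2 h2 4
  have h3 := pow_le_pow_left₀ hr2 h2 3
  rw [mul_pow] at h4 h3
  constructor
  · calc r ^ 2 ≤ r ^ 2 * (2 * r ^ 6 * wt r) := le_mul_of_one_le_right hr2 h1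
      _ = 2 * wt r * (r ^ 2) ^ 4 := by ring
      _ ≤ 2 * wt r * ((2 / κ) ^ 4 * x ^ 4) := mul_le_mul_of_nonneg_left h4 (by positivity)
      _ = _ := by ring
  · calc x ≤ x * (2 * r ^ 6 * wt r) := le_mul_of_one_le_right hx0 h1
      _ = 2 * wt r * x * (r ^ 2) ^ 3 := by ring
      _ ≤ 2 * wt r * x * ((2 / κ) ^ 3 * x ^ 3) := mul_le_mul_of_nonneg_left h3 (by positivity)
      _ = _ := by ring

variable {y₀ F f : ℝ → ℝ} {κ L : ℝ}

theorem uIcc_half_le {a h s : ℝ} (ha : 0 ≤ a) (h2 : a / 2 ≤ a + h) (hs : s ∈ uIcc a (a + h)) :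
    a / 2 ≤ s := (le_min (by linarith) h2).trans hs.1

theorem NearBound.exists_primitive_bound (hF : NearBound R1 R2 y₀ F 6 L) (h₁ : 0 ≤ R1)
    (hR : (R1 : EReal) < R2) (hκ : 0 < κ) (hy : ∀ r ∈ radial R1 R2, κ * r ^ 2 ≤ y₀ r)
    (hf : ∀ y, HasDerivAt f (F y) y) :
    ∃ C, 0 ≤ C ∧ ∀ r ∈ radial R1 R2, ∀ h,
      |f (y₀ r + h) - f (y₀ r) - F (y₀ r) * h| ≤ C * (wt r * (h ^ 2 + h ^ 4)) := by
  obtain ⟨M, hM, hdich⟩ := exists_radius_dichotomy (R1 := R1) (R2 := R2) hR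
  have hL := hF.nonneg
  refine ⟨L + L * (1 + M ^ 6) + 2 * L * (2 * (2 / κ) ^ 3), by positivity, fun r hr h => ?_⟩
  have hr0 := radial_pos h₁ hr
  have hy0 := hy r hr
  have hyp : 0 < y₀ r := lt_of_lt_of_le (by positivity) hy0
  have hw := wt_pos r
  have p1 : 0 ≤ wt r * h ^ 2 := by positivity
  have p2 : 0 ≤ wt r * h ^ 4 := by positivity
  have hC1 : 0 ≤ L * (1 + M ^ 6) := by positivity
  have hC2 : 0 ≤ 2 * L * (2 * (2 / κ) ^ 3) := by positivity
  have hgen : |f (y₀ r + h) - f (y₀ r) - F (y₀ r) * h| ≤ L * h ^ 2 := by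
    refine (abs_sub_linear_le (S := L * |h|) (fun s _ => hf s) fun s hs => ?_).trans_eq ?_
    · refine (hF.lip _ _).trans (mul_le_mul_of_nonneg_left ?_ hL)
      simpa using abs_sub_left_of_mem_uIcc hs
    · rw [mul_assoc, ← abs_mul, ← sq, abs_of_nonneg (sq_nonneg h)]
  by_cases hc : y₀ r / 2 ≤ y₀ r + h
  · have : |f (y₀ r + h) - f (y₀ r) - F (y₀ r) * h| ≤ L * (wt r * h ^ 2) := by
      refine (abs_sub_linear_le (S := L * wt r * |h|) (fun s _ => hf s) fun s hs => ?_).trans_eq ?_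
      · refine (hF.near r hr s (uIcc_half_le hyp.le hc hs)).trans ?_
        rw [wt_eq_rwt]
        refine mul_le_mul_of_nonneg_left ?_ (mul_nonneg hL (rwt_pos hr0).le)
        simpa using abs_sub_left_of_mem_uIcc hs
      · rw [mul_assoc, ← abs_mul, ← sq, abs_of_nonneg (sq_nonneg h)]; ring
    nlinarith [mul_nonneg hL p2, mul_nonneg hC1 p1, mul_nonneg hC1 p2, mul_nonneg hC2 p1,
      mul_nonneg hC2 p2]
  · have hh : κ * r ^ 2 ≤ 2 * |h| := by
      push Not at hc
      have := neg_abs_le h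
      linarith
    rcases hdich r hr with hrM | ⟨htop, hr1⟩
    · have h3 := mul_le_mul_of_nonneg_left (one_le_mul_wt_of_le hr0.le hrM)
        (show 0 ≤ L * h ^ 2 by positivity)
      nlinarith [mul_nonneg hL p2, mul_nonneg hL p1, mul_nonneg hC1 p2, mul_nonneg hC2 p1,
        mul_nonneg hC2 p2]
    · have h4 := (large_deviation hκ hr1 hh).2
      have hb : |f (y₀ r + h) - f (y₀ r) - F (y₀ r) * h| ≤ 2 * L * |h| := by
        refine abs_sub_linear_le (fun s _ => hf s) fun s _ => ?_
        have := abs_sub (F s) (F (y₀ r))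
        have := hF.bdd htop s
        have := hF.bdd htop (y₀ r)
        linarith
      have e4 : |h| ^ 4 = h ^ 4 := by
        rw [show (4 : ℕ) = 2 * 2 by norm_num, pow_mul, sq_abs, ← pow_mul]
      rw [e4] at h4
      have h5 := mul_le_mul_of_nonneg_left h4 (show 0 ≤ 2 * L by positivity)
      nlinarith [mul_nonneg hL p2, mul_nonneg hL p1, mul_nonneg hC1 p2, mul_nonneg hC1 p1,
        mul_nonneg hC2 p1]

theorem NearBound.exists_sq_bound (hF : NearBound R1 R2 y₀ F 4 L) (h₁ : 0 ≤ R1)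
    (hR : (R1 : EReal) < R2) (hκ : 0 < κ) (hy : ∀ r ∈ radial R1 R2, κ * r ^ 2 ≤ y₀ r) :
    ∃ C, 0 ≤ C ∧ ∀ r ∈ radial R1 R2, ∀ h,
      r ^ 2 * (F (y₀ r + h) - F (y₀ r)) ^ 2 ≤ C * (wt r * (h ^ 2 + h ^ 4)) := by
  obtain ⟨M, hM, hdich⟩ := exists_radius_dichotomy (R1 := R1) (R2 := R2) hR
  have hL := hF.nonneg
  refine ⟨2 * L ^ 2 + M ^ 2 * L ^ 2 * (1 + M ^ 6) + 4 * L ^ 2 * (2 * (2 / κ) ^ 4), by positivity,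
    fun r hr h => ?_⟩
  have hr0 := radial_pos h₁ hr
  have hw := wt_pos r
  have p1 : 0 ≤ wt r * h ^ 2 := by positivity
  have p2 : 0 ≤ wt r * h ^ 4 := by positivity
  have hC0 : 0 ≤ 2 * L ^ 2 := by positivity
  have hC1 : 0 ≤ M ^ 2 * L ^ 2 * (1 + M ^ 6) := by positivity
  have hC2 : 0 ≤ 4 * L ^ 2 * (2 * (2 / κ) ^ 4) := by positivity
  by_cases hc : y₀ r / 2 ≤ y₀ r + h
  · have h2 := hF.near r hr _ hc
    rw [add_sub_cancel_left] at h2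
    have h3 : (F (y₀ r + h) - F (y₀ r)) ^ 2 ≤ (L * rwt 0 4 r * |h|) ^ 2 := by
      rw [← sq_abs]
      exact pow_le_pow_left₀ (abs_nonneg _) h2 2
    rw [mul_pow, mul_pow, sq_abs] at h3
    have h4 : r ^ 2 * rwt 0 4 r ^ 2 ≤ 2 * wt r := by
      rw [rwt, wt, pow_zero, div_pow, one_pow, mul_one_div, ← div_eq_mul_inv,
        div_le_div_iff₀ (by positivity) (by positivity)]
      nlinarith [sq_nonneg (r ^ 4), sq_nonneg (r ^ 2 - 1), pow_pos hr0 4, pow_pos hr0 2]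
    have h5 : r ^ 2 * (F (y₀ r + h) - F (y₀ r)) ^ 2 ≤ 2 * L ^ 2 * (wt r * h ^ 2) := by
      calc _ ≤ r ^ 2 * (L ^ 2 * rwt 0 4 r ^ 2 * h ^ 2) :=
            mul_le_mul_of_nonneg_left h3 (sq_nonneg r)
        _ = L ^ 2 * h ^ 2 * (r ^ 2 * rwt 0 4 r ^ 2) := by ring
        _ ≤ L ^ 2 * h ^ 2 * (2 * wt r) := mul_le_mul_of_nonneg_left h4 (by positivity)
        _ = _ := by ring
    nlinarith [mul_nonneg hC0 p2, mul_nonneg hC1 p1, mul_nonneg hC1 p2, mul_nonneg hC2 p1,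
      mul_nonneg hC2 p2]
  · have hh : κ * r ^ 2 ≤ 2 * |h| := by
      push Not at hc
      have := neg_abs_le h
      have := hy r hr
      linarith
    rcases hdich r hr with hrM | ⟨htop, hr1⟩
    · have h2 := hF.lip (y₀ r + h) (y₀ r)
      rw [add_sub_cancel_left] at h2
      have h3 : (F (y₀ r + h) - F (y₀ r)) ^ 2 ≤ (L * |h|) ^ 2 := by
        rw [← sq_abs]
        exact pow_le_pow_left₀ (abs_nonneg _) h2 2
      rw [mul_pow, sq_abs] at h3
      have h4 := pow_le_pow_left₀ hr0.le hrM 2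
      have h5 := mul_le_mul h4 h3 (sq_nonneg _) (by positivity)
      have h6 := mul_le_mul_of_nonneg_left (one_le_mul_wt_of_le hr0.le hrM)
        (show 0 ≤ M ^ 2 * L ^ 2 * h ^ 2 by positivity)
      nlinarith [mul_nonneg hC0 p2, mul_nonneg hC0 p1, mul_nonneg hC1 p2, mul_nonneg hC2 p1,
        mul_nonneg hC2 p2]
    · have h4 := (large_deviation hκ hr1 hh).1
      have e4 : |h| ^ 4 = h ^ 4 := by
        rw [show (4 : ℕ) = 2 * 2 by norm_num, pow_mul, sq_abs, ← pow_mul]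
      rw [e4] at h4
      have h3 : (F (y₀ r + h) - F (y₀ r)) ^ 2 ≤ (2 * L) ^ 2 := by
        rw [← sq_abs]
        refine pow_le_pow_left₀ (abs_nonneg _) ?_ 2
        have := abs_sub (F (y₀ r + h)) (F (y₀ r))
        have := hF.bdd htop (y₀ r + h)
        have := hF.bdd htop (y₀ r)
        linarith
      have h5 := mul_le_mul h4 h3 (sq_nonneg _) (by positivity)
      nlinarith [mul_nonneg hC0 p2, mul_nonneg hC0 p1, mul_nonneg hC1 p2, mul_nonneg hC1 p1,
        mul_nonneg hC2 p1]

theorem NearBound.exists_second_order_bound {D ω : ℝ → ℝ} {K : ℝ}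
    (hF : NearBound R1 R2 y₀ F 4 L) (h₁ : 0 ≤ R1)
    (hR : (R1 : EReal) < R2) (hκ : 0 < κ) (hy : ∀ r ∈ radial R1 R2, κ * r ^ 2 ≤ y₀ r)
    (hd : ∀ y > 0, HasDerivAt F (D y) y) (hK : 0 ≤ K)
    (hω : ∀ r ∈ radial R1 R2, |ω r| ≤ K * rwt 0 2 r) (hD : ∀ r ∈ radial R1 R2, |D (y₀ r)| ≤ L)
    (hnear : ∀ r ∈ radial R1 R2, ∀ y, y₀ r / 2 ≤ y →
      |D y - D (y₀ r)| ≤ L / r ^ 2 * rwt 0 4 r * |y - y₀ r|) :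
    ∃ C, 0 ≤ C ∧ ∀ r ∈ radial R1 R2, ∀ h,
      |r ^ 2 * ω r * (F (y₀ r + h) - F (y₀ r) - D (y₀ r) * h)| ≤
        C * (wt r * (h ^ 2 + h ^ 4)) := by
  obtain ⟨M, hM, hdich⟩ := exists_radius_dichotomy (R1 := R1) (R2 := R2) hR
  have hL := hF.nonneg
  refine ⟨2 * K * L + 2 * L * K * (2 / κ) * (1 + M ^ 6) +
    (2 * K * L * (2 * (2 / κ) ^ 4) + K * L * (2 * (2 / κ) ^ 3)), by positivity, fun r hr h => ?_⟩
  have hr0 := radial_pos h₁ hr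
  have hy0 := hy r hr
  have hyp : 0 < y₀ r := lt_of_lt_of_le (by positivity) hy0
  have hw := wt_pos r
  have p1 : 0 ≤ wt r * h ^ 2 := by positivity
  have p2 : 0 ≤ wt r * h ^ 4 := by positivity
  have hC0 : 0 ≤ 2 * K * L := by positivity
  have hC1 : 0 ≤ 2 * L * K * (2 / κ) * (1 + M ^ 6) := by positivity
  have hC2 : 0 ≤ 2 * K * L * (2 * (2 / κ) ^ 4) + K * L * (2 * (2 / κ) ^ 3) := by positivity
  have hωr := hω r hr
  have hω2 : r ^ 2 * |ω r| ≤ K := by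
    calc r ^ 2 * |ω r| ≤ r ^ 2 * (K * rwt 0 2 r) := mul_le_mul_of_nonneg_left hωr (sq_nonneg r)
      _ = K * (r ^ 2 / (1 + r ^ 2)) := by rw [rwt, pow_zero]; ring
      _ ≤ K := mul_le_of_le_one_right hK (by rw [div_le_one (by positivity)]; linarith)
  rw [abs_mul, abs_mul, abs_of_nonneg (sq_nonneg r)]
  by_cases hc : y₀ r / 2 ≤ y₀ r + h
  · have h2 : |F (y₀ r + h) - F (y₀ r) - D (y₀ r) * h| ≤ L / r ^ 2 * rwt 0 4 r * h ^ 2 := by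
      refine (abs_sub_linear_le (S := L / r ^ 2 * rwt 0 4 r * |h|) (fun s hs => hd s ?_)
        fun s hs => ?_).trans_eq ?_
      · exact lt_of_lt_of_le (half_pos hyp) (uIcc_half_le hyp.le hc hs)
      · refine (hnear r hr s (uIcc_half_le hyp.le hc hs)).trans ?_
        have := rwt_pos (j := 0) (k := 4) hr0
        refine mul_le_mul_of_nonneg_left ?_ (by positivity)
        simpa using abs_sub_left_of_mem_uIcc hs
      · rw [mul_assoc, ← abs_mul, ← sq, abs_of_nonneg (sq_nonneg h)]
    have h4 : rwt 0 2 r * rwt 0 4 r ≤ 2 * wt r := by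
      rw [rwt, rwt, wt, pow_zero, div_mul_div_comm, one_mul, ← div_eq_mul_inv,
        div_le_div_iff₀ (by positivity) (by positivity)]
      nlinarith [pow_pos hr0 4, pow_pos hr0 2, pow_pos hr0 6]
    have h5 : r ^ 2 * |ω r| * |F (y₀ r + h) - F (y₀ r) - D (y₀ r) * h| ≤
        2 * K * L * (wt r * h ^ 2) := by
      calc _ ≤ r ^ 2 * (K * rwt 0 2 r) * (L / r ^ 2 * rwt 0 4 r * h ^ 2) := by
            have := rwt_pos (j := 0) (k := 2) hr0
            exact mul_le_mul (mul_le_mul_of_nonneg_left hωr (sq_nonneg r)) h2 (abs_nonneg _)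
              (by positivity)
        _ = K * L * h ^ 2 * (rwt 0 2 r * rwt 0 4 r) := by field_simp
        _ ≤ K * L * h ^ 2 * (2 * wt r) := mul_le_mul_of_nonneg_left h4 (by positivity)
        _ = _ := by ring
    nlinarith [mul_nonneg hC0 p2, mul_nonneg hC1 p1, mul_nonneg hC1 p2, mul_nonneg hC2 p1,
      mul_nonneg hC2 p2]
  · have hh : κ * r ^ 2 ≤ 2 * |h| := by
      push Not at hc
      have := neg_abs_le h
      linarith
    have hDh : |D (y₀ r) * h| ≤ L * |h| := by
      rw [abs_mul]
      exact mul_le_mul_of_nonneg_right (hD r hr) (abs_nonneg _)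
    have htri := abs_sub (F (y₀ r + h) - F (y₀ r)) (D (y₀ r) * h)
    rcases hdich r hr with hrM | ⟨htop, hr1⟩
    · have h2 := hF.lip (y₀ r + h) (y₀ r)
      rw [add_sub_cancel_left] at h2
      have h3 : |F (y₀ r + h) - F (y₀ r) - D (y₀ r) * h| ≤ 2 * L * |h| := by linarith
      have h4 : r ^ 2 * |ω r| ≤ 2 / κ * |h| * K := by
        refine mul_le_mul ?_ (hωr.trans (mul_le_of_le_one_right hK (rwt_zero_le_one hr0)))
          (abs_nonneg _) (by positivity)
        rw [div_mul_eq_mul_div, le_div_iff₀ hκ]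
        linarith
      have h5 := mul_le_mul h4 h3 (abs_nonneg _) (by positivity)
      have h6 := mul_le_mul_of_nonneg_left (one_le_mul_wt_of_le hr0.le hrM)
        (show 0 ≤ 2 * L * K * (2 / κ) * h ^ 2 by positivity)
      have e : 2 / κ * |h| * K * (2 * L * |h|) = 2 * L * K * (2 / κ) * h ^ 2 := by
        rw [← sq_abs h]; ring
      nlinarith [mul_nonneg hC0 p2, mul_nonneg hC0 p1, mul_nonneg hC1 p2, mul_nonneg hC2 p1,
        mul_nonneg hC2 p2]
    · obtain ⟨h4, h5⟩ := large_deviation hκ hr1 hh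
      have e4 : |h| ^ 4 = h ^ 4 := by
        rw [show (4 : ℕ) = 2 * 2 by norm_num, pow_mul, sq_abs, ← pow_mul]
      rw [e4] at h4 h5
      have h3 : |F (y₀ r + h) - F (y₀ r) - D (y₀ r) * h| ≤ 2 * L + L * |h| := by
        have := abs_sub (F (y₀ r + h)) (F (y₀ r))
        have := hF.bdd htop (y₀ r + h)
        have := hF.bdd htop (y₀ r)
        linarith
      have h6 := mul_le_mul hω2 h3 (abs_nonneg _) hK
      have h7 : 1 ≤ 2 * (2 / κ) ^ 4 * (wt r * h ^ 4) := le_trans (one_le_pow₀ hr1) h4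
      have h8 := mul_le_mul_of_nonneg_left h7 (show 0 ≤ 2 * K * L by positivity)
      have h9 := mul_le_mul_of_nonneg_left h5 (show 0 ≤ K * L by positivity)
      nlinarith [mul_nonneg hC0 p2, mul_nonneg hC0 p1, mul_nonneg hC1 p2, mul_nonneg hC1 p1,
        mul_nonneg hC2 p1]

end Pointwise

/-! ### The Casimir functions of the steady state -/

section Slopes

variable {R1 : ℝ} {R2 : EReal} {b : ℝ → ℝ} {c K : ℝ}

namespace PositiveBound

section

variable (hb : PositiveBound R1 R2 b c K) (h₁ : 0 ≤ R1) (hR : (R1 : EReal) < R2)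

include hb h₁ hR

theorem near_fluxSlope {φ' ψ' : ℝ → ℝ} (hφ : ContinuousOn φ' (radialClosed R1 R2))
    (hd : ∀ r ∈ radial R1 R2, HasDerivAt (fun r => φ' r / (r * b r)) (ψ' r) r) {L : ℝ}
    (hL0 : 0 ≤ L) (hL : ∀ r ∈ radial R1 R2, |ψ' r| ≤ L / r * rwt 0 4 r) :
    ∃ C, 0 ≤ C ∧ ∀ r ∈ radial R1 R2, ∀ y, flux R1 R2 b r / 2 ≤ y →
      |fluxSlope R1 R2 b φ' y - fluxSlope R1 R2 b φ' (flux R1 R2 b r)| ≤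
        C / r ^ 2 * rwt 0 4 r * |y - flux R1 R2 b r| := by
  obtain ⟨k0, k1, hk⟩ := hb.ratio_spec h₁ hR
  set κ := PositiveBound.ratio c K
  have hc := hb.c_pos
  refine ⟨L / c * (κ ^ 2)⁻¹ * (κ ^ 4)⁻¹, by positivity, fun r hr y hy => ?_⟩
  have hr0 := radial_pos h₁ hr
  have hcl := radial_subset_radialClosed h₁ hr
  obtain ⟨hy0, hs1, hs2⟩ := hk r hr y hy
  obtain ⟨a1, a2⟩ := hb.fluxInv_spec h₁ hR hy0
  rw [hb.fluxSlope_flux h₁ hR hcl, fluxSlope, if_pos hy0]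
  set s := fluxInv R1 R2 b y
  have hxm := rclamp_mem hR a1 h₁
  set x := rclamp R1 R2 s with hx
  have hcont : ContinuousOn (fun r => φ' r / (r * b r)) (radialClosed R1 R2) :=
    hφ.div (continuousOn_id.mul hb.cont) fun t ht =>
      (mul_pos ht.1 (hc.trans_le (hb.lower t ht))).ne'
  have hY : ContinuousOn (flux R1 R2 b) (radialClosed R1 R2) :=
    (hb.continuousOn_flux h₁ hR).mono fun t ht => ht.1.le
  have key : ∀ u ∈ radialClosed R1 R2, ∀ v ∈ radialClosed R1 R2, u ≤ v → κ * r ≤ u →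
      |φ' v / (v * b v) - φ' u / (u * b u)| ≤
        L / c * (κ ^ 2)⁻¹ * (κ ^ 4)⁻¹ / r ^ 2 * rwt 0 4 r *
          |flux R1 R2 b v - flux R1 R2 b u| := by
    intro u hu v hv huv hru
    have hI := Ioo_subset_radial hu hv
    have hIcc := convex_radialClosed.ordConnected.out hu hv
    refine abs_sub_le_of_abs_deriv_le huv (hcont.mono hIcc) (hY.mono hIcc)
      (fun t ht => hd t (hI ht)) (fun t ht => hb.hasDerivAt_flux h₁ hR (radial_pos h₁ (hI ht)))
      (fun t ht => ?_) fun t ht => ?_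
    · have := rclamp_eq (radial_subset_radialClosed h₁ (hI ht))
      rw [this]
      exact mul_pos (radial_pos h₁ (hI ht)) (hc.trans_le (hb.lower t (hIcc ⟨ht.1.le, ht.2.le⟩)))
    · have ht0 := radial_pos h₁ (hI ht)
      have htc := hIcc ⟨ht.1.le, ht.2.le⟩
      rw [rclamp_eq htc]
      have hrt : κ * r ≤ t := hru.trans ht.1.le
      have hw := rwt_zero_scale (k := 4) k0 k1 hr0 hrt
      have hwp := rwt_pos (j := 0) (k := 4) hr0
      have h5 : 1 / t ^ 2 ≤ (κ ^ 2)⁻¹ * (1 / r ^ 2) := by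
        rw [← one_div, div_mul_div_comm, one_mul, ← mul_pow]
        exact one_div_le_one_div_of_le (by positivity) (pow_le_pow_left₀ (by positivity) hrt 2)
      have hwt := rwt_pos (j := 0) (k := 4) ht0
      calc |ψ' t| ≤ L / t * rwt 0 4 t := hL t (hI ht)
        _ = L / c * (1 / t ^ 2 * rwt 0 4 t) * (t * c) := by field_simp
        _ ≤ L / c * ((κ ^ 2)⁻¹ * (1 / r ^ 2) * ((κ ^ 4)⁻¹ * rwt 0 4 r)) * (t * b t) := by
            refine mul_le_mul (mul_le_mul_of_nonneg_left ?_ (by positivity))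
              (mul_le_mul_of_nonneg_left (hb.lower t htc) ht0.le) (by positivity) (by positivity)
            exact mul_le_mul h5 hw hwt.le (by positivity)
        _ = _ := by ring
  have hCn : 0 ≤ L / c * (κ ^ 2)⁻¹ * (κ ^ 4)⁻¹ / r ^ 2 * rwt 0 4 r := by
    have := rwt_pos (j := 0) (k := 4) hr0
    positivity
  have hmono := (hb.strictMonoOn_flux h₁ hR).monotoneOn
  rcases le_total r s with h | h
  · obtain ⟨b1, b2⟩ := (rclamp_between (s := s) hr).1 h
    refine (key r hcl x hxm b1 (mul_le_of_le_one_left hr0.le k1)).trans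
      (mul_le_mul_of_nonneg_left ?_ hCn)
    have m1 := hmono hr0.le hxm.1.le b1
    have m2 := hmono hxm.1.le a1.le b2
    rw [a2] at m2
    rw [abs_of_nonneg (by linarith), abs_of_nonneg (by linarith)]
    linarith
  · obtain ⟨b1, b2⟩ := (rclamp_between (s := s) hr).2 h
    rw [abs_sub_comm]
    refine (key x hxm r hcl b2 hs2).trans (mul_le_mul_of_nonneg_left ?_ hCn)
    have m1 := hmono hxm.1.le hr0.le b2
    have m2 := hmono a1.le hxm.1.le b1
    rw [a2] at m2
    rw [abs_of_nonneg (by linarith), abs_sub_comm, abs_of_nonneg (by linarith)]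
    linarith

/-- First order Taylor expansion in the flux, uniformly on compact radial intervals. -/
theorem exists_uniform_taylor {ψ ψ' : ℝ → ℝ} (hd : ∀ r ∈ radial R1 R2, HasDerivAt ψ (ψ' r) r)
    (hψ' : ContinuousOn ψ' (radial R1 R2)) {a a' : ℝ} (ha : a ∈ radial R1 R2)
    (ha' : a' ∈ radial R1 R2) {η : ℝ} (hη : 0 < η) :
    ∃ τ > 0, ∀ r ∈ Icc a a', ∀ y, |y - flux R1 R2 b r| ≤ τ → 0 < y ∧
      ∃ s ∈ radial R1 R2, flux R1 R2 b s = y ∧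
        |ψ s - ψ r - ψ' r / (r * b r) * (y - flux R1 R2 b r)| ≤ η * |y - flux R1 R2 b r| := by
  have hc := hb.c_pos
  have ha0 := radial_pos h₁ ha
  have hcl := radial_subset_radialClosed (R2 := R2) h₁
  have hcomp : IsCompact (Icc a a') := isCompact_Icc
  have hsub : Icc a a' ⊆ radial R1 R2 := ordConnected_radial.out ha ha'
  have hp : ContinuousOn (fun r => ψ' r / (r * b r)) (radial R1 R2) :=
    hψ'.div (continuousOn_id.mul (hb.cont.mono hcl)) fun t ht =>
      (mul_pos (radial_pos h₁ ht) (hc.trans_le (hb.lower t (hcl ht)))).ne'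
  obtain ⟨δ₁, hδ₁, hball⟩ := hcomp.exists_cthickening_subset_open isOpen_radial hsub
  have huc := hcomp.uniformContinuousAt_of_continuousAt (fun r => ψ' r / (r * b r))
    (fun r hr => hp.continuousAt (isOpen_radial.mem_nhds (hsub hr))) (Metric.dist_mem_uniformity hη)
  obtain ⟨δ₂, hδ₂, hun⟩ := Metric.mem_uniformity_dist.1 huc
  set δ := min (min δ₁ δ₂) a / 2 with hδ
  have hδ0 : 0 < δ := by positivity
  have hδa : δ < a := by
    have : min (min δ₁ δ₂) a ≤ a := min_le_right _ _
    have : 0 < min (min δ₁ δ₂) a := by positivity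
    linarith
  have hδ1 : δ ≤ δ₁ := by
    have : min (min δ₁ δ₂) a ≤ δ₁ := (min_le_left _ _).trans (min_le_left _ _)
    linarith
  have hδ2 : δ < δ₂ := by
    have : min (min δ₁ δ₂) a ≤ δ₂ := (min_le_left _ _).trans (min_le_right _ _)
    linarith
  have hmono := hb.strictMonoOn_flux h₁ hR
  refine ⟨c / 2 * a * δ, by positivity, fun r hr y hy => ?_⟩
  have hrI := hsub hr
  have hr0 := radial_pos h₁ hrI
  have har : a ≤ r := hr.1
  have hcr := (hb.flux_bounds h₁ hR hr0.le).1
  have hy0 : 0 < y := by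
    have h1 := (abs_le.1 hy).1
    have h2 : c / 2 * a * δ < c / 2 * r ^ 2 := by
      have : a * δ < r ^ 2 := by nlinarith
      nlinarith
    linarith
  obtain ⟨s0, hs⟩ := hb.fluxInv_spec h₁ hR hy0
  set s := fluxInv R1 R2 b y
  have hsr : |s - r| ≤ δ := by
    rcases le_total r s with h | h
    · have h2 := (hb.flux_sub_bounds h₁ hR hr0.le h).1
      rw [hs] at h2
      have h3 := (le_abs_self _).trans hy
      rw [abs_of_nonneg (by linarith)]
      have h4 : c / 2 * (a * (s - r)) ≤ c / 2 * (s ^ 2 - r ^ 2) :=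
        mul_le_mul_of_nonneg_left (by nlinarith) (by positivity)
      have h5 : c / 2 * a * (s - r) ≤ c / 2 * a * δ := by linarith
      exact le_of_mul_le_mul_left h5 (by positivity)
    · have h2 := (hb.flux_sub_bounds h₁ hR s0.le h).1
      rw [hs] at h2
      have h3 := (abs_le.1 hy).1
      rw [abs_sub_comm, abs_of_nonneg (by linarith)]
      have h4 : c / 2 * (a * (r - s)) ≤ c / 2 * (r ^ 2 - s ^ 2) :=
        mul_le_mul_of_nonneg_left (by nlinarith) (by positivity)
      have h5 : c / 2 * a * (r - s) ≤ c / 2 * a * δ := by linarith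
      exact le_of_mul_le_mul_left h5 (by positivity)
  have hnear : ∀ t, |t - r| ≤ δ → t ∈ radial R1 R2 := fun t ht => by
    refine hball (Metric.mem_cthickening_of_dist_le t r δ₁ _ hr ?_)
    rw [Real.dist_eq]
    exact ht.trans hδ1
  have hsI := hnear s hsr
  refine ⟨hy0, s, hsI, hs, ?_⟩
  have hdφ : ∀ t ∈ radial R1 R2,
      HasDerivAt (fun t => ψ t - ψ' r / (r * b r) * flux R1 R2 b t)
        (ψ' t - ψ' r / (r * b r) * (t * b t)) t := fun t ht => by
    have := (hd t ht).sub
      ((hb.hasDerivAt_flux h₁ hR (radial_pos h₁ ht)).const_mul (ψ' r / (r * b r)))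
    rwa [rclamp_eq (hcl ht)] at this
  have key : ∀ u ∈ radial R1 R2, ∀ v ∈ radial R1 R2, u ≤ v →
      (∀ t ∈ Icc u v, |t - r| ≤ δ) →
      |(ψ v - ψ' r / (r * b r) * flux R1 R2 b v) - (ψ u - ψ' r / (r * b r) * flux R1 R2 b u)| ≤
        η * |flux R1 R2 b v - flux R1 R2 b u| := by
    intro u hu v hv huv hclose
    have hI : Icc u v ⊆ radial R1 R2 := ordConnected_radial.out hu hv
    refine abs_sub_le_of_abs_deriv_le (Y' := fun t => t * b (rclamp R1 R2 t)) huv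
      (fun t ht => (hdφ t (hI ht)).continuousAt.continuousWithinAt)
      (fun t ht => (hb.hasDerivAt_flux h₁ hR
        (radial_pos h₁ (hI ht))).continuousAt.continuousWithinAt)
      (fun t ht => hdφ t (hI (Ioo_subset_Icc_self ht)))
      (fun t ht => hb.hasDerivAt_flux h₁ hR (radial_pos h₁ (hI (Ioo_subset_Icc_self ht))))
      (fun t ht => ?_) fun t ht => ?_
    all_goals
      have htI := hI (Ioo_subset_Icc_self ht)
      have ht0 := radial_pos h₁ htI
      have hbt := hc.trans_le (hb.lower t (hcl htI))
      simp only [rclamp_eq (hcl htI)]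
    · positivity
    · have h7 := hun (a := r) (b := t) (by
        rw [dist_comm, Real.dist_eq]
        exact (hclose t (Ioo_subset_Icc_self ht)).trans_lt hδ2) hr
      simp only [Set.mem_ofPred_eq, Real.dist_eq] at h7
      have e : ψ' t - ψ' r / (r * b r) * (t * b t) =
          -(ψ' r / (r * b r) - ψ' t / (t * b t)) * (t * b t) := by
        field_simp
        ring
      rw [e, abs_mul, abs_neg, abs_of_pos (mul_pos ht0 hbt)]
      exact mul_le_mul_of_nonneg_right h7.le (by positivity)
  have e1 : ψ s - ψ r - ψ' r / (r * b r) * (y - flux R1 R2 b r) =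
      (ψ s - ψ' r / (r * b r) * flux R1 R2 b s) - (ψ r - ψ' r / (r * b r) * flux R1 R2 b r) := by
    rw [hs]; ring
  rw [e1, ← hs]
  rcases le_total r s with h | h
  · refine key r hrI s hsI h fun t ht => ?_
    rw [abs_of_nonneg (by linarith [ht.1])]
    rw [abs_of_nonneg (by linarith)] at hsr
    linarith [ht.2]
  · rw [abs_sub_comm, abs_sub_comm (flux R1 R2 b s)]
    refine key s hsI r hrI h fun t ht => ?_
    rw [abs_sub_comm, abs_of_nonneg (by linarith [ht.2])]
    rw [abs_sub_comm, abs_of_nonneg (by linarith)] at hsr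
    linarith [ht.1]

end

end PositiveBound

/-- A Lipschitz function with derivative continuous on `(0, ∞)` and vanishing on `(-∞, 0]` is
approximated uniformly by `C¹` functions that agree with it away from `0`. -/
theorem exists_contDiff_approx {Φ D : ℝ → ℝ} {L : ℝ} (hL : ∀ y, |D y| ≤ L)
    (hD : ContinuousOn D (Ioi 0)) (hD0 : ∀ y ≤ 0, D y = 0)
    (hi : ∀ x y, IntervalIntegrable D volume x y) (hΦ : ∀ x y, Φ y - Φ x = ∫ s in x..y, D s)
    {η : ℝ} (hη : 0 < η) :
    ∃ Ψ : ℝ → ℝ, ContDiff ℝ 1 Ψ ∧ (∀ y, |Ψ y - Φ y| ≤ η) ∧ ∀ y, 1 ≤ y → Ψ y = Φ y := by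
  have hL0 : 0 ≤ L := (abs_nonneg _).trans (hL 0)
  set δ := min 1 (η / (L + 1)) with hδ
  have hδ0 : 0 < δ := by positivity
  have hδ1 : δ ≤ 1 := min_le_left _ _
  have hLδ : L * δ ≤ η := by
    have h1 : δ ≤ η / (L + 1) := min_le_right _ _
    rw [le_div_iff₀ (by positivity)] at h1
    nlinarith
  set χ : ℝ → ℝ := fun y => min 1 (max 0 (y / δ)) with hχ
  have hχc : Continuous χ := by fun_prop
  have hχ0 : ∀ y, 0 ≤ χ y := fun y => le_min zero_le_one (le_max_left _ _)
  have hχ1 : ∀ y, χ y ≤ 1 := fun y => min_le_left _ _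
  have hχabs : ∀ y, χ y ≤ |y| / δ := fun y => (min_le_right _ _).trans
    (max_le (by positivity) (div_le_div_of_nonneg_right (le_abs_self y) hδ0.le))
  set D' : ℝ → ℝ := fun y => D y * χ y with hD'
  have hcont : Continuous D' := by
    rw [continuous_iff_continuousAt]
    intro y
    rcases lt_trichotomy y 0 with h | h | h
    · have : (fun _ => (0 : ℝ)) =ᶠ[𝓝 y] D' := by
        filter_upwards [Iio_mem_nhds h] with s hs
        simp [hD', hD0 s (le_of_lt hs)]
      exact (continuousAt_const).congr this
    · subst h
      have e0 : D' 0 = 0 := by simp [hD', hD0 0 le_rfl]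
      rw [ContinuousAt, e0, tendsto_zero_iff_abs_tendsto_zero]
      refine squeeze_zero (g := fun s => L * (|s| / δ)) (fun s => abs_nonneg _) (fun s => ?_) ?_
      · simp only [Function.comp, hD', abs_mul, abs_of_nonneg (hχ0 s)]
        exact mul_le_mul (hL s) (hχabs s) (hχ0 s) hL0
      · have : Continuous fun s : ℝ => L * (|s| / δ) := by fun_prop
        simpa using this.tendsto 0
    · exact (hD.continuousAt (Ioi_mem_nhds h)).mul hχc.continuousAt
  have hdiff : ∀ s, δ ≤ s → D' s - D s = 0 := fun s hs => by
    have : χ s = 1 := by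
      have : 1 ≤ s / δ := (one_le_div hδ0).2 hs
      simp only [hχ]
      rw [max_eq_right (by linarith), min_eq_left this]
    simp [hD', this]
  have hneg : ∀ s, s ≤ 0 → D' s - D s = 0 := fun s hs => by simp [hD', hD0 s hs]
  have hbd : ∀ s, |D' s - D s| ≤ L := fun s => by
    have e : D' s - D s = -(D s * (1 - χ s)) := by simp only [hD']; ring
    rw [e, abs_neg, abs_mul, abs_of_nonneg (sub_nonneg.2 (hχ1 s))]
    have := hL s
    have := hχ0 s
    nlinarith [abs_nonneg (D s)]
  have hiD' : ∀ x y, IntervalIntegrable D' volume x y := fun x y => hcont.intervalIntegrable _ _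
  set Ψ : ℝ → ℝ := fun y => Φ 1 + ∫ s in (1 : ℝ)..y, D' s with hΨ
  have hder : ∀ y, HasDerivAt Ψ (D' y) y := fun y =>
    (hcont.integral_hasStrictDerivAt 1 y).hasDerivAt.const_add _
  have hsub : ∀ y, Ψ y - Φ y = ∫ s in (1 : ℝ)..y, (D' s - D s) := fun y => by
    rw [intervalIntegral.integral_sub (hiD' _ _) (hi _ _), ← hΦ 1 y]
    simp only [hΨ]
    ring
  have hge : ∀ y, δ ≤ y → Ψ y - Φ y = 0 := fun y hy => by
    rw [hsub]
    refine intervalIntegral.integral_zero_ae (Eventually.of_forall fun s hs => hdiff s ?_)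
    exact (le_min hδ1 hy).trans hs.1.le
  have hmid : ∀ x y, (Ψ y - Φ y) - (Ψ x - Φ x) = ∫ s in x..y, (D' s - D s) := fun x y => by
    rw [hsub, hsub]
    exact intervalIntegral.integral_interval_sub_left ((hiD' _ _).sub (hi _ _))
      ((hiD' _ _).sub (hi _ _))
  have hpos : ∀ y, 0 ≤ y → |Ψ y - Φ y| ≤ η := fun y hy => by
    rcases le_total δ y with h | h
    · rw [hge y h, abs_zero]; exact hη.le
    · have h1 := hmid δ y
      rw [hge δ le_rfl, sub_zero] at h1
      rw [h1]
      refine (intervalIntegral.norm_integral_le_of_norm_le_const (C := L)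
        (f := fun s => D' s - D s) fun s _ => hbd s).trans ?_
      rw [abs_sub_comm, abs_of_nonneg (by linarith)]
      nlinarith
  refine ⟨Ψ, ?_, fun y => ?_, fun y hy => sub_eq_zero.1 (hge y (hδ1.trans hy))⟩
  · rw [contDiff_one_iff_deriv]
    refine ⟨fun y => (hder y).differentiableAt, ?_⟩
    rw [funext fun y => (hder y).deriv]
    exact hcont
  · rcases le_total 0 y with h | h
    · exact hpos y h
    · have h1 := hmid 0 y
      have h2 : ∫ s in (0 : ℝ)..y, (D' s - D s) = 0 := by
        refine intervalIntegral.integral_zero_ae (Eventually.of_forall fun s hs => hneg s ?_)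
        rw [uIoc_of_ge h] at hs
        exact hs.2
      have h3 : Ψ y - Φ y = Ψ 0 - Φ 0 := by linarith
      rw [h3]
      exact hpos 0 le_rfl

end Slopes

/-! ### The energy-Casimir density -/

section CasimirData

variable {R1 : ℝ} {R2 : EReal}

/-- Casimir functions `f` and `Φ` of the flux for which the steady state is a critical point of
the energy-Casimir functional, with the estimates for the remainder. -/
structure CasimirData (R1 : ℝ) (R2 : EReal) (ω b b₁ : ℝ → ℝ) (ε : ℝ) (y₀ f F Φ D₀ : ℝ → ℝ)
    (C : ℝ) : Prop where
  deriv_f : ∀ y, HasDerivAt f (F y) y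
  cont_F : Continuous F
  cont_Φ : Continuous Φ
  approx : ∀ η > 0, ∃ Ψ : ℝ → ℝ, ContDiff ℝ 1 Ψ ∧ (∀ y, |Ψ y - Φ y| ≤ η) ∧
    ∀ y, 1 ≤ y → Ψ y = Φ y
  Φ_eq : ∀ r ∈ radial R1 R2, Φ (y₀ r) = -ω r
  linear : ∀ r ∈ radial R1 R2, F (y₀ r) + r ^ 2 * ω r * D₀ r = ε ^ 2 * (b₁ r / r)
  C_nonneg : 0 ≤ C
  F_bound : ∀ r ∈ radial R1 R2, |F (y₀ r)| ≤ C * (r ^ 2 * wt r)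
  est_f : ∀ r ∈ radial R1 R2, ∀ h,
    |f (y₀ r + h) - f (y₀ r) - F (y₀ r) * h| ≤ C * (wt r * (h ^ 2 + h ^ 4))
  est_Φ : ∀ r ∈ radial R1 R2, ∀ h,
    r ^ 2 * (Φ (y₀ r + h) - Φ (y₀ r)) ^ 2 ≤ C * (wt r * (h ^ 2 + h ^ 4))
  est_ωΦ : ∀ r ∈ radial R1 R2, ∀ h,
    |r ^ 2 * ω r * (Φ (y₀ r + h) - Φ (y₀ r) - D₀ r * h)| ≤ C * (wt r * (h ^ 2 + h ^ 4))
  taylor : ∀ a ∈ radial R1 R2, ∀ a' ∈ radial R1 R2, ∀ η > 0, ∃ τ > 0, ∀ r ∈ Icc a a', ∀ h,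
    |h| ≤ τ → |f (y₀ r + h) - f (y₀ r) - 1 / 2 * (r ^ 2 * (Φ (y₀ r + h) - Φ (y₀ r)) ^ 2) +
      r ^ 2 * ω r * (Φ (y₀ r + h) - Φ (y₀ r)) - ε ^ 2 * (b₁ r / r) * h -
      1 / 2 * (ε ^ 2 * frakF ω b ε r * h ^ 2)| ≤ η * h ^ 2

namespace ProfileBound

variable {ω ω₁ ω₂ b b₁ b₂ : ℝ → ℝ} {c K : ℝ}

theorem positiveBound (hP : ProfileBound R1 R2 ω ω₁ ω₂ b b₁ b₂ c K) : PositiveBound R1 R2 b c K :=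
  ⟨hP.cont_b, hP.c_pos, hP.lower_b, hP.upper_b⟩

/-- The derivative of the magnetic potential with respect to the flux. -/
def dens (ω ω₁ b b₁ : ℝ → ℝ) (ε r : ℝ) : ℝ := r * ω r * ω₁ r / b r + ε ^ 2 * (b₁ r / r)

/-- The radial derivative of `dens`. -/
def dens' (ω ω₁ ω₂ b b₁ b₂ : ℝ → ℝ) (ε r : ℝ) : ℝ :=
  (ω r * ω₁ r + r * ω₁ r ^ 2 + r * ω r * ω₂ r) / b r - r * ω r * ω₁ r * b₁ r / b r ^ 2 +
    ε ^ 2 * (b₂ r / r - b₁ r / r ^ 2)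

/-- The radial derivative of `-ω₁ / (r b)`. -/
def slope' (ω₁ ω₂ b b₁ : ℝ → ℝ) (r : ℝ) : ℝ :=
  -(ω₂ r / (r * b r)) + ω₁ r / (r ^ 2 * b r) + ω₁ r * b₁ r / (r * b r ^ 2)

theorem hasDerivAt_dens (hP : ProfileBound R1 R2 ω ω₁ ω₂ b b₁ b₂ c K) (h₁ : 0 ≤ R1) (ε : ℝ)
    {r : ℝ} (hr : r ∈ radial R1 R2) :
    HasDerivAt (dens ω ω₁ b b₁ ε) (dens' ω ω₁ ω₂ b b₁ b₂ ε r) r := by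
  have hr0 := radial_pos h₁ hr
  have hb : b r ≠ 0 :=
    (hP.c_pos.trans_le (hP.lower_b r (radial_subset_radialClosed h₁ hr))).ne'
  have h1 := (((hasDerivAt_id r).mul (hP.deriv_ω r hr)).mul (hP.deriv_ω₁ r hr)).div
    (hP.deriv_b r hr) hb
  have h2 := (((hP.deriv_b₁ r hr).div (hasDerivAt_id r) hr0.ne').const_mul (ε ^ 2))
  refine (h1.add h2).congr_deriv ?_
  simp only [dens', Pi.mul_apply, id]
  field_simp

theorem hasDerivAt_slope (hP : ProfileBound R1 R2 ω ω₁ ω₂ b b₁ b₂ c K) (h₁ : 0 ≤ R1)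
    {r : ℝ} (hr : r ∈ radial R1 R2) :
    HasDerivAt (fun r => -ω₁ r / (r * b r)) (slope' ω₁ ω₂ b b₁ r) r := by
  have hr0 := radial_pos h₁ hr
  have hb : b r ≠ 0 :=
    (hP.c_pos.trans_le (hP.lower_b r (radial_subset_radialClosed h₁ hr))).ne'
  have h1 := (hP.deriv_ω₁ r hr).neg.div ((hasDerivAt_id r).mul (hP.deriv_b r hr))
    (mul_ne_zero hr0.ne' hb)
  refine h1.congr_deriv ?_
  simp only [slope', Pi.mul_apply, Pi.neg_apply, id]
  field_simp
  ring

theorem continuousOn_dens' (hP : ProfileBound R1 R2 ω ω₁ ω₂ b b₁ b₂ c K) (ε : ℝ) :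
    ContinuousOn (dens' ω ω₁ ω₂ b b₁ b₂ ε) (radialClosed R1 R2) := by
  have c0 := hP.cont_ω
  have c1 := hP.cont_ω₁
  have c2 := hP.cont_ω₂
  have d0 := hP.cont_b
  have d1 := hP.cont_b₁
  have d2 := hP.cont_b₂
  have hne : ∀ r ∈ radialClosed R1 R2, r ≠ 0 ∧ b r ≠ 0 := fun r hr =>
    ⟨hr.1.ne', (hP.c_pos.trans_le (hP.lower_b r hr)).ne'⟩
  unfold dens'
  refine ContinuousOn.add (ContinuousOn.sub (ContinuousOn.div (by fun_prop) d0 fun r hr =>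
    (hne r hr).2) (ContinuousOn.div (by fun_prop) (by fun_prop) fun r hr =>
      pow_ne_zero _ (hne r hr).2)) (continuousOn_const.mul (ContinuousOn.sub
        (ContinuousOn.div d2 (by fun_prop) fun r hr => (hne r hr).1)
        (ContinuousOn.div d1 (by fun_prop) fun r hr => pow_ne_zero _ (hne r hr).1)))

theorem continuousOn_slope' (hP : ProfileBound R1 R2 ω ω₁ ω₂ b b₁ b₂ c K) :
    ContinuousOn (slope' ω₁ ω₂ b b₁) (radialClosed R1 R2) := by
  have c1 := hP.cont_ω₁
  have c2 := hP.cont_ω₂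
  have d0 := hP.cont_b
  have d1 := hP.cont_b₁
  have hne : ∀ r ∈ radialClosed R1 R2, r ≠ 0 ∧ b r ≠ 0 := fun r hr =>
    ⟨hr.1.ne', (hP.c_pos.trans_le (hP.lower_b r hr)).ne'⟩
  unfold slope'
  refine ContinuousOn.add (ContinuousOn.add (ContinuousOn.neg (ContinuousOn.div c2 (by fun_prop)
    fun r hr => mul_ne_zero (hne r hr).1 (hne r hr).2)) (ContinuousOn.div c1 (by fun_prop)
    fun r hr => mul_ne_zero (pow_ne_zero _ (hne r hr).1) (hne r hr).2))
    (ContinuousOn.div (by fun_prop) (by fun_prop)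
    fun r hr => mul_ne_zero (hne r hr).1 (pow_ne_zero _ (hne r hr).2))

theorem rwt_product {r : ℝ} (hr : 0 < r) : rwt 0 2 r * rwt 0 4 r ≤ 2 * rwt 0 6 r ∧
    r ^ 2 * rwt 0 4 r ≤ 2 * rwt 0 2 r ∧ r ^ 4 * rwt 0 6 r ≤ 1 := by
  simp only [rwt, pow_zero]
  refine ⟨?_, ?_, ?_⟩
  · rw [div_mul_div_comm, one_mul, mul_one_div, div_le_div_iff₀ (by positivity) (by positivity)]
    nlinarith [pow_pos hr 2, pow_pos hr 4, pow_pos hr 6]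
  · rw [mul_one_div, mul_one_div, div_le_div_iff₀ (by positivity) (by positivity)]
    nlinarith [sq_nonneg (r ^ 2 - 1), pow_pos hr 4]
  · rw [mul_one_div, div_le_one (by positivity)]
    exact pow_le_one_add_pow hr.le (by norm_num)

theorem rwt_eq_mul (j k : ℕ) (r : ℝ) : rwt j k r = r ^ j * rwt 0 k r := by
  simp [rwt, div_eq_mul_inv]

theorem abs_dens_le (hP : ProfileBound R1 R2 ω ω₁ ω₂ b b₁ b₂ c K) (ε : ℝ) {r : ℝ}
    (hr : r ∈ radialClosed R1 R2) :
    |dens ω ω₁ b b₁ ε r| ≤ (2 * K ^ 2 / c + ε ^ 2 * K) * (r ^ 2 * wt r) := by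
  have hr0 := hr.1
  have hc := hP.c_pos
  have hK := hP.K_nonneg
  have hb := hP.lower_b r hr
  obtain ⟨w1, w2, w3⟩ := rwt_product hr0
  have hω := hP.bound_ω r hr
  have hω₁ := hP.bound_ω₁ r hr
  have hb₁ := hP.bound_b₁ r hr
  rw [rwt_eq_mul] at hω₁ hb₁
  rw [wt_eq_rwt]
  have p2 := rwt_pos (j := 0) (k := 2) hr0
  have p4 := rwt_pos (j := 0) (k := 4) hr0
  have p6 := rwt_pos (j := 0) (k := 6) hr0
  have e1 : |r * ω r * ω₁ r / b r| ≤ 2 * K ^ 2 / c * (r ^ 2 * rwt 0 6 r) := by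
    rw [abs_div, abs_mul, abs_mul, abs_of_pos hr0, abs_of_pos (hc.trans_le hb)]
    calc r * |ω r| * |ω₁ r| / b r ≤ r * (K * rwt 0 2 r) * (K * (r ^ 1 * rwt 0 4 r)) / c := by
          gcongr
      _ = K ^ 2 / c * r ^ 2 * (rwt 0 2 r * rwt 0 4 r) := by ring
      _ ≤ K ^ 2 / c * r ^ 2 * (2 * rwt 0 6 r) := mul_le_mul_of_nonneg_left w1 (by positivity)
      _ = _ := by ring
  have e2 : |ε ^ 2 * (b₁ r / r)| ≤ ε ^ 2 * K * (r ^ 2 * rwt 0 6 r) := by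
    rw [abs_mul, abs_div, abs_of_pos hr0, abs_of_nonneg (sq_nonneg ε)]
    calc ε ^ 2 * (|b₁ r| / r) ≤ ε ^ 2 * (K * (r ^ 3 * rwt 0 6 r) / r) := by gcongr
      _ = _ := by field_simp
  rw [dens, add_mul]
  exact (abs_add_le _ _).trans (add_le_add e1 e2)

theorem abs_dens'_le (hP : ProfileBound R1 R2 ω ω₁ ω₂ b b₁ b₂ c K) (ε : ℝ) :
    ∃ L, 0 ≤ L ∧ ∀ r ∈ radialClosed R1 R2,
      |dens' ω ω₁ ω₂ b b₁ b₂ ε r| ≤ L * (r * rwt 0 6 r) := by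
  have hc := hP.c_pos
  have hK := hP.K_nonneg
  refine ⟨(2 * K ^ 2 / c + 4 * K ^ 2 / c + 2 * K ^ 2 / c) + 2 * K ^ 3 / c ^ 2 +
    ε ^ 2 * (K + K), by positivity, fun r hr => ?_⟩
  have hr0 := hr.1
  have hb := hP.lower_b r hr
  have hb0 := hc.trans_le hb
  obtain ⟨w1, w2, w3⟩ := rwt_product hr0
  have hω := hP.bound_ω r hr
  have hω₁ := hP.bound_ω₁ r hr
  have hω₂ := hP.bound_ω₂ r hr
  have hb₁ := hP.bound_b₁ r hr
  have hb₂ := hP.bound_b₂ r hr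
  rw [rwt_eq_mul] at hω₁ hb₁ hb₂
  have p2 := rwt_pos (j := 0) (k := 2) hr0
  have p4 := rwt_pos (j := 0) (k := 4) hr0
  have p6 := rwt_pos (j := 0) (k := 6) hr0
  have e1 : |ω r * ω₁ r / b r| ≤ 2 * K ^ 2 / c * (r * rwt 0 6 r) := by
    rw [abs_div, abs_mul, abs_of_pos hb0]
    calc |ω r| * |ω₁ r| / b r ≤ (K * rwt 0 2 r) * (K * (r ^ 1 * rwt 0 4 r)) / c := by
          gcongr
      _ = K ^ 2 / c * r * (rwt 0 2 r * rwt 0 4 r) := by ring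
      _ ≤ K ^ 2 / c * r * (2 * rwt 0 6 r) := mul_le_mul_of_nonneg_left w1 (by positivity)
      _ = _ := by ring
  have e2 : |r * ω₁ r ^ 2 / b r| ≤ 4 * K ^ 2 / c * (r * rwt 0 6 r) := by
    rw [abs_div, abs_mul, abs_pow, abs_of_pos hr0, abs_of_pos hb0]
    calc r * |ω₁ r| ^ 2 / b r ≤ r * (K * (r ^ 1 * rwt 0 4 r)) ^ 2 / c := by
          gcongr
      _ = K ^ 2 / c * r * ((r ^ 2 * rwt 0 4 r) * rwt 0 4 r) := by ring
      _ ≤ K ^ 2 / c * r * ((2 * rwt 0 2 r) * rwt 0 4 r) :=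
          mul_le_mul_of_nonneg_left (mul_le_mul_of_nonneg_right w2 p4.le) (by positivity)
      _ = K ^ 2 / c * r * 2 * (rwt 0 2 r * rwt 0 4 r) := by ring
      _ ≤ K ^ 2 / c * r * 2 * (2 * rwt 0 6 r) := mul_le_mul_of_nonneg_left w1 (by positivity)
      _ = _ := by ring
  have e3 : |r * ω r * ω₂ r / b r| ≤ 2 * K ^ 2 / c * (r * rwt 0 6 r) := by
    rw [abs_div, abs_mul, abs_mul, abs_of_pos hr0, abs_of_pos hb0]
    calc r * |ω r| * |ω₂ r| / b r ≤ r * (K * rwt 0 2 r) * (K * rwt 0 4 r) / c := by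
          gcongr
      _ = K ^ 2 / c * r * (rwt 0 2 r * rwt 0 4 r) := by ring
      _ ≤ K ^ 2 / c * r * (2 * rwt 0 6 r) := mul_le_mul_of_nonneg_left w1 (by positivity)
      _ = _ := by ring
  have e4 : |r * ω r * ω₁ r * b₁ r / b r ^ 2| ≤ 2 * K ^ 3 / c ^ 2 * (r * rwt 0 6 r) := by
    rw [abs_div, abs_mul, abs_mul, abs_mul, abs_of_pos hr0, abs_of_pos (pow_pos hb0 2)]
    calc r * |ω r| * |ω₁ r| * |b₁ r| / b r ^ 2 ≤
          r * (K * rwt 0 2 r) * (K * (r ^ 1 * rwt 0 4 r)) * (K * (r ^ 3 * rwt 0 6 r)) / c ^ 2 := by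
          gcongr
      _ = K ^ 3 / c ^ 2 * r * (rwt 0 2 r * rwt 0 4 r * (r ^ 4 * rwt 0 6 r)) := by ring
      _ ≤ K ^ 3 / c ^ 2 * r * (2 * rwt 0 6 r * 1) :=
          mul_le_mul_of_nonneg_left (mul_le_mul w1 w3 (by positivity) (by positivity))
            (by positivity)
      _ = _ := by ring
  have e5 : |b₂ r / r| ≤ K * (r * rwt 0 6 r) := by
    rw [abs_div, abs_of_pos hr0, div_le_iff₀ hr0]
    exact hb₂.trans_eq (by ring)
  have e6 : |b₁ r / r ^ 2| ≤ K * (r * rwt 0 6 r) := by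
    rw [abs_div, abs_of_pos (pow_pos hr0 2), div_le_iff₀ (pow_pos hr0 2)]
    exact hb₁.trans_eq (by ring)
  have e56 : |ε ^ 2 * (b₂ r / r - b₁ r / r ^ 2)| ≤ ε ^ 2 * (K + K) * (r * rwt 0 6 r) := by
    rw [abs_mul, abs_of_nonneg (sq_nonneg ε), mul_assoc]
    refine mul_le_mul_of_nonneg_left ((abs_sub _ _).trans ?_) (sq_nonneg ε)
    rw [add_mul]
    exact add_le_add e5 e6
  rw [dens', add_div, add_div]
  have t1 := abs_add_le (ω r * ω₁ r / b r + r * ω₁ r ^ 2 / b r) (r * ω r * ω₂ r / b r)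
  have t2 := abs_add_le (ω r * ω₁ r / b r) (r * ω₁ r ^ 2 / b r)
  have t3 := abs_sub (ω r * ω₁ r / b r + r * ω₁ r ^ 2 / b r + r * ω r * ω₂ r / b r)
    (r * ω r * ω₁ r * b₁ r / b r ^ 2)
  have t4 := abs_add_le (ω r * ω₁ r / b r + r * ω₁ r ^ 2 / b r + r * ω r * ω₂ r / b r -
    r * ω r * ω₁ r * b₁ r / b r ^ 2) (ε ^ 2 * (b₂ r / r - b₁ r / r ^ 2))
  simp only [add_mul] at *
  linarith

theorem abs_slope'_le (hP : ProfileBound R1 R2 ω ω₁ ω₂ b b₁ b₂ c K) :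
    ∃ L, 0 ≤ L ∧ ∀ r ∈ radialClosed R1 R2, |slope' ω₁ ω₂ b b₁ r| ≤ L / r * rwt 0 4 r := by
  have hc := hP.c_pos
  have hK := hP.K_nonneg
  refine ⟨K / c + K / c + K ^ 2 / c ^ 2, by positivity, fun r hr => ?_⟩
  have hr0 := hr.1
  have hb := hP.lower_b r hr
  have hb0 := hc.trans_le hb
  obtain ⟨w1, w2, w3⟩ := rwt_product hr0
  have hω₁ := hP.bound_ω₁ r hr
  have hω₂ := hP.bound_ω₂ r hr
  have hb₁ := hP.bound_b₁ r hr
  rw [rwt_eq_mul] at hω₁ hb₁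
  have p4 := rwt_pos (j := 0) (k := 4) hr0
  have p6 := rwt_pos (j := 0) (k := 6) hr0
  have e1 : |-(ω₂ r / (r * b r))| ≤ K / c / r * rwt 0 4 r := by
    rw [abs_neg, abs_div, abs_of_pos (mul_pos hr0 hb0)]
    calc |ω₂ r| / (r * b r) ≤ K * rwt 0 4 r / (r * c) := by gcongr
      _ = _ := by field_simp
  have e2 : |ω₁ r / (r ^ 2 * b r)| ≤ K / c / r * rwt 0 4 r := by
    rw [abs_div, abs_of_pos (mul_pos (pow_pos hr0 2) hb0)]
    calc |ω₁ r| / (r ^ 2 * b r) ≤ K * (r ^ 1 * rwt 0 4 r) / (r ^ 2 * c) := by gcongr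
      _ = _ := by field_simp
  have e3 : |ω₁ r * b₁ r / (r * b r ^ 2)| ≤ K ^ 2 / c ^ 2 / r * rwt 0 4 r := by
    rw [abs_div, abs_mul, abs_of_pos (mul_pos hr0 (pow_pos hb0 2))]
    calc |ω₁ r| * |b₁ r| / (r * b r ^ 2) ≤
          K * (r ^ 1 * rwt 0 4 r) * (K * (r ^ 3 * rwt 0 6 r)) / (r * c ^ 2) := by gcongr
      _ = K ^ 2 / c ^ 2 / r * (rwt 0 4 r) * (r ^ 4 * rwt 0 6 r) := by field_simp
      _ ≤ _ := mul_le_of_le_one_right (by positivity) w3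
  have t1 := abs_add_le (-(ω₂ r / (r * b r)) + ω₁ r / (r ^ 2 * b r)) (ω₁ r * b₁ r / (r * b r ^ 2))
  have t2 := abs_add_le (-(ω₂ r / (r * b r))) (ω₁ r / (r ^ 2 * b r))
  rw [slope', add_div, add_div, add_mul, add_mul]
  linarith

end ProfileBound

end CasimirData

/-! ### Existence of the Casimir functions -/

section CasimirExists

variable {R1 : ℝ} {R2 : EReal}

theorem NearBound.mono {y₀ F : ℝ → ℝ} {k : ℕ} {L L' : ℝ} (hF : NearBound R1 R2 y₀ F k L)
    (h₁ : 0 ≤ R1) (hLL : L ≤ L') : NearBound R1 R2 y₀ F k L' where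
  nonneg := hF.nonneg.trans hLL
  lip y y' := (hF.lip y y').trans (mul_le_mul_of_nonneg_right hLL (abs_nonneg _))
  near r hr y hy := (hF.near r hr y hy).trans (mul_le_mul_of_nonneg_right
    (mul_le_mul_of_nonneg_right hLL (rwt_pos (radial_pos h₁ hr)).le) (abs_nonneg _))
  bdd h y := (hF.bdd h y).trans hLL

theorem NearBound.continuous {y₀ F : ℝ → ℝ} {k : ℕ} {L : ℝ} (hF : NearBound R1 R2 y₀ F k L) :
    Continuous F :=
  (LipschitzWith.of_dist_le_mul (K := ⟨L, hF.nonneg⟩) fun x y => hF.lip x y).continuous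

namespace ProfileBound

variable {ω ω₁ ω₂ b b₁ b₂ : ℝ → ℝ} {c K : ℝ}

theorem second_variation (hP : ProfileBound R1 R2 ω ω₁ ω₂ b b₁ b₂ c K) (h₁ : 0 ≤ R1) {ε : ℝ}
    (hε : ε ≠ 0) {r : ℝ} (hr : r ∈ radial R1 R2) :
    dens' ω ω₁ ω₂ b b₁ b₂ ε r / (r * b r) + r ^ 2 * ω r * (slope' ω₁ ω₂ b b₁ r / (r * b r)) -
      r ^ 2 * (-ω₁ r / (r * b r)) ^ 2 = ε ^ 2 * frakF ω b ε r := by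
  have hr0 := (radial_pos h₁ hr).ne'
  have hb : b r ≠ 0 :=
    (hP.c_pos.trans_le (hP.lower_b r (radial_subset_radialClosed h₁ hr))).ne'
  rw [hP.frakF_eq r hr, dens', slope']
  field_simp
  ring

set_option maxHeartbeats 1600000 in
theorem exists_casimirData (hP : ProfileBound R1 R2 ω ω₁ ω₂ b b₁ b₂ c K) (h₁ : 0 ≤ R1)
    (hR : (R1 : EReal) < R2) {ε : ℝ} (hε : ε ≠ 0) :
    ∃ f F Φ D₀ : ℝ → ℝ, ∃ C, CasimirData R1 R2 ω b b₁ ε (flux R1 R2 b) f F Φ D₀ C := by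
  obtain ⟨r₀, hr₀⟩ := radial_nonempty hR
  have hb := hP.positiveBound
  have hc := hP.c_pos
  have hK := hP.K_nonneg
  have hcl := radial_subset_radialClosed (R2 := R2) h₁
  obtain ⟨L₁, hL₁, hdens'⟩ := hP.abs_dens'_le ε
  obtain ⟨L₂, hL₂, hslope'⟩ := hP.abs_slope'_le
  have hdd : ∀ r ∈ radial R1 R2, HasDerivAt (dens ω ω₁ b b₁ ε) (dens' ω ω₁ ω₂ b b₁ b₂ ε r) r :=
    fun r hr => hP.hasDerivAt_dens h₁ ε hr
  have hωd : ∀ r ∈ radial R1 R2, HasDerivAt (fun r => -ω r) (-ω₁ r) r :=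
    fun r hr => (hP.deriv_ω r hr).neg
  have hω₁c : ContinuousOn (fun r => -ω₁ r) (radialClosed R1 R2) := hP.cont_ω₁.neg
  have hω₁b : ∀ r ∈ radialClosed R1 R2, |(fun r => -ω₁ r) r| ≤ K * (r * rwt 0 4 r) := by
    intro r hr
    have := hP.bound_ω₁ r hr
    rw [rwt_eq_mul, pow_one] at this
    simpa using this
  have hyκ : ∀ r ∈ radial R1 R2, c / 2 * r ^ 2 ≤ flux R1 R2 b r := fun r hr =>
    (hb.flux_bounds h₁ hR (radial_pos h₁ hr).le).1
  obtain ⟨M₁, hF⟩ := hb.nearBound_fluxFun (φ := dens ω ω₁ b b₁ ε) h₁ hR (hP.continuousOn_dens' ε)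
    hL₁ hdens' hdd (B := 2 * K ^ 2 / c + ε ^ 2 * K) (fun r hr => (hP.abs_dens_le ε (hcl hr)).trans
      (mul_le_of_le_one_right (by positivity) (by
        rw [mul_comm]; exact wt_mul_pow_le (radial_pos h₁ hr).le (by norm_num)))) hr₀
  obtain ⟨M₂, hΦ⟩ := hb.nearBound_fluxFun (φ := fun r => -ω r) h₁ hR hω₁c hK hω₁b hωd (B := K)
    (fun r hr => by
      rw [abs_neg]
      exact (hP.bound_ω r (hcl hr)).trans (mul_le_of_le_one_right hK
        (rwt_zero_le_one (radial_pos h₁ hr)))) hr₀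
  set F := fluxFun R1 R2 b (dens ω ω₁ b b₁ ε) (dens' ω ω₁ ω₂ b b₁ b₂ ε) r₀ with hFdef
  set Φ := fluxFun R1 R2 b (fun r => -ω r) (fun r => -ω₁ r) r₀ with hΦdef
  set D := fluxSlope R1 R2 b (fun r => -ω₁ r) with hDdef
  obtain ⟨C₃, hC₃, hnear⟩ := hb.near_fluxSlope h₁ hR hω₁c
    (fun r hr => hP.hasDerivAt_slope h₁ hr) hL₂ fun r hr => hslope' r (hcl hr)
  have hFc : Continuous F := hF.continuous
  set f : ℝ → ℝ := fun y => ∫ s in (0 : ℝ)..y, F s with hf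
  have hfd : ∀ y, HasDerivAt f (F y) y := fun y =>
    (hFc.integral_hasStrictDerivAt 0 y).hasDerivAt
  have hΦd : ∀ y > 0, HasDerivAt Φ (D y) y := fun y hy =>
    hb.hasDerivAt_fluxFun h₁ hR hω₁c hK hω₁b hy
  have hF0 : ∀ r ∈ radial R1 R2, F (flux R1 R2 b r) = dens ω ω₁ b b₁ ε r := fun r hr =>
    hb.fluxFun_flux h₁ hR (hP.continuousOn_dens' ε) hL₁ hdens' hdd hr₀ hr
  have hΦ0 : ∀ r ∈ radial R1 R2, Φ (flux R1 R2 b r) = -ω r := fun r hr =>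
    hb.fluxFun_flux h₁ hR hω₁c hK hω₁b hωd hr₀ hr
  have hD0 : ∀ r ∈ radial R1 R2, D (flux R1 R2 b r) = -ω₁ r / (r * b r) := fun r hr =>
    hb.fluxSlope_flux h₁ hR (hcl hr)
  obtain ⟨B₁, hB₁, est1⟩ := hF.exists_primitive_bound h₁ hR (half_pos hc) hyκ hfd
  obtain ⟨B₂, hB₂, est2⟩ := hΦ.exists_sq_bound h₁ hR (half_pos hc) hyκ
  have hDb := hb.abs_fluxSlope_le_const h₁ hR hK hω₁b
  obtain ⟨B₃, hB₃, est3⟩ := (hΦ.mono h₁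
    (show M₂ ≤ M₂ + (K / c + C₃) by linarith [show 0 ≤ K / c + C₃ by positivity])).exists_second_order_bound
      (D := D) (ω := ω) h₁ hR (half_pos hc) hyκ hΦd hK (fun r hr => hP.bound_ω r (hcl hr))
      (fun r hr => (hDb _).trans (by linarith [hΦ.nonneg])) fun r hr y hy => by
        refine (hnear r hr y hy).trans ?_
        have hr0 := radial_pos h₁ hr
        have hw := rwt_pos (j := 0) (k := 4) hr0
        have h0 := hΦ.nonneg
        have h2 : 0 ≤ K / c := by positivity
        refine mul_le_mul_of_nonneg_right (mul_le_mul_of_nonneg_right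
          (div_le_div_of_nonneg_right (by linarith) (sq_nonneg r)) hw.le) (abs_nonneg _)
  set C := B₁ + B₂ + B₃ + (2 * K ^ 2 / c + ε ^ 2 * K) with hC
  have hB₄ : 0 ≤ 2 * K ^ 2 / c + ε ^ 2 * K := by positivity
  have wpos : ∀ (r h : ℝ), 0 ≤ wt r * (h ^ 2 + h ^ 4) := fun r h => by
    have := wt_pos r
    positivity
  refine ⟨f, F, Φ, fun r => -ω₁ r / (r * b r), C, ⟨hfd, hFc, hΦ.continuous, fun η hη => ?_, hΦ0,
    fun r hr => ?_, by positivity, fun r hr => ?_, fun r hr h => ?_, fun r hr h => ?_,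
    fun r hr h => ?_, fun a ha a' ha' η hη => ?_⟩⟩
  · refine exists_contDiff_approx hDb (hb.continuousOn_clamped h₁ hR hω₁c) (fun y hy => ?_)
      (hb.intervalIntegrable_fluxSlope h₁ hR hω₁c hK hω₁b)
      (hb.fluxFun_sub h₁ hR hω₁c hK hω₁b r₀) hη
    rw [fluxSlope, if_neg (not_lt.2 hy)]
  · have hr0 := (radial_pos h₁ hr).ne'
    have hb0 : b r ≠ 0 := (hc.trans_le (hP.lower_b r (hcl hr))).ne'
    rw [hF0 r hr, dens]
    field_simp
    ring
  · rw [hF0 r hr]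
    refine (hP.abs_dens_le ε (hcl hr)).trans (mul_le_mul_of_nonneg_right (by linarith) ?_)
    have := wt_pos r
    positivity
  · exact (est1 r hr h).trans (mul_le_mul_of_nonneg_right (by linarith) (wpos r h))
  · exact (est2 r hr h).trans (mul_le_mul_of_nonneg_right (by linarith) (wpos r h))
  · have := est3 r hr h
    rw [hD0 r hr] at this
    exact this.trans (mul_le_mul_of_nonneg_right (by linarith) (wpos r h))
  · have hsub : Icc a a' ⊆ radial R1 R2 := ordConnected_radial.out ha ha'
    have ha'0 := radial_pos h₁ ha'
    obtain ⟨P, hPb⟩ := isCompact_Icc.exists_bound_of_continuousOn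
      (f := fun r => slope' ω₁ ω₂ b b₁ r / (r * b r)) (s := Icc a a')
      ((hP.continuousOn_slope'.mono (hsub.trans hcl)).div
        (continuousOn_id.mul (hP.cont_b.mono (hsub.trans hcl))) fun r hr =>
          (mul_pos (radial_pos h₁ (hsub hr)) (hc.trans_le (hP.lower_b r (hcl (hsub hr))))).ne')
    set η₁ := η / (4 * (1 + a' ^ 2 * K)) with hη₁
    have hη₁0 : 0 < η₁ := by positivity
    set Q := |P| + η₁ with hQ
    have hQ0 : 0 ≤ Q := by positivity
    obtain ⟨τ₁, hτ₁, ht1⟩ := hb.exists_uniform_taylor h₁ hR hdd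
      ((hP.continuousOn_dens' ε).mono hcl) ha ha' hη₁0
    obtain ⟨τ₂, hτ₂, ht2⟩ := hb.exists_uniform_taylor h₁ hR
      (fun r hr => hP.hasDerivAt_slope h₁ hr) (hP.continuousOn_slope'.mono hcl) ha ha' hη₁0
    set τ₃ := η / (2 * (a' ^ 2 * Q * (2 * (K / c) + Q) + 1)) with hτ₃
    have hτ₃0 : 0 < τ₃ := by positivity
    refine ⟨min (min τ₁ τ₂) (min τ₃ 1), by positivity, fun r hr h hh => ?_⟩
    have h1 : |h| ≤ τ₁ := hh.trans ((min_le_left _ _).trans (min_le_left _ _))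
    have h2 : |h| ≤ τ₂ := hh.trans ((min_le_left _ _).trans (min_le_right _ _))
    have h3 : |h| ≤ τ₃ := hh.trans ((min_le_right _ _).trans (min_le_left _ _))
    have h4 : |h| ≤ 1 := hh.trans ((min_le_right _ _).trans (min_le_right _ _))
    have hrI := hsub hr
    have hr0 := radial_pos h₁ hrI
    set y₀ := flux R1 R2 b r with hy₀
    have habs : ∀ s ∈ uIcc y₀ (y₀ + h), |s - y₀| ≤ |h| := fun s hs => by
      simpa using abs_sub_left_of_mem_uIcc hs
    have q1 := abs_sub_quadratic_le (f := f) (F := F) (a := y₀) (h := h)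
      (p := dens' ω ω₁ ω₂ b b₁ b₂ ε r / (r * b r)) hη₁0.le (fun s _ => hfd s) fun s hs => by
        obtain ⟨-, t, htI, hts, hle⟩ := ht1 r hr s ((habs s hs).trans h1)
        rw [← hts, hF0 t htI, hts, hF0 r hrI]
        exact hle
    have q2 := abs_sub_quadratic_le (f := Φ) (F := D) (a := y₀) (h := h)
      (p := slope' ω₁ ω₂ b b₁ r / (r * b r)) hη₁0.le
      (fun s hs => hΦd s (ht2 r hr s ((habs s hs).trans h2)).1) fun s hs => by
        obtain ⟨-, t, htI, hts, hle⟩ := ht2 r hr s ((habs s hs).trans h2)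
        rw [← hts, hD0 t htI, hts, hD0 r hrI]
        exact hle
    rw [hF0 r hrI] at q1
    rw [hD0 r hrI] at q2
    have hsv := hP.second_variation h₁ hε hrI
    have hD0b : |-ω₁ r / (r * b r)| ≤ K / c := by
      rw [← hD0 r hrI]; exact hDb _
    have hPr : |slope' ω₁ ω₂ b b₁ r / (r * b r)| ≤ |P| :=
      (hPb r hr).trans (le_abs_self P)
    set p := dens' ω ω₁ ω₂ b b₁ b₂ ε r / (r * b r)
    set p' := slope' ω₁ ω₂ b b₁ r / (r * b r)
    set d := -ω₁ r / (r * b r) with hd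
    set e₁ := f (y₀ + h) - f y₀ - dens ω ω₁ b b₁ ε r * h - 1 / 2 * p * h ^ 2 with he₁
    set e₂ := Φ (y₀ + h) - Φ y₀ - d * h - 1 / 2 * p' * h ^ 2 with he₂
    have hlin : dens ω ω₁ b b₁ ε r + r ^ 2 * ω r * d = ε ^ 2 * (b₁ r / r) := by
      have hb0 : b r ≠ 0 := (hc.trans_le (hP.lower_b r (hcl hrI))).ne'
      rw [dens, hd]
      field_simp
      ring
    set u := 1 / 2 * p' * h ^ 2 + e₂ with hu
    have hub : |u| ≤ Q * h ^ 2 := by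
      refine (abs_add_le _ _).trans ?_
      rw [hQ, add_mul]
      refine add_le_add ?_ q2
      rw [abs_mul, abs_mul, abs_of_nonneg (sq_nonneg h), abs_of_pos (show (0 : ℝ) < 1 / 2 by norm_num)]
      refine mul_le_mul_of_nonneg_right ?_ (sq_nonneg h)
      linarith [abs_nonneg p']
    have hΔ : Φ (y₀ + h) - Φ y₀ = d * h + u := by rw [hu, he₂]; ring
    have hmain : f (y₀ + h) - f y₀ - 1 / 2 * (r ^ 2 * (Φ (y₀ + h) - Φ y₀) ^ 2) +
        r ^ 2 * ω r * (Φ (y₀ + h) - Φ y₀) - ε ^ 2 * (b₁ r / r) * h -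
        1 / 2 * (ε ^ 2 * frakF ω b ε r * h ^ 2) =
        e₁ + r ^ 2 * ω r * e₂ - 1 / 2 * r ^ 2 * (u * (2 * (d * h) + u)) := by
      rw [← hsv, ← hlin, hΔ]
      have : e₂ = u - 1 / 2 * p' * h ^ 2 := by rw [hu]; ring
      rw [this, he₁]
      ring
    rw [hmain]
    have hh2 : h ^ 2 = |h| * |h| := by rw [← sq, sq_abs]
    have hωr : |ω r| ≤ K := (hP.bound_ω r (hcl hrI)).trans
      (mul_le_of_le_one_right hK (rwt_zero_le_one hr0))
    have hra : r ^ 2 ≤ a' ^ 2 := pow_le_pow_left₀ hr0.le hr.2 2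
    have b2 : |r ^ 2 * ω r * e₂| ≤ a' ^ 2 * K * (η₁ * h ^ 2) := by
      rw [abs_mul, abs_mul, abs_of_nonneg (sq_nonneg r)]
      exact mul_le_mul (mul_le_mul hra hωr (abs_nonneg _) (sq_nonneg _)) q2 (abs_nonneg _)
        (by positivity)
    have b3 : |1 / 2 * r ^ 2 * (u * (2 * (d * h) + u))| ≤
        1 / 2 * a' ^ 2 * (Q * h ^ 2 * ((2 * (K / c) + Q) * |h|)) := by
      rw [abs_mul, abs_mul u, abs_of_nonneg (show 0 ≤ 1 / 2 * r ^ 2 by positivity)]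
      refine mul_le_mul (by linarith) (mul_le_mul hub ?_ (abs_nonneg _) (by positivity))
        (by positivity) (by positivity)
      refine (abs_add_le _ _).trans ?_
      rw [add_mul, abs_mul, abs_mul, abs_two]
      have n1 : |d| * |h| ≤ K / c * |h| := mul_le_mul_of_nonneg_right hD0b (abs_nonneg h)
      have n2 : Q * h ^ 2 ≤ Q * |h| := by
        refine mul_le_mul_of_nonneg_left ?_ hQ0
        rw [hh2]
        exact mul_le_of_le_one_left (abs_nonneg h) h4
      linarith
    have b4 : 1 / 2 * a' ^ 2 * (Q * h ^ 2 * ((2 * (K / c) + Q) * |h|)) ≤ η / 4 * h ^ 2 := by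
      have n1 : a' ^ 2 * Q * (2 * (K / c) + Q) * |h| ≤ η / 2 := by
        have n2 : a' ^ 2 * Q * (2 * (K / c) + Q) * |h| ≤
            (a' ^ 2 * Q * (2 * (K / c) + Q) + 1) * τ₃ :=
          mul_le_mul (by linarith) h3 (abs_nonneg _) (by positivity)
        refine n2.trans (le_of_eq ?_)
        rw [hτ₃]
        field_simp
      linarith [mul_le_mul_of_nonneg_right n1 (sq_nonneg h)]
    have b5 : η₁ * h ^ 2 + a' ^ 2 * K * (η₁ * h ^ 2) = η / 4 * h ^ 2 := by
      rw [hη₁]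
      field_simp
      try ring
    have t1 := abs_sub (e₁ + r ^ 2 * ω r * e₂) (1 / 2 * r ^ 2 * (u * (2 * (d * h) + u)))
    have t2 := abs_add_le e₁ (r ^ 2 * ω r * e₂)
    linarith [mul_nonneg hη.le (sq_nonneg h)]

end ProfileBound

end CasimirExists

/-! ### The cylindrical measure -/

section Cyl

variable {R1 : ℝ} {R2 : EReal} {F : ℝ × ℝ → ℝ}

theorem ae_cylMeasure {P : ℝ × ℝ → Prop} (h : ∀ᵐ p ∂planeMeasure R1 R2, P p) :
    ∀ᵐ p ∂cylMeasure R1 R2, P p :=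
  Measure.ae_smul_measure ((withDensity_absolutelyContinuous _ _).ae_le h) _

theorem ae_cylMeasure_mem : ∀ᵐ p ∂cylMeasure R1 R2, p.1 ∈ radial R1 R2 :=
  ae_cylMeasure ae_planeMeasure_mem

theorem planeMeasure_absolutelyContinuous (h₁ : 0 ≤ R1) :
    planeMeasure R1 R2 ≪ cylMeasure R1 R2 := by
  have h : planeMeasure R1 R2 ≪
      (planeMeasure R1 R2).withDensity (fun p => ENNReal.ofReal p.1) := by
    refine withDensity_absolutelyContinuous' (by fun_prop) ?_
    filter_upwards [ae_planeMeasure_mem] with p hp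
    simpa using radial_pos h₁ hp
  exact h.trans (Measure.absolutelyContinuous_smul (by simpa using Real.pi_pos))

theorem cylMeasure_absolutelyContinuous : cylMeasure R1 R2 ≪ planeMeasure R1 R2 :=
  fun _ hs => by
    rw [cylMeasure, Measure.smul_apply, withDensity_absolutelyContinuous _ _ hs, smul_zero]

theorem integrable_cylMeasure_iff (h₁ : 0 ≤ R1) :
    Integrable F (cylMeasure R1 R2) ↔ Integrable (fun p => p.1 * F p) (planeMeasure R1 R2) := by
  rw [cylMeasure, integrable_smul_measure (by simpa using Real.pi_pos) ENNReal.ofReal_ne_top,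
    integrable_withDensity_iff_integrable_smul' (by fun_prop) (by simp)]
  refine integrable_congr ?_
  filter_upwards [ae_planeMeasure_mem] with p hp
  rw [ENNReal.toReal_ofReal (radial_pos h₁ hp).le, smul_eq_mul]

theorem integral_cylMeasure (h₁ : 0 ≤ R1) (F : ℝ × ℝ → ℝ) :
    ∫ p, F p ∂cylMeasure R1 R2 = 2 * Real.pi * ∫ p, p.1 * F p ∂planeMeasure R1 R2 := by
  rw [cylMeasure, integral_smul_measure, integral_withDensity_eq_integral_toReal_smul
    (by fun_prop) (by simp), ENNReal.toReal_ofReal Real.two_pi_pos.le, smul_eq_mul]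
  congr 1
  refine integral_congr_ae ?_
  filter_upwards [ae_planeMeasure_mem] with p hp
  rw [ENNReal.toReal_ofReal (radial_pos h₁ hp).le, smul_eq_mul]

theorem measurableSet_fst_lt (R : ℝ) : MeasurableSet {p : ℝ × ℝ | p.1 < R} :=
  measurableSet_lt measurable_fst measurable_const

theorem setIntegral_cylMeasure (h₁ : 0 ≤ R1) (F : ℝ × ℝ → ℝ) (R : ℝ) :
    ∫ p in {p | p.1 < R}, F p ∂cylMeasure R1 R2 =
      2 * Real.pi * ∫ p in {p | p.1 < R}, p.1 * F p ∂planeMeasure R1 R2 := by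
  rw [← integral_indicator (measurableSet_fst_lt R), ← integral_indicator (measurableSet_fst_lt R),
    integral_cylMeasure h₁]
  congr 2
  ext p
  by_cases h : p ∈ {p : ℝ × ℝ | p.1 < R} <;> simp [h]

theorem tendsto_setIntegral_fst_lt (hR : (R1 : EReal) < R2) {ν : Measure (ℝ × ℝ)}
    (hν : ν ≪ planeMeasure R1 R2) (hF : Integrable F ν) :
    Tendsto (fun R => ∫ p in {p | p.1 < R}, F p ∂ν) (toOuter R2) (𝓝 (∫ p, F p ∂ν)) := by
  have := toOuter_isCountablyGenerated (R2 := R2)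
  simp_rw [← integral_indicator (measurableSet_fst_lt _)]
  refine tendsto_integral_filter_of_dominated_convergence (fun p => ‖F p‖)
    (Eventually.of_forall fun R => hF.1.indicator (measurableSet_fst_lt R))
    (Eventually.of_forall fun R => Eventually.of_forall fun p => norm_indicator_le_norm_self _ _)
    hF.norm ?_
  filter_upwards [hν.ae_le ae_planeMeasure_mem] with p hp
  refine tendsto_const_nhds.congr' ?_
  filter_upwards [eventually_lt_toOuter hR hp] with R h
  rw [indicator_of_mem (show p ∈ {p : ℝ × ℝ | p.1 < R} from h)]

end Cyl

/-! ### Perturbations of the steady state -/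

section State

variable {R1 : ℝ} {R2 : EReal} {ω b : ℝ → ℝ} {ε : ℝ} {c K : ℝ}

/-- The normalised perturbation `-(ψ - ψ₀) / ε` of the magnetic potential. -/
def relPot (R1 : ℝ) (b : ℝ → ℝ) (ε : ℝ) (ψ : ℝ → ℝ → ℝ) (p : ℝ × ℝ) : ℝ :=
  -(ψ p.1 p.2 - ψ₀ R1 b ε p.1) / ε

/-- The radial derivative of `relPot`. -/
def relGrad (b : ℝ → ℝ) (ε : ℝ) (H : AxiField) (p : ℝ × ℝ) : ℝ :=
  p.1 * (H.z p.1 p.2 - ε * b p.1) / ε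

/-- The axial derivative of `relPot`. -/
def relAxial (ε : ℝ) (H : AxiField) (p : ℝ × ℝ) : ℝ := -(p.1 * H.r p.1 p.2) / ε

section

variable (hb : PositiveBound R1 R2 b c K) (h₁ : 0 ≤ R1) (hR : (R1 : EReal) < R2)

include hb h₁ hR

theorem PositiveBound.flux_eq {r : ℝ} (hr : r ∈ radial R1 R2) :
    flux R1 R2 b r = flux R1 R2 b R1 + ∫ s in R1..r, s * b s := by
  rw [← sub_eq_iff_eq_add', hb.flux_sub h₁ hR h₁ (radial_pos h₁ hr).le]
  rw [intervalIntegral.integral_of_le hr.1.le, intervalIntegral.integral_of_le hr.1.le]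
  refine setIntegral_congr_fun measurableSet_Ioc fun s hs => ?_
  rw [rclamp_eq (radial_subset_radialClosed h₁ (Ioc_subset_radial hr hs))]

theorem PositiveBound.potential_eq {r : ℝ} (hr : r ∈ radial R1 R2) :
    ψ₀ R1 b ε r = ε * (flux R1 R2 b R1 - flux R1 R2 b r) := by
  rw [hb.flux_eq h₁ hR hr, ψ₀]
  ring

theorem PositiveBound.add_relPot (hε : ε ≠ 0) {ψ : ℝ → ℝ → ℝ} {p : ℝ × ℝ}
    (hp : p.1 ∈ radial R1 R2) :
    flux R1 R2 b p.1 + relPot R1 b ε ψ p = flux R1 R2 b R1 - ψ p.1 p.2 / ε := by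
  rw [relPot, hb.potential_eq h₁ hR hp]
  field_simp
  ring

end

/-- The velocity and magnetic field at one time, with the normalised perturbation `h` of the
magnetic potential. -/
structure IsState (R1 : ℝ) (R2 : EReal) (ω b : ℝ → ℝ) (ε : ℝ) (v H : AxiField)
    (h : ℝ × ℝ → ℝ) : Prop where
  memv : (v - v₀ ω).MemL2 R1 R2
  memH : (H - H₀ b ε).MemL2 R1 R2
  strip : StripPert R1 R2 h (relGrad b ε H) (relAxial ε H)

theorem integrable_sq_of_memLp {α : Type*} [MeasurableSpace α] {μ : Measure α} {f : α → ℝ}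
    (h : MemLp f 2 μ) : Integrable (fun x => f x ^ 2) μ :=
  (memLp_two_iff_integrable_sq h.1).1 h

theorem stripBase_of_memL2 (hb : PositiveBound R1 R2 b c K) (h₁ : 0 ≤ R1)
    (hR : (R1 : EReal) < R2) (hε : ε ≠ 0) {H : AxiField} {ψ : ℝ → ℝ → ℝ} {κ : ℝ}
    (hm : AEStronglyMeasurable (fun p : ℝ × ℝ => ψ p.1 p.2) (planeMeasure R1 R2))
    (hH : (H - H₀ b ε).MemL2 R1 R2)
    (hψ : ∀ᵐ z ∂zMeasure, ∀ r ∈ radial R1 R2, ψ r z = -∫ s in R1..r, s * H.z s z)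
    (hκ : ∀ᵐ z ∂zMeasure,
      Tendsto (fun r => relPot R1 b ε ψ (r, z)) (toOuter R2) (𝓝 κ)) :
    StripBase R1 R2 (relPot R1 b ε ψ) (relGrad b ε H) (relAxial ε H) := by
  have hac := planeMeasure_absolutelyContinuous (R2 := R2) h₁
  have hz : MemLp (fun p : ℝ × ℝ => H.z p.1 p.2 - ε * b p.1) 2 (cylMeasure R1 R2) := hH.2.2
  have hr : MemLp (fun p : ℝ × ℝ => H.r p.1 p.2) 2 (cylMeasure R1 R2) := by
    have := hH.1
    change MemLp (fun p : ℝ × ℝ => H.r p.1 p.2 - 0) 2 (cylMeasure R1 R2) at this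
    simpa using this
  have hbi : ∀ r ∈ radial R1 R2, IntervalIntegrable (fun s => s * b s) volume R1 r := by
    intro r hr'
    refine (hb.intervalIntegrable h₁ hR h₁ (radial_pos h₁ hr').le).congr fun s hs => ?_
    rw [uIoc_of_le hr'.1.le] at hs
    rw [rclamp_eq (radial_subset_radialClosed h₁ (Ioc_subset_radial hr' hs))]
  have ag : AEStronglyMeasurable (relGrad b ε H) (planeMeasure R1 R2) := by
    have := hz.1.mono_ac hac
    unfold relGrad
    simp only [div_eq_mul_inv]
    exact (measurable_fst.aestronglyMeasurable.mul this).mul_const _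
  have ak : AEStronglyMeasurable (relAxial ε H) (planeMeasure R1 R2) := by
    have := hr.1.mono_ac hac
    unfold relAxial
    simp only [div_eq_mul_inv]
    exact (measurable_fst.aestronglyMeasurable.mul this).neg.mul_const _
  have ig : Integrable (fun p => relGrad b ε H p ^ 2 / p.1) (planeMeasure R1 R2) := by
    refine (((integrable_cylMeasure_iff h₁).1 (integrable_sq_of_memLp hz)).div_const
      (ε ^ 2)).congr ?_
    filter_upwards [ae_planeMeasure_mem] with p hp
    have := radial_pos h₁ hp
    simp only [relGrad]
    field_simp
  refine ⟨?_, ag, ak, ig, ?_, ?_, fun _ => ⟨κ, hκ⟩⟩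
  · have h2 : AEStronglyMeasurable (fun p : ℝ × ℝ => ψ₀ R1 b ε p.1) (planeMeasure R1 R2) := by
      refine aestronglyMeasurable_fst (AEStronglyMeasurable.congr
        (f := fun r => ε * (flux R1 R2 b R1 - flux R1 R2 b r)) ?_ ?_)
      · refine (ContinuousOn.aestronglyMeasurable ?_ measurableSet_radial)
        exact continuousOn_const.mul (continuousOn_const.sub
          ((hb.continuousOn_flux h₁ hR).mono fun r hr => (radial_pos h₁ hr).le))
      · filter_upwards [ae_restrict_mem measurableSet_radial] with r hr
        rw [hb.potential_eq h₁ hR hr]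
    unfold relPot
    simp only [div_eq_mul_inv]
    exact (hm.sub h2).neg.mul_const _
  · refine (((integrable_cylMeasure_iff h₁).1 (integrable_sq_of_memLp hr)).div_const
      (ε ^ 2)).congr ?_
    filter_upwards [ae_planeMeasure_mem] with p hp
    have := radial_pos h₁ hp
    simp only [relAxial]
    field_simp
  · filter_upwards [hψ, ag.prodMk_right, ig.prod_left_ae] with z h2 h3 h4 r hr'
    have hi : IntervalIntegrable (fun s => relGrad b ε H (s, z)) volume R1 r :=
      intervalIntegrable_of_sq_div h₁ h3 h4 (mem_insert _ _) (mem_insert_of_mem _ hr')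
    have e : ∫ s in R1..r, s * H.z s z =
        ∫ s in R1..r, (ε * relGrad b ε H (s, z) + ε * (s * b s)) := by
      refine intervalIntegral.integral_congr fun s _ => ?_
      simp only [relGrad]
      field_simp
      ring
    rw [intervalIntegral.integral_add (hi.const_mul _) ((hbi r hr').const_mul _),
      intervalIntegral.integral_const_mul, intervalIntegral.integral_const_mul] at e
    rw [relPot, h2 r hr', e, ψ₀]
    field_simp
    ring

end State

/-! ### The axial derivative of the magnetic potential -/

section Axial

variable {R1 : ℝ} {R2 : EReal} {ω b : ℝ → ℝ} {ε : ℝ} {c K : ℝ}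

theorem StripBase.integrable_compact {h g k : ℝ × ℝ → ℝ} (hs : StripBase R1 R2 h g k)
    (h₁ : 0 ≤ R1) {S : Set ℝ} (hS : IsCompact S) (hSr : S ⊆ radial R1 R2) :
    Integrable h ((volume.restrict S).prod zMeasure) ∧
    Integrable k ((volume.restrict S).prod zMeasure) := by
  have hle : (volume.restrict S).prod zMeasure ≤ planeMeasure R1 R2 :=
    Measure.prod_mono (Measure.restrict_mono hSr le_rfl) le_rfl
  have hmem : ∀ᵐ p : ℝ × ℝ ∂(volume.restrict S).prod zMeasure, p.1 ∈ S :=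
    Measure.quasiMeasurePreserving_fst.ae (ae_restrict_mem hS.measurableSet)
  have i1 : Integrable (fun p : ℝ × ℝ => p.1) ((volume.restrict S).prod zMeasure) :=
    Integrable.comp_fst (f := fun s : ℝ => s) (continuousOn_id.integrableOn_compact hS) zMeasure
  have i2 : Integrable (fun p : ℝ × ℝ => (wt p.1 * p.1)⁻¹) ((volume.restrict S).prod zMeasure) := by
    refine Integrable.comp_fst (f := fun s : ℝ => (wt s * s)⁻¹)
      (ContinuousOn.integrableOn_compact hS (ContinuousOn.inv₀
        (continuous_wt.mul continuous_id).continuousOn fun s hs => ?_)) zMeasure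
    exact (mul_pos (wt_pos s) (radial_pos h₁ (hSr hs))).ne'
  constructor
  · refine Integrable.mono' (((hs.integral_wt_sq_le h₁).1.mono_measure hle).add i2)
      (hs.aesm.mono_measure hle) ?_
    filter_upwards [hmem] with p hp
    have hpos := mul_pos (wt_pos p.1) (radial_pos h₁ (hSr hp))
    have := abs_le_sq_div_add (x := h p) (inv_pos.2 hpos)
    rwa [div_inv_eq_mul, mul_comm (h p ^ 2)] at this
  · refine Integrable.mono' ((hs.int_k.mono_measure hle).add i1) (hs.aesm_k.mono_measure hle) ?_
    filter_upwards [hmem] with p hp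
    exact abs_le_sq_div_add (radial_pos h₁ (hSr hp))

section

variable {ψ : ℝ → ℝ → ℝ} {H : AxiField} (h₁ : 0 ≤ R1) (hε : ε ≠ 0)
    (hs : StripBase R1 R2 (relPot R1 b ε ψ) (relGrad b ε H) (relAxial ε H))
    (hψ₀ : ContinuousOn (ψ₀ R1 b ε) (radial R1 R2))
    (hax : ∀ χ : ℝ × ℝ → ℝ, ContDiff ℝ ((⊤ : ℕ∞) : WithTop ℕ∞) χ →
      (∀ r z, χ (r, z + 2 * Real.pi) = χ (r, z)) →
      (∃ K ⊆ radial R1 R2, IsCompact K ∧ ∀ p, χ p ≠ 0 → p.1 ∈ K) →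
      ∫ p, ψ p.1 p.2 * deriv (fun z => χ (p.1, z)) p.2 ∂(planeMeasure R1 R2) =
        -∫ p, p.1 * H.r p.1 p.2 * χ p ∂(planeMeasure R1 R2))

include h₁ hε hs hψ₀ hax

theorem ae_integral_axial
    {φ φ' : ℝ → ℝ} (hφ : ContDiff ℝ ((⊤ : ℕ∞) : WithTop ℕ∞) φ) (hφ' : ∀ z, HasDerivAt φ (φ' z) z)
    (hφc : Continuous φ') (hper : ∀ z, φ (z + 2 * Real.pi) = φ z)
    (hb1 : ∀ z, |φ z| ≤ 1) {M : ℝ} (hb2 : ∀ z, |φ' z| ≤ M) :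
    ∀ᵐ r ∂volume.restrict (radial R1 R2),
      ∫ z, (relAxial ε H (r, z) * φ z + relPot R1 b ε ψ (r, z) * φ' z) ∂zMeasure = 0 := by
  have hint : ∀ S : Set ℝ, IsCompact S → S ⊆ radial R1 R2 → Integrable (fun p : ℝ × ℝ =>
      relAxial ε H p * φ p.2 + relPot R1 b ε ψ p * φ' p.2) ((volume.restrict S).prod zMeasure) := by
    intro S hS hSr
    obtain ⟨i1, i2⟩ := hs.integrable_compact h₁ hS hSr
    exact (i2.mul_bdd (c := 1) (hφ.continuous.comp continuous_snd).aestronglyMeasurable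
      (Eventually.of_forall fun p => hb1 p.2)).add (i1.mul_bdd (c := M)
      (hφc.comp continuous_snd).aestronglyMeasurable (Eventually.of_forall fun p => hb2 p.2))
  have hφ0 : ∫ z, φ' z ∂zMeasure = 0 := by
    rw [integral_zMeasure, intervalIntegral.integral_eq_sub_of_hasDerivAt (fun z _ => hφ' z)
      (hφc.intervalIntegrable _ _)]
    simpa using sub_eq_zero.2 (hper 0)
  rw [ae_restrict_iff' measurableSet_radial]
  refine IsOpen.ae_eq_zero_of_integral_contDiff_smul_eq_zero isOpen_radial ?_ ?_
  · rw [locallyIntegrableOn_iff isOpen_radial.isLocallyClosed]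
    intro S hSr hS
    exact (hint S hS hSr).integral_prod_left
  intro a ha hac hasub
  have hS : IsCompact (tsupport a) := hac
  have h0 : ∀ r ∉ tsupport a, a r = 0 := fun r hr => image_eq_zero_of_notMem_tsupport hr
  have key := hax (fun p => a p.1 * φ p.2) (by fun_prop) (fun r z => by simp only [hper])
    ⟨tsupport a, hasub, hS, fun p hp => by
      by_contra hn
      exact hp (by simp only [h0 _ hn, zero_mul])⟩
  have hd : ∀ p : ℝ × ℝ, deriv (fun z => a p.1 * φ z) p.2 = a p.1 * φ' p.2 :=
    fun p => ((hφ' p.2).const_mul _).deriv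
  simp only [hd] at key
  obtain ⟨A, hA⟩ := hac.exists_bound_of_continuous ha.continuous
  have toS : ∀ {G : ℝ × ℝ → ℝ}, (∀ p : ℝ × ℝ, p.1 ∉ tsupport a → G p = 0) →
      Integrable G ((volume.restrict (tsupport a)).prod zMeasure) →
      Integrable G (planeMeasure R1 R2) := by
    intro G hG hi
    have e : (volume.restrict (tsupport a)).prod zMeasure =
        (planeMeasure R1 R2).restrict (Prod.fst ⁻¹' tsupport a) := by
      rw [planeMeasure, ← Measure.restrict_restrict_of_subset hasub, ← Measure.restrict_univ
        (μ := zMeasure), Measure.prod_restrict, Measure.restrict_univ, prod_univ]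
    rw [e] at hi
    exact (integrableOn_iff_integrable_of_support_subset fun p hp => by
      by_contra hn
      exact hp (hG p hn)).1 hi
  obtain ⟨i1, i2⟩ := hs.integrable_compact h₁ hS hasub
  have j1 : Integrable (fun p : ℝ × ℝ => a p.1 * (relPot R1 b ε ψ p * φ' p.2))
      (planeMeasure R1 R2) := by
    refine toS (fun p hp => by rw [h0 _ hp, zero_mul]) ?_
    exact (i1.mul_bdd (c := M) (hφc.comp continuous_snd).aestronglyMeasurable
      (Eventually.of_forall fun p => hb2 p.2)).bdd_mul (c := A)
      (ha.continuous.comp continuous_fst).aestronglyMeasurable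
      (Eventually.of_forall fun p => hA p.1)
  have j2 : Integrable (fun p : ℝ × ℝ => a p.1 * (relAxial ε H p * φ p.2))
      (planeMeasure R1 R2) := by
    refine toS (fun p hp => by rw [h0 _ hp, zero_mul]) ?_
    exact (i2.mul_bdd (c := 1) (hφ.continuous.comp continuous_snd).aestronglyMeasurable
      (Eventually.of_forall fun p => hb1 p.2)).bdd_mul (c := A)
      (ha.continuous.comp continuous_fst).aestronglyMeasurable
      (Eventually.of_forall fun p => hA p.1)
  have j3 : Integrable (fun p : ℝ × ℝ => a p.1 * ψ₀ R1 b ε p.1 * φ' p.2)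
      (planeMeasure R1 R2) := by
    refine toS (fun p hp => by rw [h0 _ hp, zero_mul, zero_mul]) ?_
    refine Integrable.mul_prod (f := fun r => a r * ψ₀ R1 b ε r) (g := φ') ?_ ?_
    · exact (ha.continuous.continuousOn.mul (hψ₀.mono hasub)).integrableOn_compact hS
    · exact hφc.integrableOn_Ioc
  have e3 : ∫ p, a p.1 * ψ₀ R1 b ε p.1 * φ' p.2 ∂planeMeasure R1 R2 = 0 := by
    rw [planeMeasure, integral_prod_mul (fun r => a r * ψ₀ R1 b ε r) φ', hφ0, mul_zero]
  have e1 : ∫ p : ℝ × ℝ, ψ p.1 p.2 * (a p.1 * φ' p.2) ∂planeMeasure R1 R2 =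
      -(ε * ∫ p, a p.1 * (relPot R1 b ε ψ p * φ' p.2) ∂planeMeasure R1 R2) := by
    have j5 : Integrable (fun p : ℝ × ℝ => -(ε * (a p.1 * (relPot R1 b ε ψ p * φ' p.2))))
        (planeMeasure R1 R2) := (j1.const_mul ε).neg
    rw [← integral_const_mul, ← integral_neg, ← zero_add (∫ p, -_ ∂_), ← e3, ← integral_add j3 j5]
    refine integral_congr_ae (Eventually.of_forall fun p => ?_)
    simp only [relPot]
    field_simp
    ring
  have e2 : ∫ p : ℝ × ℝ, p.1 * H.r p.1 p.2 * (a p.1 * φ p.2) ∂planeMeasure R1 R2 =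
      -(ε * ∫ p, a p.1 * (relAxial ε H p * φ p.2) ∂planeMeasure R1 R2) := by
    rw [← integral_const_mul, ← integral_neg]
    refine integral_congr_ae (Eventually.of_forall fun p => ?_)
    simp only [relAxial]
    field_simp
  rw [e1, e2] at key
  have hsum : ∫ p, a p.1 * (relAxial ε H p * φ p.2) ∂planeMeasure R1 R2 +
      ∫ p, a p.1 * (relPot R1 b ε ψ p * φ' p.2) ∂planeMeasure R1 R2 = 0 := by
    have : ε * (∫ p, a p.1 * (relAxial ε H p * φ p.2) ∂planeMeasure R1 R2 +
      ∫ p, a p.1 * (relPot R1 b ε ψ p * φ' p.2) ∂planeMeasure R1 R2) = 0 := by linarith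
    exact (mul_eq_zero.1 this).resolve_left hε
  rw [← integral_add j2 j1] at hsum
  have j4 : Integrable (fun p : ℝ × ℝ => a p.1 * (relAxial ε H p * φ p.2) +
      a p.1 * (relPot R1 b ε ψ p * φ' p.2)) ((volume.restrict (radial R1 R2)).prod zMeasure) :=
    j2.add j1
  rw [planeMeasure, integral_prod _ j4] at hsum
  rw [← hsum, ← setIntegral_eq_integral_of_forall_compl_eq_zero (s := radial R1 R2)]
  · refine integral_congr_ae (Eventually.of_forall fun r => ?_)
    simp only [smul_eq_mul]
    rw [← integral_const_mul]
    refine integral_congr_ae (Eventually.of_forall fun z => ?_)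
    simp only
    ring
  · intro r hr
    rw [h0 r fun h => hr (hasub h), zero_smul]

theorem isPeriodicDeriv_of_axial :
    ∀ᵐ r ∂volume.restrict (radial R1 R2), IsPeriodicDeriv
      (fun z => relPot R1 b ε ψ (r, z)) (fun z => relAxial ε H (r, z)) := by
  have hdc : ∀ (n : ℤ) (z : ℝ), HasDerivAt (fun z : ℝ => Real.cos (n * z))
      (-(n * Real.sin (n * z))) z := fun n z => by
    refine (((hasDerivAt_id z).const_mul (n : ℝ)).cos).congr_deriv ?_
    simp only [id]
    ring
  have hds : ∀ (n : ℤ) (z : ℝ), HasDerivAt (fun z : ℝ => Real.sin (n * z))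
      (n * Real.cos (n * z)) z := fun n z => by
    refine (((hasDerivAt_id z).const_mul (n : ℝ)).sin).congr_deriv ?_
    simp only [id]
    ring
  have hc : ∀ n : ℤ, _ := fun n : ℤ => ae_integral_axial h₁ hε hs hψ₀ hax
    (φ := fun z => Real.cos (n * z)) (M := |(n : ℝ)|) (by fun_prop) (hdc n) (by fun_prop)
    (fun z => by rw [mul_add, Real.cos_add_int_mul_two_pi]) (fun z => Real.abs_cos_le_one _)
    (fun z => by
      rw [abs_neg, abs_mul]
      exact mul_le_of_le_one_right (abs_nonneg _) (Real.abs_sin_le_one _))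
  have hsn : ∀ n : ℤ, _ := fun n : ℤ => ae_integral_axial h₁ hε hs hψ₀ hax
    (φ := fun z => Real.sin (n * z)) (M := |(n : ℝ)|) (by fun_prop) (hds n) (by fun_prop)
    (fun z => by rw [mul_add, Real.sin_add_int_mul_two_pi]) (fun z => Real.abs_sin_le_one _)
    (fun z => by
      rw [abs_mul]
      exact mul_le_of_le_one_right (abs_nonneg _) (Real.abs_cos_le_one _))
  have hint : ∀ᵐ r ∂volume.restrict (radial R1 R2),
      Integrable (fun z => relPot R1 b ε ψ (r, z)) zMeasure ∧
      Integrable (fun z => relAxial ε H (r, z)) zMeasure := by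
    filter_upwards [hs.aesm.prodMk_left, (hs.integral_wt_sq_le h₁).1.prod_right_ae,
      hs.aesm_k.prodMk_left, hs.int_k.prod_right_ae,
      ae_restrict_mem measurableSet_radial] with r m1 i1 m2 i2 hr
    have hr0 := radial_pos h₁ hr
    have hpos := mul_pos (wt_pos r) hr0
    constructor
    · refine Integrable.mono' (i1.add (integrable_const (wt r * r)⁻¹)) m1
        (Eventually.of_forall fun z => ?_)
      have := abs_le_sq_div_add (x := relPot R1 b ε ψ (r, z)) (inv_pos.2 hpos)
      rwa [div_inv_eq_mul, mul_comm (relPot R1 b ε ψ (r, z) ^ 2)] at this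
    · exact Integrable.mono' (i2.add (integrable_const r)) m2
        (Eventually.of_forall fun z => abs_le_sq_div_add hr0)
  filter_upwards [ae_all_iff.2 hc, ae_all_iff.2 hsn, hint] with r h2 h3 ⟨i1, i2⟩ n
  specialize h2 n
  specialize h3 n
  have t1 := integrable_mul_cos i2 n
  have t2 := integrable_mul_sin i2 n
  have t3 := integrable_mul_cos i1 n
  have t4 := integrable_mul_sin i1 n
  have s1 : Integrable (fun z => relPot R1 b ε ψ (r, z) * -(n * Real.sin (n * z))) zMeasure :=
    (t4.const_mul (-(n : ℝ))).congr (Eventually.of_forall fun z => by simp only; ring)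
  have s2 : Integrable (fun z => relPot R1 b ε ψ (r, z) * (n * Real.cos (n * z))) zMeasure :=
    (t3.const_mul (n : ℝ)).congr (Eventually.of_forall fun z => by simp only; ring)
  rw [integral_add t1 s1] at h2
  rw [integral_add t2 s2] at h3
  have q1 : ∫ z, relPot R1 b ε ψ (r, z) * -(n * Real.sin (n * z)) ∂zMeasure =
      -(n * ∫ z, relPot R1 b ε ψ (r, z) * Real.sin (n * z) ∂zMeasure) := by
    rw [← integral_const_mul, ← integral_neg]
    exact integral_congr_ae (Eventually.of_forall fun z => by simp only; ring)
  have q2 : ∫ z, relPot R1 b ε ψ (r, z) * (n * Real.cos (n * z)) ∂zMeasure =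
      n * ∫ z, relPot R1 b ε ψ (r, z) * Real.cos (n * z) ∂zMeasure := by
    rw [← integral_const_mul]
    exact integral_congr_ae (Eventually.of_forall fun z => by simp only; ring)
  rw [q1] at h2
  rw [q2] at h3
  constructor <;> linarith

end

/-- A weak solution with its magnetic potential consists of states. -/
theorem exists_isState (hb : PositiveBound R1 R2 b c K) (h₁ : 0 ≤ R1)
    (hR : (R1 : EReal) < R2) (hε : ε ≠ 0) {v H : ℝ → AxiField} {ψ : ℝ → ℝ → ℝ → ℝ}
    (hw : ∀ t, 0 ≤ t → (v t - v₀ ω).MemL2 R1 R2 ∧ (H t - H₀ b ε).MemL2 R1 R2)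
    (hψ : IsMagneticPotential R1 R2 b ε H ψ) :
    ∃ κ : ℝ, (R2 = ⊤ → κ = 0) ∧ ∀ t, 0 ≤ t →
      IsState R1 R2 ω b ε (v t) (H t) (relPot R1 b ε (ψ t)) ∧
      ∀ᵐ z ∂zMeasure, Tendsto (fun r => relPot R1 b ε (ψ t) (r, z)) (toOuter R2) (𝓝 κ) := by
  have hfl : ContinuousOn (flux R1 R2 b) (Ici 0) := hb.continuousOn_flux h₁ hR
  have hψ₀ : ContinuousOn (ψ₀ R1 b ε) (radial R1 R2) := by
    refine ContinuousOn.congr (f := fun r => ε * (flux R1 R2 b R1 - flux R1 R2 b r)) ?_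
      fun r hr => hb.potential_eq h₁ hR hr
    exact continuousOn_const.mul (continuousOn_const.sub
      (hfl.mono fun r hr => (radial_pos h₁ hr).le))
  have hout : ∃ κ : ℝ, (R2 = ⊤ → κ = 0) ∧ ∀ t, 0 ≤ t → ∀ᵐ z ∂zMeasure,
      Tendsto (fun r => relPot R1 b ε (ψ t) (r, z)) (toOuter R2) (𝓝 κ) := by
    by_cases htop : R2 = ⊤
    · refine ⟨0, fun _ => rfl, fun t ht => ?_⟩
      filter_upwards [hψ.outer_infinite htop t ht] with z hz
      subst htop
      rw [toOuter_top]
      simpa [relPot] using hz.neg.div_const ε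
    · obtain ⟨C, hC⟩ := hψ.outer_finite htop
      obtain ⟨d, rfl, hd, ho, -⟩ := exists_toOuter_eq hR htop
      refine ⟨-(C - ε * (flux R1 d b R1 - flux R1 d b d)) / ε, fun h => absurd h htop,
        fun t ht => ?_⟩
      filter_upwards [hC t ht] with z hz
      have hd0 : 0 < d := h₁.trans_lt hd
      have hf : Tendsto (flux R1 d b) (toOuter d) (𝓝 (flux R1 d b d)) := by
        rw [ho]
        exact ((hfl.continuousAt (Ici_mem_nhds hd0)).tendsto).mono_left nhdsWithin_le_nhds
      refine Tendsto.congr' ?_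
        (((hz.sub ((tendsto_const_nhds.sub hf).const_mul ε)).neg).div_const ε)
      filter_upwards [radial_mem_toOuter hR] with r hr
      simp only [relPot]
      rw [hb.potential_eq h₁ hR hr]
  obtain ⟨κ, hκ, hout⟩ := hout
  refine ⟨κ, hκ, fun t ht => ⟨⟨(hw t ht).1, (hw t ht).2, ?_⟩, hout t ht⟩⟩
  have hs := stripBase_of_memL2 hb h₁ hR hε (hψ.aesm t ht) (hw t ht).2 (hψ.radial_deriv t ht)
    (hout t ht)
  exact ⟨hs, isPeriodicDeriv_of_axial h₁ hε hs hψ₀ (hψ.axial_deriv t ht)⟩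

end Axial

/-! ### Casimir functionals of a state -/

section Casimir

variable {R1 : ℝ} {R2 : EReal} {ω ω₁ ω₂ b b₁ b₂ : ℝ → ℝ} {ε : ℝ} {c K C : ℝ}
  {v H : AxiField} {h : ℝ × ℝ → ℝ} {f F Φ D₀ : ℝ → ℝ}

/-- The Dirichlet energy of the normalised perturbation of the potential. -/
def fluxEnergy (R1 : ℝ) (R2 : EReal) (b : ℝ → ℝ) (ε : ℝ) (H : AxiField) : ℝ :=
  stripEnergy R1 R2 (relGrad b ε H) + stripEnergy R1 R2 (relAxial ε H)

theorem fluxEnergy_nonneg (h₁ : 0 ≤ R1) : 0 ≤ fluxEnergy R1 R2 b ε H :=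
  add_nonneg (stripEnergy_nonneg h₁ _) (stripEnergy_nonneg h₁ _)

theorem integral_wt_mul_cube_nonneg (h₁ : 0 ≤ R1) : 0 ≤ ∫ r in radial R1 R2, wt r * r ^ 3 :=
  setIntegral_nonneg measurableSet_radial fun r hr => by
    have := radial_pos h₁ hr
    have := wt_pos r
    positivity

namespace IsState

theorem magnetic (hS : IsState R1 R2 ω b ε v H h) (h₁ : 0 ≤ R1) (hε : ε ≠ 0) :
    Integrable (fun p => H.r p.1 p.2 ^ 2 + (H.z p.1 p.2 - ε * b p.1) ^ 2) (cylMeasure R1 R2) ∧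
    ∫ p, (H.r p.1 p.2 ^ 2 + (H.z p.1 p.2 - ε * b p.1) ^ 2) ∂cylMeasure R1 R2 =
      2 * Real.pi * (ε ^ 2 * fluxEnergy R1 R2 b ε H) := by
  have i1 := hS.strip.int_g
  have i2 := hS.strip.int_k
  have e : ∀ᵐ p ∂planeMeasure R1 R2, ε ^ 2 * (relGrad b ε H p ^ 2 / p.1 +
      relAxial ε H p ^ 2 / p.1) =
      p.1 * (H.r p.1 p.2 ^ 2 + (H.z p.1 p.2 - ε * b p.1) ^ 2) := by
    filter_upwards [ae_planeMeasure_mem] with p hp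
    have := radial_pos h₁ hp
    simp only [relGrad, relAxial]
    field_simp
    ring
  constructor
  · rw [integrable_cylMeasure_iff h₁]
    exact ((i1.add i2).const_mul (ε ^ 2)).congr e
  · rw [integral_cylMeasure h₁, ← integral_congr_ae e, integral_const_mul, integral_add i1 i2]
    rfl

theorem integrable_swirl (hS : IsState R1 R2 ω b ε v H h) :
    MemLp (fun p : ℝ × ℝ => v.θ p.1 p.2 - p.1 * ω p.1) 2 (cylMeasure R1 R2) := hS.memv.2.1

theorem integrable_poloidal (hS : IsState R1 R2 ω b ε v H h) :
    Integrable (fun p : ℝ × ℝ => v.r p.1 p.2 ^ 2 + v.z p.1 p.2 ^ 2 + H.θ p.1 p.2 ^ 2)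
      (cylMeasure R1 R2) := by
  have h1 : MemLp (fun p : ℝ × ℝ => v.r p.1 p.2 - 0) 2 (cylMeasure R1 R2) := hS.memv.1
  have h2 : MemLp (fun p : ℝ × ℝ => v.z p.1 p.2 - 0) 2 (cylMeasure R1 R2) := hS.memv.2.2
  have h3 : MemLp (fun p : ℝ × ℝ => H.θ p.1 p.2 - 0) 2 (cylMeasure R1 R2) := hS.memH.2.1
  simp only [sub_zero] at h1 h2 h3
  exact ((integrable_sq_of_memLp h1).add (integrable_sq_of_memLp h2)).add
    (integrable_sq_of_memLp h3)

theorem aesm (hS : IsState R1 R2 ω b ε v H h) : AEStronglyMeasurable h (cylMeasure R1 R2) :=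
  hS.strip.aesm.mono_ac cylMeasure_absolutelyContinuous

theorem integrable_wt_sq (hS : IsState R1 R2 ω b ε v H h) (h₁ : 0 ≤ R1) :
    Integrable (fun p => wt p.1 * h p ^ 2) (cylMeasure R1 R2) ∧
    ∫ p, wt p.1 * h p ^ 2 ∂cylMeasure R1 R2 ≤
      Real.pi * (∫ r in radial R1 R2, wt r * r ^ 3) * fluxEnergy R1 R2 b ε H := by
  obtain ⟨i1, i2⟩ := hS.strip.integral_wt_sq_le h₁
  have e : ∀ p : ℝ × ℝ, wt p.1 * p.1 * h p ^ 2 = p.1 * (wt p.1 * h p ^ 2) := fun p => by ring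
  simp only [e] at i1 i2
  refine ⟨(integrable_cylMeasure_iff h₁).2 i1, ?_⟩
  rw [integral_cylMeasure h₁]
  have hI := integral_wt_mul_cube_nonneg (R2 := R2) h₁
  have h3 := stripEnergy_nonneg (R2 := R2) h₁ (relAxial ε H)
  refine (mul_le_mul_of_nonneg_left i2 Real.two_pi_pos.le).trans ?_
  have h4 : 0 ≤ Real.pi * (∫ r in radial R1 R2, wt r * r ^ 3) *
      stripEnergy R1 R2 (relAxial ε H) := by positivity
  rw [fluxEnergy]
  linarith

theorem integrable_wt_pow_four (hS : IsState R1 R2 ω b ε v H h) (h₁ : 0 ≤ R1)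
    (hR : (R1 : EReal) < R2) :
    Integrable (fun p => wt p.1 * h p ^ 4) (cylMeasure R1 R2) ∧
    ∫ p, wt p.1 * h p ^ 4 ∂cylMeasure R1 R2 ≤
      8 * Real.pi ^ 2 * fluxEnergy R1 R2 b ε H ^ 2 := by
  obtain ⟨i1, i2⟩ := hS.strip.integral_wt_pow_four_le h₁ hR
  have e : ∀ p : ℝ × ℝ, wt p.1 * p.1 * h p ^ 4 = p.1 * (wt p.1 * h p ^ 4) := fun p => by ring
  simp only [e] at i1 i2
  refine ⟨(integrable_cylMeasure_iff h₁).2 i1, ?_⟩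
  rw [integral_cylMeasure h₁]
  refine (mul_le_mul_of_nonneg_left i2 Real.two_pi_pos.le).trans_eq ?_
  rw [fluxEnergy]
  ring

theorem integrable_wt_sq_add (hS : IsState R1 R2 ω b ε v H h) (h₁ : 0 ≤ R1)
    (hR : (R1 : EReal) < R2) :
    Integrable (fun p => wt p.1 * (h p ^ 2 + h p ^ 4)) (cylMeasure R1 R2) := by
  simp only [mul_add]
  exact (hS.integrable_wt_sq h₁).1.add (hS.integrable_wt_pow_four h₁ hR).1

theorem integrable_wt (h₁ : 0 ≤ R1) :
    Integrable (fun p : ℝ × ℝ => wt p.1) (cylMeasure R1 R2) := by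
  rw [integrable_cylMeasure_iff h₁]
  refine ((integrableOn_wt_mul_pow (R2 := R2) h₁ (show 1 ≤ 4 by norm_num)).comp_fst
    zMeasure).congr (Eventually.of_forall fun p => ?_)
  simp only [pow_one, mul_comm]

theorem integrable_linear (hS : IsState R1 R2 ω b ε v H h) (h₁ : 0 ≤ R1) {a : ℝ → ℝ}
    (ham : AEStronglyMeasurable a (volume.restrict (radial R1 R2)))
    (ha : ∀ r ∈ radial R1 R2, |a r| ≤ C * (r ^ 2 * wt r)) :
    Integrable (fun p => a p.1 * h p) (cylMeasure R1 R2) := by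
  rw [integrable_cylMeasure_iff h₁]
  have h4 := integrableOn_wt_mul_pow (R2 := R2) h₁ (show 4 ≤ 4 by norm_num)
  have i1 := (hS.strip.integral_weight_sq_le h₁ (w := fun r => wt r * r ^ 2)
    (fun r _ => mul_nonneg (wt_pos r).le (sq_nonneg _)) (h4.congr (Eventually.of_forall fun r => by
      simp only; ring)) (continuous_wt.mul (continuous_pow 2)).aestronglyMeasurable).1
  refine Integrable.mono' ((i1.add (h4.comp_fst zMeasure)).const_mul |C|)
    (measurable_fst.aestronglyMeasurable.mul ((aestronglyMeasurable_fst ham).mul hS.strip.aesm)) ?_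
  filter_upwards [ae_planeMeasure_mem] with p hp
  have hp0 := radial_pos h₁ hp
  have hw := wt_pos p.1
  simp only [Pi.add_apply]
  rw [norm_mul, norm_mul, Real.norm_of_nonneg hp0.le, Real.norm_eq_abs, Real.norm_eq_abs]
  have h2 : |a p.1| ≤ |C| * (p.1 ^ 2 * wt p.1) :=
    (ha _ hp).trans (mul_le_mul_of_nonneg_right (le_abs_self C) (by positivity))
  have h3 : p.1 * |h p| ≤ h p ^ 2 + p.1 ^ 2 := by
    nlinarith [sq_nonneg (p.1 - |h p|), sq_abs (h p), sq_nonneg (h p), sq_nonneg p.1]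
  calc p.1 * (|a p.1| * |h p|) ≤ p.1 * (|C| * (p.1 ^ 2 * wt p.1) * |h p|) := by
        refine mul_le_mul_of_nonneg_left (mul_le_mul_of_nonneg_right h2 (abs_nonneg _)) hp0.le
    _ = |C| * (wt p.1 * p.1 ^ 2 * (p.1 * |h p|)) := by ring
    _ ≤ |C| * (wt p.1 * p.1 ^ 2 * (h p ^ 2 + p.1 ^ 2)) :=
        mul_le_mul_of_nonneg_left (mul_le_mul_of_nonneg_left h3 (by positivity)) (abs_nonneg _)
    _ = _ := by ring

theorem exists_integral_wt_bound (h₁ : 0 ≤ R1) (hR : (R1 : EReal) < R2) :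
    ∃ G, 0 ≤ G ∧ ∀ (ω b : ℝ → ℝ) (ε : ℝ) (v H : AxiField) (h : ℝ × ℝ → ℝ),
      IsState R1 R2 ω b ε v H h → fluxEnergy R1 R2 b ε H ≤ 1 →
      ∫ p, wt p.1 * (h p ^ 2 + h p ^ 4) ∂cylMeasure R1 R2 ≤ G * fluxEnergy R1 R2 b ε H := by
  have hpi := Real.pi_pos
  have hI0 := integral_wt_mul_cube_nonneg (R2 := R2) h₁
  refine ⟨Real.pi * (∫ r in radial R1 R2, wt r * r ^ 3) + 8 * Real.pi ^ 2, by positivity,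
    fun ω b ε v H h hS hn => ?_⟩
  have hn0 : 0 ≤ fluxEnergy R1 R2 b ε H := fluxEnergy_nonneg h₁
  obtain ⟨i2, l2⟩ := hS.integrable_wt_sq h₁
  obtain ⟨i4, l4⟩ := hS.integrable_wt_pow_four h₁ hR
  simp only [mul_add (wt _)]
  rw [integral_add i2 i4]
  have h4 : fluxEnergy R1 R2 b ε H ^ 2 ≤ fluxEnergy R1 R2 b ε H := by nlinarith
  have h5 := mul_le_mul_of_nonneg_left h4 (by positivity : 0 ≤ 8 * Real.pi ^ 2)
  linarith

end IsState

/-- The density of the relative Casimir functional of `f`. -/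
def casimirDensity (R1 : ℝ) (R2 : EReal) (b f : ℝ → ℝ) (h : ℝ × ℝ → ℝ) (p : ℝ × ℝ) : ℝ :=
  f (flux R1 R2 b p.1 + h p) - f (flux R1 R2 b p.1)

/-- The density of the relative swirl Casimir functional of `Φ`. -/
def swirlDensity (R1 : ℝ) (R2 : EReal) (ω b Φ : ℝ → ℝ) (v : AxiField) (h : ℝ × ℝ → ℝ)
    (p : ℝ × ℝ) : ℝ :=
  p.1 * v.θ p.1 p.2 * Φ (flux R1 R2 b p.1 + h p) - p.1 ^ 2 * ω p.1 * Φ (flux R1 R2 b p.1)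

theorem aestronglyMeasurable_cyl_fst {a : ℝ → ℝ}
    (ha : AEStronglyMeasurable a (volume.restrict (radial R1 R2))) :
    AEStronglyMeasurable (fun p : ℝ × ℝ => a p.1) (cylMeasure R1 R2) :=
  (aestronglyMeasurable_fst ha).mono_ac cylMeasure_absolutelyContinuous

namespace PositiveBound

section

variable (hb : PositiveBound R1 R2 b c K) (h₁ : 0 ≤ R1) (hR : (R1 : EReal) < R2)

include hb h₁ hR

theorem aestronglyMeasurable_flux :
    AEStronglyMeasurable (flux R1 R2 b) (volume.restrict (radial R1 R2)) :=
  ((hb.continuousOn_flux h₁ hR).mono fun _ hr => (radial_pos h₁ hr).le).aestronglyMeasurable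
    measurableSet_radial

theorem aesm_comp_flux
    (hf : Continuous f) :
    AEStronglyMeasurable (fun p : ℝ × ℝ => f (flux R1 R2 b p.1)) (cylMeasure R1 R2) :=
  hf.comp_aestronglyMeasurable (aestronglyMeasurable_cyl_fst (hb.aestronglyMeasurable_flux h₁ hR))

theorem aesm_comp_flux_add (hf : Continuous f) (hS : IsState R1 R2 ω b ε v H h) :
    AEStronglyMeasurable (fun p : ℝ × ℝ => f (flux R1 R2 b p.1 + h p)) (cylMeasure R1 R2) :=
  hf.comp_aestronglyMeasurable
    ((aestronglyMeasurable_cyl_fst (hb.aestronglyMeasurable_flux h₁ hR)).add hS.aesm)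

theorem integrable_casimirDensity (hS : IsState R1 R2 ω b ε v H h) (hf : Continuous f)
    (hF : Continuous F) (hFb : ∀ r ∈ radial R1 R2, |F (flux R1 R2 b r)| ≤ C * (r ^ 2 * wt r))
    (hest : ∀ r ∈ radial R1 R2, ∀ x, |f (flux R1 R2 b r + x) - f (flux R1 R2 b r) -
      F (flux R1 R2 b r) * x| ≤ C * (wt r * (x ^ 2 + x ^ 4))) :
    Integrable (fun p : ℝ × ℝ => F (flux R1 R2 b p.1) * h p) (cylMeasure R1 R2) ∧
    Integrable (casimirDensity R1 R2 b f h) (cylMeasure R1 R2) := by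
  have i1 : Integrable (fun p : ℝ × ℝ => F (flux R1 R2 b p.1) * h p) (cylMeasure R1 R2) :=
    hS.integrable_linear (a := fun r => F (flux R1 R2 b r)) h₁
      (hF.comp_aestronglyMeasurable (hb.aestronglyMeasurable_flux h₁ hR)) hFb
  refine ⟨i1, ?_⟩
  refine Integrable.mono' (i1.norm.add ((hS.integrable_wt_sq_add h₁ hR).const_mul C))
    ((hb.aesm_comp_flux_add h₁ hR hf hS).sub (hb.aesm_comp_flux h₁ hR hf)) ?_
  filter_upwards [ae_cylMeasure_mem] with p hp
  have := hest _ hp (h p)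
  simp only [casimirDensity, Real.norm_eq_abs, Pi.add_apply]
  have h2 := abs_sub_abs_le_abs_sub (f (flux R1 R2 b p.1 + h p) - f (flux R1 R2 b p.1))
    (F (flux R1 R2 b p.1) * h p)
  linarith

end

end PositiveBound

namespace ProfileBound

theorem aesm_ω (hP : ProfileBound R1 R2 ω ω₁ ω₂ b b₁ b₂ c K) (h₁ : 0 ≤ R1) :
    AEStronglyMeasurable ω (volume.restrict (radial R1 R2)) :=
  (hP.cont_ω.mono (radial_subset_radialClosed h₁)).aestronglyMeasurable measurableSet_radial

theorem memLp_swirl (hP : ProfileBound R1 R2 ω ω₁ ω₂ b b₁ b₂ c K) (h₁ : 0 ≤ R1) :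
    MemLp (fun p : ℝ × ℝ => p.1 * ω p.1) 2 (cylMeasure R1 R2) := by
  refine (memLp_two_iff_integrable_sq (aestronglyMeasurable_cyl_fst
    (continuous_id.aestronglyMeasurable.mul (hP.aesm_ω h₁)))).2 ?_
  rw [integrable_cylMeasure_iff h₁]
  refine (hP.integrable.comp_fst zMeasure).congr (Eventually.of_forall fun p => ?_)
  simp only [Pi.mul_apply, id]
  ring

theorem integrable_swirlDensity (hP : ProfileBound R1 R2 ω ω₁ ω₂ b b₁ b₂ c K) (h₁ : 0 ≤ R1)
    (hR : (R1 : EReal) < R2) (hS : IsState R1 R2 ω b ε v H h)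
    (hC : CasimirData R1 R2 ω b b₁ ε (flux R1 R2 b) f F Φ D₀ C) :
    Integrable (fun p : ℝ × ℝ => ε ^ 2 * (b₁ p.1 / p.1) * h p) (cylMeasure R1 R2) ∧
    Integrable (fun p : ℝ × ℝ =>
      p.1 ^ 2 * (Φ (flux R1 R2 b p.1 + h p) - Φ (flux R1 R2 b p.1)) ^ 2) (cylMeasure R1 R2) ∧
    Integrable (fun p : ℝ × ℝ =>
      p.1 ^ 2 * ω p.1 * (Φ (flux R1 R2 b p.1 + h p) - Φ (flux R1 R2 b p.1))) (cylMeasure R1 R2) ∧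
    Integrable (swirlDensity R1 R2 ω b Φ v h) (cylMeasure R1 R2) := by
  have hb := hP.positiveBound
  have hfc : Continuous f := continuous_iff_continuousAt.2 fun y => (hC.deriv_f y).continuousAt
  obtain ⟨iF, -⟩ := hb.integrable_casimirDensity h₁ hR hS hfc hC.cont_F hC.F_bound hC.est_f
  have mid : AEStronglyMeasurable (fun p : ℝ × ℝ => p.1) (cylMeasure R1 R2) :=
    measurable_fst.aestronglyMeasurable
  have mω := aestronglyMeasurable_cyl_fst (hP.aesm_ω h₁)
  have mΔ := (hb.aesm_comp_flux_add h₁ hR hC.cont_Φ hS).sub (hb.aesm_comp_flux h₁ hR hC.cont_Φ)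
  have iW := (hS.integrable_wt_sq_add h₁ hR).const_mul C
  have ib : Integrable (fun p : ℝ × ℝ => ε ^ 2 * (b₁ p.1 / p.1) * h p) (cylMeasure R1 R2) := by
    refine hS.integrable_linear (C := ε ^ 2 * K) h₁ (a := fun r => ε ^ 2 * (b₁ r / r)) ?_ ?_
    · refine (ContinuousOn.aestronglyMeasurable (ContinuousOn.mul continuousOn_const
        (ContinuousOn.div (hP.cont_b₁.mono (radial_subset_radialClosed h₁)) continuousOn_id
        fun r hr => (radial_pos h₁ hr).ne')) measurableSet_radial)
    · intro r hr
      have hr0 := radial_pos h₁ hr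
      have := hP.bound_b₁ r (radial_subset_radialClosed h₁ hr)
      rw [abs_mul, abs_of_nonneg (sq_nonneg ε), mul_assoc]
      refine mul_le_mul_of_nonneg_left ?_ (sq_nonneg ε)
      rw [abs_div, abs_of_pos hr0, div_le_iff₀ hr0]
      refine this.trans_eq ?_
      rw [rwt, wt]
      field_simp
  have iΦ : Integrable (fun p : ℝ × ℝ =>
      p.1 ^ 2 * (Φ (flux R1 R2 b p.1 + h p) - Φ (flux R1 R2 b p.1)) ^ 2) (cylMeasure R1 R2) := by
    refine Integrable.mono' iW ((mid.pow 2).mul (mΔ.pow 2)) ?_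
    filter_upwards [ae_cylMeasure_mem] with p hp
    rw [Real.norm_of_nonneg (by positivity)]
    exact hC.est_Φ _ hp _
  have iω : Integrable (fun p : ℝ × ℝ =>
      p.1 ^ 2 * ω p.1 * (Φ (flux R1 R2 b p.1 + h p) - Φ (flux R1 R2 b p.1)))
      (cylMeasure R1 R2) := by
    refine Integrable.mono' ((iW.add ib.norm).add iF.norm) (((mid.pow 2).mul mω).mul mΔ) ?_
    filter_upwards [ae_cylMeasure_mem] with p hp
    have h1 := hC.est_ωΦ _ hp (h p)
    have h2 := congrArg (· * h p) (hC.linear _ hp)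
    simp only [Pi.add_apply, Real.norm_eq_abs]
    have e : p.1 ^ 2 * ω p.1 * (Φ (flux R1 R2 b p.1 + h p) - Φ (flux R1 R2 b p.1)) =
        p.1 ^ 2 * ω p.1 * (Φ (flux R1 R2 b p.1 + h p) - Φ (flux R1 R2 b p.1) - D₀ p.1 * h p) +
        ε ^ 2 * (b₁ p.1 / p.1) * h p - F (flux R1 R2 b p.1) * h p := by
      rw [← h2]; ring
    rw [e]
    refine (abs_sub _ _).trans (add_le_add_left ((abs_add_le _ _).trans ?_) _)
    exact add_le_add_left h1 _
  refine ⟨ib, iΦ, iω, ?_⟩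
  have iu := integrable_sq_of_memLp hS.integrable_swirl
  have iuω := hS.integrable_swirl.integrable_mul (hP.memLp_swirl h₁)
  have iuΦ : Integrable (fun p : ℝ × ℝ => (v.θ p.1 p.2 - p.1 * ω p.1) *
      (p.1 * (Φ (flux R1 R2 b p.1 + h p) - Φ (flux R1 R2 b p.1)))) (cylMeasure R1 R2) := by
    refine Integrable.mono' (iu.add iΦ) (hS.integrable_swirl.1.mul (mid.mul mΔ))
      (Eventually.of_forall fun p => ?_)
    simp only [Pi.add_apply, Real.norm_eq_abs, ← mul_pow]
    rw [abs_le]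
    constructor <;> nlinarith [sq_nonneg (v.θ p.1 p.2 - p.1 * ω p.1 + p.1 *
      (Φ (flux R1 R2 b p.1 + h p) - Φ (flux R1 R2 b p.1))), sq_nonneg (v.θ p.1 p.2 - p.1 * ω p.1 -
      p.1 * (Φ (flux R1 R2 b p.1 + h p) - Φ (flux R1 R2 b p.1)))]
  refine ((iuΦ.add iω).sub iuω).congr ?_
  filter_upwards [ae_cylMeasure_mem] with p hp
  simp only [swirlDensity, Pi.add_apply, Pi.sub_apply, Pi.mul_apply]
  rw [hC.Φ_eq _ hp]
  ring

end ProfileBound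

end Casimir

/-! ### Conservation of the Casimir functionals -/

section Conservation

variable {R1 : ℝ} {R2 : EReal} {ω ω₁ ω₂ b b₁ b₂ : ℝ → ℝ} {ε : ℝ} {c K C : ℝ}
  {f F Φ D₀ : ℝ → ℝ}

theorem integrable_cyl_of_bounded (h₁ : 0 ≤ R1) (hR : (R1 : EReal) < R2) (h2 : R2 ≠ ⊤)
    {a : ℝ → ℝ} {M : ℝ} (ha : AEStronglyMeasurable a (volume.restrict (radial R1 R2)))
    (hM : ∀ r ∈ radial R1 R2, |a r| ≤ M) :
    Integrable (fun p : ℝ × ℝ => a p.1) (cylMeasure R1 R2) := by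
  rw [integrable_cylMeasure_iff h₁]
  refine Integrable.comp_fst (f := fun r : ℝ => r * a r) ?_ zMeasure
  obtain ⟨d, rfl, hd, -, hI⟩ := exists_toOuter_eq hR h2
  refine IntegrableOn.of_bound (C := d * M) ?_ (continuous_id.aestronglyMeasurable.mul ha) ?_
  · rw [hI]; exact measure_Ioo_lt_top
  · filter_upwards [ae_restrict_mem measurableSet_radial] with r hr
    have hr0 := radial_pos h₁ hr
    have hrd : r ≤ d := by exact_mod_cast hr.2.le
    rw [norm_mul, Real.norm_of_nonneg hr0.le]
    exact mul_le_mul hrd (hM r hr) (abs_nonneg _) (hr0.le.trans hrd)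

namespace PositiveBound

section

variable (hb : PositiveBound R1 R2 b c K) (h₁ : 0 ≤ R1) (hR : (R1 : EReal) < R2)

include hb h₁ hR

theorem exists_comp_flux_bound (h2 : R2 ≠ ⊤) (hf : Continuous f) :
    ∃ M, ∀ r ∈ radial R1 R2, |f (flux R1 R2 b r)| ≤ M := by
  obtain ⟨d, rfl, hd, -, -⟩ := exists_toOuter_eq hR h2
  obtain ⟨M, hM⟩ := (isCompact_Icc (a := (0 : ℝ)) (b := d)).exists_bound_of_continuousOn
    (hf.comp_continuousOn ((hb.continuousOn_flux h₁ hR).mono fun r hr => hr.1))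
  refine ⟨M, fun r hr => hM r ⟨(radial_pos h₁ hr).le, ?_⟩⟩
  exact_mod_cast hr.2.le

theorem casimir_conserved (hε : ε ≠ 0) {v : ℝ → AxiField} {ψ : ℝ → ℝ → ℝ → ℝ}
    (hcas : CasimirsConserved R1 R2 ω b ε v ψ) (hf : ContDiff ℝ 1 f) {t : ℝ} (ht : 0 ≤ t)
    (i0 : Integrable (casimirDensity R1 R2 b f (relPot R1 b ε (ψ 0))) (cylMeasure R1 R2))
    (it : Integrable (casimirDensity R1 R2 b f (relPot R1 b ε (ψ t))) (cylMeasure R1 R2)) :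
    ∫ p, casimirDensity R1 R2 b f (relPot R1 b ε (ψ t)) p ∂cylMeasure R1 R2 =
      ∫ p, casimirDensity R1 R2 b f (relPot R1 b ε (ψ 0)) p ∂cylMeasure R1 R2 := by
  have hf' : ContDiff ℝ 1 fun y => f (flux R1 R2 b R1 - y / ε) := by fun_prop
  have e : ∀ s, ∀ᵐ p ∂cylMeasure R1 R2, f (flux R1 R2 b p.1 + relPot R1 b ε (ψ s) p) =
      f (flux R1 R2 b R1 - ψ s p.1 p.2 / ε) := fun s => by
    filter_upwards [ae_cylMeasure_mem] with p hp
    rw [hb.add_relPot h₁ hR hε hp]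
  by_cases h2 : R2 = ⊤
  · have hc := (hcas.2 h2).1 _ hf' t ht
    have e' : ∀ s, (casimirDensity R1 R2 b f (relPot R1 b ε (ψ s))) =ᵐ[cylMeasure R1 R2]
        fun p => f (flux R1 R2 b R1 - ψ s p.1 p.2 / ε) -
          f (flux R1 R2 b R1 - ψ₀ R1 b ε p.1 / ε) := fun s => by
      filter_upwards [e s, ae_cylMeasure_mem] with p hp hpr
      rw [casimirDensity, hp, hb.potential_eq h₁ hR hpr, mul_div_cancel_left₀ _ hε, sub_sub_cancel]
    rw [integral_congr_ae (e' t), integral_congr_ae (e' 0)]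
    exact hc (i0.congr (e' 0)) (it.congr (e' t))
  · have hc := (hcas.1 h2).1 _ hf' t ht
    obtain ⟨M, hM⟩ := hb.exists_comp_flux_bound h₁ hR h2 hf.continuous
    have ib : Integrable (fun p : ℝ × ℝ => f (flux R1 R2 b p.1)) (cylMeasure R1 R2) :=
      integrable_cyl_of_bounded (a := fun r => f (flux R1 R2 b r)) h₁ hR h2
        (hf.continuous.comp_aestronglyMeasurable (hb.aestronglyMeasurable_flux h₁ hR)) hM
    have e' : ∀ s, (fun p => casimirDensity R1 R2 b f (relPot R1 b ε (ψ s)) p +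
        f (flux R1 R2 b p.1)) =ᵐ[cylMeasure R1 R2]
        fun p => f (flux R1 R2 b R1 - ψ s p.1 p.2 / ε) := fun s => by
      filter_upwards [e s] with p hp
      rw [casimirDensity, hp, sub_add_cancel]
    have hc' := hc ((i0.add ib).congr (e' 0)) ((it.add ib).congr (e' t))
    rw [← integral_congr_ae (e' t), ← integral_congr_ae (e' 0), integral_add it ib,
      integral_add i0 ib] at hc'
    linarith

end

end PositiveBound

namespace ProfileBound

theorem swirl_conserved (hP : ProfileBound R1 R2 ω ω₁ ω₂ b b₁ b₂ c K) (h₁ : 0 ≤ R1)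
    (hR : (R1 : EReal) < R2) (hε : ε ≠ 0) {v : ℝ → AxiField} {ψ : ℝ → ℝ → ℝ → ℝ}
    (hcas : CasimirsConserved R1 R2 ω b ε v ψ) (hΦ : ContDiff ℝ 1 Φ) {t : ℝ} (ht : 0 ≤ t)
    (i0 : Integrable (swirlDensity R1 R2 ω b Φ (v 0) (relPot R1 b ε (ψ 0))) (cylMeasure R1 R2))
    (it : Integrable (swirlDensity R1 R2 ω b Φ (v t) (relPot R1 b ε (ψ t))) (cylMeasure R1 R2)) :
    ∫ p, swirlDensity R1 R2 ω b Φ (v t) (relPot R1 b ε (ψ t)) p ∂cylMeasure R1 R2 =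
      ∫ p, swirlDensity R1 R2 ω b Φ (v 0) (relPot R1 b ε (ψ 0)) p ∂cylMeasure R1 R2 := by
  have hb := hP.positiveBound
  have hf' : ContDiff ℝ 1 fun y => Φ (flux R1 R2 b R1 - y / ε) := by fun_prop
  have e : ∀ s, ∀ᵐ p ∂cylMeasure R1 R2, Φ (flux R1 R2 b p.1 + relPot R1 b ε (ψ s) p) =
      Φ (flux R1 R2 b R1 - ψ s p.1 p.2 / ε) := fun s => by
    filter_upwards [ae_cylMeasure_mem] with p hp
    rw [hb.add_relPot h₁ hR hε hp]
  by_cases h2 : R2 = ⊤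
  · have hc := (hcas.2 h2).2 _ hf' t ht
    have e' : ∀ s, (swirlDensity R1 R2 ω b Φ (v s) (relPot R1 b ε (ψ s))) =ᵐ[cylMeasure R1 R2]
        fun p => p.1 * (v s).θ p.1 p.2 * Φ (flux R1 R2 b R1 - ψ s p.1 p.2 / ε) -
          p.1 ^ 2 * ω p.1 * Φ (flux R1 R2 b R1 - ψ₀ R1 b ε p.1 / ε) := fun s => by
      filter_upwards [e s, ae_cylMeasure_mem] with p hp hpr
      rw [swirlDensity, hp, hb.potential_eq h₁ hR hpr, mul_div_cancel_left₀ _ hε, sub_sub_cancel]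
    rw [integral_congr_ae (e' t), integral_congr_ae (e' 0)]
    exact hc (i0.congr (e' 0)) (it.congr (e' t))
  · have hc := (hcas.1 h2).2 _ hf' t ht
    obtain ⟨M, hM⟩ := hb.exists_comp_flux_bound h₁ hR h2 hΦ.continuous
    obtain ⟨d, hd2, hd, -, -⟩ := exists_toOuter_eq hR h2
    have ib : Integrable (fun p : ℝ × ℝ => p.1 ^ 2 * ω p.1 * Φ (flux R1 R2 b p.1))
        (cylMeasure R1 R2) := by
      refine integrable_cyl_of_bounded (a := fun r => r ^ 2 * ω r * Φ (flux R1 R2 b r))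
        (M := d ^ 2 * K * M) h₁ hR h2 (((continuous_pow 2).aestronglyMeasurable.mul
        (hP.aesm_ω h₁)).mul (hΦ.continuous.comp_aestronglyMeasurable
        (hb.aestronglyMeasurable_flux h₁ hR))) fun r hr => ?_
      have hr0 := radial_pos h₁ hr
      have hK := hP.K_nonneg
      have h3 : |ω r| ≤ K := (hP.bound_ω r (radial_subset_radialClosed h₁ hr)).trans
        (mul_le_of_le_one_right hK (rwt_zero_le_one hr0))
      have hrd : r ^ 2 ≤ d ^ 2 := by
        have : r ≤ d := by
          have := hr.2.le
          rw [hd2] at this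
          exact_mod_cast this
        exact pow_le_pow_left₀ hr0.le this 2
      rw [abs_mul, abs_mul, abs_of_nonneg (sq_nonneg r)]
      exact mul_le_mul (mul_le_mul hrd h3 (abs_nonneg _) (sq_nonneg _)) (hM r hr) (abs_nonneg _)
        (by positivity)
    have e' : ∀ s, (fun p => swirlDensity R1 R2 ω b Φ (v s) (relPot R1 b ε (ψ s)) p +
        p.1 ^ 2 * ω p.1 * Φ (flux R1 R2 b p.1)) =ᵐ[cylMeasure R1 R2]
        fun p => p.1 * (v s).θ p.1 p.2 * Φ (flux R1 R2 b R1 - ψ s p.1 p.2 / ε) := fun s => by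
      filter_upwards [e s] with p hp
      rw [swirlDensity, hp, sub_add_cancel]
    have hc' := hc ((i0.add ib).congr (e' 0)) ((it.add ib).congr (e' t))
    rw [← integral_congr_ae (e' t), ← integral_congr_ae (e' 0), integral_add it ib,
      integral_add i0 ib] at hc'
    linarith

end ProfileBound

/-- The region where the flux of the state or of the perturbation is below `1` is small. -/
theorem PositiveBound.exists_low_flux_bound (hb : PositiveBound R1 R2 b c K) (h₁ : 0 ≤ R1)
    (hR : (R1 : EReal) < R2) : ∃ B, 0 ≤ B ∧ ∀ r ∈ radial R1 R2, ∀ x,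
      flux R1 R2 b r < 1 ∨ flux R1 R2 b r + x < 1 → r ^ 2 ≤ B * (wt r * (1 + x ^ 4)) := by
  have hc := hb.c_pos
  set M := 1 + 4 / c with hMd
  have hM1 : 1 ≤ M := by
    have : 0 < 4 / c := by positivity
    linarith
  refine ⟨M ^ 2 * (1 + M ^ 6) + 2 * (2 / (c / 2)) ^ 4, by positivity, fun r hr x hx => ?_⟩
  have hr0 := radial_pos h₁ hr
  have hw := wt_pos r
  have hx4 : 0 ≤ x ^ 4 := by positivity
  have hwx : 0 ≤ wt r * x ^ 4 := by positivity
  rcases le_total r M with h | h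
  · have h3 := one_le_mul_wt_of_le hr0.le h
    have h4 : r ^ 2 ≤ M ^ 2 := pow_le_pow_left₀ hr0.le h 2
    have h5 : M ^ 2 ≤ M ^ 2 * ((1 + M ^ 6) * wt r) := le_mul_of_one_le_right (sq_nonneg _) h3
    have h6 : 0 ≤ M ^ 2 * (1 + M ^ 6) * (wt r * x ^ 4) := by positivity
    have h7 : 0 ≤ 2 * (2 / (c / 2)) ^ 4 * (wt r * (1 + x ^ 4)) := by positivity
    linarith
  · have hr1 : 1 ≤ r := hM1.trans h
    have hfl := (hb.flux_bounds h₁ hR hr0.le).1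
    have h2 : 2 ≤ c / 2 * r ^ 2 := by
      have h3 : 4 / c ≤ r ^ 2 := by
        have : 4 / c ≤ r := by linarith
        nlinarith
      rw [div_le_iff₀ hc] at h3
      linarith
    have hx' : flux R1 R2 b r + x < 1 := hx.resolve_left (by linarith)
    have h3 := (large_deviation (r := r) (x := -x) (κ := c / 2) (by positivity) hr1
      (by linarith)).1
    have e : (-x) ^ 4 = x ^ 4 := by ring
    rw [e] at h3
    have h6 : 0 ≤ 2 * (2 / (c / 2)) ^ 4 * wt r := by positivity
    have h7 : 0 ≤ M ^ 2 * (1 + M ^ 6) * (wt r * (1 + x ^ 4)) := by positivity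
    linarith

namespace ProfileBound

section

variable (hP : ProfileBound R1 R2 ω ω₁ ω₂ b b₁ b₂ c K) (h₁ : 0 ≤ R1) (hR : (R1 : EReal) < R2)

include hP h₁ hR

/-- Approximation of the swirl Casimir functional. -/
theorem exists_swirl_approx {v H : AxiField} {h : ℝ × ℝ → ℝ} (hS : IsState R1 R2 ω b ε v H h)
    (hC : CasimirData R1 R2 ω b b₁ ε (flux R1 R2 b) f F Φ D₀ C) :
    ∃ B, ∀ η > 0, ∀ Ψ : ℝ → ℝ, Continuous Ψ → (∀ y, |Ψ y - Φ y| ≤ η) →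
      (∀ y, 1 ≤ y → Ψ y = Φ y) →
      Integrable (swirlDensity R1 R2 ω b Ψ v h) (cylMeasure R1 R2) ∧
      |∫ p, swirlDensity R1 R2 ω b Ψ v h p ∂cylMeasure R1 R2 -
        ∫ p, swirlDensity R1 R2 ω b Φ v h p ∂cylMeasure R1 R2| ≤ η * B := by
  have hb := hP.positiveBound
  have hK := hP.K_nonneg
  obtain ⟨A, hA, hlow⟩ := hb.exists_low_flux_bound h₁ hR
  obtain ⟨-, -, -, iΦ⟩ := hP.integrable_swirlDensity h₁ hR hS hC
  have iu := integrable_sq_of_memLp hS.integrable_swirl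
  have iS : Integrable (fun p : ℝ × ℝ => (v.θ p.1 p.2 - p.1 * ω p.1) ^ 2 +
      (1 + 2 * K) * A * (wt p.1 + wt p.1 * h p ^ 4)) (cylMeasure R1 R2) :=
    iu.add (((IsState.integrable_wt h₁).add (hS.integrable_wt_pow_four h₁ hR).1).const_mul _)
  refine ⟨∫ p : ℝ × ℝ, ((v.θ p.1 p.2 - p.1 * ω p.1) ^ 2 +
      (1 + 2 * K) * A * (wt p.1 + wt p.1 * h p ^ 4)) ∂cylMeasure R1 R2, fun η hη Ψ hΨc hΨ hΨ1 => ?_⟩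
  have mid : AEStronglyMeasurable (fun p : ℝ × ℝ => p.1) (cylMeasure R1 R2) :=
    measurable_fst.aestronglyMeasurable
  have mv : AEStronglyMeasurable (fun p : ℝ × ℝ => v.θ p.1 p.2) (cylMeasure R1 R2) := by
    refine (hS.integrable_swirl.1.add (hP.memLp_swirl h₁).1).congr
      (Eventually.of_forall fun p => ?_)
    simp only [Pi.add_apply, sub_add_cancel]
  have mω := aestronglyMeasurable_cyl_fst (hP.aesm_ω h₁)
  have mΨ : AEStronglyMeasurable (swirlDensity R1 R2 ω b Ψ v h) (cylMeasure R1 R2) :=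
    ((mid.mul mv).mul (hb.aesm_comp_flux_add h₁ hR hΨc hS)).sub
      (((mid.pow 2).mul mω).mul (hb.aesm_comp_flux h₁ hR hΨc))
  have hle : ∀ᵐ p ∂cylMeasure R1 R2,
      ‖swirlDensity R1 R2 ω b Ψ v h p - swirlDensity R1 R2 ω b Φ v h p‖ ≤
      η * ((v.θ p.1 p.2 - p.1 * ω p.1) ^ 2 + (1 + 2 * K) * A * (wt p.1 + wt p.1 * h p ^ 4)) := by
    filter_upwards [ae_cylMeasure_mem] with p hp
    have hr0 := radial_pos h₁ hp
    have hω : |ω p.1| ≤ K := (hP.bound_ω _ (radial_subset_radialClosed h₁ hp)).trans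
      (mul_le_of_le_one_right hK (rwt_zero_le_one hr0))
    have hw := wt_pos p.1
    set X := Ψ (flux R1 R2 b p.1 + h p) - Φ (flux R1 R2 b p.1 + h p) with hX
    set X0 := Ψ (flux R1 R2 b p.1) - Φ (flux R1 R2 b p.1) with hX0
    set u := v.θ p.1 p.2 - p.1 * ω p.1 with hu
    set W := wt p.1 + wt p.1 * h p ^ 4 with hW
    have hW0 : 0 ≤ W := by positivity
    have e : swirlDensity R1 R2 ω b Ψ v h p - swirlDensity R1 R2 ω b Φ v h p =
        p.1 * u * X + p.1 ^ 2 * ω p.1 * X - p.1 ^ 2 * ω p.1 * X0 := by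
      simp only [swirlDensity, hX, hX0, hu]
      ring
    rw [e, Real.norm_eq_abs]
    have key : ∀ Y : ℝ, |Y| ≤ η → (Y ≠ 0 → p.1 ^ 2 ≤ A * W) →
        p.1 ^ 2 * |Y| ≤ η * (A * W) := by
      intro Y hY hY0
      by_cases h0 : Y = 0
      · rw [h0, abs_zero, mul_zero]; positivity
      · calc p.1 ^ 2 * |Y| ≤ A * W * η := mul_le_mul (hY0 h0) hY (abs_nonneg _) (by positivity)
          _ = _ := by ring
    have hlow' : ∀ y, Ψ y - Φ y ≠ 0 → y < 1 := fun y hy => by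
      by_contra hn
      exact hy (sub_eq_zero.2 (hΨ1 y (not_lt.1 hn)))
    have eW : wt p.1 * (1 + h p ^ 4) = W := by rw [hW]; ring
    have k1 := key X (hΨ _) fun h0 => eW ▸ hlow _ hp (h p) (Or.inr (hlow' _ h0))
    have k2 := key X0 (hΨ _) fun h0 => eW ▸ hlow _ hp (h p) (Or.inl (hlow' _ h0))
    have k3 : |p.1 * u * X| ≤ η * u ^ 2 + p.1 ^ 2 * |X| := by
      rw [abs_mul, abs_mul, abs_of_pos hr0]
      have h3 : p.1 * |u| ≤ u ^ 2 + p.1 ^ 2 := by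
        nlinarith [sq_nonneg (p.1 - |u|), sq_abs u, sq_nonneg u, sq_nonneg p.1]
      calc p.1 * |u| * |X| ≤ (u ^ 2 + p.1 ^ 2) * |X| :=
            mul_le_mul_of_nonneg_right h3 (abs_nonneg _)
        _ = u ^ 2 * |X| + p.1 ^ 2 * |X| := by ring
        _ ≤ η * u ^ 2 + p.1 ^ 2 * |X| := by
            rw [mul_comm η]
            exact add_le_add_left (mul_le_mul_of_nonneg_left (hΨ _) (sq_nonneg _)) _
    have k4 : ∀ Y, p.1 ^ 2 * |Y| ≤ η * (A * W) → |p.1 ^ 2 * ω p.1 * Y| ≤ K * (η * (A * W)) := by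
      intro Y hY
      rw [abs_mul, abs_mul, abs_of_nonneg (sq_nonneg p.1)]
      calc p.1 ^ 2 * |ω p.1| * |Y| = |ω p.1| * (p.1 ^ 2 * |Y|) := by ring
        _ ≤ K * (η * (A * W)) := mul_le_mul hω hY (by positivity) hK
    have k5 := k4 X k1
    have k6 := k4 X0 k2
    have k7 := abs_sub (p.1 * u * X + p.1 ^ 2 * ω p.1 * X) (p.1 ^ 2 * ω p.1 * X0)
    have k8 := abs_add_le (p.1 * u * X) (p.1 ^ 2 * ω p.1 * X)
    linarith
  have idiff : Integrable (fun p => swirlDensity R1 R2 ω b Ψ v h p -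
      swirlDensity R1 R2 ω b Φ v h p) (cylMeasure R1 R2) :=
    Integrable.mono' (iS.const_mul η) (mΨ.sub iΦ.1) hle
  have iΨ : Integrable (swirlDensity R1 R2 ω b Ψ v h) (cylMeasure R1 R2) :=
    (idiff.add iΦ).congr (Eventually.of_forall fun p => by simp)
  refine ⟨iΨ, ?_⟩
  rw [← integral_sub iΨ iΦ, ← integral_const_mul]
  exact norm_integral_le_of_norm_le (iS.const_mul η) hle

/-- The swirl Casimir functional of the steady state is conserved, although it is only a limit of
continuously differentiable ones. -/
theorem swirl_conserved_data (hε : ε ≠ 0) {v H : ℝ → AxiField} {ψ : ℝ → ℝ → ℝ → ℝ}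
    (hS : ∀ t, 0 ≤ t → IsState R1 R2 ω b ε (v t) (H t) (relPot R1 b ε (ψ t)))
    (hC : CasimirData R1 R2 ω b b₁ ε (flux R1 R2 b) f F Φ D₀ C)
    (hcas : CasimirsConserved R1 R2 ω b ε v ψ) {t : ℝ} (ht : 0 ≤ t) :
    ∫ p, swirlDensity R1 R2 ω b Φ (v t) (relPot R1 b ε (ψ t)) p ∂cylMeasure R1 R2 =
      ∫ p, swirlDensity R1 R2 ω b Φ (v 0) (relPot R1 b ε (ψ 0)) p ∂cylMeasure R1 R2 := by
  obtain ⟨B0, hB0⟩ := hP.exists_swirl_approx h₁ hR (hS 0 le_rfl) hC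
  obtain ⟨B, hB⟩ := hP.exists_swirl_approx h₁ hR (hS t ht) hC
  rw [← sub_eq_zero, ← abs_nonpos_iff]
  refine le_of_forall_pos_le_add fun δ hδ => ?_
  have hpos : 0 < |B0| + |B| + 1 := by positivity
  obtain ⟨Ψ, hΨ, hΨΦ, hΨ1⟩ := hC.approx (δ / (|B0| + |B| + 1)) (by positivity)
  set η := δ / (|B0| + |B| + 1) with hη
  have hη0 : 0 < η := by positivity
  obtain ⟨i0, l0⟩ := hB0 η hη0 Ψ hΨ.continuous hΨΦ hΨ1
  obtain ⟨i1, l1⟩ := hB η hη0 Ψ hΨ.continuous hΨΦ hΨ1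
  have hc := hP.swirl_conserved h₁ hR hε hcas hΨ ht i0 i1
  rw [hc] at l1
  have hs : η * (|B0| + |B| + 1) = δ := div_mul_cancel₀ _ hpos.ne'
  have p1 := mul_le_mul_of_nonneg_left (le_abs_self B) hη0.le
  have p2 := mul_le_mul_of_nonneg_left (le_abs_self B0) hη0.le
  rw [abs_le] at l0 l1 ⊢
  constructor <;> linarith

end

end ProfileBound

end Conservation

/-! ### The energy of a state -/

section Energy

variable {R1 : ℝ} {R2 : EReal} {ω ω₁ ω₂ b b₁ b₂ : ℝ → ℝ} {ε : ℝ} {c K : ℝ}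
  {v H : AxiField} {h : ℝ × ℝ → ℝ}

namespace ProfileBound

theorem abs_b_le (hP : ProfileBound R1 R2 ω ω₁ ω₂ b b₁ b₂ c K) {r : ℝ}
    (hr : r ∈ radialClosed R1 R2) : |b r| ≤ K := by
  rw [abs_of_pos (hP.c_pos.trans_le (hP.lower_b r hr))]
  exact hP.upper_b r hr

theorem aesm_b (hP : ProfileBound R1 R2 ω ω₁ ω₂ b b₁ b₂ c K) (h₁ : 0 ≤ R1) :
    AEStronglyMeasurable b (volume.restrict (radial R1 R2)) :=
  (hP.cont_b.mono (radial_subset_radialClosed h₁)).aestronglyMeasurable measurableSet_radial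

/-- Product rule against the profile `b`, up to the inner boundary. -/
theorem integral_mul_add_mul (hP : ProfileBound R1 R2 ω ω₁ ω₂ b b₁ b₂ c K) (h₁ : 0 ≤ R1)
    {u g : ℝ → ℝ} (hp : RadialPrimitive R1 R2 u g) {R : ℝ} (hR : R ∈ radial R1 R2)
    (hi : IntervalIntegrable (fun r => b₁ r * u r + b r * g r) volume R1 R) :
    ∫ r in R1..R, (b₁ r * u r + b r * g r) = b R * u R := by
  have hsub : ∀ a ∈ Ioc R1 R, a ∈ radial R1 R2 := fun a ha => Ioc_subset_radial hR ha
  have hlim : Tendsto (fun a => ∫ r in a..R, (b₁ r * u r + b r * g r)) (𝓝[>] R1)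
      (𝓝 (∫ r in R1..R, (b₁ r * u r + b r * g r))) := by
    have hc := intervalIntegral.continuousOn_primitive_interval_left
      (μ := volume) (f := fun r => b₁ r * u r + b r * g r) (a := R1) (b := R) (by
        rw [uIcc_of_le hR.1.le, integrableOn_Icc_iff_integrableOn_Ioc]
        exact (intervalIntegrable_iff_integrableOn_Ioc_of_le hR.1.le).1 hi)
    rw [uIcc_of_le hR.1.le] at hc
    refine (hc R1 (left_mem_Icc.2 hR.1.le)).tendsto.mono_left ?_
    rw [← nhdsWithin_Ioo_eq_nhdsGT hR.1]
    exact nhdsWithin_mono _ Ioo_subset_Icc_self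
  have hlim0 : Tendsto (fun a => b a * u a) (𝓝[>] R1) (𝓝 0) := by
    have hq : Tendsto (fun a : ℝ => K ^ 2 * ((a ^ 2 - R1 ^ 2) / 2 * gradEnergy R1 R2 g)) (𝓝[>] R1)
        (𝓝 0) := by
      have : Continuous fun a : ℝ => K ^ 2 * ((a ^ 2 - R1 ^ 2) / 2 * gradEnergy R1 R2 g) := by
        fun_prop
      have h2 := this.tendsto R1
      simp only [sub_self, zero_div, zero_mul, mul_zero] at h2
      exact h2.mono_left nhdsWithin_le_nhds
    have hsq : Tendsto (fun a => (b a * u a) ^ 2) (𝓝[>] R1) (𝓝 0) := by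
      refine squeeze_zero' (Eventually.of_forall fun _ => sq_nonneg _) ?_ hq
      filter_upwards [Ioo_mem_nhdsGT hR.1] with a ha
      have har := hsub a ⟨ha.1, ha.2.le⟩
      rw [mul_pow]
      have hb2 := pow_le_pow_left₀ (abs_nonneg _)
        (hP.abs_b_le (radial_subset_radialClosed h₁ har)) 2
      rw [sq_abs] at hb2
      exact mul_le_mul hb2 (hp.sq_le' h₁ har) (sq_nonneg _) (sq_nonneg _)
    have := hsq.sqrt
    simp only [Real.sqrt_sq_eq_abs, Real.sqrt_zero] at this
    exact (tendsto_zero_iff_abs_tendsto_zero _).2 this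
  refine tendsto_nhds_unique hlim ?_
  have h3 : Tendsto (fun a => b R * u R - b a * u a) (𝓝[>] R1) (𝓝 (b R * u R)) := by
    simpa using tendsto_const_nhds.sub hlim0
  refine h3.congr' ?_
  filter_upwards [Ioo_mem_nhdsGT hR.1] with a ha
  have har := hsub a ⟨ha.1, ha.2.le⟩
  have hIcc : ∀ x ∈ Icc a R, x ∈ radial R1 R2 := fun x hx => hsub x ⟨ha.1.trans_le hx.1, hx.2⟩
  have key := integral_mul_add_mul_of_primitive (c := u a) ha.2.le
    (fun x hx => hP.deriv_b x (hIcc x hx))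
    (hP.cont_b₁.mono fun x hx => radial_subset_radialClosed h₁ (hIcc x hx))
    (hp.intervalIntegrable h₁ (mem_insert_of_mem _ har) (mem_insert_of_mem _ hR))
  have e : ∀ x ∈ Icc a R, u a + ∫ s in a..x, g s = u x := fun x hx => by
    rw [← hp.sub_eq h₁ har (hIcc x hx)]; ring
  rw [e R (right_mem_Icc.2 ha.2.le)] at key
  rw [← key]
  refine intervalIntegral.integral_congr fun x hx => ?_
  rw [uIcc_of_le ha.2.le] at hx
  simp only [e x hx]

end ProfileBound

theorem planeMeasure_restrict_fst_lt {R : ℝ} (hR : R ∈ radial R1 R2) :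
    (planeMeasure R1 R2).restrict {p | p.1 < R} = (volume.restrict (Ioc R1 R)).prod zMeasure := by
  have e : {p : ℝ × ℝ | p.1 < R} = Iio R ×ˢ univ := by
    ext p; simp
  rw [e, planeMeasure, ← Measure.prod_restrict, Measure.restrict_univ,
    Measure.restrict_restrict measurableSet_Iio, ← restrict_Ioo_eq_restrict_Ioc]
  congr 2
  ext r
  exact ⟨fun hr => ⟨hr.2.1, hr.1⟩, fun hr => ⟨hr.2, Ioc_subset_radial hR ⟨hr.1, hr.2.le⟩⟩⟩

theorem integrableOn_fst_lt_relGrad (hP : ProfileBound R1 R2 ω ω₁ ω₂ b b₁ b₂ c K) (h₁ : 0 ≤ R1)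
    (hS : IsState R1 R2 ω b ε v H h) {R : ℝ} (hR : R ∈ radial R1 R2) :
    IntegrableOn (fun p : ℝ × ℝ => b p.1 * relGrad b ε H p) {p | p.1 < R}
      (planeMeasure R1 R2) := by
  have hi : IntegrableOn (fun p : ℝ × ℝ => p.1) {p | p.1 < R} (planeMeasure R1 R2) := by
    rw [IntegrableOn, planeMeasure_restrict_fst_lt hR]
    exact Integrable.comp_fst (f := fun r : ℝ => r) continuous_id.integrableOn_Ioc zMeasure
  have hm : AEStronglyMeasurable (fun p : ℝ × ℝ => b p.1 * relGrad b ε H p)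
      (planeMeasure R1 R2) := (aestronglyMeasurable_fst (hP.aesm_b h₁)).mul hS.strip.aesm_g
  refine Integrable.mono' ((hS.strip.int_g.integrableOn.add hi).const_mul K) hm.restrict ?_
  filter_upwards [ae_restrict_of_ae (ae_planeMeasure_mem (R1 := R1) (R2 := R2))] with p hp
  rw [norm_mul]
  exact mul_le_mul (hP.abs_b_le (radial_subset_radialClosed h₁ hp))
    (abs_le_sq_div_add (radial_pos h₁ hp)) (abs_nonneg _) hP.K_nonneg

/-- Integration by parts against the profile `b` on a truncated strip. -/
theorem integral_fst_lt_relGrad (hP : ProfileBound R1 R2 ω ω₁ ω₂ b b₁ b₂ c K) (h₁ : 0 ≤ R1)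
    (hS : IsState R1 R2 ω b ε v H h)
    (hi : Integrable (fun p : ℝ × ℝ => b₁ p.1 * h p) (planeMeasure R1 R2)) {R : ℝ}
    (hR : R ∈ radial R1 R2) :
    ∫ p in {p : ℝ × ℝ | p.1 < R}, b p.1 * relGrad b ε H p ∂planeMeasure R1 R2 =
      2 * Real.pi * (b R * zMean fun z => h (R, z)) -
        ∫ p in {p : ℝ × ℝ | p.1 < R}, b₁ p.1 * h p ∂planeMeasure R1 R2 := by
  have i1 := integrableOn_fst_lt_relGrad hP h₁ hS hR
  have i2 := hi.integrableOn (s := {p : ℝ × ℝ | p.1 < R})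
  rw [eq_sub_iff_add_eq, add_comm, ← integral_add i2 i1]
  have i3 : Integrable (fun p : ℝ × ℝ => b₁ p.1 * h p + b p.1 * relGrad b ε H p)
      ((volume.restrict (Ioc R1 R)).prod zMeasure) := by
    rw [← planeMeasure_restrict_fst_lt hR]; exact i2.add i1
  rw [planeMeasure_restrict_fst_lt hR, integral_prod_symm _ i3]
  have e : ∫ z, (∫ r in Ioc R1 R, (b₁ r * h (r, z) + b r * relGrad b ε H (r, z))) ∂zMeasure =
      ∫ z, b R * h (R, z) ∂zMeasure := by
    refine integral_congr_ae ?_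
    filter_upwards [hS.strip.radialPrimitive, i3.prod_left_ae] with z hz hiz
    have := hP.integral_mul_add_mul h₁ hz hR
      ((intervalIntegrable_iff_integrableOn_Ioc_of_le hR.1.le).2 hiz)
    rwa [intervalIntegral.integral_of_le hR.1.le] at this
  rw [e, integral_const_mul, zMean]
  have := Real.pi_pos
  field_simp

/-- The part of the energy density that is quadratic in the perturbation or integrable. -/
def energyDensity (ω b : ℝ → ℝ) (ε : ℝ) (v H : AxiField) (p : ℝ × ℝ) : ℝ :=
  v.r p.1 p.2 ^ 2 + v.z p.1 p.2 ^ 2 + H.θ p.1 p.2 ^ 2 + (v.θ p.1 p.2 - p.1 * ω p.1) ^ 2 +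
    2 * ((v.θ p.1 p.2 - p.1 * ω p.1) * (p.1 * ω p.1)) +
    (H.r p.1 p.2 ^ 2 + (H.z p.1 p.2 - ε * b p.1) ^ 2)

theorem energyDensity_eq (p : ℝ × ℝ) :
    v.sq p + H.sq p - (v₀ ω).sq p - (H₀ b ε).sq p =
      energyDensity ω b ε v H p + 2 * (ε * b p.1) * (H.z p.1 p.2 - ε * b p.1) := by
  simp only [AxiField.sq, v₀, H₀, energyDensity]
  ring

theorem IsState.integrable_energyDensity (hS : IsState R1 R2 ω b ε v H h)
    (hP : ProfileBound R1 R2 ω ω₁ ω₂ b b₁ b₂ c K) (h₁ : 0 ≤ R1) (hε : ε ≠ 0) :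
    Integrable (energyDensity ω b ε v H) (cylMeasure R1 R2) :=
  ((hS.integrable_poloidal.add (integrable_sq_of_memLp hS.integrable_swirl)).add
    ((hS.integrable_swirl.integrable_mul (hP.memLp_swirl h₁)).const_mul 2)).add
    (hS.magnetic h₁ hε).1

/-- At infinity the boundary term in the energy vanishes. -/
theorem IsState.outer_limit_eq_zero (hS : IsState R1 ⊤ ω b ε v H h)
    (hP : ProfileBound R1 ⊤ ω ω₁ ω₂ b b₁ b₂ c K) (h₁ : 0 ≤ R1)
    (h0 : ∀ᵐ z ∂zMeasure, Tendsto (fun r => h (r, z)) atTop (𝓝 0)) {β : ℝ}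
    (hβ : Tendsto (fun R => b R * zMean fun z => h (R, z)) atTop (𝓝 β)) : β = 0 := by
  by_contra hne
  have hK := hP.K_nonneg
  set m := |β| / (2 * (K + 1)) with hm
  have hm0 : 0 < m := by
    have := abs_pos.2 hne
    positivity
  have hlarge : ∀ᶠ R in atTop, m ≤ |zMean fun z => h (R, z)| := by
    have h2 := hβ.abs.eventually_const_le (half_lt_self (abs_pos.2 hne))
    filter_upwards [h2, eventually_gt_atTop R1] with R h3 hR
    have hr : R ∈ radial R1 ⊤ := by rw [radial_top]; exact hR
    have hbK := hP.abs_b_le (radial_subset_radialClosed h₁ hr)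
    rw [abs_mul] at h3
    rw [hm, div_le_iff₀ (by positivity)]
    have := mul_le_mul_of_nonneg_right (hbK.trans (by linarith : K ≤ K + 1))
      (abs_nonneg (zMean fun z => h (R, z)))
    linarith
  have : NeBot (ae zMeasure) := by
    rw [ae_neBot]
    intro h
    have := zMeasure_univ
    rw [h] at this
    simp at this
  obtain ⟨z, hz, hzi⟩ := (h0.and (hS.strip.fluctuation h₁).1.prod_left_ae).exists
  have hsmall := hz.abs.eventually_le_const (u := m / 2) (by simpa using hm0)
  obtain ⟨M, hM⟩ := ((hlarge.and hsmall).and (eventually_gt_atTop (max R1 0))).exists_forall_of_atTop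
  refine not_integrableOn_Ioi_inv (a := M) ?_
  have hMR : Ioi M ⊆ radial R1 ⊤ := by
    rw [radial_top]
    exact Ioi_subset_Ioi ((le_max_left _ _).trans (hM M le_rfl).2.le)
  refine Integrable.mono' ((hzi.mono_measure (Measure.restrict_mono hMR le_rfl)).const_mul
    ((m / 2) ^ 2)⁻¹) measurable_inv.aestronglyMeasurable ?_
  filter_upwards [ae_restrict_mem measurableSet_Ioi] with r hr
  obtain ⟨⟨h2, h3⟩, h4⟩ := hM r (le_of_lt hr)
  have hr0 : 0 < r := (le_max_right _ _).trans_lt h4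
  rw [Real.norm_of_nonneg (inv_nonneg.2 hr0.le), inv_mul_eq_div, le_div_iff₀ (by positivity),
    inv_mul_eq_div]
  refine div_le_div_of_nonneg_right ?_ hr0.le
  have h5 : m / 2 ≤ |h (r, z) - zMean fun z => h (r, z)| := by
    have := abs_sub_abs_le_abs_sub (zMean fun z => h (r, z)) (h (r, z))
    rw [abs_sub_comm] at this
    linarith
  rw [← sq_abs (h (r, z) - _)]
  exact pow_le_pow_left₀ (by positivity) h5 2

/-- The truncated relative energies converge. -/
theorem IsTotalEnergy.tendsto {e : ℝ} (he : IsTotalEnergy R1 R2 ω b ε v H e)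
    (hS : IsState R1 R2 ω b ε v H h) (hP : ProfileBound R1 R2 ω ω₁ ω₂ b b₁ b₂ c K)
    (h₁ : 0 ≤ R1) (hR : (R1 : EReal) < R2) (hε : ε ≠ 0) :
    Tendsto (fun R : ℝ => 1 / 2 * ∫ p in {p : ℝ × ℝ | p.1 < R},
      (v.sq p + H.sq p - (v₀ ω).sq p - (H₀ b ε).sq p) ∂(cylMeasure R1 R2)) (toOuter R2)
      (𝓝 (e - if R2 = ⊤ then 0 else
        1 / 2 * ∫ p, ((v₀ ω).sq p + (H₀ b ε).sq p) ∂cylMeasure R1 R2)) := by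
  split_ifs with h2
  · subst h2
    rw [sub_zero, toOuter_top]
    exact he.2 rfl
  · have ib : Integrable (fun p : ℝ × ℝ => b p.1 ^ 2) (cylMeasure R1 R2) :=
      integrable_cyl_of_bounded (a := fun r => b r ^ 2) (M := K ^ 2) h₁ hR h2
        ((hP.aesm_b h₁).pow 2) fun r hr => by
          rw [abs_pow]
          exact pow_le_pow_left₀ (abs_nonneg _)
            (hP.abs_b_le (radial_subset_radialClosed h₁ hr)) 2
    have mb : MemLp (fun p : ℝ × ℝ => b p.1) 2 (cylMeasure R1 R2) :=
      (memLp_two_iff_integrable_sq (aestronglyMeasurable_cyl_fst (hP.aesm_b h₁))).2 ib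
    have hz : MemLp (fun p : ℝ × ℝ => H.z p.1 p.2 - ε * b p.1) 2 (cylMeasure R1 R2) :=
      hS.memH.2.2
    have i1 : Integrable (fun p => v.sq p + H.sq p - (v₀ ω).sq p - (H₀ b ε).sq p)
        (cylMeasure R1 R2) := by
      simp only [energyDensity_eq]
      refine (hS.integrable_energyDensity hP h₁ hε).add
        (((mb.integrable_mul hz).const_mul (2 * ε)).congr (Eventually.of_forall fun p => ?_))
      simp only [Pi.mul_apply]
      ring
    have i2 : Integrable (fun p => (v₀ ω).sq p + (H₀ b ε).sq p) (cylMeasure R1 R2) := by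
      refine ((integrable_sq_of_memLp (hP.memLp_swirl h₁)).add (ib.const_mul (ε ^ 2))).congr
        (Eventually.of_forall fun p => ?_)
      simp only [AxiField.sq, v₀, H₀, Pi.add_apply]
      ring
    have e1 : e - 1 / 2 * ∫ p, ((v₀ ω).sq p + (H₀ b ε).sq p) ∂cylMeasure R1 R2 =
        1 / 2 * ∫ p, (v.sq p + H.sq p - (v₀ ω).sq p - (H₀ b ε).sq p) ∂cylMeasure R1 R2 := by
      have i3 : Integrable (fun p => v.sq p + H.sq p) (cylMeasure R1 R2) :=
        (i1.add i2).congr (Eventually.of_forall fun p => by simp only [Pi.add_apply]; ring)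
      rw [he.1 h2, ← mul_sub, ← integral_sub i3 i2]
      congr 2
      ext p
      ring
    rw [e1]
    exact (tendsto_setIntegral_fst_lt hR cylMeasure_absolutelyContinuous i1).const_mul _

/-- The energy in terms of the perturbation, up to a constant. -/
theorem ProfileBound.exists_energy_eq (hP : ProfileBound R1 R2 ω ω₁ ω₂ b b₁ b₂ c K)
    (h₁ : 0 ≤ R1) (hR : (R1 : EReal) < R2) (hε : ε ≠ 0) {κ : ℝ} (hκ : R2 = ⊤ → κ = 0) :
    ∃ e₀ : ℝ, ∀ (v H : AxiField) (h : ℝ × ℝ → ℝ) (e : ℝ), IsState R1 R2 ω b ε v H h →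
      Integrable (fun p : ℝ × ℝ => ε ^ 2 * (b₁ p.1 / p.1) * h p) (cylMeasure R1 R2) →
      (∀ᵐ z ∂zMeasure, Tendsto (fun r => h (r, z)) (toOuter R2) (𝓝 κ)) →
      IsTotalEnergy R1 R2 ω b ε v H e →
      e = e₀ + (1 / 2 * ∫ p, energyDensity ω b ε v H p ∂cylMeasure R1 R2 -
        ∫ p, ε ^ 2 * (b₁ p.1 / p.1) * h p ∂cylMeasure R1 R2) := by
  set S : ℝ := if R2 = ⊤ then 0 else
    1 / 2 * ∫ p, ((v₀ ω).sq p + (H₀ b ε).sq p) ∂cylMeasure R1 R2 with hSd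
  have hne : NeBot (toOuter R2) := toOuter_neBot
  have hpi := Real.pi_pos
  refine ⟨S + (2 * Real.pi) ^ 2 * ε ^ 2 * (b R2.toReal * κ), fun v H h e hS hi hκz he => ?_⟩
  have hi' : Integrable (fun p : ℝ × ℝ => b₁ p.1 * h p) (planeMeasure R1 R2) := by
    refine (((integrable_cylMeasure_iff h₁).1 hi).const_mul (ε ^ 2)⁻¹).congr ?_
    filter_upwards [ae_planeMeasure_mem] with p hp
    have := radial_pos h₁ hp
    field_simp
  have eI : ∫ p, ε ^ 2 * (b₁ p.1 / p.1) * h p ∂cylMeasure R1 R2 =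
      2 * Real.pi * (ε ^ 2 * ∫ p, b₁ p.1 * h p ∂planeMeasure R1 R2) := by
    rw [integral_cylMeasure h₁, ← integral_const_mul (ε ^ 2)]
    congr 1
    refine integral_congr_ae ?_
    filter_upwards [ae_planeMeasure_mem] with p hp
    have := radial_pos h₁ hp
    field_simp
  have iQ := hS.integrable_energyDensity hP h₁ hε
  have lT := he.tendsto hS hP h₁ hR hε
  rw [← hSd] at lT
  have lQ := tendsto_setIntegral_fst_lt hR cylMeasure_absolutelyContinuous iQ
  have lb := tendsto_setIntegral_fst_lt hR Measure.AbsolutelyContinuous.rfl hi'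
  have eT : ∀ R ∈ radial R1 R2, 1 / 2 * ∫ p in {p : ℝ × ℝ | p.1 < R},
      (v.sq p + H.sq p - (v₀ ω).sq p - (H₀ b ε).sq p) ∂(cylMeasure R1 R2) =
      1 / 2 * ∫ p in {p : ℝ × ℝ | p.1 < R}, energyDensity ω b ε v H p ∂cylMeasure R1 R2 +
      2 * Real.pi * ε ^ 2 * (2 * Real.pi * (b R * zMean fun z => h (R, z)) -
        ∫ p in {p : ℝ × ℝ | p.1 < R}, b₁ p.1 * h p ∂planeMeasure R1 R2) := by
    intro R hRr
    rw [← integral_fst_lt_relGrad hP h₁ hS hi' hRr, setIntegral_cylMeasure h₁,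
      setIntegral_cylMeasure h₁]
    have j1 : IntegrableOn (fun p => p.1 * energyDensity ω b ε v H p) {p | p.1 < R}
        (planeMeasure R1 R2) := ((integrable_cylMeasure_iff h₁).1 iQ).integrableOn
    have j2 := (integrableOn_fst_lt_relGrad hP h₁ hS hRr).const_mul (2 * ε ^ 2)
    have : ∫ p in {p : ℝ × ℝ | p.1 < R}, p.1 * (v.sq p + H.sq p - (v₀ ω).sq p - (H₀ b ε).sq p)
        ∂(planeMeasure R1 R2) = ∫ p in {p : ℝ × ℝ | p.1 < R}, (p.1 * energyDensity ω b ε v H p +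
          2 * ε ^ 2 * (b p.1 * relGrad b ε H p)) ∂planeMeasure R1 R2 := by
      refine integral_congr_ae (Eventually.of_forall fun p => ?_)
      simp only [energyDensity_eq, relGrad]
      field_simp
    rw [this, integral_add j1 j2, integral_const_mul]
    ring
  set A := 1 / 2 * ∫ p, energyDensity ω b ε v H p ∂cylMeasure R1 R2 with hA
  set B := ∫ p, b₁ p.1 * h p ∂planeMeasure R1 R2 with hB
  have lβ : Tendsto (fun R => b R * zMean fun z => h (R, z)) (toOuter R2)
      (𝓝 (((e - S - A) / (2 * Real.pi * ε ^ 2) + B) / (2 * Real.pi))) := by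
    refine ((((lT.sub (lQ.const_mul (1 / 2))).div_const (2 * Real.pi * ε ^ 2)).add lb).div_const
      (2 * Real.pi)).congr' ?_
    filter_upwards [radial_mem_toOuter hR] with R hRr
    rw [eT R hRr]
    field_simp
    ring
  have hβ : ((e - S - A) / (2 * Real.pi * ε ^ 2) + B) / (2 * Real.pi) = b R2.toReal * κ := by
    by_cases h2 : R2 = ⊤
    · rw [hκ h2, mul_zero]
      subst h2
      rw [hκ rfl, toOuter_top] at hκz
      rw [toOuter_top] at lβ
      exact hS.outer_limit_eq_zero hP h₁ hκz lβ
    · refine tendsto_nhds_unique lβ (Tendsto.mul ?_ (hS.strip.tendsto_zMean h₁ hR h2 hκz))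
      obtain ⟨d, rfl, hd, ho, hI⟩ := exists_toOuter_eq hR h2
      rw [ho, EReal.toReal_coe]
      have hdm : d ∈ radialClosed R1 d := ⟨h₁.trans_lt hd, hd.le, le_rfl⟩
      refine (hP.cont_b d hdm).tendsto.mono_left ?_
      rw [← nhdsWithin_Ioo_eq_nhdsLT hd, ← hI]
      exact nhdsWithin_mono _ (radial_subset_radialClosed h₁)
  rw [eI]
  field_simp at hβ
  linarith

end Energy

/-! ### The Lyapunov functional -/

section Lyapunov

variable {R1 : ℝ} {R2 : EReal} {ω ω₁ ω₂ b b₁ b₂ : ℝ → ℝ} {ε : ℝ} {c K C L : ℝ}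
  {v H : AxiField} {h : ℝ × ℝ → ℝ} {f F Φ D₀ : ℝ → ℝ}

/-- The variation of `r Φ` along the perturbation. -/
def swirlShift (R1 : ℝ) (R2 : EReal) (b Φ : ℝ → ℝ) (h : ℝ × ℝ → ℝ) (p : ℝ × ℝ) : ℝ :=
  p.1 * (Φ (flux R1 R2 b p.1 + h p) - Φ (flux R1 R2 b p.1))

/-- The part of the Casimir density that is quadratic in the perturbation of the potential. -/
def potentialDensity (R1 : ℝ) (R2 : EReal) (ω b b₁ : ℝ → ℝ) (ε : ℝ) (f Φ : ℝ → ℝ)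
    (h : ℝ × ℝ → ℝ) (p : ℝ × ℝ) : ℝ :=
  f (flux R1 R2 b p.1 + h p) - f (flux R1 R2 b p.1) -
    1 / 2 * (p.1 ^ 2 * (Φ (flux R1 R2 b p.1 + h p) - Φ (flux R1 R2 b p.1)) ^ 2) +
    p.1 ^ 2 * ω p.1 * (Φ (flux R1 R2 b p.1 + h p) - Φ (flux R1 R2 b p.1)) -
    ε ^ 2 * (b₁ p.1 / p.1) * h p

/-- The conserved functional measuring the distance to the steady state. -/
def lyapunov (R1 : ℝ) (R2 : EReal) (ω b b₁ : ℝ → ℝ) (ε : ℝ) (f Φ : ℝ → ℝ) (v H : AxiField)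
    (h : ℝ × ℝ → ℝ) : ℝ :=
  1 / 2 * (∫ p, (v.r p.1 p.2 ^ 2 + v.z p.1 p.2 ^ 2 + H.θ p.1 p.2 ^ 2) ∂cylMeasure R1 R2) +
  1 / 2 * (∫ p, (v.θ p.1 p.2 - p.1 * ω p.1 + swirlShift R1 R2 b Φ h p) ^ 2 ∂cylMeasure R1 R2) +
  1 / 2 * (∫ p, (H.r p.1 p.2 ^ 2 + (H.z p.1 p.2 - ε * b p.1) ^ 2) ∂cylMeasure R1 R2) +
  ∫ p, potentialDensity R1 R2 ω b b₁ ε f Φ h p ∂cylMeasure R1 R2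

namespace ProfileBound

section

variable (hP : ProfileBound R1 R2 ω ω₁ ω₂ b b₁ b₂ c K) (h₁ : 0 ≤ R1) (hR : (R1 : EReal) < R2)

include hP h₁ hR

theorem memLp_swirlShift
    (hS : IsState R1 R2 ω b ε v H h)
    (hC : CasimirData R1 R2 ω b b₁ ε (flux R1 R2 b) f F Φ D₀ C) :
    MemLp (swirlShift R1 R2 b Φ h) 2 (cylMeasure R1 R2) := by
  have hb := hP.positiveBound
  refine (memLp_two_iff_integrable_sq ?_).2
    ((hP.integrable_swirlDensity h₁ hR hS hC).2.1.congr (Eventually.of_forall fun p => ?_))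
  · exact measurable_fst.aestronglyMeasurable.mul
      ((hb.aesm_comp_flux_add h₁ hR hC.cont_Φ hS).sub (hb.aesm_comp_flux h₁ hR hC.cont_Φ))
  · simp only [swirlShift]
    ring

theorem integrable_casimirData
    (hS : IsState R1 R2 ω b ε v H h)
    (hC : CasimirData R1 R2 ω b b₁ ε (flux R1 R2 b) f F Φ D₀ C) :
    Integrable (casimirDensity R1 R2 b f h) (cylMeasure R1 R2) :=
  (hP.positiveBound.integrable_casimirDensity h₁ hR hS
    (continuous_iff_continuousAt.2 fun y => (hC.deriv_f y).continuousAt) hC.cont_F hC.F_bound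
    hC.est_f).2

theorem integrable_potentialDensity
    (hS : IsState R1 R2 ω b ε v H h)
    (hC : CasimirData R1 R2 ω b b₁ ε (flux R1 R2 b) f F Φ D₀ C) :
    Integrable (potentialDensity R1 R2 ω b b₁ ε f Φ h) (cylMeasure R1 R2) := by
  obtain ⟨ib, iΦ, iω, -⟩ := hP.integrable_swirlDensity h₁ hR hS hC
  exact (((hP.integrable_casimirData h₁ hR hS hC).sub (iΦ.const_mul (1 / 2))).add iω).sub ib

theorem lyapunov_eq
    (hS : IsState R1 R2 ω b ε v H h)
    (hC : CasimirData R1 R2 ω b b₁ ε (flux R1 R2 b) f F Φ D₀ C)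
    (hε : ε ≠ 0) :
    1 / 2 * ∫ p, energyDensity ω b ε v H p ∂cylMeasure R1 R2 -
      ∫ p, ε ^ 2 * (b₁ p.1 / p.1) * h p ∂cylMeasure R1 R2 +
      ∫ p, casimirDensity R1 R2 b f h p ∂cylMeasure R1 R2 +
      ∫ p, swirlDensity R1 R2 ω b Φ v h p ∂cylMeasure R1 R2 =
    lyapunov R1 R2 ω b b₁ ε f Φ v H h := by
  obtain ⟨ib, -, -, iΨ⟩ := hP.integrable_swirlDensity h₁ hR hS hC
  have iE := hS.integrable_energyDensity hP h₁ hε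
  have iC := hP.integrable_casimirData h₁ hR hS hC
  have iX := hS.integrable_poloidal
  have iW : Integrable (fun p : ℝ × ℝ => (v.θ p.1 p.2 - p.1 * ω p.1 +
      swirlShift R1 R2 b Φ h p) ^ 2) (cylMeasure R1 R2) :=
    integrable_sq_of_memLp (hS.integrable_swirl.add (hP.memLp_swirlShift h₁ hR hS hC))
  have iM := (hS.magnetic h₁ hε).1
  have iV := hP.integrable_potentialDensity h₁ hR hS hC
  have j1 : Integrable (fun p : ℝ × ℝ => 1 / 2 * energyDensity ω b ε v H p -
      ε ^ 2 * (b₁ p.1 / p.1) * h p) (cylMeasure R1 R2) := (iE.const_mul _).sub ib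
  have j2 : Integrable (fun p : ℝ × ℝ => 1 / 2 * energyDensity ω b ε v H p -
      ε ^ 2 * (b₁ p.1 / p.1) * h p + casimirDensity R1 R2 b f h p) (cylMeasure R1 R2) := j1.add iC
  have j3 : Integrable (fun p : ℝ × ℝ => 1 / 2 * (v.r p.1 p.2 ^ 2 + v.z p.1 p.2 ^ 2 +
      H.θ p.1 p.2 ^ 2) + 1 / 2 * (v.θ p.1 p.2 - p.1 * ω p.1 + swirlShift R1 R2 b Φ h p) ^ 2)
      (cylMeasure R1 R2) := (iX.const_mul _).add (iW.const_mul _)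
  have j4 : Integrable (fun p : ℝ × ℝ => 1 / 2 * (v.r p.1 p.2 ^ 2 + v.z p.1 p.2 ^ 2 +
      H.θ p.1 p.2 ^ 2) + 1 / 2 * (v.θ p.1 p.2 - p.1 * ω p.1 + swirlShift R1 R2 b Φ h p) ^ 2 +
      1 / 2 * (H.r p.1 p.2 ^ 2 + (H.z p.1 p.2 - ε * b p.1) ^ 2))
      (cylMeasure R1 R2) := j3.add (iM.const_mul _)
  rw [lyapunov, ← integral_const_mul, ← integral_const_mul, ← integral_const_mul,
    ← integral_const_mul, ← integral_sub (iE.const_mul _) ib, ← integral_add j1 iC,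
    ← integral_add j2 iΨ, ← integral_add (iX.const_mul _) (iW.const_mul _),
    ← integral_add j3 (iM.const_mul _), ← integral_add j4 iV]
  refine integral_congr_ae ?_
  filter_upwards [ae_cylMeasure_mem] with p hp
  simp only [energyDensity, casimirDensity, swirlDensity, swirlShift, potentialDensity]
  rw [hC.Φ_eq _ hp]
  ring

theorem integral_swirlShift_sq_le
    (hS : IsState R1 R2 ω b ε v H h)
    (hC : CasimirData R1 R2 ω b b₁ ε (flux R1 R2 b) f F Φ D₀ C) :
    ∫ p, swirlShift R1 R2 b Φ h p ^ 2 ∂cylMeasure R1 R2 ≤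
    C * ∫ p, wt p.1 * (h p ^ 2 + h p ^ 4) ∂cylMeasure R1 R2 := by
  rw [← integral_const_mul]
  refine integral_mono_ae (integrable_sq_of_memLp (hP.memLp_swirlShift h₁ hR hS hC))
    ((hS.integrable_wt_sq_add h₁ hR).const_mul C) ?_
  filter_upwards [ae_cylMeasure_mem] with p hp
  have := hC.est_Φ _ hp (h p)
  simp only [swirlShift, mul_pow]
  exact this

end

end ProfileBound

/-- Bounds for the potential part of the Lyapunov functional. -/
theorem CasimirData.abs_potentialDensity_le
    (hC : CasimirData R1 R2 ω b b₁ ε (flux R1 R2 b) f F Φ D₀ C) (h : ℝ × ℝ → ℝ) : ∀ᵐ p ∂cylMeasure R1 R2,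
    |potentialDensity R1 R2 ω b b₁ ε f Φ h p| ≤ 3 * C * (wt p.1 * (h p ^ 2 + h p ^ 4)) := by
  filter_upwards [ae_cylMeasure_mem] with p hp
  have k1 := hC.est_f _ hp (h p)
  have k2 := hC.est_Φ _ hp (h p)
  have k3 := hC.est_ωΦ _ hp (h p)
  have k4 : F (flux R1 R2 b p.1) * h p + p.1 ^ 2 * ω p.1 * D₀ p.1 * h p =
      ε ^ 2 * (b₁ p.1 / p.1) * h p := by
    rw [← hC.linear _ hp]; ring
  have k5 : 0 ≤ p.1 ^ 2 * (Φ (flux R1 R2 b p.1 + h p) - Φ (flux R1 R2 b p.1)) ^ 2 := by positivity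
  rw [abs_le] at k1 k3 ⊢
  simp only [potentialDensity]
  constructor <;> linarith

/-- The weight has small mass near the boundary. -/
theorem exists_wt_tail (h₁ : 0 ≤ R1) (hR : (R1 : EReal) < R2) {δ : ℝ} (hδ : 0 < δ) :
    ∃ a ∈ radial R1 R2, ∃ a' ∈ radial R1 R2,
      ∫ r in radial R1 R2, (Icc a a')ᶜ.indicator (fun r => wt r * r ^ 3) r < δ := by
  have hcg : (toOuter R2).IsCountablyGenerated := toOuter_isCountablyGenerated
  have hne : NeBot (toOuter R2) := toOuter_neBot
  have h3 := integrableOn_wt_mul_pow (R2 := R2) h₁ (show 3 ≤ 4 by norm_num)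
  have hlim : Tendsto (fun q : ℝ × ℝ => ∫ r in radial R1 R2,
      (Icc q.1 q.2)ᶜ.indicator (fun r => wt r * r ^ 3) r) (𝓝[>] R1 ×ˢ toOuter R2)
      (𝓝 (∫ r in radial R1 R2, (0 : ℝ))) := by
    refine tendsto_integral_filter_of_dominated_convergence (fun r => ‖wt r * r ^ 3‖)
      (Eventually.of_forall fun q => h3.1.indicator measurableSet_Icc.compl)
      (Eventually.of_forall fun q => Eventually.of_forall fun r => norm_indicator_le_norm_self _ _)
      h3.norm ?_
    filter_upwards [ae_restrict_mem measurableSet_radial] with r hr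
    refine tendsto_const_nhds.congr' ?_
    have hin : ∀ᶠ a in 𝓝[>] R1, a < r := by
      filter_upwards [Ioo_mem_nhdsGT hr.1] with a ha using ha.2
    filter_upwards [hin.prod_inl (toOuter R2),
      (eventually_lt_toOuter hR hr).prod_inr (𝓝[>] R1)] with q hq hq'
    rw [indicator_of_notMem]
    exact fun hn => hn ⟨hq.le, hq'.le⟩
  rw [integral_zero] at hlim
  obtain ⟨r, hr⟩ := radial_nonempty hR
  have hin : ∀ᶠ a in 𝓝[>] R1, a ∈ radial R1 R2 := by
    filter_upwards [Ioo_mem_nhdsGT hr.1] with a ha using Ioc_subset_radial hr ⟨ha.1, ha.2.le⟩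
  obtain ⟨q, ⟨hq1, hq2⟩, hq3⟩ := ((hin.prod_inl (toOuter R2)).and
    (Eventually.prod_inr (radial_mem_toOuter hR) (𝓝[>] R1)) |>.and
    (hlim.eventually (gt_mem_nhds hδ))).exists
  exact ⟨q.1, hq1, q.2, hq2, hq3⟩

theorem abs_sub_half_mul_sq_le {P V w x C L ε τ E s : ℝ} (hP : |P| ≤ 3 * C * (w * (x ^ 2 + x ^ 4)))
    (hV : |V| ≤ L * w) (hw : 0 < w) (hC : 0 ≤ C) (hL : 0 ≤ L) (hτ : 0 < τ) (hE : 0 ≤ E)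
    (hs : 0 ≤ s)
    (hcase : (|x| ≤ τ → |P - 1 / 2 * (ε ^ 2 * V * x ^ 2)| ≤ E * (w * x ^ 2)) ∨ s = w * x ^ 2) :
    |P - 1 / 2 * ε ^ 2 * (V * x ^ 2)| ≤ E * (w * x ^ 2) + (3 * C + ε ^ 2 * L) * s +
      (3 * C + ε ^ 2 * L) * (1 + (τ ^ 2)⁻¹) * (w * x ^ 4) := by
  have hA : 0 ≤ 3 * C + ε ^ 2 * L := by positivity
  set A := 3 * C + ε ^ 2 * L with hAd
  have hcrude : |P - 1 / 2 * ε ^ 2 * (V * x ^ 2)| ≤ A * (w * x ^ 2) + A * (w * x ^ 4) := by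
    have h3 : |1 / 2 * ε ^ 2 * (V * x ^ 2)| ≤ ε ^ 2 * L * (w * x ^ 2) := by
      rw [abs_mul, abs_mul V, abs_of_nonneg (by positivity : 0 ≤ 1 / 2 * ε ^ 2),
        abs_of_nonneg (sq_nonneg x)]
      have h5 := mul_le_mul_of_nonneg_left (mul_le_mul_of_nonneg_right hV (sq_nonneg x))
        (sq_nonneg ε)
      have h6 : 0 ≤ ε ^ 2 * (|V| * x ^ 2) := by positivity
      linarith
    have h4 := abs_sub P (1 / 2 * ε ^ 2 * (V * x ^ 2))
    have h5 : 0 ≤ ε ^ 2 * L * (w * x ^ 4) := by positivity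
    have h6 : A * (w * x ^ 2) + A * (w * x ^ 4) = 3 * C * (w * (x ^ 2 + x ^ 4)) +
      ε ^ 2 * L * (w * x ^ 2) + ε ^ 2 * L * (w * x ^ 4) := by rw [hAd]; ring
    linarith
  have hE2 : 0 ≤ E * (w * x ^ 2) := by positivity
  have hτ4 : 0 ≤ A * (τ ^ 2)⁻¹ * (w * x ^ 4) := by positivity
  have hA4 : 0 ≤ A * (w * x ^ 4) := by positivity
  have hAs : 0 ≤ A * s := by positivity
  rcases hcase with h | rfl
  · by_cases hx : |x| ≤ τ
    · have h3 := h hx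
      have e : P - 1 / 2 * ε ^ 2 * (V * x ^ 2) = P - 1 / 2 * (ε ^ 2 * V * x ^ 2) := by ring
      rw [e]
      linarith
    · push Not at hx
      have h3 : x ^ 2 ≤ (τ ^ 2)⁻¹ * x ^ 4 := by
        rw [inv_mul_eq_div, le_div_iff₀ (by positivity)]
        have h4 := pow_le_pow_left₀ hτ.le hx.le 2
        rw [sq_abs] at h4
        nlinarith [mul_le_mul_of_nonneg_left h4 (sq_nonneg x)]
      have h4 := mul_le_mul_of_nonneg_left (mul_le_mul_of_nonneg_left h3 hw.le) hA
      linarith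
  · linarith

set_option maxHeartbeats 400000 in
/-- The potential part of the Lyapunov functional is given by the quadratic form with potential
`frakF`, up to small quadratic and higher order terms. -/
theorem ProfileBound.exists_potential_expansion
    (hP : ProfileBound R1 R2 ω ω₁ ω₂ b b₁ b₂ c K) (h₁ : 0 ≤ R1) (hR : (R1 : EReal) < R2)
    (hC : CasimirData R1 R2 ω b b₁ ε (flux R1 R2 b) f F Φ D₀ C)
    (hV : WeightBound R1 R2 (frakF ω b ε) L) {η : ℝ} (hη : 0 < η) :
    ∃ B, 0 ≤ B ∧ ∀ (v H : AxiField) (h : ℝ × ℝ → ℝ), IsState R1 R2 ω b ε v H h →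
      |∫ p, potentialDensity R1 R2 ω b b₁ ε f Φ h p ∂cylMeasure R1 R2 -
        Real.pi * ε ^ 2 * ∫ p, frakF ω b ε p.1 * p.1 * h p ^ 2 ∂planeMeasure R1 R2| ≤
      η * fluxEnergy R1 R2 b ε H + B * fluxEnergy R1 R2 b ε H ^ 2 := by
  have hC0 := hC.C_nonneg
  have hL0 := hV.nonneg
  have hpi := Real.pi_pos
  set I₃ := ∫ r in radial R1 R2, wt r * r ^ 3 with hI₃
  have hI0 : 0 ≤ I₃ := integral_wt_mul_cube_nonneg h₁
  set A := 3 * C + ε ^ 2 * L with hA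
  have hA0 : 0 ≤ A := by positivity
  obtain ⟨a, ha, a', ha', htail⟩ := exists_wt_tail (R1 := R1) (R2 := R2) h₁ hR
    (show 0 < η / 2 / (Real.pi * (A + 1)) by positivity)
  set I' := ∫ r in radial R1 R2, (Icc a a')ᶜ.indicator (fun r => wt r * r ^ 3) r with hI'
  set η' := η / 2 / ((1 + a' ^ 6) * (Real.pi * (I₃ + 1))) with hη'
  have hη'0 : 0 < η' := by positivity
  obtain ⟨τ, hτ, htay⟩ := hC.taylor a ha a' ha' η' hη'0
  refine ⟨A * (1 + (τ ^ 2)⁻¹) * (8 * Real.pi ^ 2), by positivity, fun v H h hS => ?_⟩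
  set n := fluxEnergy R1 R2 b ε H with hn
  have hn0 : 0 ≤ n := fluxEnergy_nonneg h₁
  obtain ⟨i2, l2⟩ := hS.integrable_wt_sq h₁
  obtain ⟨i4, l4⟩ := hS.integrable_wt_pow_four h₁ hR
  have iV := hP.integrable_potentialDensity h₁ hR hS hC
  have iF0 : Integrable (fun p => 1 / 2 * ε ^ 2 * (frakF ω b ε p.1 * h p ^ 2))
      (cylMeasure R1 R2) := by
    refine Integrable.const_mul ?_ _
    rw [integrable_cylMeasure_iff h₁]
    refine (hS.strip.integrable_weight h₁ hV).congr (Eventually.of_forall fun p => ?_)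
    simp only
    ring
  have eF : Real.pi * ε ^ 2 * ∫ p, frakF ω b ε p.1 * p.1 * h p ^ 2 ∂planeMeasure R1 R2 =
      ∫ p, 1 / 2 * ε ^ 2 * (frakF ω b ε p.1 * h p ^ 2) ∂cylMeasure R1 R2 := by
    rw [integral_const_mul, integral_cylMeasure h₁]
    have : ∫ p, p.1 * (frakF ω b ε p.1 * h p ^ 2) ∂planeMeasure R1 R2 =
        ∫ p, frakF ω b ε p.1 * p.1 * h p ^ 2 ∂planeMeasure R1 R2 :=
      integral_congr_ae (Eventually.of_forall fun p => by simp only; ring)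
    rw [this]
    ring
  set w' : ℝ → ℝ := (Icc a a')ᶜ.indicator fun r => wt r * r with hw'
  have ew' : ∀ r, w' r * r ^ 2 = (Icc a a')ᶜ.indicator (fun r => wt r * r ^ 3) r := by
    intro r
    by_cases hr : r ∈ (Icc a a')ᶜ
    · rw [hw', indicator_of_mem hr, indicator_of_mem hr]; ring
    · rw [hw', indicator_of_notMem hr, indicator_of_notMem hr, zero_mul]
  obtain ⟨it, lt'⟩ := hS.strip.integral_weight_sq_le h₁ (w := w')
    (fun r hr => indicator_apply_nonneg fun _ => mul_nonneg (wt_pos r).le (radial_pos h₁ hr).le)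
    (by
      simp only [ew']
      exact (integrableOn_wt_mul_pow h₁ (show 3 ≤ 4 by norm_num)).indicator measurableSet_Icc.compl)
    ((continuous_wt.mul continuous_id).aestronglyMeasurable.indicator measurableSet_Icc.compl)
  simp only [ew', ← hI'] at lt'
  set s : ℝ × ℝ → ℝ := fun p => (Icc a a')ᶜ.indicator wt p.1 * h p ^ 2 with hs
  have es : ∀ p : ℝ × ℝ, p.1 * s p = w' p.1 * h p ^ 2 := by
    intro p
    by_cases hr : p.1 ∈ (Icc a a')ᶜ
    · rw [hw', hs, indicator_of_mem hr]
      simp only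
      rw [indicator_of_mem hr]; ring
    · rw [hw', hs, indicator_of_notMem hr]
      simp only
      rw [indicator_of_notMem hr]; ring
  have is : Integrable s (cylMeasure R1 R2) := by
    rw [integrable_cylMeasure_iff h₁]
    simpa only [es] using it
  have ls : ∫ p, s p ∂cylMeasure R1 R2 ≤ Real.pi * I' * n := by
    rw [integral_cylMeasure h₁]
    simp only [es]
    have h3 := stripEnergy_nonneg (R2 := R2) h₁ (relAxial ε H)
    have hI'0 : 0 ≤ I' := setIntegral_nonneg measurableSet_radial fun r hr =>
      indicator_apply_nonneg fun _ => by
        have := radial_pos h₁ hr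
        have := wt_pos r
        positivity
    have h4 := mul_le_mul_of_nonneg_left lt' Real.two_pi_pos.le
    have h5 : 0 ≤ Real.pi * I' * stripEnergy R1 R2 (relAxial ε H) := by positivity
    rw [hn, fluxEnergy]
    linarith
  have hE0 : 0 ≤ η' * (1 + a' ^ 6) := by positivity
  have j2 := i2.const_mul (η' * (1 + a' ^ 6))
  have j3 := is.const_mul A
  have j4 := i4.const_mul (A * (1 + (τ ^ 2)⁻¹))
  have j23 : Integrable (fun p => η' * (1 + a' ^ 6) * (wt p.1 * h p ^ 2) + A * s p)
      (cylMeasure R1 R2) := j2.add j3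
  have j234 : Integrable (fun p => η' * (1 + a' ^ 6) * (wt p.1 * h p ^ 2) + A * s p +
      A * (1 + (τ ^ 2)⁻¹) * (wt p.1 * h p ^ 4)) (cylMeasure R1 R2) := j23.add j4
  have hpt : ∀ᵐ p ∂cylMeasure R1 R2, ‖potentialDensity R1 R2 ω b b₁ ε f Φ h p -
      1 / 2 * ε ^ 2 * (frakF ω b ε p.1 * h p ^ 2)‖ ≤
      η' * (1 + a' ^ 6) * (wt p.1 * h p ^ 2) + A * s p +
      A * (1 + (τ ^ 2)⁻¹) * (wt p.1 * h p ^ 4) := by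
    filter_upwards [ae_cylMeasure_mem, hC.abs_potentialDensity_le h] with p hp hpot
    have hr0 := radial_pos h₁ hp
    have hw := wt_pos p.1
    have hs0 : 0 ≤ s p := mul_nonneg (indicator_nonneg (fun r _ => (wt_pos r).le) _) (sq_nonneg _)
    refine abs_sub_half_mul_sq_le hpot (hV.le _ hp) hw hC0 hL0 hτ hE0 hs0 ?_
    by_cases hin : p.1 ∈ Icc a a'
    · refine Or.inl fun hsmall => (htay _ hin (h p) hsmall).trans ?_
      have h6 : η' * h p ^ 2 ≤ η' * h p ^ 2 * ((1 + a' ^ 6) * wt p.1) :=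
        le_mul_of_one_le_right (by positivity) (one_le_mul_wt_of_le hr0.le hin.2)
      linarith
    · refine Or.inr ?_
      simp only [hs]
      rw [indicator_of_mem (show p.1 ∈ (Icc a a')ᶜ from hin)]
  rw [eF, ← integral_sub iV iF0, ← Real.norm_eq_abs]
  refine (norm_integral_le_of_norm_le j234 hpt).trans ?_
  rw [integral_add j23 j4, integral_add j2 j3, integral_const_mul, integral_const_mul,
    integral_const_mul]
  have f2 : η' * (1 + a' ^ 6) * ∫ p, wt p.1 * h p ^ 2 ∂cylMeasure R1 R2 ≤ η / 2 * n := by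
    have h3 := mul_le_mul_of_nonneg_left l2 (by positivity : 0 ≤ η' * (1 + a' ^ 6))
    refine h3.trans ?_
    have e : η' * (1 + a' ^ 6) * (Real.pi * (I₃ + 1)) = η / 2 := by
      rw [hη']; field_simp
    rw [← e]
    have : 0 ≤ η' * (1 + a' ^ 6) * Real.pi * n := by positivity
    linarith
  have f3 : A * ∫ p, s p ∂cylMeasure R1 R2 ≤ η / 2 * n := by
    refine (mul_le_mul_of_nonneg_left ls hA0).trans ?_
    rw [lt_div_iff₀ (by positivity)] at htail
    have hI'0 : 0 ≤ I' := setIntegral_nonneg measurableSet_radial fun r hr =>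
      indicator_apply_nonneg fun _ => by
        have := radial_pos h₁ hr
        have := wt_pos r
        positivity
    have h4 := mul_le_mul_of_nonneg_right htail.le hn0
    have h5 : 0 ≤ I' * Real.pi * n := by positivity
    linarith
  have f4 := mul_le_mul_of_nonneg_left l4 (by positivity : 0 ≤ A * (1 + (τ ^ 2)⁻¹))
  linarith

end Lyapunov

/-! ### Moments of the axial mean -/

section Moments

variable {R1 : ℝ} {R2 : EReal} {ω ω₁ ω₂ b b₁ b₂ : ℝ → ℝ} {ε : ℝ} {c K C L : ℝ}
  {v H : AxiField} {h : ℝ × ℝ → ℝ} {q : ℝ × ℝ}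

theorem exists_hasDerivAt_tent (q : ℝ × ℝ) :
    ∃ f : ℝ → ℝ, ContDiff ℝ 1 f ∧ ∀ y, HasDerivAt f (tent q y) y := by
  have hd : ∀ y, HasDerivAt (fun y => ∫ s in (0 : ℝ)..y, tent q s) (tent q y) y := fun y =>
    intervalIntegral.integral_hasDerivAt_right ((continuous_tent q).intervalIntegrable _ _)
      ((continuous_tent q).stronglyMeasurableAtFilter _ _) (continuous_tent q).continuousAt
  refine ⟨_, contDiff_one_iff_deriv.2 ⟨fun y => (hd y).differentiableAt, ?_⟩, hd⟩
  rw [show deriv (fun y => ∫ s in (0 : ℝ)..y, tent q s) = tent q from funext fun y => (hd y).deriv]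
  exact continuous_tent q

namespace PositiveBound

theorem nearBound_tent (hb : PositiveBound R1 R2 b c K) (h₁ : 0 ≤ R1) (hR : (R1 : EReal) < R2)
    (q : ℝ × ℝ) : ∃ L, NearBound R1 R2 (flux R1 R2 b) (tent q) 6 L := by
  have hc := hb.c_pos
  set M := 1 + 4 * (|q.1| + |q.2|) / c with hM
  have hM1 : 1 ≤ M := by
    have : 0 ≤ 4 * (|q.1| + |q.2|) / c := by positivity
    linarith
  have hM6 : 0 ≤ M ^ 6 := by positivity
  have hzero : ∀ y, |q.1| + |q.2| ≤ y → tent q y = 0 := by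
    intro y hy
    by_contra hne
    have h3 := abs_lt_of_tent_ne_zero hne
    have h4 := le_abs_self (y - q.1)
    have h5 := le_abs_self q.1
    have h6 := le_abs_self q.2
    linarith
  refine ⟨(1 + M ^ 6) + |q.2|, ⟨by positivity, fun y y' => ?_, fun r hr y hy => ?_, fun _ y => ?_⟩⟩
  · refine (abs_tent_sub_le q y y').trans (le_mul_of_one_le_left (abs_nonneg _) ?_)
    have := abs_nonneg q.2
    linarith
  · have hr0 := radial_pos h₁ hr
    rw [← wt_eq_rwt]
    have hw := wt_pos r
    rcases le_total r M with h | h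
    · refine (abs_tent_sub_le q y _).trans (le_mul_of_one_le_left (abs_nonneg _) ?_)
      have h3 := one_le_mul_wt_of_le hr0.le h
      have : 0 ≤ |q.2| * wt r := by positivity
      linarith
    · have h3 := (hb.flux_bounds h₁ hR hr0.le).1
      have h4 : |q.1| + |q.2| ≤ c / 4 * r ^ 2 := by
        have h5 : 4 * (|q.1| + |q.2|) / c ≤ r ^ 2 := by
          have : 4 * (|q.1| + |q.2|) / c ≤ r := by linarith
          have : r ≤ r ^ 2 := by nlinarith
          linarith
        rw [div_le_iff₀ hc] at h5
        linarith
      have h5 := mul_pos hc (sq_pos_of_pos hr0)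
      rw [hzero y (by linarith), hzero (flux R1 R2 b r) (by linarith), sub_self, abs_zero]
      positivity
  · rw [abs_of_nonneg (tent_nonneg q y)]
    have h3 := le_abs_self q.2
    refine max_le (by positivity) ?_
    have := abs_nonneg (y - q.1)
    linarith

theorem exists_tent_bound (h₁ : 0 ≤ R1) (hT : TentSupported R1 R2 (flux R1 R2 b) q) :
    ∃ C, 0 ≤ C ∧ ∀ r ∈ radial R1 R2, |tent q (flux R1 R2 b r)| ≤ C * (r ^ 2 * wt r) := by
  obtain ⟨a, ha, d, hd, hsupp⟩ := hT
  have ha0 := radial_pos h₁ ha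
  refine ⟨|q.2| * ((a ^ 2)⁻¹ * (1 + d ^ 6)), by positivity, fun r hr => ?_⟩
  have hr0 := radial_pos h₁ hr
  have hw := wt_pos r
  by_cases h0 : tent q (flux R1 R2 b r) = 0
  · rw [h0, abs_zero]; positivity
  · obtain ⟨h3, h4⟩ := hsupp r hr h0
    rw [abs_of_nonneg (tent_nonneg q _)]
    have h5 : tent q (flux R1 R2 b r) ≤ |q.2| := by
      have h3 := le_abs_self q.2
      refine max_le (by positivity) ?_
      have := abs_nonneg (flux R1 R2 b r - q.1)
      linarith
    have h6 : 1 ≤ (a ^ 2)⁻¹ * r ^ 2 := by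
      rw [inv_mul_eq_div, one_le_div (by positivity)]
      exact pow_le_pow_left₀ ha0.le h3 2
    have h7 := one_le_mul_wt_of_le hr0.le h4
    calc tent q (flux R1 R2 b r) ≤ |q.2| * 1 := by rwa [mul_one]
      _ ≤ |q.2| * ((a ^ 2)⁻¹ * r ^ 2 * ((1 + d ^ 6) * wt r)) :=
          mul_le_mul_of_nonneg_left (one_le_mul_of_one_le_of_one_le h6 h7) (abs_nonneg _)
      _ = _ := by ring

end PositiveBound

/-- A moment of the axial mean is an integral over the cylinder. -/
theorem integral_tent_mul_eq (h₁ : 0 ≤ R1)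
    (hi : Integrable (fun p : ℝ × ℝ => tent q (flux R1 R2 b p.1) * h p) (cylMeasure R1 R2)) :
    ∫ p, tent q (flux R1 R2 b p.1) * h p ∂cylMeasure R1 R2 =
      (2 * Real.pi) ^ 2 * moment R1 R2 (flux R1 R2 b) q (fun r => zMean fun z => h (r, z)) := by
  have hi' := (integrable_cylMeasure_iff h₁).1 hi
  have hpi := Real.pi_pos
  rw [integral_cylMeasure h₁, planeMeasure, integral_prod _ hi', moment, sq,
    mul_assoc (2 * Real.pi) (2 * Real.pi)]
  congr 1
  rw [← integral_const_mul]
  refine integral_congr_ae (Eventually.of_forall fun r => ?_)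
  simp only
  rw [zMean, integral_const_mul, integral_const_mul]
  field_simp

/-- The moments of the axial mean are conserved up to quadratic errors. -/
theorem PositiveBound.exists_moment_bound (hb : PositiveBound R1 R2 b c K) (h₁ : 0 ≤ R1)
    (hR : (R1 : EReal) < R2) (hε : ε ≠ 0) (hT : TentSupported R1 R2 (flux R1 R2 b) q) :
    ∃ B, 0 ≤ B ∧ ∀ (v H : ℝ → AxiField) (ψ : ℝ → ℝ → ℝ → ℝ),
      CasimirsConserved R1 R2 ω b ε v ψ →
      (∀ t, 0 ≤ t → IsState R1 R2 ω b ε (v t) (H t) (relPot R1 b ε (ψ t))) → ∀ t, 0 ≤ t →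
      fluxEnergy R1 R2 b ε (H 0) ≤ 1 → fluxEnergy R1 R2 b ε (H t) ≤ 1 →
      moment R1 R2 (flux R1 R2 b) q (fun r => zMean fun z => relPot R1 b ε (ψ t) (r, z)) ^ 2 ≤
        B * (fluxEnergy R1 R2 b ε (H 0) + fluxEnergy R1 R2 b ε (H t) ^ 2) := by
  have hpi := Real.pi_pos
  have hc := hb.c_pos
  obtain ⟨f, hf, hd⟩ := exists_hasDerivAt_tent q
  obtain ⟨L, hL⟩ := hb.nearBound_tent h₁ hR q
  obtain ⟨C₁, hC₁, hest⟩ := hL.exists_primitive_bound h₁ hR (κ := c / 2) (by positivity)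
    (fun r hr => (hb.flux_bounds h₁ hR (radial_pos h₁ hr).le).1) hd
  obtain ⟨C₂, hC₂, hbd⟩ := PositiveBound.exists_tent_bound h₁ hT
  obtain ⟨C₃, hC₃, hmom⟩ := exists_sq_moment_le hT h₁
    ((hb.continuousOn_flux h₁ hR).mono fun r hr => (radial_pos h₁ hr).le)
  obtain ⟨G, hG, hwt⟩ := IsState.exists_integral_wt_bound h₁ hR
  set A := C₁ * G with hA
  have hA0 : 0 ≤ A := by positivity
  have hcas : ∀ (v H : AxiField) (h : ℝ × ℝ → ℝ), IsState R1 R2 ω b ε v H h →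
      fluxEnergy R1 R2 b ε H ≤ 1 →
      Integrable (casimirDensity R1 R2 b f h) (cylMeasure R1 R2) ∧
      |∫ p, casimirDensity R1 R2 b f h p ∂cylMeasure R1 R2 - (2 * Real.pi) ^ 2 *
        moment R1 R2 (flux R1 R2 b) q (fun r => zMean fun z => h (r, z))| ≤
        A * fluxEnergy R1 R2 b ε H := by
    intro v H h hS hn
    have hn0 : 0 ≤ fluxEnergy R1 R2 b ε H := fluxEnergy_nonneg h₁
    have hle1 : ∀ r ∈ radial R1 R2, |tent q (flux R1 R2 b r)| ≤ (C₁ + C₂) * (r ^ 2 * wt r) :=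
      fun r hr => (hbd r hr).trans (mul_le_mul_of_nonneg_right (by linarith)
        (mul_nonneg (sq_nonneg _) (wt_pos r).le))
    obtain ⟨i1, i2⟩ := hb.integrable_casimirDensity (C := C₁ + C₂) h₁ hR hS hf.continuous
      (continuous_tent q) hle1 fun r hr x => (hest r hr x).trans
        (mul_le_mul_of_nonneg_right (by linarith) (mul_nonneg (wt_pos r).le (by positivity)))
    refine ⟨i2, ?_⟩
    rw [← integral_tent_mul_eq h₁ i1, ← integral_sub i2 i1]
    have i3 := (hS.integrable_wt_sq_add h₁ hR).const_mul C₁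
    have h3 : |∫ p, (casimirDensity R1 R2 b f h p - tent q (flux R1 R2 b p.1) * h p)
        ∂cylMeasure R1 R2| ≤ ∫ p, C₁ * (wt p.1 * (h p ^ 2 + h p ^ 4)) ∂cylMeasure R1 R2 := by
      rw [← Real.norm_eq_abs]
      refine norm_integral_le_of_norm_le i3 ?_
      filter_upwards [ae_cylMeasure_mem] with p hp
      exact hest _ hp _
    rw [integral_const_mul] at h3
    refine h3.trans ((mul_le_mul_of_nonneg_left (hwt _ _ _ _ _ _ hS hn) hC₁).trans_eq ?_)
    ring
  refine ⟨4 * (C₃ + 4 * A ^ 2), by positivity, fun v H ψ hcons hS t ht hn0' hnt' => ?_⟩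
  obtain ⟨i0, l0⟩ := hcas _ _ _ (hS 0 le_rfl) hn0'
  obtain ⟨it, lt'⟩ := hcas _ _ _ (hS t ht) hnt'
  have hc0 := hb.casimir_conserved h₁ hR hε hcons hf ht i0 it
  rw [hc0] at lt'
  set n0 := fluxEnergy R1 R2 b ε (H 0) with hn0
  set nt := fluxEnergy R1 R2 b ε (H t) with hnt
  have n0n : 0 ≤ n0 := fluxEnergy_nonneg h₁
  have ntn : 0 ≤ nt := fluxEnergy_nonneg h₁
  set m0 := moment R1 R2 (flux R1 R2 b) q (fun r => zMean fun z => relPot R1 b ε (ψ 0) (r, z))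
  set mt := moment R1 R2 (flux R1 R2 b) q (fun r => zMean fun z => relPot R1 b ε (ψ t) (r, z))
  have hm0 : m0 ^ 2 ≤ C₃ * n0 := by
    refine (hmom _ _ ((hS 0 le_rfl).strip.zMean_radialPrimitive h₁).1).trans
      (mul_le_mul_of_nonneg_left ?_ hC₃)
    have h3 := (hS 0 le_rfl).strip.gradEnergy_zMean_le h₁
    have h4 := gradEnergy_nonneg (R2 := R2)
      (g := fun r => zMean fun z => relGrad b ε (H 0) (r, z)) h₁
    have h5 := stripEnergy_nonneg (R2 := R2) h₁ (relAxial ε (H 0))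
    have h6 : gradEnergy R1 R2 (fun r => zMean fun z => relGrad b ε (H 0) (r, z)) ≤
        2 * Real.pi * gradEnergy R1 R2 (fun r => zMean fun z => relGrad b ε (H 0) (r, z)) :=
      le_mul_of_one_le_left h4 (by linarith [Real.pi_gt_three])
    rw [hn0, fluxEnergy]
    linarith
  have hdiff : |mt - m0| ≤ A * n0 + A * nt := by
    have h3 : |(2 * Real.pi) ^ 2 * (mt - m0)| ≤ A * n0 + A * nt := by
      rw [abs_le] at l0 lt' ⊢
      constructor <;> linarith
    rw [abs_mul, abs_of_pos (by positivity : 0 < (2 * Real.pi) ^ 2)] at h3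
    refine (le_mul_of_one_le_left (abs_nonneg _) ?_).trans h3
    nlinarith [Real.pi_gt_three]
  have h7 : (mt - m0) ^ 2 ≤ (A * n0 + A * nt) ^ 2 := by
    rw [← sq_abs]
    exact pow_le_pow_left₀ (abs_nonneg _) hdiff 2
  have h8 : n0 ^ 2 ≤ n0 := by nlinarith
  have h9 : mt ^ 2 ≤ 2 * m0 ^ 2 + 2 * (mt - m0) ^ 2 := by nlinarith [sq_nonneg (mt - 2 * m0)]
  have h10 : (A * n0 + A * nt) ^ 2 ≤ 2 * A ^ 2 * (n0 ^ 2 + nt ^ 2) := by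
    nlinarith [sq_nonneg (A * n0 - A * nt)]
  have h11 := mul_le_mul_of_nonneg_left h8 (sq_nonneg A)
  have h12 : 0 ≤ A ^ 2 * n0 := by positivity
  have h13 : 0 ≤ A ^ 2 * nt ^ 2 := by positivity
  have h14 : 0 ≤ C₃ * n0 := by positivity
  have h15 : 0 ≤ C₃ * nt ^ 2 := by positivity
  linarith

end Moments

/-! ### Stability -/

section Stability

variable {R1 : ℝ} {R2 : EReal} {ω ω₁ ω₂ b b₁ b₂ : ℝ → ℝ} {ε : ℝ} {c K C L : ℝ}
  {v H : AxiField} {h : ℝ × ℝ → ℝ} {f F Φ D₀ : ℝ → ℝ}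

theorem integral_add_sq_le {α : Type*} [MeasurableSpace α] {μ : Measure α} {f g : α → ℝ}
    (hf : MemLp f 2 μ) (hg : MemLp g 2 μ) :
    ∫ x, (f x + g x) ^ 2 ∂μ ≤ 2 * ∫ x, f x ^ 2 ∂μ + 2 * ∫ x, g x ^ 2 ∂μ := by
  have i1 := (integrable_sq_of_memLp hf).const_mul 2
  have i2 := (integrable_sq_of_memLp hg).const_mul 2
  rw [← integral_const_mul, ← integral_const_mul, ← integral_add i1 i2]
  refine integral_mono (integrable_sq_of_memLp (hf.add hg)) (i1.add i2) fun x => ?_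
  simp only
  nlinarith [sq_nonneg (f x - g x)]

theorem IsState.fluxEnergy_le (hS : IsState R1 R2 ω b ε v H h) (h₁ : 0 ≤ R1) (hε : ε ≠ 0) :
    Real.pi * ε ^ 2 * fluxEnergy R1 R2 b ε H ≤ mhdDist R1 R2 ω b ε v H := by
  have hM := (hS.magnetic h₁ hε).2
  have hX : 0 ≤ ∫ p, (v.r p.1 p.2 ^ 2 + v.z p.1 p.2 ^ 2 + H.θ p.1 p.2 ^ 2) ∂cylMeasure R1 R2 :=
    integral_nonneg fun p => by positivity
  have hU : 0 ≤ ∫ p, (v.θ p.1 p.2 - p.1 * ω p.1) ^ 2 ∂cylMeasure R1 R2 :=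
    integral_nonneg fun p => by positivity
  rw [mhdDist, hM]
  linarith

namespace ProfileBound

section

variable (hP : ProfileBound R1 R2 ω ω₁ ω₂ b b₁ b₂ c K) (h₁ : 0 ≤ R1) (hR : (R1 : EReal) < R2)

include hP h₁ hR

theorem exists_lyapunov_le
    (hC : CasimirData R1 R2 ω b b₁ ε (flux R1 R2 b) f F Φ D₀ C) :
    ∃ B, 0 ≤ B ∧ ∀ (v H : AxiField) (h : ℝ × ℝ → ℝ), IsState R1 R2 ω b ε v H h →
      fluxEnergy R1 R2 b ε H ≤ 1 →
      lyapunov R1 R2 ω b b₁ ε f Φ v H h ≤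
        2 * mhdDist R1 R2 ω b ε v H + B * fluxEnergy R1 R2 b ε H := by
  obtain ⟨G, hG, hwt⟩ := IsState.exists_integral_wt_bound (R2 := R2) h₁ hR
  have hC0 := hC.C_nonneg
  refine ⟨4 * C * G, by positivity, fun v H h hS hn => ?_⟩
  have hw := hwt _ _ _ _ _ _ hS hn
  have hs := hP.integral_swirlShift_sq_le h₁ hR hS hC
  have hu := integral_add_sq_le hS.integrable_swirl (hP.memLp_swirlShift h₁ hR hS hC)
  have hpot : ∫ p, potentialDensity R1 R2 ω b b₁ ε f Φ h p ∂cylMeasure R1 R2 ≤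
      3 * C * ∫ p, wt p.1 * (h p ^ 2 + h p ^ 4) ∂cylMeasure R1 R2 := by
    rw [← integral_const_mul]
    refine integral_mono_ae (hP.integrable_potentialDensity h₁ hR hS hC)
      ((hS.integrable_wt_sq_add h₁ hR).const_mul _) ?_
    filter_upwards [hC.abs_potentialDensity_le h] with p hp using (le_abs_self _).trans hp
  have hw' := mul_le_mul_of_nonneg_left hw hC0
  have hX : 0 ≤ ∫ p, (v.r p.1 p.2 ^ 2 + v.z p.1 p.2 ^ 2 + H.θ p.1 p.2 ^ 2) ∂cylMeasure R1 R2 :=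
    integral_nonneg fun p => by positivity
  have hM : 0 ≤ ∫ p, (H.r p.1 p.2 ^ 2 + (H.z p.1 p.2 - ε * b p.1) ^ 2) ∂cylMeasure R1 R2 :=
    integral_nonneg fun p => by positivity
  rw [lyapunov, mhdDist]
  linarith

theorem exists_le_lyapunov (hε : ε ≠ 0) (hL : FormPos R1 R2 (frakF ω b ε))
    (hC : CasimirData R1 R2 ω b b₁ ε (flux R1 R2 b) f F Φ D₀ C) :
    ∃ ρ > 0, ∃ T : Finset (ℝ × ℝ), (∀ q ∈ T, TentSupported R1 R2 (flux R1 R2 b) q) ∧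
      ∃ B, 0 ≤ B ∧ ∀ (v H : AxiField) (h : ℝ × ℝ → ℝ), IsState R1 R2 ω b ε v H h →
      fluxEnergy R1 R2 b ε H ≤ 1 →
      ρ * mhdDist R1 R2 ω b ε v H ≤ lyapunov R1 R2 ω b b₁ ε f Φ v H h +
        B * (∑ q ∈ T, moment R1 R2 (flux R1 R2 b) q (fun r => zMean fun z => h (r, z)) ^ 2 +
          fluxEnergy R1 R2 b ε H ^ 2) := by
  have hb := hP.positiveBound
  have hpi := Real.pi_pos
  have hC0 := hC.C_nonneg
  obtain ⟨L, hV⟩ := hP.frakF_bound h₁ hε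
  obtain ⟨G, hG, hwt⟩ := IsState.exists_integral_wt_bound (R2 := R2) h₁ hR
  obtain ⟨c₀, hc₀, T, hT, A, hA, hcoer⟩ := StripPert.exists_coercive hL hV h₁ hR
    ((hb.continuousOn_flux h₁ hR).mono fun r hr => (radial_pos h₁ hr).le)
    ((hb.strictMonoOn_flux h₁ hR).mono fun r hr => (radial_pos h₁ hr).le)
  obtain ⟨B, hB, hexp⟩ := hP.exists_potential_expansion h₁ hR hC hV
    (η := Real.pi * ε ^ 2 * c₀ / 2) (by positivity)
  set θ := min 1 (Real.pi * ε ^ 2 * c₀ / (2 * (C * G + 1))) with hθ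
  have hθ0 : 0 < θ := by positivity
  have hθ1 : θ ≤ 1 := min_le_left _ _
  have hθ2 : θ * (C * G) ≤ Real.pi * ε ^ 2 * c₀ / 2 := by
    have h3 : θ ≤ Real.pi * ε ^ 2 * c₀ / (2 * (C * G + 1)) := min_le_right _ _
    rw [le_div_iff₀ (by positivity)] at h3
    linarith
  refine ⟨min (min 1 (θ / 2)) (c₀ / 4), by positivity, T, hT, Real.pi * ε ^ 2 * A + B,
    by positivity, fun v H h hS hn => ?_⟩
  set n := fluxEnergy R1 R2 b ε H with hnd
  have hn0 : 0 ≤ n := fluxEnergy_nonneg h₁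
  have hw := hwt _ _ _ _ _ _ hS hn
  have hs := hP.integral_swirlShift_sq_le h₁ hR hS hC
  have hsm := hP.memLp_swirlShift h₁ hR hS hC
  have hu := integral_add_sq_le (hS.integrable_swirl.add hsm) hsm.neg
  simp only [Pi.add_apply, Pi.neg_apply, add_neg_cancel_right, even_two, Even.neg_pow] at hu
  have hc := hcoer _ _ _ hS.strip
  have he := (abs_le.1 (hexp _ _ _ hS)).1
  have hM := (hS.magnetic h₁ hε).2
  set S := ∑ q ∈ T, moment R1 R2 (flux R1 R2 b) q (fun r => zMean fun z => h (r, z)) ^ 2 with hSd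
  have hS0 : 0 ≤ S := Finset.sum_nonneg fun q _ => sq_nonneg _
  have hX : 0 ≤ ∫ p, (v.r p.1 p.2 ^ 2 + v.z p.1 p.2 ^ 2 + H.θ p.1 p.2 ^ 2) ∂cylMeasure R1 R2 :=
    integral_nonneg fun p => by positivity
  have hU : 0 ≤ ∫ p, (v.θ p.1 p.2 - p.1 * ω p.1) ^ 2 ∂cylMeasure R1 R2 :=
    integral_nonneg fun p => by positivity
  have hW : 0 ≤ ∫ p, (v.θ p.1 p.2 - p.1 * ω p.1 + swirlShift R1 R2 b Φ h p) ^ 2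
      ∂cylMeasure R1 R2 := integral_nonneg fun p => by positivity
  rw [lyapunov, mhdDist, hM, ← hnd]
  change c₀ * n ≤ n + _ + _ at hc
  have hc' := mul_le_mul_of_nonneg_left hc (by positivity : 0 ≤ Real.pi * ε ^ 2)
  set X := ∫ p, (v.r p.1 p.2 ^ 2 + v.z p.1 p.2 ^ 2 + H.θ p.1 p.2 ^ 2) ∂cylMeasure R1 R2
  set U := ∫ p, (v.θ p.1 p.2 - p.1 * ω p.1) ^ 2 ∂cylMeasure R1 R2
  set W := ∫ p, (v.θ p.1 p.2 - p.1 * ω p.1 + swirlShift R1 R2 b Φ h p) ^ 2 ∂cylMeasure R1 R2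
  set Z := ∫ p, swirlShift R1 R2 b Φ h p ^ 2 ∂cylMeasure R1 R2
  set V := ∫ p, frakF ω b ε p.1 * p.1 * h p ^ 2 ∂planeMeasure R1 R2
  set P := ∫ p, potentialDensity R1 R2 ω b b₁ ε f Φ h p ∂cylMeasure R1 R2
  set ρ := min (min 1 (θ / 2)) (c₀ / 4) with hρ
  have r1 : ρ * X ≤ X := mul_le_of_le_one_left hX ((min_le_left _ _).trans (min_le_left _ _))
  have r2 : ρ * U ≤ θ / 2 * U :=
    mul_le_mul_of_nonneg_right ((min_le_left _ _).trans (min_le_right _ _)) hU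
  have hpn : 0 ≤ Real.pi * ε ^ 2 * n := by positivity
  have r3 : ρ * (Real.pi * ε ^ 2 * n) ≤ c₀ / 4 * (Real.pi * ε ^ 2 * n) :=
    mul_le_mul_of_nonneg_right (min_le_right _ _) hpn
  have hZ : Z ≤ C * (G * n) := hs.trans (mul_le_mul_of_nonneg_left hw hC0)
  have r4 : θ * W ≤ W := mul_le_of_le_one_left hW hθ1
  have r5 : θ * U ≤ θ * (2 * W + 2 * (C * (G * n))) :=
    mul_le_mul_of_nonneg_left (by linarith) hθ0.le
  have r6 := mul_le_mul_of_nonneg_right hθ2 hn0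
  have r7 : 0 ≤ Real.pi * ε ^ 2 * A * n ^ 2 := by positivity
  have r8 : 0 ≤ B * S := by positivity
  linarith

/-- The distance to the steady state at time `t` is controlled by the initial distance, up to a
quadratic error. -/
theorem exists_dist_le (hε : ε ≠ 0) (hL : FormPos R1 R2 (frakF ω b ε)) :
    ∃ A, 0 < A ∧ ∀ (v H : ℝ → AxiField) (ψ : ℝ → ℝ → ℝ → ℝ),
      IsWeakSolution R1 R2 ω b ε v H → IsMagneticPotential R1 R2 b ε H ψ →
      EnergyNonincreasing R1 R2 ω b ε v H → CasimirsConserved R1 R2 ω b ε v ψ →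
      ∀ t, 0 ≤ t → mhdDist R1 R2 ω b ε (v 0) (H 0) ≤ Real.pi * ε ^ 2 →
      mhdDist R1 R2 ω b ε (v t) (H t) ≤ Real.pi * ε ^ 2 →
      mhdDist R1 R2 ω b ε (v t) (H t) ≤ A * (mhdDist R1 R2 ω b ε (v 0) (H 0) +
        mhdDist R1 R2 ω b ε (v t) (H t) ^ 2) := by
  have hb := hP.positiveBound
  have hπε : 0 < Real.pi * ε ^ 2 := by
    have := Real.pi_pos
    positivity
  obtain ⟨f, F, Φ, D₀, C, hC⟩ := hP.exists_casimirData h₁ hR hε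
  obtain ⟨B₁, hB₁, hup⟩ := hP.exists_lyapunov_le h₁ hR hC
  obtain ⟨ρ, hρ, T, hT, B₂, hB₂, hlow⟩ := hP.exists_le_lyapunov h₁ hR hε hL hC
  choose! B hB hmom using fun q hq => hb.exists_moment_bound (ω := ω) h₁ hR hε (hT q hq)
  have hBs : 0 ≤ ∑ q ∈ T, B q := Finset.sum_nonneg fun q hq => hB q hq
  set s := (Real.pi * ε ^ 2)⁻¹ with hs
  have hs0 : 0 < s := inv_pos.2 hπε
  refine ⟨ρ⁻¹ * (2 + B₁ * s + B₂ * (∑ q ∈ T, B q) * (s + s ^ 2) + B₂ * s ^ 2), by positivity,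
    fun v H ψ hw hψ hE hcas t ht hd0 hdt => ?_⟩
  obtain ⟨κ, hκ, hst⟩ := exists_isState (ω := ω) hb h₁ hR hε hw.memL2 hψ
  have hS : ∀ t, 0 ≤ t → IsState R1 R2 ω b ε (v t) (H t) (relPot R1 b ε (ψ t)) :=
    fun t ht => (hst t ht).1
  have hn : ∀ t, 0 ≤ t → fluxEnergy R1 R2 b ε (H t) ≤ s * mhdDist R1 R2 ω b ε (v t) (H t) :=
    fun t ht => by
      rw [hs, inv_mul_eq_div, le_div_iff₀ hπε, mul_comm]
      exact (hS t ht).fluxEnergy_le h₁ hε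
  have hn1 : ∀ t, 0 ≤ t → mhdDist R1 R2 ω b ε (v t) (H t) ≤ Real.pi * ε ^ 2 →
      fluxEnergy R1 R2 b ε (H t) ≤ 1 := fun t ht hd =>
    (hn t ht).trans (by rw [hs, inv_mul_eq_div, div_le_one hπε]; exact hd)
  obtain ⟨E, hEt, hanti⟩ := hE
  obtain ⟨e₀, he₀⟩ := hP.exists_energy_eq h₁ hR hε hκ
  have hlyap : ∀ t, 0 ≤ t → lyapunov R1 R2 ω b b₁ ε f Φ (v t) (H t) (relPot R1 b ε (ψ t)) =
      E t - e₀ + ∫ p, casimirDensity R1 R2 b f (relPot R1 b ε (ψ t)) p ∂cylMeasure R1 R2 +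
        ∫ p, swirlDensity R1 R2 ω b Φ (v t) (relPot R1 b ε (ψ t)) p ∂cylMeasure R1 R2 := by
    intro t ht
    rw [← hP.lyapunov_eq h₁ hR (hS t ht) hC hε, he₀ _ _ _ _ (hS t ht)
      (hP.integrable_swirlDensity h₁ hR (hS t ht) hC).1 (hst t ht).2 (hEt t ht)]
    ring
  have hfd : ContDiff ℝ 1 f := contDiff_one_iff_deriv.2
    ⟨fun y => (hC.deriv_f y).differentiableAt, by
      rw [show deriv f = F from funext fun y => (hC.deriv_f y).deriv]
      exact hC.cont_F⟩
  have hmono : lyapunov R1 R2 ω b b₁ ε f Φ (v t) (H t) (relPot R1 b ε (ψ t)) ≤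
      lyapunov R1 R2 ω b b₁ ε f Φ (v 0) (H 0) (relPot R1 b ε (ψ 0)) := by
    rw [hlyap t ht, hlyap 0 le_rfl, hP.swirl_conserved_data h₁ hR hε hS hC hcas ht,
      hb.casimir_conserved h₁ hR hε hcas hfd ht
      (hP.integrable_casimirData h₁ hR (hS 0 le_rfl) hC)
      (hP.integrable_casimirData h₁ hR (hS t ht) hC)]
    have := hanti (mem_Ici.2 le_rfl) (mem_Ici.2 ht) ht
    linarith
  have k1 := hlow _ _ _ (hS t ht) (hn1 t ht hdt)
  have k2 := hup _ _ _ (hS 0 le_rfl) (hn1 0 le_rfl hd0)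
  have n0 := hn 0 le_rfl
  have nt := hn t ht
  have n0' : 0 ≤ fluxEnergy R1 R2 b ε (H 0) := fluxEnergy_nonneg h₁
  have nt' : 0 ≤ fluxEnergy R1 R2 b ε (H t) := fluxEnergy_nonneg h₁
  have k3 : ∑ q ∈ T, moment R1 R2 (flux R1 R2 b) q
      (fun r => zMean fun z => relPot R1 b ε (ψ t) (r, z)) ^ 2 ≤
      (∑ q ∈ T, B q) * (fluxEnergy R1 R2 b ε (H 0) + fluxEnergy R1 R2 b ε (H t) ^ 2) := by
    rw [Finset.sum_mul]
    exact Finset.sum_le_sum fun q hq => hmom q hq v H ψ hcas hS t ht (hn1 0 le_rfl hd0)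
      (hn1 t ht hdt)
  set d0 := mhdDist R1 R2 ω b ε (v 0) (H 0)
  set dt := mhdDist R1 R2 ω b ε (v t) (H t)
  have d0n : 0 ≤ d0 := (mul_nonneg hπε.le n0').trans ((hS 0 le_rfl).fluxEnergy_le h₁ hε)
  have nt2 := pow_le_pow_left₀ nt' nt 2
  rw [mul_pow] at nt2
  set Bs := ∑ q ∈ T, B q
  have k4 := mul_le_mul_of_nonneg_left (k3.trans (mul_le_mul_of_nonneg_left
    (add_le_add n0 nt2) hBs)) hB₂
  have k5 := mul_le_mul_of_nonneg_left nt2 hB₂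
  have k6 := mul_le_mul_of_nonneg_left n0 hB₁
  have p1 : 0 ≤ B₂ * Bs * s * dt ^ 2 := by positivity
  have p2 : 0 ≤ B₂ * Bs * s ^ 2 * d0 := by positivity
  have p3 : 0 ≤ B₂ * s ^ 2 * d0 := by positivity
  have p4 : 0 ≤ (2 + B₁ * s) * dt ^ 2 := by positivity
  rw [mul_assoc, inv_mul_eq_div, le_div_iff₀ hρ]
  linarith

end

end ProfileBound

/-- Continuity argument for a quadratic self-bounding inequality. -/
theorem le_of_quadratic_bound {d : ℝ → ℝ} (hd : ContinuousOn d (Ici 0)) {A m₀ : ℝ} (hA : 0 < A)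
    (hm₀ : 0 < m₀) (h0 : d 0 < min m₀ (1 / (2 * A)) / (2 * A + 1))
    (h0' : 0 ≤ d 0) (hq : ∀ t, 0 ≤ t → d 0 ≤ m₀ → d t ≤ m₀ → d t ≤ A * (d 0 + d t ^ 2))
    (hn : ∀ t, 0 ≤ t → 0 ≤ d t) {t : ℝ} (ht : 0 ≤ t) : d t ≤ 2 * A * d 0 := by
  set m := min m₀ (1 / (2 * A)) with hm
  have hmpos : 0 < m := by positivity
  rw [lt_div_iff₀ (by positivity)] at h0
  have hAd : 0 ≤ A * d 0 := mul_nonneg hA.le h0'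
  have h0m : d 0 < m := by linarith
  have step : ∀ s, 0 ≤ s → d s ≤ m → d s ≤ 2 * A * d 0 := by
    intro s hs hds
    have h3 := hq s hs (h0m.le.trans (min_le_left _ _)) (hds.trans (min_le_left _ _))
    have h4 : d s ≤ 1 / (2 * A) := hds.trans (min_le_right _ _)
    rw [le_div_iff₀ (by positivity)] at h4
    have h5 := mul_le_mul_of_nonneg_right h4 (hn s hs)
    linarith
  refine step t ht ?_
  by_contra hcon
  push Not at hcon
  obtain ⟨s, hs, hsm⟩ := intermediate_value_Icc ht (hd.mono Icc_subset_Ici_self) ⟨h0m.le, hcon.le⟩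
  have := step s hs.1 hsm.le
  linarith

theorem LPos.formPos (hL : LPos R1 R2 ω b ε 1) : FormPos R1 R2 (frakF ω b ε) := by
  intro h g hm hne
  have := hL h g hm hne
  simpa [formL, formQ] using this

end Stability

end RotMHD

end

theorem theorem1p2 (R₁ : ℝ) (R₂ : EReal) (hR₁ : 0 ≤ R₁) (hR : (R₁ : EReal) < R₂)
    (ω b : ℝ → ℝ) (ε : ℝ) (hε : ε ≠ 0)
    (hreg : RotMHD.RegularProfile R₁ R₂ ω b)
    (hzero : R₁ = 0 → RotMHD.DecayAtZero ω b)
    (hinf : R₂ = ⊤ → RotMHD.DecayAtInfinity ω b)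
    (hL : RotMHD.LPos R₁ R₂ ω b ε 1) :
    ∃ δ > 0, ∃ C > 0, ∀ (v H : ℝ → RotMHD.AxiField) (ψ : ℝ → ℝ → ℝ → ℝ),
      RotMHD.IsWeakSolution R₁ R₂ ω b ε v H →
      RotMHD.IsMagneticPotential R₁ R₂ b ε H ψ →
      RotMHD.EnergyNonincreasing R₁ R₂ ω b ε v H →
      ContinuousOn (fun t => RotMHD.mhdDist R₁ R₂ ω b ε (v t) (H t)) (Ici 0) →
      RotMHD.CasimirsConserved R₁ R₂ ω b ε v ψ →
      RotMHD.mhdDist R₁ R₂ ω b ε (v 0) (H 0) < δ →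
      ∀ t, 0 ≤ t → RotMHD.mhdDist R₁ R₂ ω b ε (v t) (H t) ≤
        C * RotMHD.mhdDist R₁ R₂ ω b ε (v 0) (H 0) := by
  obtain ⟨ω₁, ω₂, b₁, b₂, c, K, hP⟩ := RotMHD.exists_profileBound hR₁ hR hreg hzero hinf
  obtain ⟨A, hA, hdist⟩ := hP.exists_dist_le hR₁ hR hε hL.formPos
  have hπε : 0 < Real.pi * ε ^ 2 := by
    have := Real.pi_pos
    positivity
  refine ⟨min (Real.pi * ε ^ 2) (1 / (2 * A)) / (2 * A + 1), by positivity, 2 * A, by positivity,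
    fun v H ψ hw hψ hE hcont hcas h0 t ht => ?_⟩
  have hn : ∀ t, 0 ≤ RotMHD.mhdDist R₁ R₂ ω b ε (v t) (H t) := fun t => by
    unfold RotMHD.mhdDist
    have h1 := fun F : ℝ × ℝ → ℝ => fun hF : ∀ p, 0 ≤ F p =>
      MeasureTheory.integral_nonneg (μ := RotMHD.cylMeasure R₁ R₂) (f := F) hF
    refine add_nonneg (add_nonneg ?_ ?_) ?_ <;>
      exact mul_nonneg (by norm_num) (h1 _ fun p => by positivity)
  exact RotMHD.le_of_quadratic_bound (d := fun t => RotMHD.mhdDist R₁ R₂ ω b ε (v t) (H t)) hcont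
    hA hπε h0 (hn 0) (fun t ht => hdist v H ψ hw hψ hE hcas t ht) (fun t _ => hn t) ht
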